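/- Let $\varphi_0=dx_{123}+\sum_{i=1}^3dx_i\wedge(da_0\wedge da_i-da_j\wedge da_k)$, with $(i,j,k)$ cyclic, be the standard $G_2$ form on $\mathbb R^7=\mathbb R^3\oplus\mathbb R^4$. Let $(M,\varphi)$ be a connected $G_2$ manifold: $M$ is a connected smooth 7-manifold and $\varphi$ is a smooth 3-form on $M$ such that for each $x\in M$ there is a linear isomorphism $\mathbb R^7\cong T_xM$ identifying $\varphi_0$ with $\varphi_x$, and $\varphi$ and $\ast_\varphi\varphi$ are closed. Let $g_\varphi$ be the metric induced by $\varphi$. Suppose that $\mathbb T^2\times SU(2)$ acts smoothly on $M$, preserving $\varphi$, with cohomogeneity two, i.e. the maximal dimension of an orbit is $5$. Let $\Gamma$ be the kernel of the action (it is discrete) and let $G=(\mathbb T^2\times SU(2))/\Gamma$, which acts effectively on $M$. For $x\in M$ let $G_x$ be the stabilizer of $x$ in $G$, let $G_x^0$ be its identity component, and let $N=(T_x(Gx))^\perp\subset T_xM$ be the normal space of the orbit $Gx$, on which $G_x$ acts by differentials. Let $\mathcal S\subset M$ be the set of points at which the generators of the action of $\mathbb T^2=\mathbb T^2\times\{1\}$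 are linearly dependent. **Theorem.** For every $x\in M$ we have $\dim G_x\le 4$, and: * if $\dim G_x=0$, then $G_x$ is trivial; * if $\dim G_x=1$, then $x\notin\mathcal S$ (moreover, every element of $\mathbb T^2$ that fixes $x$ acts trivially on $M$) and $G_x\cong SO(2)$. There is an orthogonal splitting $N=N_1\oplus N_2$ with $\dim N_1=1$, $\dim N_2=2$, such that $G_x$ acts trivially on $N_1$, and $G_x\cong SO(2)$ acts on $N_2\cong\mathbb R^2$ by the standard rotations (in particular faithfully); * if $\dim G_x=2$, then $x\in\mathcal S$, and there are an isomorphism $G_x^0\cong\mathbb T^2=U(1)\times U(1)$ and a linear isometry $N\cong\mathbb C^2$ for which $(z,w)\in U(1)\times U(1)$ acts on $N$ as $(a,b)\mapsto(za,wb)$. The orbit $Gx$ is an associative submanifold of $M$; * if $\dim G_x=3$, then $x\notin\mathcal S$ and $G_x\cong SU(2)$. There is an orthogonal splitting $N=N_1\oplus N_2$ with $\dim N_1=1$ such that $G_x$ acts trivially on $N_1$, and on $N_2\cong\mathbb C^2=\mathbb R^4$ it acts by the standard embedding $SU(2)\to SO(4)$; * if $\dim G_x=4$, then $x\in\mathcal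 S$, and there are an isomorphism $G_x^0\cong U(2)$ and a linear isometry $N\cong\mathbb C^3$ for which $G_x^0$ acts on $N$ via the embedding $$U(2)\to SU(3),\qquad A\mapsto\begin{pmatrix}A&0\\0&\det A^{-1}\end{pmatrix}.$$ Here the identifications of $N$ and $N_2$ with Euclidean spaces are real-linear isometries with respect to $g_\varphi$, and the isomorphisms of groups are isomorphisms of Lie groups. Consequently, the complement in $M$ of the set of points of principal orbit type of the $G$-action (the points whose stabilizer is, up to conjugation, contained in every stabilizer) is $\mathcal S_1\cup\mathcal S_2\cup\mathcal S_3\cup\mathcal S_4$, where $\mathcal S_i$ is the set of points whose $G$-stabilizer has dimension $i$. In particular, there are no exceptional orbits. -/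

import Mathlib

open scoped Manifold ContDiff Matrix Topology

noncomputable section

namespace G2Sym

/-! ### The linear model -/

/-- Euclidean `ℝ⁷ = ℝ³ ⊕ ℝ⁴` with coordinates `(x₁, x₂, x₃, a₀, a₁, a₂, a₃)`, numbered `0, …, 6`. -/
abbrev E7 : Type := EuclideanSpace ℝ (Fin 7)

/-- The alternating form `dx_{i 0} ∧ ⋯ ∧ dx_{i (k-1)}` on `ℝ⁷`, i.e.
`v ↦ det (x_{i b} (v a))_{a, b}`. -/
def coordForm {k : ℕ} (i : Fin k → Fin 7) : E7 [⋀^Fin k]→L[ℝ] ℝ :=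
  { (Matrix.detRowAlternating (n := Fin k) (R := ℝ)).compLinearMap
      (LinearMap.pi fun b => (EuclideanSpace.proj (𝕜 := ℝ) (i b)).toLinearMap) with
    cont := by
      change Continuous fun v : Fin k → E7 =>
        Matrix.det (Matrix.of fun a b : Fin k => v a (i b))
      refine Continuous.matrix_det (continuous_matrix fun a b => ?_)
      exact (EuclideanSpace.proj (𝕜 := ℝ) (i b)).continuous.comp (continuous_apply a) }

theorem coordForm_apply {k : ℕ} (i : Fin k → Fin 7) (v : Fin k → E7) :
    coordForm i v = Matrix.det (Matrix.of fun a b : Fin k => v a (i b)) := rfl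

/-- `φ₀ = dx₁∧dx₂∧dx₃ + ∑ᵢ dxᵢ∧Ωᵢ`, where `Ωᵢ = da₀∧daᵢ - daⱼ∧daₖ` for cyclic `(i,j,k)`. -/
def phi0 : E7 [⋀^Fin 3]→L[ℝ] ℝ :=
  coordForm ![0, 1, 2]
    + (coordForm ![0, 3, 4] - coordForm ![0, 5, 6])
    + (coordForm ![1, 3, 5] - coordForm ![1, 6, 4])
    + (coordForm ![2, 3, 6] - coordForm ![2, 4, 5])

/-- `∗φ₀ = da₀∧da₁∧da₂∧da₃ - ∑ᵢ dxⱼ∧dxₖ∧Ωᵢ`, `(i,j,k)` cyclic. -/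
def starPhi0 : E7 [⋀^Fin 4]→L[ℝ] ℝ :=
  coordForm ![3, 4, 5, 6]
    - (coordForm ![1, 2, 3, 4] - coordForm ![1, 2, 5, 6])
    - (coordForm ![2, 0, 3, 5] - coordForm ![2, 0, 6, 4])
    - (coordForm ![0, 1, 3, 6] - coordForm ![0, 1, 4, 5])

/-! ### Differential forms and `G₂` manifolds -/

section Forms

variable {M : Type*} [TopologicalSpace M] [ChartedSpace E7 M]

/-- A (not necessarily continuous) `k`-form on the 7-manifold `M`. -/
abbrev FormField (k : ℕ) (M : Type*) [TopologicalSpace M] [ChartedSpace E7 M] : Type _ :=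
  ∀ x : M, TangentSpace (𝓡 7) x [⋀^Fin k]→L[ℝ] ℝ

/-- The expression of a form in the preferred chart at `x₀`: its pullback under the inverse of
the chart, a form on the target of the chart (only the values there are used). -/
def inChart {k : ℕ} (η : FormField k M) (x₀ : M) : E7 → E7 [⋀^Fin k]→L[ℝ] ℝ := fun y =>
  (η ((chartAt E7 x₀).symm y)).compContinuousLinearMap
    (mfderiv (𝓡 7) (𝓡 7) (chartAt E7 x₀).symm y)

/-- A form is smooth if all its coordinate expressions are. -/
def IsSmoothForm {k : ℕ} (η : FormField k M) : Prop :=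
  ∀ x₀ : M, ContDiffOn ℝ ∞ (inChart η x₀) (chartAt E7 x₀).target

/-- A form is closed if the exterior derivatives of all its coordinate expressions vanish. -/
def IsClosedForm {k : ℕ} (η : FormField k M) : Prop :=
  ∀ x₀ : M, ∀ y ∈ (chartAt E7 x₀).target, extDeriv (inChart η x₀) y = 0

/-- `p : ℝ⁷ ≅ T_x M` identifies `φ₀` with `φ` at `x`. -/
def IsG2Frame (φ : FormField 3 M) (x : M) (p : E7 ≃L[ℝ] TangentSpace (𝓡 7) x) : Prop :=
  (φ x).compContinuousLinearMap (p : E7 →L[ℝ] TangentSpace (𝓡 7) x) = phi0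

/-- `(M, φ)` is a `G₂` manifold: `φ` is a `G₂`-structure such that `φ` and `∗_φ φ` are closed.
The 4-form `∗_φ φ` is the unique one that every frame `p_x` identifies with `∗φ₀`. -/
structure IsG2Manifold (φ : FormField 3 M) : Prop where
  smooth : IsSmoothForm φ
  exists_frame : ∀ x : M, ∃ p : E7 ≃L[ℝ] TangentSpace (𝓡 7) x, IsG2Frame φ x p
  closed : IsClosedForm φ
  coclosed : ∃ ψ : FormField 4 M,
    (∀ (x : M) (p : E7 ≃L[ℝ] TangentSpace (𝓡 7) x), IsG2Frame φ x p →
      (ψ x).compContinuousLinearMap (p : E7 →L[ℝ] TangentSpace (𝓡 7) x) = starPhi0) ∧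
    IsSmoothForm ψ ∧ IsClosedForm ψ

/-- A linear isomorphism `ℝ⁷ ≅ T_x M` that identifies `φ₀` with `φ` at `x`, if there is one. -/
def g2Frame (φ : FormField 3 M) (x : M) : E7 ≃L[ℝ] TangentSpace (𝓡 7) x :=
  letI : Nonempty (E7 ≃L[ℝ] TangentSpace (𝓡 7) x) := ⟨ContinuousLinearEquiv.refl ℝ E7⟩
  Classical.epsilon (IsG2Frame φ x)

/-- The metric `g_φ`: it makes the frames `p_x` isometries. (It does not depend on the frame,
because linear automorphisms of `φ₀` are orthogonal.) -/
def g2Metric (φ : FormField 3 M) (x : M) (u v : TangentSpace (𝓡 7) x) : ℝ :=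
  inner ℝ ((g2Frame φ x).symm u) ((g2Frame φ x).symm v)

/-- `F ⊆ T_x M` is an associative plane: it is 3-dimensional and `φ` restricts to the volume form
of `F` (for one of its orientations), i.e. to `1` on some orthonormal basis of `F`. -/
def IsAssociativePlane (φ : FormField 3 M) (x : M)
    (F : Submodule ℝ (TangentSpace (𝓡 7) x)) : Prop :=
  Module.finrank ℝ F = 3 ∧ ∃ u : Fin 3 → TangentSpace (𝓡 7) x,
    (∀ i, u i ∈ F) ∧ (∀ i j, g2Metric φ x (u i) (u j) = if i = j then 1 else 0) ∧ φ x u = 1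

/-- `L ⊆ M` is an (embedded) associative submanifold: around each of its points `y` there is a
smooth chart `e` of `M` that maps `L` to a linear subspace `V` of `ℝ⁷`, and `T_y L = (de_y)⁻¹ V`
is an associative plane. -/
def IsAssociativeSubmanifold (φ : FormField 3 M) (L : Set M) : Prop :=
  ∀ y ∈ L, ∃ e ∈ IsManifold.maximalAtlas (𝓡 7) ∞ M, ∃ V : Submodule ℝ E7,
    y ∈ e.source ∧ (∀ z ∈ e.source, z ∈ L ↔ e z ∈ V) ∧
    IsAssociativePlane φ y
      (V.comap (mfderiv (𝓡 7) (𝓡 7) e y : TangentSpace (𝓡 7) y →L[ℝ] E7).toLinearMap)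

/-- `e` is a linear isometry from the Euclidean space `V` onto the subspace `N` of
`(T_x M, g_φ)`. -/
def IsIsometryOnto (φ : FormField 3 M) (x : M) {V : Type*} [NormedAddCommGroup V] [Module ℝ V]
    (e : V →ₗ[ℝ] TangentSpace (𝓡 7) x) (N : Submodule ℝ (TangentSpace (𝓡 7) x)) : Prop :=
  LinearMap.range e = N ∧ ∀ a, g2Metric φ x (e a) (e a) = ‖a‖ ^ 2

end Forms

/-! ### The group `T² × SU(2)` -/

instance : Fact (Module.finrank ℝ (Quaternion ℝ) = 3 + 1) := ⟨Quaternion.finrank_eq_four⟩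

/-- The Lie group `SU(2)`, realised as the group of unit quaternions. -/
abbrev SU2 : Type := Metric.sphere (0 : Quaternion ℝ) 1

/-- The Lie group `T² × SU(2)`. -/
abbrev T2SU2 : Type := Circle × Circle × SU2

/-- The model of the manifold `T² × SU(2)`. -/
abbrev modelT2SU2 := (𝓡 1).prod ((𝓡 1).prod (𝓡 3))

instance : LieGroup (𝓡 3) ∞ SU2 where
  contMDiff_mul := by
    apply ContMDiff.codRestrict_sphere
    let c : SU2 → Quaternion ℝ := (↑)
    have h₂ : ContMDiff (𝓘(ℝ, Quaternion ℝ).prod 𝓘(ℝ, Quaternion ℝ)) 𝓘(ℝ, Quaternion ℝ) ∞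
        fun z : Quaternion ℝ × Quaternion ℝ => z.fst * z.snd := by
      rw [contMDiff_iff]
      exact ⟨continuous_mul, fun x y => contDiff_mul.contDiffOn⟩
    suffices h₁ : ContMDiff _ _ _ (Prod.map c c) from h₂.comp h₁
    apply ContMDiff.prodMap <;> exact contMDiff_coe_sphere
  contMDiff_inv := by
    apply ContMDiff.codRestrict_sphere
    let c : Quaternion ℝ →ₗ[ℝ] Quaternion ℝ :=
      { toFun := star
        map_add' := star_add
        map_smul' := fun r q => Quaternion.star_smul r q }
    have h : (fun q : SU2 => (q : Quaternion ℝ)⁻¹) =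
        fun q : SU2 => c.toContinuousLinearMap (q : Quaternion ℝ) := by
      funext q
      have hq : Quaternion.normSq (q : Quaternion ℝ) = 1 := by
        rw [Quaternion.normSq_eq_norm_mul_self, norm_eq_of_mem_sphere q, one_mul]
      change (q : Quaternion ℝ)⁻¹ = star (q : Quaternion ℝ)
      simp [Quaternion.inv_def, hq]
    change ContMDiff _ _ _ (fun q : SU2 => (q : Quaternion ℝ)⁻¹)
    rw [h]
    exact c.toContinuousLinearMap.contDiff.contMDiff.comp contMDiff_coe_sphere

/-- The Lie algebra of `T² × SU(2)`: the tangent space at the identity. -/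
abbrev LieT2SU2 : Type := GroupLieAlgebra modelT2SU2 T2SU2

/-- The Lie algebra of a closed subgroup `H` of `T² × SU(2)`: the set of velocities of the
one-parameter subgroups that are contained in `H` (this set is a linear subspace). -/
def lieAlgebraOf (H : Subgroup T2SU2) : Submodule ℝ LieT2SU2 :=
  Submodule.span ℝ {ξ | ∃ γ : ℝ → T2SU2, (∀ s t, γ (s + t) = γ s * γ t) ∧
    ContMDiff 𝓘(ℝ, ℝ) modelT2SU2 ∞ γ ∧ (∀ t, γ t ∈ H) ∧
    (mfderiv 𝓘(ℝ, ℝ) modelT2SU2 γ 0 : ℝ →L[ℝ] LieT2SU2) 1 = ξ}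

/-- Points of principal orbit type for an action of `A`: the stabilizer of `x` is, up to
conjugation, contained in the stabilizer of every point. -/
def principalSet (A M : Type*) [Group A] [MulAction A M] : Set M :=
  {x | ∀ y : M, ∃ a : A, MulAction.stabilizer A x ≤ MulAction.stabilizer A (a • y)}

/-! ### Actions of `T² × SU(2)` -/

section Action

variable (M : Type*) [MulAction T2SU2 M]

/-- The group `G = (T² × SU(2)) / Γ`, where `Γ` is the kernel of the action on `M`. -/
abbrev EffGroup : Type := T2SU2 ⧸ (MulAction.toPermHom T2SU2 M).ker

/-- The induced (effective) action of `G` on `M`. -/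
instance : MulAction (EffGroup M) M :=
  MulAction.compHom M (QuotientGroup.kerLift (MulAction.toPermHom T2SU2 M))

theorem mk_smul (k : T2SU2) (x : M) : (QuotientGroup.mk k : EffGroup M) • x = k • x := rfl

variable {M}

/-- The dimension of the stabilizer `G_x`. As `Γ` is discrete, `G` and `T² × SU(2)` have the same
Lie algebra, and that of `G_x` is that of the preimage of `G_x` in `T² × SU(2)`. -/
def stabDim (x : M) : ℕ :=
  Module.finrank ℝ
    (lieAlgebraOf ((MulAction.stabilizer (EffGroup M) x).comap (QuotientGroup.mk' _)))

variable (M) in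
/-- The set of points with `i`-dimensional stabilizer `G_x`. -/
def stratum (i : ℕ) : Set M := {x | stabDim x = i}

/-- The identity component of the stabilizer `G_x`. -/
abbrev stabIdComponent (x : M) : Subgroup (MulAction.stabilizer (EffGroup M) x) :=
  Subgroup.connectedComponentOfOne (MulAction.stabilizer (EffGroup M) x)

variable [TopologicalSpace M] [ChartedSpace E7 M]

variable (M) in
/-- The action of `T² × SU(2)` is smooth. -/
def IsSmoothAction : Prop :=
  ContMDiff (modelT2SU2.prod (𝓡 7)) (𝓡 7) ∞ (fun p : T2SU2 × M => p.1 • p.2)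

/-- The action of `T² × SU(2)` preserves `φ`. -/
def PreservesForm (φ : FormField 3 M) : Prop :=
  ∀ (k : T2SU2) (x : M), (φ (k • x)).compContinuousLinearMap
    (mfderiv (𝓡 7) (𝓡 7) (fun y : M => k • y) x) = φ x

/-- The infinitesimal action at `x`: the derivative at the identity of `k ↦ k • x`. -/
def infinitesimalAction (x : M) : LieT2SU2 →L[ℝ] TangentSpace (𝓡 7) x :=
  mfderiv modelT2SU2 (𝓡 7) (fun k : T2SU2 => k • x) 1

/-- The tangent space at `x` of the orbit of `x`. -/
def orbitTangent (x : M) : Submodule ℝ (TangentSpace (𝓡 7) x) :=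
  LinearMap.range (infinitesimalAction x).toLinearMap

variable (M) in
/-- The action is of cohomogeneity two: the maximal dimension of an orbit is `5 = 7 - 2`. -/
def HasCohomogeneityTwo : Prop :=
  IsGreatest (Set.range fun x : M => Module.finrank ℝ (orbitTangent x)) 5

variable (M) in
/-- The singular set `𝒮` of the action of `T² = T² × {1}`: the points where the generators of the
action of `T²` are linearly dependent. -/
def torusSingularSet : Set M :=
  {x | ∃ a b : EuclideanSpace ℝ (Fin 1), (a, b) ≠ 0 ∧
    infinitesimalAction x ((a, b, (0 : EuclideanSpace ℝ (Fin 3))) : LieT2SU2) = 0}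

/-- The normal space at `x` to the orbit of `x`. -/
def normalSpace (φ : FormField 3 M) (x : M) : Submodule ℝ (TangentSpace (𝓡 7) x) where
  carrier := {v | ∀ u ∈ orbitTangent x, g2Metric φ x u v = 0}
  zero_mem' := by intro u _; simp [g2Metric]
  add_mem' := by
    intro v w hv hw u hu
    have h1 := hv u hu
    have h2 := hw u hu
    simp only [g2Metric] at h1 h2 ⊢
    rw [map_add, inner_add_right, h1, h2, add_zero]
  smul_mem' := by
    intro c v hv u hu
    have h1 := hv u hu
    simp only [g2Metric] at h1 ⊢
    rw [map_smul, inner_smul_right, h1, mul_zero]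

/-- The isotropy action on `T_x M`: `g ∈ G_x` acts by the derivative at `x` of `y ↦ g • y`. -/
def isotropy (x : M) (g : MulAction.stabilizer (EffGroup M) x) :
    TangentSpace (𝓡 7) x →L[ℝ] TangentSpace (𝓡 7) x :=
  mfderiv (𝓡 7) (𝓡 7) (fun y : M => (g : EffGroup M) • y) x

end Action

/-- The embedding `U(2) → SU(3)`, `A ↦ diag(A, det A⁻¹)`. -/
def u2ToSU3 (A : Matrix.unitaryGroup (Fin 2) ℂ) : Matrix (Fin 3) (Fin 3) ℂ :=
  !![A.1 0 0, A.1 0 1, 0; A.1 1 0, A.1 1 1, 0; 0, 0, (A.1.det)⁻¹]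

end G2Sym

end

open G2Sym

noncomputable section
namespace G2Sym

open Module

/-! ### The cross product of `ℝ⁷` -/

/-! A frame turns the stabilizer `H` of a point `x` into a group of automorphisms of φ₀. These are
isometries that respect the cross product of ℝ⁷ (`IsG2.inner_self`, `IsG2.map_cross`). The basic
rigidity is that a subspace closed under the cross product has dimension 0, 1, 3 or 7. Hence two
automorphisms that agree on an associative plane and on one further vector are equal, and a
derivation that vanishes there is zero. In particular three commuting derivations are always
linearly dependent.

An element that fixes `x` to first order acts trivially on the connected manifold, because its
powers stay in a compact group (`smul_eq_of_tr_eq_id`). So the isotropy representation of the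
effective stabilizer is faithful, and since some orbit has dimension five, its differential is
faithful as well. Closedness of φ gives one more relation. For the generators U₁, U₂ of the torus,
the functional φ(U₁, U₂, ·) on 𝔰𝔲(2) is invariant under the adjoint action and therefore zero, so U₁
× U₂ is normal to the orbit (`phi_infK_eq_zero`). These facts are collected in `IsotropyData`; from
there the classification is algebra.

The torus is central. Therefore `H` fixes the torus directions, and a torus element in `H` fixes the
whole tangent space of the orbit.

If U₁ and U₂ are independent at `x`, then `H` fixes pointwise the associative plane `F` spanned by
U₁, U₂ and U₁ × U₂, and it acts freely on the unit sphere of `Fᗮ` modulo elements acting trivially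
on `M`. The Lie algebra of `H` embeds in 𝔰𝔲(2), so its dimension is 0, 1 or 3. In dimension 0 the
rotation axis of `Ad k` supplies a fourth fixed vector, and `H` acts trivially. In dimension 1 it
rotates a normal plane. In dimension 3 it is transitive on a 3-sphere and must be SU(2).

If U₁ and U₂ are dependent, the bound on commuting derivations shows that exactly one torus
direction lies in the stabilizer. The other gives an invariant unit vector `u`, and `u ×` is an
invariant complex structure on its complement. The stabilizer has dimension 2 or 4. In dimension 2
the tangent space of the orbit is the kernel of a derivation, hence associative, and two commuting
derivations are diagonalised on the normal space. In dimension 4 the weights of the central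
derivation on ℂ³ add up to zero, and 𝔰𝔲(2) kills every simple weight line. This leaves the weights
l, l, -2l, which is the embedding of U(2) in SU(3).

Compactness turns the matching of representations into isomorphisms of topological groups
(`exists_continuousMulEquiv`), and a slice chart shows that orbits are embedded submanifolds
(`exists_slice_chart`). -/

theorem inner_E7 (u v : E7) : inner ℝ u v = u 0 * v 0 + u 1 * v 1 + u 2 * v 2 + u 3 * v 3
    + u 4 * v 4 + u 5 * v 5 + u 6 * v 6 := by
  simp [PiLp.inner_apply, Fin.sum_univ_succ]
  ring

/-- The cross product on `ℝ⁷` determined by `φ₀`. -/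
def cross : E7 →ₗ[ℝ] E7 →ₗ[ℝ] E7 :=
  LinearMap.mk₂ ℝ (fun u v => WithLp.toLp 2
    ![u 1 * v 2 - u 2 * v 1 + (u 3 * v 4 - u 4 * v 3) - (u 5 * v 6 - u 6 * v 5),
      u 2 * v 0 - u 0 * v 2 + (u 3 * v 5 - u 5 * v 3) - (u 6 * v 4 - u 4 * v 6),
      u 0 * v 1 - u 1 * v 0 + (u 3 * v 6 - u 6 * v 3) - (u 4 * v 5 - u 5 * v 4),
      u 4 * v 0 - u 0 * v 4 + (u 5 * v 1 - u 1 * v 5) + (u 6 * v 2 - u 2 * v 6),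
      u 0 * v 3 - u 3 * v 0 - (u 1 * v 6 - u 6 * v 1) - (u 5 * v 2 - u 2 * v 5),
      u 1 * v 3 - u 3 * v 1 - (u 6 * v 0 - u 0 * v 6) - (u 2 * v 4 - u 4 * v 2),
      u 2 * v 3 - u 3 * v 2 - (u 0 * v 5 - u 5 * v 0) - (u 4 * v 1 - u 1 * v 4)])
    (fun u u' v => by ext i; fin_cases i <;> simp <;> ring)
    (fun c u v => by ext i; fin_cases i <;> simp <;> ring)
    (fun u v v' => by ext i; fin_cases i <;> simp <;> ring)
    (fun c u v => by ext i; fin_cases i <;> simp <;> ring)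

section coords
variable (u v : E7)
theorem cross_0 : cross u v 0 =
    u 1 * v 2 - u 2 * v 1 + (u 3 * v 4 - u 4 * v 3) - (u 5 * v 6 - u 6 * v 5) := rfl
theorem cross_1 : cross u v 1 =
    u 2 * v 0 - u 0 * v 2 + (u 3 * v 5 - u 5 * v 3) - (u 6 * v 4 - u 4 * v 6) := rfl
theorem cross_2 : cross u v 2 =
    u 0 * v 1 - u 1 * v 0 + (u 3 * v 6 - u 6 * v 3) - (u 4 * v 5 - u 5 * v 4) := rfl
theorem cross_3 : cross u v 3 =
    u 4 * v 0 - u 0 * v 4 + (u 5 * v 1 - u 1 * v 5) + (u 6 * v 2 - u 2 * v 6) := rfl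
theorem cross_4 : cross u v 4 =
    u 0 * v 3 - u 3 * v 0 - (u 1 * v 6 - u 6 * v 1) - (u 5 * v 2 - u 2 * v 5) := rfl
theorem cross_5 : cross u v 5 =
    u 1 * v 3 - u 3 * v 1 - (u 6 * v 0 - u 0 * v 6) - (u 2 * v 4 - u 4 * v 2) := rfl
theorem cross_6 : cross u v 6 =
    u 2 * v 3 - u 3 * v 2 - (u 0 * v 5 - u 5 * v 0) - (u 4 * v 1 - u 1 * v 4) := rfl
end coords

theorem phi0_apply (v : Fin 3 → E7) : phi0 v = inner ℝ (cross (v 0) (v 1)) (v 2) := by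
  rw [inner_E7]
  simp only [cross_0, cross_1, cross_2, cross_3, cross_4, cross_5, cross_6]
  simp [phi0, coordForm_apply, Matrix.det_fin_three]
  ring

theorem cross_anticomm (u v : E7) : cross u v = -cross v u := by
  ext i
  fin_cases i <;> simp [cross_0, cross_1, cross_2, cross_3, cross_4, cross_5, cross_6] <;> ring

theorem cross_self (u : E7) : cross u u = 0 := by
  ext i
  fin_cases i <;> simp [cross_0, cross_1, cross_2, cross_3, cross_4, cross_5, cross_6] <;> ring

theorem inner_cross_right (u v w : E7) :
    inner ℝ (cross u v) w = -(inner ℝ v (cross u w) : ℝ) := by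
  simp only [inner_E7, cross_0, cross_1, cross_2, cross_3, cross_4, cross_5, cross_6]
  ring

theorem inner_cross_cyclic (u v w : E7) :
    (inner ℝ (cross u v) w : ℝ) = inner ℝ (cross v w) u := by
  simp only [inner_E7, cross_0, cross_1, cross_2, cross_3, cross_4, cross_5, cross_6]
  ring

/-- The cross product with a fixed vector squares to a multiple of a projection. -/
theorem cross_cross_add (a b c : E7) :
    cross a (cross b c) + cross b (cross a c) =
      (inner ℝ a c : ℝ) • b + (inner ℝ b c : ℝ) • a - (2 * inner ℝ a b : ℝ) • c := by
  ext i
  fin_cases i <;>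
  simp [inner_E7, cross_0, cross_1, cross_2, cross_3, cross_4, cross_5, cross_6] <;> ring

/-- The case `b = a` of the polarised identity, divided by two. For a unit vector `a` it makes `a ×`
a complex structure on the complement of `a`. -/
theorem cross_cross (a c : E7) :
    cross a (cross a c) = (inner ℝ a c : ℝ) • a - (inner ℝ a a : ℝ) • c := by
  have h := cross_cross_add a a c
  have h2 : (2 : ℝ) • cross a (cross a c) =
      (2 : ℝ) • ((inner ℝ a c : ℝ) • a - (inner ℝ a a : ℝ) • c) := by
    rw [two_smul, h]
    module
  exact smul_right_injective E7 (two_ne_zero (α := ℝ)) h2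

theorem inner_cross_left_self (u v : E7) : (inner ℝ (cross u v) u : ℝ) = 0 := by
  rw [inner_cross_cyclic, inner_cross_cyclic, cross_self, inner_zero_left]

theorem inner_cross_right_self (u v : E7) : (inner ℝ (cross u v) v : ℝ) = 0 := by
  rw [inner_cross_cyclic, cross_self, inner_zero_left]

theorem inner_cross_cross (u v w : E7) : (inner ℝ (cross u v) (cross u w) : ℝ) =
    inner ℝ u u * inner ℝ v w - inner ℝ u v * inner ℝ u w := by
  rw [inner_cross_right, cross_cross, inner_sub_right, inner_smul_right, inner_smul_right,
    real_inner_comm u v]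
  ring

/-! ### Automorphisms of `φ₀` are orthogonal -/

/-- The matrix of the 2-form `ι_u φ₀`. -/
def contraction (u : E7) : Matrix (Fin 7) (Fin 7) ℝ :=
  Matrix.of fun i j => inner ℝ (cross u (EuclideanSpace.single i 1)) (EuclideanSpace.single j 1)

theorem dotProduct_contraction (u v w : E7) :
    v.ofLp ⬝ᵥ contraction u *ᵥ w.ofLp = inner ℝ (cross u v) w := by
  have h (x : E7) : x = ∑ i, x i • EuclideanSpace.single i (1 : ℝ) := by
    simpa using ((EuclideanSpace.basisFun (Fin 7) ℝ).sum_repr x).symm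
  conv_rhs => rw [h v, h w]
  simp only [map_sum, map_smul, sum_inner, inner_sum, inner_smul_left, inner_smul_right,
    Matrix.mulVec, dotProduct, contraction, Matrix.of_apply, Finset.mul_sum]
  rw [Finset.sum_comm]
  refine Finset.sum_congr rfl fun i _ => Finset.sum_congr rfl fun j _ => ?_
  simp
  ring

theorem inner_eq_dotProduct (v w : E7) : inner ℝ v w = v.ofLp ⬝ᵥ w.ofLp := by
  simp [PiLp.inner_apply, dotProduct, mul_comm]

theorem ext_of_dotProduct {a b : Matrix (Fin 7) (Fin 7) ℝ}
    (h : ∀ v w : E7, v.ofLp ⬝ᵥ a *ᵥ w.ofLp = v.ofLp ⬝ᵥ b *ᵥ w.ofLp) : a = b := by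
  ext i j
  simpa using h (EuclideanSpace.single i 1) (EuclideanSpace.single j 1)

theorem contraction_mulVec (u w : E7) :
    contraction u *ᵥ w.ofLp = -(cross u w).ofLp := by
  refine dotProduct_eq _ _ fun x => ?_
  have := dotProduct_contraction u (WithLp.toLp 2 x) w
  rw [dotProduct_comm, this, inner_cross_right, inner_eq_dotProduct, neg_dotProduct,
    dotProduct_comm]

theorem contraction_mul_self (u : E7) : contraction u * contraction u =
    Matrix.vecMulVec u.ofLp u.ofLp - (inner ℝ u u : ℝ) • (1 : Matrix (Fin 7) (Fin 7) ℝ) := by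
  refine ext_of_dotProduct fun v w => ?_
  have hn : contraction u *ᵥ w.ofLp = (-(cross u w)).ofLp := contraction_mulVec u w
  rw [← Matrix.mulVec_mulVec, hn, dotProduct_contraction,
    inner_neg_right, inner_cross_cross, Matrix.sub_mulVec, dotProduct_sub, Matrix.smul_mulVec,
    Matrix.one_mulVec, dotProduct_smul, ← inner_eq_dotProduct, Matrix.vecMulVec_mulVec,
    inner_eq_dotProduct u w, inner_eq_dotProduct u v]
  simp
  rw [inner_smul_right, inner_eq_dotProduct v w, inner_eq_dotProduct v u,
    dotProduct_comm v.ofLp u.ofLp]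
  ring

/-- Let `C` be the contraction with `v`, and `m = |v|²`. Since `C v = 0` and `C² = v vᵀ - m`, the
product of the two rank-one perturbations of `C` is `-m` times a rank-two perturbation of the
identity. Its determinant reduces to one of size two. -/
theorem det_contraction_add_mul (v b : E7) (hv : v ≠ 0) :
    (contraction v + Matrix.vecMulVec b.ofLp b.ofLp).det *
      (contraction v + Matrix.vecMulVec v.ofLp v.ofLp).det =
      (inner ℝ v v : ℝ) ^ 6 * (inner ℝ b v : ℝ) ^ 2 := by
  set m : ℝ := inner ℝ v v with hm
  set s : ℝ := inner ℝ b v with hs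
  have hm0 : m ≠ 0 := inner_self_ne_zero.mpr hv
  -- the rank two correction
  let w : E7 := cross v b + s • v
  have hvb : (inner ℝ v b : ℝ) = s := real_inner_comm _ _
  have hww : b.ofLp ᵥ* contraction v + s • v.ofLp = w.ofLp := by
    refine dotProduct_eq _ _ fun x => ?_
    have h := dotProduct_contraction v b (WithLp.toLp 2 x)
    rw [add_dotProduct, ← Matrix.dotProduct_mulVec, h, inner_eq_dotProduct]
    simp [w, add_dotProduct]
  let P : Matrix (Fin 2) (Fin 7) ℝ := Matrix.of ![v.ofLp, b.ofLp]
  let Q : Matrix (Fin 2) (Fin 7) ℝ := Matrix.of ![v.ofLp, w.ofLp]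
  have key : (contraction v + Matrix.vecMulVec b.ofLp b.ofLp) *
      (contraction v + Matrix.vecMulVec v.ofLp v.ofLp) =
      (-m) • (1 + Pᵀ * ((-m⁻¹) • Q)) := by
    have h0 : contraction v *ᵥ v.ofLp = 0 := by rw [contraction_mulVec, cross_self]; simp
    rw [add_mul, mul_add, mul_add, contraction_mul_self, Matrix.mul_vecMulVec, h0,
      Matrix.zero_vecMulVec, Matrix.vecMulVec_mul, Matrix.vecMulVec_mul_vecMulVec, ← hm,
      ← inner_eq_dotProduct, ← hs]
    ext i j
    have hwj : (b.ofLp ᵥ* contraction v) j = w.ofLp j - s * v.ofLp j := by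
      rw [← hww]; simp
    simp [P, Q, Matrix.vecMulVec_apply, Matrix.mul_apply, Matrix.one_apply, hwj]
    field_simp
    split_ifs <;> ring
  rw [← Matrix.det_mul, key, Matrix.det_smul, Matrix.det_one_add_mul_comm, Matrix.det_fin_two]
  have e1 : v.ofLp ⬝ᵥ v.ofLp = m := by rw [← inner_eq_dotProduct]
  have e2 : v.ofLp ⬝ᵥ b.ofLp = s := by rw [← inner_eq_dotProduct, hvb]
  have e3 : w.ofLp ⬝ᵥ v.ofLp = s * m := by
    rw [← inner_eq_dotProduct, inner_add_left, inner_cross_left_self, inner_smul_left, ← hm]; simp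
  have e4 : w.ofLp ⬝ᵥ b.ofLp = s * s := by
    rw [← inner_eq_dotProduct, inner_add_left, inner_cross_right_self, inner_smul_left, hvb]; simp
  have f (i j : Fin 2) : (((-m⁻¹) • Q) * Pᵀ) i j = -m⁻¹ * (Q i ⬝ᵥ P j) := by
    rw [Matrix.smul_mul, Matrix.smul_apply, smul_eq_mul, Matrix.mul_apply]; rfl
  have g0 : P 0 = v.ofLp := rfl
  have g1 : P 1 = b.ofLp := rfl
  have g2 : Q 0 = v.ofLp := rfl
  have g3 : Q 1 = w.ofLp := rfl
  rw [Matrix.add_apply, Matrix.add_apply, Matrix.add_apply, Matrix.add_apply, f, f, f, f,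
    g0, g1, g2, g3, e1, e2, e3, e4]
  simp
  field_simp
  ring

/-- The case `b = v` of the product formula evaluates the square of the auxiliary factor, which can
then be cancelled. Squaring avoids deciding the sign of that factor. -/
theorem det_contraction_add_pow (v b : E7) (hv : v ≠ 0) :
    (contraction v + Matrix.vecMulVec b.ofLp b.ofLp).det ^ 2 =
      (inner ℝ v v : ℝ) ^ 4 * (inner ℝ b v : ℝ) ^ 4 := by
  have h1 := det_contraction_add_mul v b hv
  have h2 := det_contraction_add_mul v v hv
  have hm0 : (inner ℝ v v : ℝ) ≠ 0 := inner_self_ne_zero.mpr hv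
  set x := (contraction v + Matrix.vecMulVec b.ofLp b.ofLp).det
  set y := (contraction v + Matrix.vecMulVec v.ofLp v.ofLp).det
  set m : ℝ := inner ℝ v v
  set s : ℝ := inner ℝ b v
  have h3 : x ^ 2 * m ^ 8 = m ^ 4 * s ^ 4 * m ^ 8 := by
    calc x ^ 2 * m ^ 8 = (x * y) ^ 2 := by rw [mul_pow, pow_two y, h2]; ring
      _ = _ := by rw [h1]; ring
  exact mul_right_cancel₀ (pow_ne_zero 8 hm0) h3

/-- `A` is a linear endomorphism of `ℝ⁷` that preserves `φ₀`. -/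
def IsG2 (A : E7 →L[ℝ] E7) : Prop := phi0.compContinuousLinearMap A = phi0

theorem IsG2.phi {A : E7 →L[ℝ] E7} (hA : IsG2 A) (u v w : E7) :
    (inner ℝ (cross (A u) (A v)) (A w) : ℝ) = inner ℝ (cross u v) w := by
  have h := DFunLike.congr_fun hA ![u, v, w]
  rw [ContinuousAlternatingMap.compContinuousLinearMap_apply, phi0_apply, phi0_apply] at h
  simpa using h

/-- A vector `u` of the kernel satisfies `u × v = 0` for all `v`; the double cross product formula
then makes every `v` a multiple of `u`. -/
theorem IsG2.injective {A : E7 →L[ℝ] E7} (hA : IsG2 A) : Function.Injective A := by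
  rw [injective_iff_map_eq_zero]
  intro u hu
  by_contra hne
  have h1 (v w : E7) : (inner ℝ (cross u v) w : ℝ) = 0 := by
    rw [← hA.phi, hu]; simp
  have h2 (v : E7) : cross u v = 0 := inner_self_eq_zero.mp (h1 v _)
  have h3 (v : E7) : (inner ℝ u v : ℝ) • u = (inner ℝ u u : ℝ) • v := by
    have := cross_cross u v
    rw [h2 v, map_zero] at this
    exact (sub_eq_zero.mp this.symm)
  have hm0 : (inner ℝ u u : ℝ) ≠ 0 := inner_self_ne_zero.mpr hne
  have h4 : Module.finrank ℝ E7 ≤ 1 := finrank_le_one u fun v =>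
    ⟨(inner ℝ u u : ℝ)⁻¹ * inner ℝ u v, by rw [mul_smul, h3 v, smul_smul, inv_mul_cancel₀ hm0, one_smul]⟩
  simp at h4

/-- Preserving φ₀ means that the contraction matrices of `u` and `A u` are congruent under `A`.
Comparing determinants of rank-one perturbations expresses `|A u|` through `|u|` and `det A`, so `A`
is conformal. A conformal map satisfies `det² = c⁷` as well as `c² det² = 1`, which leaves only `c =
1`. -/
theorem IsG2.inner_self {A : E7 →L[ℝ] E7} (hA : IsG2 A) (u : E7) :
    (inner ℝ (A u) (A u) : ℝ) = inner ℝ u u := by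
  let a : Matrix (Fin 7) (Fin 7) ℝ := Matrix.of fun i j => A (EuclideanSpace.single j 1) i
  have ha (x : E7) : a *ᵥ x.ofLp = (A x).ofLp := by
    have h : x = ∑ i, x i • EuclideanSpace.single i (1 : ℝ) := by
      simpa using ((EuclideanSpace.basisFun (Fin 7) ℝ).sum_repr x).symm
    conv_rhs => rw [h]
    ext i
    simp [a, Matrix.mulVec, dotProduct, mul_comm]
  have hdet : a.det ≠ 0 := by
    intro h0
    obtain ⟨x, hx, hx0⟩ := Matrix.exists_mulVec_eq_zero_iff.mpr h0
    apply hx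
    have h1 := ha (WithLp.toLp 2 x)
    rw [hx0] at h1
    have h2 : A (WithLp.toLp 2 x) = 0 := by ext i; exact (congrFun h1 i).symm
    have h3 := hA.injective (h2.trans (map_zero A).symm)
    exact congrArg WithLp.ofLp h3
  have hcong (u : E7) : aᵀ * contraction (A u) * a = contraction u := by
    refine ext_of_dotProduct fun v w => ?_
    rw [dotProduct_contraction, ← hA.phi, ← dotProduct_contraction, ← ha, ← ha,
      ← Matrix.mulVec_mulVec, ← Matrix.mulVec_mulVec, Matrix.dotProduct_mulVec v.ofLp,
      Matrix.vecMul_transpose]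
  have hpow (u : E7) (hu : u ≠ 0) :
      a.det ^ 4 * (inner ℝ (A u) (A u) : ℝ) ^ 4 = (inner ℝ u u : ℝ) ^ 4 := by
    -- Chosen so that `aᵀ b = u`: the congruence then carries `b bᵀ` to `u uᵀ`, and `⟨b, A u⟩ = ⟨u,
    -- u⟩`.
    let b : E7 := WithLp.toLp 2 ((a⁻¹)ᵀ *ᵥ u.ofLp)
    have hb : aᵀ *ᵥ b.ofLp = u.ofLp := by
      simp only [b, Matrix.mulVec_mulVec, ← Matrix.transpose_mul]
      rw [Matrix.nonsing_inv_mul _ (Ne.isUnit hdet)]; simp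
    have hba : (inner ℝ b (A u) : ℝ) = inner ℝ u u := by
      rw [inner_eq_dotProduct, ← ha, Matrix.dotProduct_mulVec, ← Matrix.mulVec_transpose, hb,
        inner_eq_dotProduct]
    have h1 : aᵀ * (contraction (A u) + Matrix.vecMulVec b.ofLp b.ofLp) * a =
        contraction u + Matrix.vecMulVec u.ofLp u.ofLp := by
      rw [mul_add, add_mul, hcong, Matrix.mul_vecMulVec, hb, Matrix.vecMulVec_mul,
        ← Matrix.mulVec_transpose, hb]
    have h2 := congrArg (fun x => x.det ^ 2) h1
    simp only [Matrix.det_mul, Matrix.det_transpose, mul_pow] at h2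
    have hAu : A u ≠ 0 := fun h => hu (hA.injective (h.trans (map_zero A).symm))
    rw [det_contraction_add_pow _ _ hAu, det_contraction_add_pow _ _ hu, hba] at h2
    have hm0 : (inner ℝ u u : ℝ) ≠ 0 := inner_self_ne_zero.mpr hu
    refine mul_right_cancel₀ (pow_ne_zero 4 hm0) ?_
    linear_combination h2
  -- By `hpow`, the map `A` multiplies squared lengths by this constant.
  set c : ℝ := |a.det|⁻¹ with hc
  have hc0 : 0 < c := inv_pos.mpr (abs_pos.mpr hdet)
  have hconf (u : E7) : (inner ℝ (A u) (A u) : ℝ) = c * inner ℝ u u := by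
    rcases eq_or_ne u 0 with rfl | hu
    · simp
    have h := hpow u hu
    have h1 : (inner ℝ (A u) (A u) : ℝ) ^ 4 = (c * inner ℝ u u) ^ 4 := by
      rw [mul_pow, ← h, hc, inv_pow, (by decide : Even 4).pow_abs]
      field_simp
    exact (pow_left_inj₀ real_inner_self_nonneg
      (mul_nonneg hc0.le real_inner_self_nonneg) (by norm_num)).mp h1
  have hpol (u v : E7) : (inner ℝ (A u) (A v) : ℝ) = c * inner ℝ u v := by
    have h1 := hconf (u + v)
    rw [map_add, real_inner_add_add_self, real_inner_add_add_self, hconf, hconf] at h1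
    linarith
  have hata : aᵀ * a = c • (1 : Matrix (Fin 7) (Fin 7) ℝ) := by
    refine ext_of_dotProduct fun v w => ?_
    rw [← Matrix.mulVec_mulVec, Matrix.dotProduct_mulVec, Matrix.vecMul_transpose, ha, ha,
      ← inner_eq_dotProduct, hpol, Matrix.smul_mulVec, Matrix.one_mulVec, dotProduct_smul,
      inner_eq_dotProduct, smul_eq_mul]
  have hd := congrArg Matrix.det hata
  rw [Matrix.det_mul, Matrix.det_transpose, Matrix.det_smul, Matrix.det_one] at hd
  have hd' : a.det * a.det = c ^ 7 := by simpa using hd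
  have h9 : c ^ 9 = 1 := by
    have : c ^ 2 * (a.det * a.det) = 1 := by
      rw [hc, inv_pow, sq_abs]; field_simp
    calc c ^ 9 = c ^ 2 * c ^ 7 := by ring
      _ = 1 := by rw [← hd', this]
  have hc1 : c = 1 := (pow_eq_one_iff_of_nonneg hc0.le (by norm_num)).mp h9
  rw [hconf, hc1, one_mul]

theorem IsG2.inner {A : E7 →L[ℝ] E7} (hA : IsG2 A) (u v : E7) :
    (inner ℝ (A u) (A v) : ℝ) = inner ℝ u v := by
  have h1 := hA.inner_self (u + v)
  rw [map_add, real_inner_add_add_self, real_inner_add_add_self, hA.inner_self,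
    hA.inner_self] at h1
  linarith

theorem IsG2.norm {A : E7 →L[ℝ] E7} (hA : IsG2 A) (u : E7) : ‖A u‖ = ‖u‖ := by
  rw [norm_eq_sqrt_real_inner, hA.inner_self, ← norm_eq_sqrt_real_inner]

theorem IsG2.surjective {A : E7 →L[ℝ] E7} (hA : IsG2 A) : Function.Surjective A :=
  (LinearMap.injective_iff_surjective (f := A.toLinearMap)).mp hA.injective

/-- The cross product is φ₀ with an index raised by the metric, and both are preserved. -/
theorem IsG2.map_cross {A : E7 →L[ℝ] E7} (hA : IsG2 A) (u v : E7) :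
    A (cross u v) = cross (A u) (A v) := by
  refine ext_inner_right ℝ fun w => ?_
  obtain ⟨z, rfl⟩ := hA.surjective w
  rw [hA.inner, hA.phi]

/-! ### Subspaces closed under the cross product -/

/-- A subspace of `ℝ⁷` that is closed under the cross product. -/
def CrossClosed (F : Submodule ℝ E7) : Prop := ∀ u ∈ F, ∀ v ∈ F, cross u v ∈ F

theorem CrossClosed.inf {F G : Submodule ℝ E7} (hF : CrossClosed F) (hG : CrossClosed G) :
    CrossClosed (F ⊓ G) :=
  fun u hu v hv => ⟨hF u hu.1 v hv.1, hG u hu.2 v hv.2⟩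

theorem finrank_orthogonal_E7 (F : Submodule ℝ E7) : finrank ℝ F + finrank ℝ Fᗮ = 7 := by
  rw [Submodule.finrank_add_finrank_orthogonal, finrank_euclideanSpace, Fintype.card_fin]

theorem inner_eq_zero_of_mem {F : Submodule ℝ E7} {f m : E7} (hf : f ∈ F) (hm : m ∈ Fᗮ) :
    (inner ℝ f m : ℝ) = 0 := (Submodule.mem_orthogonal F m).mp hm f hf

theorem inner_eq_zero_of_mem' {F : Submodule ℝ E7} {f m : E7} (hf : f ∈ F) (hm : m ∈ Fᗮ) :
    (inner ℝ m f : ℝ) = 0 := (Submodule.mem_orthogonal' F m).mp hm f hf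

theorem CrossClosed.cross_mem_orthogonal {F : Submodule ℝ E7} (hF : CrossClosed F) {f m : E7}
    (hf : f ∈ F) (hm : m ∈ Fᗮ) : cross f m ∈ Fᗮ := by
  rw [Submodule.mem_orthogonal']
  intro g hg
  rw [inner_cross_right, inner_eq_zero_of_mem' (hF f hf g hg) hm, neg_zero]

/-- For `f` orthogonal to `m` one has `|f × m| = |f| |m|`. -/
theorem injOn_cross {F : Submodule ℝ E7} {m : E7} (hm : m ∈ Fᗮ) (hm0 : m ≠ 0) :
    Function.Injective ((cross.flip m).domRestrict F) := by
  rw [injective_iff_map_eq_zero]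
  rintro ⟨f, hf⟩ h
  have h0 : cross f m = 0 := h
  have h1 := inner_cross_cross f m m
  rw [h0, inner_zero_left, inner_eq_zero_of_mem hf hm, mul_zero, sub_zero] at h1
  rcases mul_eq_zero.mp h1.symm with h2 | h2
  · exact Subtype.ext (inner_self_eq_zero.mp h2)
  · exact absurd (inner_self_eq_zero.mp h2) hm0

theorem finrank_map_cross {F : Submodule ℝ E7} {m : E7} (hm : m ∈ Fᗮ) (hm0 : m ≠ 0) :
    finrank ℝ (F.map (cross.flip m)) = finrank ℝ F := by
  rw [← LinearMap.range_domRestrict, LinearMap.finrank_range_of_inj (injOn_cross hm hm0)]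

/-- If `m ≠ 0` is orthogonal to `F`, then `f ↦ f × m` embeds `F` in its orthogonal complement, so
twice the dimension of `F` is at most seven. -/
theorem CrossClosed.eq_top {F : Submodule ℝ E7} (hF : CrossClosed F) (h4 : 4 ≤ finrank ℝ F) :
    F = ⊤ := by
  by_contra hne
  have h7 := finrank_orthogonal_E7 F
  have hb : Fᗮ ≠ ⊥ := fun h => hne (Submodule.orthogonal_eq_bot_iff.mp h)
  obtain ⟨m, hm, hm0⟩ := Submodule.exists_mem_ne_zero_of_ne_bot hb
  have hle : F.map (cross.flip m) ≤ Fᗮ := by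
    rintro _ ⟨f, hf, rfl⟩
    exact hF.cross_mem_orthogonal hf hm
  have := Submodule.finrank_mono hle
  rw [finrank_map_cross hm hm0] at this
  omega

theorem exists_unit_mem_orthogonal {F G : Submodule ℝ E7} (h : finrank ℝ G < finrank ℝ F) :
    ∃ w ∈ F, ‖w‖ = 1 ∧ w ∈ Gᗮ := by
  have h1 := Submodule.finrank_sup_add_finrank_inf_eq F Gᗮ
  have h2 := finrank_orthogonal_E7 G
  have h3 : finrank ℝ ↥(F ⊔ Gᗮ) ≤ 7 := by
    simpa using Submodule.finrank_le (F ⊔ Gᗮ)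
  have h4 : F ⊓ Gᗮ ≠ ⊥ := by
    intro h0
    rw [h0, finrank_bot] at h1
    omega
  obtain ⟨w, hw, hw0⟩ := Submodule.exists_mem_ne_zero_of_ne_bot h4
  refine ⟨(‖w‖⁻¹ : ℝ) • w, F.smul_mem _ hw.1, ?_, Submodule.smul_mem _ _ hw.2⟩
  rw [norm_smul, norm_inv, norm_norm, inv_mul_cancel₀ (norm_ne_zero_iff.mpr hw0)]

theorem inner_self_of_norm_one {u : E7} (hu : ‖u‖ = 1) : (inner ℝ u u : ℝ) = 1 := by
  rw [real_inner_self_eq_norm_sq, hu, one_pow]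

theorem exists_orthonormal_pair {F : Submodule ℝ E7} (h : 2 ≤ finrank ℝ F) :
    ∃ u ∈ F, ∃ v ∈ F, ‖u‖ = 1 ∧ ‖v‖ = 1 ∧ (inner ℝ u v : ℝ) = 0 := by
  obtain ⟨u, hu, hu1, -⟩ := exists_unit_mem_orthogonal (F := F) (G := ⊥) (by simp; omega)
  obtain ⟨v, hv, hv1, hvu⟩ := exists_unit_mem_orthogonal (F := F) (G := ℝ ∙ u)
    (lt_of_le_of_lt (finrank_span_singleton (K := ℝ) (by rintro rfl; simp at hu1)).le (by omega))
  exact ⟨u, hu, v, hv, hu1, hv1, inner_eq_zero_of_mem (Submodule.mem_span_singleton_self u) hvu⟩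

theorem norm_cross {u v : E7} (hu : ‖u‖ = 1) (huv : (inner ℝ u v : ℝ) = 0) :
    ‖cross u v‖ = ‖v‖ := by
  rw [norm_eq_sqrt_real_inner, inner_cross_cross, inner_self_of_norm_one hu, huv,
    norm_eq_sqrt_real_inner]
  simp

theorem orthonormal_cross {u v : E7} (hu : ‖u‖ = 1) (hv : ‖v‖ = 1)
    (huv : (inner ℝ u v : ℝ) = 0) : Orthonormal ℝ ![u, v, cross u v] := by
  rw [orthonormal_iff_ite]
  have h1 := inner_self_of_norm_one hu
  have h2 := inner_self_of_norm_one hv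
  have h3 : (inner ℝ (cross u v) (cross u v) : ℝ) = 1 :=
    inner_self_of_norm_one ((norm_cross hu huv).trans hv)
  have h4 := inner_cross_left_self u v
  have h5 := inner_cross_right_self u v
  have h4' := (real_inner_comm _ _).trans h4
  have h5' := (real_inner_comm _ _).trans h5
  have huv' := (real_inner_comm _ _).trans huv
  intro i j
  fin_cases i <;> fin_cases j <;> simp_all

/-- The span of two vectors and of their cross product. -/
def assocSpan (u v : E7) : Submodule ℝ E7 := Submodule.span ℝ (Set.range ![u, v, cross u v])

theorem mem_assocSpan {u v x : E7} :
    x ∈ assocSpan u v ↔ ∃ a b c : ℝ, x = a • u + b • v + c • cross u v := by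
  rw [assocSpan, Submodule.mem_span_range_iff_exists_fun]
  constructor
  · rintro ⟨c, rfl⟩
    exact ⟨c 0, c 1, c 2, by simp [Fin.sum_univ_three]⟩
  · rintro ⟨a, b, c, rfl⟩
    exact ⟨![a, b, c], by simp [Fin.sum_univ_three]⟩

theorem left_mem_assocSpan (u v : E7) : u ∈ assocSpan u v :=
  Submodule.subset_span ⟨0, rfl⟩

theorem right_mem_assocSpan (u v : E7) : v ∈ assocSpan u v :=
  Submodule.subset_span ⟨1, rfl⟩

theorem cross_mem_assocSpan (u v : E7) : cross u v ∈ assocSpan u v :=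
  Submodule.subset_span ⟨2, rfl⟩

theorem assocSpan_le {u v : E7} {F : Submodule ℝ E7} (hF : CrossClosed F) (hu : u ∈ F)
    (hv : v ∈ F) : assocSpan u v ≤ F := by
  intro x hx
  obtain ⟨a, b, c, rfl⟩ := mem_assocSpan.mp hx
  exact F.add_mem (F.add_mem (F.smul_mem _ hu) (F.smul_mem _ hv)) (F.smul_mem _ (hF _ hu _ hv))

theorem finrank_assocSpan {u v : E7} (hu : ‖u‖ = 1) (hv : ‖v‖ = 1)
    (huv : (inner ℝ u v : ℝ) = 0) : finrank ℝ (assocSpan u v) = 3 := by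
  rw [assocSpan, finrank_span_eq_card (orthonormal_cross hu hv huv).linearIndependent]
  simp

/-- The double products `u × (u × v)` and `v × (u × v)` are combinations of `u` and `v`. No
orthogonality is needed. -/
theorem crossClosed_assocSpan (u v : E7) : CrossClosed (assocSpan u v) := by
  have h1 : cross u (cross u v) ∈ assocSpan u v := by
    rw [cross_cross]
    exact Submodule.sub_mem _ (Submodule.smul_mem _ _ (left_mem_assocSpan u v))
      (Submodule.smul_mem _ _ (right_mem_assocSpan u v))
  have h2 : cross v (cross u v) ∈ assocSpan u v := by
    rw [cross_anticomm u v, map_neg, cross_cross]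
    exact Submodule.neg_mem _ (Submodule.sub_mem _
      (Submodule.smul_mem _ _ (right_mem_assocSpan u v))
      (Submodule.smul_mem _ _ (left_mem_assocSpan u v)))
  intro x hx y hy
  obtain ⟨a, b, c, rfl⟩ := mem_assocSpan.mp hx
  obtain ⟨a', b', c', rfl⟩ := mem_assocSpan.mp hy
  have key : cross (a • u + b • v + c • cross u v) (a' • u + b' • v + c' • cross u v) =
      (a * b' - b * a') • cross u v + (a * c' - c * a') • cross u (cross u v) +
      (b * c' - c * b') • cross v (cross u v) := by
    simp only [map_add, map_smul, LinearMap.add_apply, LinearMap.smul_apply, cross_self]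
    rw [cross_anticomm v u, cross_anticomm (cross u v) u, cross_anticomm (cross u v) v]
    module
  rw [key]
  exact Submodule.add_mem _ (Submodule.add_mem _ (Submodule.smul_mem _ _ (cross_mem_assocSpan u v))
    (Submodule.smul_mem _ _ h1)) (Submodule.smul_mem _ _ h2)

theorem CrossClosed.three_le {F : Submodule ℝ E7} (hF : CrossClosed F) (h : 2 ≤ finrank ℝ F) :
    3 ≤ finrank ℝ F := by
  obtain ⟨u, hu, v, hv, hu1, hv1, huv⟩ := exists_orthonormal_pair h
  rw [← finrank_assocSpan hu1 hv1 huv]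
  exact Submodule.finrank_mono (assocSpan_le hF hu hv)

theorem succ_le_finrank {F K : Submodule ℝ E7} {w : E7} (hFK : F ≤ K) (hw : w ∈ K) (hwF : w ∉ F) :
    finrank ℝ F + 1 ≤ finrank ℝ K :=
  Submodule.finrank_lt_finrank_of_lt (lt_of_le_of_ne hFK fun h => hwF (h ▸ hw))

theorem not_mem_of_mem_orthogonal {F : Submodule ℝ E7} {w : E7} (hw : w ∈ Fᗮ) (hw0 : w ≠ 0) :
    w ∉ F := fun h => hw0 (inner_self_eq_zero.mp (inner_eq_zero_of_mem h hw))

/-- The orthogonal complement of an associative plane `F` is spanned by `w` and `F × w`. -/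
theorem CrossClosed.exists_cross_eq {F : Submodule ℝ E7} (hF : CrossClosed F)
    (h3 : finrank ℝ F = 3) {w z : E7} (hw : w ∈ Fᗮ) (hw0 : w ≠ 0) (hz : z ∈ Fᗮ)
    (hwz : (inner ℝ w z : ℝ) = 0) : ∃ f ∈ F, cross f w = z := by
  have hle : F.map (cross.flip w) ≤ (ℝ ∙ w)ᗮ ⊓ Fᗮ := by
    rintro _ ⟨f, hf, rfl⟩
    refine ⟨?_, hF.cross_mem_orthogonal hf hw⟩
    rw [SetLike.mem_coe, Submodule.mem_orthogonal_singleton_iff_inner_left]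
    exact inner_cross_right_self f w
  have h1 := Submodule.finrank_add_inf_finrank_orthogonal
    (K₁ := ℝ ∙ w) (K₂ := Fᗮ) ((Submodule.span_singleton_le_iff_mem _ _).mpr hw)
  rw [finrank_span_singleton hw0] at h1
  have h2 := finrank_orthogonal_E7 F
  have heq := Submodule.eq_of_le_of_finrank_le hle (by rw [finrank_map_cross hw hw0]; omega)
  have hzm : z ∈ F.map (cross.flip w) := by
    rw [heq]
    exact ⟨Submodule.mem_orthogonal_singleton_iff_inner_right.mpr hwz, hz⟩
  obtain ⟨f, hf, h⟩ := hzm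
  exact ⟨f, hf, h⟩

/-! ### Automorphisms and derivations with many fixed vectors -/

theorem IsG2.crossClosed_eqLocus {A B : E7 →L[ℝ] E7} (hA : IsG2 A) (hB : IsG2 B) :
    CrossClosed (LinearMap.eqLocus A.toLinearMap B.toLinearMap) := by
  intro u hu v hv
  have hu' : A u = B u := hu
  have hv' : A v = B v := hv
  change A (cross u v) = B (cross u v)
  rw [hA.map_cross, hB.map_cross, hu', hv']

/-- The set where two automorphisms agree is closed under the cross product, and such a subspace of
dimension at least four is everything. -/
theorem IsG2.ext_of_finrank {A B : E7 →L[ℝ] E7} (hA : IsG2 A) (hB : IsG2 B) {F : Submodule ℝ E7}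
    (hF : ∀ v ∈ F, A v = B v) (h4 : 4 ≤ finrank ℝ F) : A = B := by
  have h := (hA.crossClosed_eqLocus hB).eq_top (h4.trans (Submodule.finrank_mono fun v hv => hF v hv))
  ext1 v
  have : v ∈ LinearMap.eqLocus A.toLinearMap B.toLinearMap := h ▸ Submodule.mem_top
  exact this

theorem isG2_id : IsG2 (ContinuousLinearMap.id ℝ E7) := by
  ext v; rfl

/-- This is the form in which rigidity is used: elements that fix an associative plane pointwise are
determined by the image of one vector outside it. -/
theorem IsG2.ext_of_assoc {A B : E7 →L[ℝ] E7} (hA : IsG2 A) (hB : IsG2 B) {F : Submodule ℝ E7}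
    (h3 : finrank ℝ F = 3) (hF : ∀ v ∈ F, A v = B v) {w : E7} (hw : w ∉ F) (h : A w = B w) :
    A = B := by
  have h1 := succ_le_finrank (F := F) (K := LinearMap.eqLocus A.toLinearMap B.toLinearMap)
    (fun v hv => hF v hv) h hw
  exact hA.ext_of_finrank hB (F := LinearMap.eqLocus A.toLinearMap B.toLinearMap)
    (fun v hv => hv) (by omega)

/-- `B` is a derivation of the cross product and of the metric, i.e. an element of `𝔤₂`. -/
structure IsDer (B : E7 →L[ℝ] E7) : Prop where
  map_cross : ∀ u v, B (cross u v) = cross (B u) v + cross u (B v)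
  skew : ∀ u v, (inner ℝ (B u) v : ℝ) = -inner ℝ u (B v)

theorem IsDer.add {B C : E7 →L[ℝ] E7} (hB : IsDer B) (hC : IsDer C) : IsDer (B + C) where
  map_cross u v := by
    simp only [_root_.add_apply, hB.map_cross, hC.map_cross, map_add, LinearMap.add_apply]
    abel
  skew u v := by
    simp only [_root_.add_apply, inner_add_left, inner_add_right, hB.skew, hC.skew]
    ring

theorem IsDer.smul {B : E7 →L[ℝ] E7} (hB : IsDer B) (c : ℝ) : IsDer (c • B) where
  map_cross u v := by
    simp only [_root_.smul_apply, hB.map_cross, map_smul, LinearMap.smul_apply, smul_add]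
  skew u v := by
    simp only [_root_.smul_apply, inner_smul_left, inner_smul_right, hB.skew]
    simp

theorem IsDer.inner_self {B : E7 →L[ℝ] E7} (hB : IsDer B) (u : E7) :
    (inner ℝ (B u) u : ℝ) = 0 := by
  have h := hB.skew u u
  rw [real_inner_comm (B u) u] at h
  linarith

theorem IsDer.crossClosed_ker {B : E7 →L[ℝ] E7} (hB : IsDer B) :
    CrossClosed (LinearMap.ker B.toLinearMap) := by
  intro u hu v hv
  have hu' : B u = 0 := hu
  have hv' : B v = 0 := hv
  change B (cross u v) = 0
  rw [hB.map_cross, hu', hv']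
  simp

theorem IsDer.eq_zero_of_finrank {B : E7 →L[ℝ] E7} (hB : IsDer B) {F : Submodule ℝ E7}
    (hF : ∀ v ∈ F, B v = 0) (h4 : 4 ≤ finrank ℝ F) : B = 0 := by
  have h := hB.crossClosed_ker.eq_top (h4.trans (Submodule.finrank_mono fun v hv => hF v hv))
  ext1 v
  have : v ∈ LinearMap.ker B.toLinearMap := h ▸ Submodule.mem_top
  exact this

theorem IsDer.eq_zero_of_assoc {B : E7 →L[ℝ] E7} (hB : IsDer B) {F : Submodule ℝ E7}
    (h3 : finrank ℝ F = 3) (hF : ∀ v ∈ F, B v = 0) {w : E7} (hw : w ∉ F) (h : B w = 0) :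
    B = 0 := by
  have h1 := succ_le_finrank (F := F) (K := LinearMap.ker B.toLinearMap)
    (fun v hv => hF v hv) h hw
  exact hB.eq_zero_of_finrank (F := LinearMap.ker B.toLinearMap) (fun v hv => hv) (by omega)

theorem IsDer.mem_orthogonal {B : E7 →L[ℝ] E7} (hB : IsDer B) {F : Submodule ℝ E7}
    (hF : ∀ v ∈ F, B v ∈ F) {m : E7} (hm : m ∈ Fᗮ) : B m ∈ Fᗮ := by
  rw [Submodule.mem_orthogonal']
  intro f hf
  rw [hB.skew, inner_eq_zero_of_mem' (hF f hf) hm, neg_zero]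

/-- Commuting derivations with two common independent zeros are linearly dependent. -/
theorem IsDer.dependent_of_commute {B C : E7 →L[ℝ] E7} (hB : IsDer B) (hC : IsDer C)
    (hBC : ∀ v, B (C v) = C (B v)) {F₀ : Submodule ℝ E7} (h2 : 2 ≤ finrank ℝ F₀)
    (hF₀B : ∀ v ∈ F₀, B v = 0) (hF₀C : ∀ v ∈ F₀, C v = 0) :
    ∃ s t : ℝ, (s ≠ 0 ∨ t ≠ 0) ∧ s • B + t • C = 0 := by
  by_cases hB0 : B = 0
  · exact ⟨1, 0, Or.inl one_ne_zero, by ext1; simp [hB0]⟩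
  set F := LinearMap.ker B.toLinearMap ⊓ LinearMap.ker C.toLinearMap with hFdef
  have hF : CrossClosed F := hB.crossClosed_ker.inf hC.crossClosed_ker
  have hle : F₀ ≤ F := fun v hv => ⟨hF₀B v hv, hF₀C v hv⟩
  have h3 : 3 ≤ finrank ℝ F := hF.three_le (h2.trans (Submodule.finrank_mono hle))
  have hFB : ∀ v ∈ F, B v = 0 := fun v hv => hv.1
  have hFC : ∀ v ∈ F, C v = 0 := fun v hv => hv.2
  have h3' : finrank ℝ F = 3 := by
    by_contra hne
    exact hB0 (hB.eq_zero_of_finrank hFB (by omega))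
  have h7 := finrank_orthogonal_E7 F
  obtain ⟨w, hw, hw1, -⟩ := exists_unit_mem_orthogonal (F := Fᗮ) (G := ⊥) (by simp; omega)
  have hw0 : w ≠ 0 := by rintro rfl; simp at hw1
  have hwF := not_mem_of_mem_orthogonal hw hw0
  have hBw : B w ∈ Fᗮ := hB.mem_orthogonal (fun v hv => by rw [hFB v hv]; exact F.zero_mem) hw
  have hCw : C w ∈ Fᗮ := hC.mem_orthogonal (fun v hv => by rw [hFC v hv]; exact F.zero_mem) hw
  -- A skew map sends `w` to a vector orthogonal to `w`, hence to some `b × w` with `b` in the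
  -- common kernel; likewise for `C`. Both derivations are encoded by the vectors `b` and `c`.
  obtain ⟨b, hb, hbw⟩ := hF.exists_cross_eq h3' hw hw0 hBw
    (by rw [real_inner_comm]; exact hB.inner_self w)
  obtain ⟨c, hc, hcw⟩ := hF.exists_cross_eq h3' hw hw0 hCw
    (by rw [real_inner_comm]; exact hC.inner_self w)
  have e1 : B (C w) = cross c (B w) := by rw [← hcw, hB.map_cross, hFB c hc]; simp
  have e2 : C (B w) = cross b (C w) := by
    conv_lhs => rw [← hbw]
    rw [hC.map_cross, hFC b hb]; simp
  -- Because `B` and `C` commute, the two summands of the Clifford relation for `b` and `c` coincide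
  -- at `w`, so each is half of the right-hand side.
  have e3 : cross b (cross c w) = -(inner ℝ b c : ℝ) • w := by
    have h := cross_cross_add b c w
    rw [inner_eq_zero_of_mem hb hw, inner_eq_zero_of_mem hc hw, hbw, ← e1, hBC, e2, ← hcw] at h
    have h' : (2 : ℝ) • cross b (cross c w) = (2 : ℝ) • (-(inner ℝ b c : ℝ) • w) := by
      rw [two_smul, h]; module
    exact smul_right_injective E7 (two_ne_zero (α := ℝ)) h'
  -- Applying `b ×` once more yields a linear relation between `B w` and `C w`, which extends to one
  -- between `B` and `C`.
  have e4 : (inner ℝ b b : ℝ) • C w = (inner ℝ b c : ℝ) • B w := by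
    have h := cross_cross b (cross c w)
    rw [e3, map_smul, hbw, hcw, inner_eq_zero_of_mem hb hCw, zero_smul, zero_sub] at h
    rw [← neg_inj, ← h, neg_smul]
  by_cases hb0 : b = 0
  · refine absurd (hB.eq_zero_of_assoc h3' hFB hwF ?_) hB0
    rw [← hbw, hb0]; simp
  · refine ⟨-inner ℝ b c, inner ℝ b b, Or.inr (inner_self_ne_zero.mpr hb0), ?_⟩
    refine ((hB.smul _).add (hC.smul _)).eq_zero_of_assoc h3' (fun v hv => ?_) hwF ?_
    · simp [hFB v hv, hFC v hv]
    · simp only [_root_.add_apply, _root_.smul_apply, e4]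
      module

/-- A skew endomorphism has a zero in each odd-dimensional invariant subspace. -/
theorem IsDer.exists_zero {B : E7 →L[ℝ] E7} (hB : IsDer B) {V : Submodule ℝ E7}
    (hV : ∀ v ∈ V, B v ∈ V) (hodd : Odd (finrank ℝ V)) : ∃ v ∈ V, v ≠ 0 ∧ B v = 0 := by
  let T : V →ₗ[ℝ] V := B.toLinearMap.restrict hV
  let b := stdOrthonormalBasis ℝ V
  have hM : (LinearMap.toMatrix b.toBasis b.toBasis T)ᵀ =
      -LinearMap.toMatrix b.toBasis b.toBasis T := by
    ext i j
    simp only [Matrix.transpose_apply, Matrix.neg_apply, LinearMap.toMatrix_apply,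
      OrthonormalBasis.coe_toBasis, OrthonormalBasis.coe_toBasis_repr_apply,
      OrthonormalBasis.repr_apply_apply]
    have h := hB.skew (b i : E7) (b j : E7)
    have e : (inner ℝ (b j) (T (b i)) : ℝ) = inner ℝ ((b j : V) : E7) (B (b i : E7)) := rfl
    have e' : (inner ℝ (b i) (T (b j)) : ℝ) = inner ℝ ((b i : V) : E7) (B (b j : E7)) := rfl
    rw [e, e', real_inner_comm, h]
  have hdet : LinearMap.det T = 0 := by
    rw [← LinearMap.det_toMatrix b.toBasis]
    have h := congrArg Matrix.det hM
    rw [Matrix.det_transpose, Matrix.det_neg, Fintype.card_fin, hodd.neg_one_pow] at h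
    linarith
  obtain ⟨v, hv, hv0⟩ := Submodule.exists_mem_ne_zero_of_ne_bot
    (LinearMap.bot_lt_ker_of_det_eq_zero hdet).ne'
  exact ⟨v, v.2, fun h => hv0 (Subtype.ext h), congrArg Subtype.val hv⟩

/-- On the complement of the kernel inside `V`, the derivation is skew and injective, so that
complement has even dimension. -/
theorem IsDer.odd_finrank_inf_ker {B : E7 →L[ℝ] E7} (hB : IsDer B) {V : Submodule ℝ E7}
    (hV : ∀ v ∈ V, B v ∈ V) (hodd : Odd (finrank ℝ V)) :
    Odd (finrank ℝ ↥(V ⊓ LinearMap.ker B.toLinearMap)) := by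
  set K := V ⊓ LinearMap.ker B.toLinearMap
  have h := Submodule.finrank_add_inf_finrank_orthogonal (K₁ := K) (K₂ := V) inf_le_left
  by_contra hne
  have h2 : Odd (finrank ℝ ↥(Kᗮ ⊓ V)) := by
    rw [Nat.not_odd_iff_even] at hne
    rw [← h, Nat.odd_add] at hodd
    by_contra h3
    rw [Nat.not_odd_iff_even] at h3
    exact Nat.not_odd_iff_even.mpr hne (hodd.mpr h3)
  obtain ⟨v, hv, hv0, hBv⟩ := hB.exists_zero (V := Kᗮ ⊓ V) (fun v hv =>
    ⟨hB.mem_orthogonal (fun u hu => by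
      have : B u = 0 := hu.2
      rw [this]; exact K.zero_mem) hv.1, hV v hv.2⟩) h2
  exact not_mem_of_mem_orthogonal hv.1 hv0 ⟨hv.2, hBv⟩

/-- A derivation that kills the unit vector `u` acts as a multiple of the complex structure `u ×`
on some vector of each nonzero invariant complex subspace of `uᗮ`. -/
theorem IsDer.exists_eigenvector {B : E7 →L[ℝ] E7} (hB : IsDer B) {u : E7} (hu : ‖u‖ = 1)
    (hBu : B u = 0) {V : Submodule ℝ E7} (hV : V ≠ ⊥) (hVu : ∀ v ∈ V, (inner ℝ u v : ℝ) = 0)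
    (hVB : ∀ v ∈ V, B v ∈ V) (hVI : ∀ v ∈ V, cross u v ∈ V) :
    ∃ l : ℝ, ∃ v ∈ V, ‖v‖ = 1 ∧ B v = l • cross u v := by
  -- `B` and `u ×` are skew and commute, so their product is symmetric and has a real eigenvector in
  -- `V`; applying `u ×` to the eigenvalue equation recovers `B`.
  let T₀ : E7 →ₗ[ℝ] E7 := -(cross u ∘ₗ B.toLinearMap)
  have hT₀ (v : E7) : T₀ v = -cross u (B v) := rfl
  have hsymm : T₀.IsSymmetric := by
    intro v w
    rw [hT₀, hT₀, inner_neg_left, inner_neg_right, inner_cross_right, hB.skew, hB.map_cross, hBu]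
    simp
  have hinv : ∀ v ∈ V, T₀ v ∈ V := fun v hv => V.neg_mem (hVI _ (hVB v hv))
  have : Nontrivial V := Submodule.nontrivial_iff_ne_bot.mpr hV
  obtain ⟨v, hv⟩ := (hsymm.restrict_invariant hinv).hasEigenvalue_iSup_of_finiteDimensional.exists_hasEigenvector
  set l := (⨆ x : { x : V // x ≠ 0 },
    RCLike.re (inner ℝ ((T₀.restrict hinv) ↑x) (x : V)) / ‖(x : V)‖ ^ 2 : ℝ)
  have h1 : T₀ v = l • (v : E7) := congrArg Subtype.val hv.apply_eq_smul
  have hv0 : (v : E7) ≠ 0 := fun h => hv.2 (Subtype.ext h)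
  have h2 : B v = l • cross u v := by
    have h3 := congrArg (cross u) h1
    rw [hT₀, map_neg, cross_cross, inner_self_of_norm_one hu, hVu _ (hVB v v.2), map_smul] at h3
    simpa using h3
  refine ⟨l, (‖(v : E7)‖⁻¹ : ℝ) • (v : E7), V.smul_mem _ v.2, ?_, ?_⟩
  · rw [norm_smul, norm_inv, norm_norm, inv_mul_cancel₀ (norm_ne_zero_iff.mpr hv0)]
  · rw [map_smul, map_smul, h2, smul_comm]

/-- Two commuting derivations that kill `u` have a common eigenvector. -/
theorem IsDer.exists_common_eigenvector {B C : E7 →L[ℝ] E7} (hB : IsDer B) (hC : IsDer C)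
    (hBC : ∀ v, B (C v) = C (B v)) {u : E7} (hu : ‖u‖ = 1)
    (hBu : B u = 0) (hCu : C u = 0) {V : Submodule ℝ E7} (hV : V ≠ ⊥)
    (hVu : ∀ v ∈ V, (inner ℝ u v : ℝ) = 0) (hVB : ∀ v ∈ V, B v ∈ V) (hVC : ∀ v ∈ V, C v ∈ V)
    (hVI : ∀ v ∈ V, cross u v ∈ V) :
    ∃ l m : ℝ, ∃ v ∈ V, ‖v‖ = 1 ∧ B v = l • cross u v ∧ C v = m • cross u v := by
  obtain ⟨l, v, hv, hv1, hBv⟩ := hB.exists_eigenvector hu hBu hV hVu hVB hVI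
  -- The weight space of `B` is invariant under `C` and under the complex structure, since both
  -- commute with `B`.
  let V' : Submodule ℝ E7 := V ⊓ LinearMap.eqLocus B.toLinearMap (l • cross u)
  have hmem {x : E7} : x ∈ V' ↔ x ∈ V ∧ B x = l • cross u x := Iff.rfl
  have hV' : V' ≠ ⊥ := by
    intro h
    have : v ∈ V' := hmem.mpr ⟨hv, hBv⟩
    rw [h, Submodule.mem_bot] at this
    simp [this] at hv1
  obtain ⟨m, w, hw, hw1, hCw⟩ := hC.exists_eigenvector hu hCu hV' (fun x hx => hVu x hx.1)
    (fun x hx => by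
      obtain ⟨h1, h2⟩ := hmem.mp hx
      refine hmem.mpr ⟨hVC x h1, ?_⟩
      rw [hBC, h2, map_smul, hC.map_cross, hCu]; simp)
    (fun x hx => by
      obtain ⟨h1, h2⟩ := hmem.mp hx
      refine hmem.mpr ⟨hVI x h1, ?_⟩
      rw [hB.map_cross, hBu, h2, map_smul]; simp)
  exact ⟨l, m, w, hw.1, hw1, hw.2, hCw⟩

/-- `𝔤₂` contains no three linearly independent commuting elements. -/
theorem IsDer.dependent_of_three_commute {B C D : E7 →L[ℝ] E7} (hB : IsDer B) (hC : IsDer C)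
    (hD : IsDer D) (hBC : ∀ v, B (C v) = C (B v)) (hBD : ∀ v, B (D v) = D (B v))
    (hCD : ∀ v, C (D v) = D (C v)) :
    ∃ r s t : ℝ, (r ≠ 0 ∨ s ≠ 0 ∨ t ≠ 0) ∧ r • B + s • C + t • D = 0 := by
  -- a common zero
  have o1 := hB.odd_finrank_inf_ker (V := ⊤) (fun _ _ => trivial)
    (by rw [finrank_top, finrank_euclideanSpace, Fintype.card_fin]; decide)
  have o2 := hC.odd_finrank_inf_ker (V := ⊤ ⊓ LinearMap.ker B.toLinearMap)
    (fun v hv => ⟨trivial, by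
      have : B v = 0 := hv.2
      change B (C v) = 0
      rw [hBC, this, map_zero]⟩) o1
  obtain ⟨u₀, hu₀, hu₀0, hDu₀⟩ := hD.exists_zero
    (V := ⊤ ⊓ LinearMap.ker B.toLinearMap ⊓ LinearMap.ker C.toLinearMap)
    (fun v hv => by
      have h1 : B v = 0 := hv.1.2
      have h2 : C v = 0 := hv.2
      refine ⟨⟨trivial, ?_⟩, ?_⟩
      · change B (D v) = 0
        rw [hBD, h1, map_zero]
      · change C (D v) = 0
        rw [hCD, h2, map_zero]) o2
  have hBu₀ : B u₀ = 0 := hu₀.1.2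
  have hCu₀ : C u₀ = 0 := hu₀.2
  let u : E7 := (‖u₀‖⁻¹ : ℝ) • u₀
  have hu : ‖u‖ = 1 := by
    rw [norm_smul, norm_inv, norm_norm, inv_mul_cancel₀ (norm_ne_zero_iff.mpr hu₀0)]
  have hBu : B u = 0 := by rw [map_smul, hBu₀, smul_zero]
  have hCu : C u = 0 := by rw [map_smul, hCu₀, smul_zero]
  have hDu : D u = 0 := by rw [map_smul, hDu₀, smul_zero]
  -- a common eigenvector
  let V : Submodule ℝ E7 := (ℝ ∙ u)ᗮ
  have hVu : ∀ v ∈ V, (inner ℝ u v : ℝ) = 0 := fun v hv =>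
    Submodule.mem_orthogonal_singleton_iff_inner_right.mp hv
  have hV : V ≠ ⊥ := by
    intro h
    have h1 := finrank_orthogonal_E7 (ℝ ∙ u)
    rw [finrank_span_singleton (by rintro h; simp [h] at hu), show (ℝ ∙ u)ᗮ = ⊥ from h,
      finrank_bot] at h1
    omega
  have hVX {X : E7 →L[ℝ] E7} (hX : IsDer X) (hXu : X u = 0) : ∀ v ∈ V, X v ∈ V := fun v hv =>
    hX.mem_orthogonal (fun f hf => by
      obtain ⟨c, rfl⟩ := Submodule.mem_span_singleton.mp hf
      rw [map_smul, hXu, smul_zero]; exact Submodule.zero_mem _) hv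
  have hVI : ∀ v ∈ V, cross u v ∈ V := fun v _ =>
    Submodule.mem_orthogonal_singleton_iff_inner_left.mpr (inner_cross_left_self u v)
  obtain ⟨l, v, hv, hv1, hBv⟩ := hB.exists_eigenvector hu hBu hV hVu (hVX hB hBu) hVI
  let V' : Submodule ℝ E7 := V ⊓ LinearMap.eqLocus B.toLinearMap (l • cross u)
  have hmem {x : E7} : x ∈ V' ↔ x ∈ V ∧ B x = l • cross u x := Iff.rfl
  have hV' : V' ≠ ⊥ := by
    intro h
    have : v ∈ V' := hmem.mpr ⟨hv, hBv⟩
    rw [h, Submodule.mem_bot] at this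
    simp [this] at hv1
  have hV'X {X : E7 →L[ℝ] E7} (hX : IsDer X) (hXu : X u = 0) (hBX : ∀ v, B (X v) = X (B v)) :
      ∀ x ∈ V', X x ∈ V' := fun x hx => by
    obtain ⟨h1, h2⟩ := hmem.mp hx
    refine hmem.mpr ⟨hVX hX hXu x h1, ?_⟩
    rw [hBX, h2, map_smul, hX.map_cross, hXu]; simp
  obtain ⟨m, n, f, hf, hf1, hCf, hDf⟩ := hC.exists_common_eigenvector hD hCD hu hCu hDu hV'
    (fun x hx => hVu x hx.1) (hV'X hC hCu hBC) (hV'X hD hDu hBD)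
    (fun x hx => by
      obtain ⟨h1, h2⟩ := hmem.mp hx
      refine hmem.mpr ⟨hVI x h1, ?_⟩
      rw [hB.map_cross, hBu, h2, map_smul]; simp)
  have hBf : B f = l • cross u f := hf.2
  have huf : (inner ℝ u f : ℝ) = 0 := hVu f hf.1
  -- combinations that kill `u` and `f`
  have h2 : 2 ≤ finrank ℝ (assocSpan u f) := by rw [finrank_assocSpan hu hf1 huf]; omega
  have hkill {X : E7 →L[ℝ] E7} (hX : IsDer X) (hXu : X u = 0) (hXf : X f = 0) :
      ∀ v ∈ assocSpan u f, X v = 0 := fun v hv =>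
    assocSpan_le hX.crossClosed_ker (show X u = 0 from hXu) (show X f = 0 from hXf) hv
  -- The weights `(l, m, n)` on `f` define a functional on the combinations of `B`, `C`, `D`. Two
  -- combinations in its kernel vanish on the associative plane of `u` and `f` and commute, so they
  -- are dependent. The cases choose two combinations whose dependence gives a nontrivial relation.
  by_cases hl : l = 0
  · by_cases hm : m = 0
    · obtain ⟨s, t, hst, h⟩ := hB.dependent_of_commute hC hBC h2
        (hkill hB hBu (by rw [hBf, hl, zero_smul])) (hkill hC hCu (by rw [hCf, hm, zero_smul]))
      exact ⟨s, t, 0, by tauto, by rw [← h]; ext1; simp⟩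
    · have hX : IsDer (n • C + (-m) • D) := (hC.smul n).add (hD.smul (-m))
      obtain ⟨s, t, hst, h⟩ := hB.dependent_of_commute hX (fun v => by simp [hBC, hBD]) h2
        (hkill hB hBu (by rw [hBf, hl, zero_smul]))
        (hkill hX (by simp [hCu, hDu]) (by simp [hCf, hDf, smul_smul, mul_comm]))
      refine ⟨s, t * n, -(t * m), ?_, ?_⟩
      · rcases hst with h | h
        · exact Or.inl h
        · exact Or.inr (Or.inr (neg_ne_zero.mpr (mul_ne_zero h hm)))
      · rw [← h]; module
  · have hX : IsDer (m • B + (-l) • C) := (hB.smul m).add (hC.smul (-l))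
    have hY : IsDer (n • B + (-l) • D) := (hB.smul n).add (hD.smul (-l))
    obtain ⟨s, t, hst, h⟩ := hX.dependent_of_commute hY
      (fun v => by simp [hBC, hBD, hCD]; module) h2
      (hkill hX (by simp [hCu, hBu]) (by simp [hCf, hBf, smul_smul, mul_comm]))
      (hkill hY (by simp [hDu, hBu]) (by simp [hDf, hBf, smul_smul, mul_comm]))
    refine ⟨s * m + t * n, -(s * l), -(t * l), ?_, ?_⟩
    · rcases hst with h | h
      · exact Or.inr (Or.inl (neg_ne_zero.mpr (mul_ne_zero h hl)))
      · exact Or.inr (Or.inr (neg_ne_zero.mpr (mul_ne_zero h hl)))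
    · rw [← h]; module

/-! ### One-parameter subgroups of `T² × SU(2)` -/

abbrev E3 : Type := EuclideanSpace ℝ (Fin 3)

local instance : Group T2SU2 := inferInstance

local instance : Monoid T2SU2 := inferInstance

/-- The Lie algebra `ℝ² ⊕ ℝ³` of `T² × SU(2)`. -/
abbrev LieK : Type := ℝ × ℝ × E3

/-- The identification of `ℝ³` with the imaginary quaternions. -/
def imQ : E3 →ₗ[ℝ] Quaternion ℝ where
  toFun X := ⟨0, X 0, X 1, X 2⟩
  map_add' _ _ := QuaternionAlgebra.ext (add_zero (0 : ℝ)).symm rfl rfl rfl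
  map_smul' c _ := QuaternionAlgebra.ext (mul_zero c).symm rfl rfl rfl

theorem imQ_re (X : E3) : (imQ X).re = 0 := rfl
theorem imQ_imI (X : E3) : (imQ X).imI = X 0 := rfl
theorem imQ_imJ (X : E3) : (imQ X).imJ = X 1 := rfl
theorem imQ_imK (X : E3) : (imQ X).imK = X 2 := rfl

/-- The imaginary part of a quaternion. -/
def imPart : Quaternion ℝ →ₗ[ℝ] E3 where
  toFun a := WithLp.toLp 2 ![a.imI, a.imJ, a.imK]
  map_add' X Y := by ext i; fin_cases i <;> simp
  map_smul' c X := by ext i; fin_cases i <;> simp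

theorem imPart_0 (a : Quaternion ℝ) : imPart a 0 = a.imI := rfl
theorem imPart_1 (a : Quaternion ℝ) : imPart a 1 = a.imJ := rfl
theorem imPart_2 (a : Quaternion ℝ) : imPart a 2 = a.imK := rfl

theorem imPart_imQ (X : E3) : imPart (imQ X) = X := by
  ext i; fin_cases i <;> rfl

theorem imQ_imPart {a : Quaternion ℝ} (ha : a.re = 0) : imQ (imPart a) = a := by
  ext
  · exact ha.symm
  all_goals rfl

theorem imQ_injective : Function.Injective imQ :=
  Function.LeftInverse.injective imPart_imQ

theorem inner_E3 (X Y : E3) : (inner ℝ X Y : ℝ) = X 0 * Y 0 + X 1 * Y 1 + X 2 * Y 2 := by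
  simp [PiLp.inner_apply, Fin.sum_univ_three]
  ring

theorem normSq_imQ (X : E3) : Quaternion.normSq (imQ X) = ‖X‖ ^ 2 := by
  rw [← real_inner_self_eq_norm_sq, inner_E3, Quaternion.normSq_def', imQ_re, imQ_imI, imQ_imJ,
    imQ_imK]
  ring

theorem norm_imQ (X : E3) : ‖imQ X‖ = ‖X‖ := by
  have h := normSq_imQ X
  rw [Quaternion.normSq_eq_norm_mul_self, ← pow_two] at h
  exact (pow_left_inj₀ (norm_nonneg _) (norm_nonneg _) two_ne_zero).mp h

theorem norm_exp_imQ (X : E3) : ‖NormedSpace.exp (imQ X)‖ = 1 := by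
  rw [Quaternion.norm_exp, imQ_re, NormedSpace.exp_zero, norm_one]

/-- The exponential map of `SU(2)`. -/
def expSU2 (X : E3) : SU2 := ⟨NormedSpace.exp (imQ X), by
  rw [mem_sphere_zero_iff_norm]; exact norm_exp_imQ X⟩

theorem coe_expSU2 (X : E3) : (expSU2 X : Quaternion ℝ) = NormedSpace.exp (imQ X) := rfl

theorem contDiff_exp_imQ : ContDiff ℝ ∞ fun X : E3 => NormedSpace.exp (imQ X) := by
  have h1 : ContDiff ℝ ∞ (NormedSpace.exp : Quaternion ℝ → Quaternion ℝ) :=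
    contDiff_iff_contDiffAt.mpr fun x => (NormedSpace.exp_analytic (𝕂 := ℝ) x).contDiffAt
  exact h1.comp (LinearMap.toContinuousLinearMap imQ).contDiff

theorem contMDiff_expSU2 : ContMDiff 𝓘(ℝ, E3) (𝓡 3) ∞ expSU2 :=
  contDiff_exp_imQ.contMDiff.codRestrict_sphere _

theorem expSU2_zero : expSU2 0 = 1 := by
  apply Subtype.ext
  rw [coe_expSU2, map_zero, NormedSpace.exp_zero]; rfl

theorem coe_SU2_mul (p q : SU2) : ((p * q : SU2) : Quaternion ℝ) = p * q := rfl

theorem normSq_SU2 (q : SU2) : Quaternion.normSq (q : Quaternion ℝ) = 1 := by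
  rw [Quaternion.normSq_eq_norm_mul_self, norm_eq_of_mem_sphere q, one_mul]

theorem coe_SU2_inv (q : SU2) : ((q⁻¹ : SU2) : Quaternion ℝ) = star (q : Quaternion ℝ) := by
  change (q : Quaternion ℝ)⁻¹ = star (q : Quaternion ℝ)
  simp [Quaternion.inv_def, normSq_SU2]

theorem expSU2_add_smul (s t : ℝ) (X : E3) :
    expSU2 ((s + t) • X) = expSU2 (s • X) * expSU2 (t • X) := by
  let _ : NormedAlgebra ℚ (Quaternion ℝ) := NormedAlgebra.restrictScalars ℚ ℝ _
  apply Subtype.ext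
  rw [coe_SU2_mul, coe_expSU2, coe_expSU2, coe_expSU2, add_smul, map_add,
    NormedSpace.exp_add_of_commute]
  rw [map_smul, map_smul]
  exact ((Commute.refl _).smul_left _).smul_right _

/-- The exponential map of `T² × SU(2)`. -/
def expK (ξ : LieK) : T2SU2 := (Circle.exp ξ.1, Circle.exp ξ.2.1, expSU2 ξ.2.2)

theorem contMDiff_expK : ContMDiff 𝓘(ℝ, LieK) modelT2SU2 ∞ expK := by
  have h1 : ContMDiff 𝓘(ℝ, LieK) 𝓘(ℝ, ℝ) ∞ fun ξ : LieK => ξ.1 := contDiff_fst.contMDiff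
  have h2 : ContMDiff 𝓘(ℝ, LieK) 𝓘(ℝ, ℝ) ∞ fun ξ : LieK => ξ.2.1 :=
    contDiff_snd.fst.contMDiff
  have h3 : ContMDiff 𝓘(ℝ, LieK) 𝓘(ℝ, E3) ∞ fun ξ : LieK => ξ.2.2 :=
    contDiff_snd.snd.contMDiff
  exact (contMDiff_circleExp.comp h1).prodMk
    ((contMDiff_circleExp.comp h2).prodMk (contMDiff_expSU2.comp h3))

theorem expK_zero : expK 0 = 1 := by
  simp [expK, expSU2_zero]

theorem expK_add_smul (s t : ℝ) (ξ : LieK) :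
    expK ((s + t) • ξ) = expK (s • ξ) * expK (t • ξ) := by
  simp only [expK, Prod.smul_fst, Prod.smul_snd, smul_eq_mul, add_mul, Circle.exp_add,
    expSU2_add_smul, Prod.mk_mul_mk]

theorem continuous_expK : Continuous expK := contMDiff_expK.continuous

/-- The adjoint action of `SU(2)` on `ℝ³`. -/
def adjSU2 (q : SU2) : E3 →ₗ[ℝ] E3 :=
  imPart ∘ₗ LinearMap.mulLeft ℝ (q : Quaternion ℝ) ∘ₗ
    LinearMap.mulRight ℝ (star (q : Quaternion ℝ)) ∘ₗ imQ

theorem imQ_adjSU2 (q : SU2) (X : E3) :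
    imQ (adjSU2 q X) = (q : Quaternion ℝ) * (imQ X * star (q : Quaternion ℝ)) := by
  refine imQ_imPart ?_
  simp only [LinearMap.comp_apply, LinearMap.mulRight_apply, LinearMap.mulLeft_apply,
    Quaternion.re_mul, Quaternion.imI_mul, Quaternion.imJ_mul, Quaternion.imK_mul,
    Quaternion.re_star, Quaternion.imI_star, Quaternion.imJ_star, Quaternion.imK_star, imQ_re]
  ring

theorem conj_expSU2 (q : SU2) (X : E3) : q * expSU2 X * q⁻¹ = expSU2 (adjSU2 q X) := by
  let _ : NormedAlgebra ℚ (Quaternion ℝ) := NormedAlgebra.restrictScalars ℚ ℝ _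
  apply Subtype.ext
  have hq : (q : Quaternion ℝ) ≠ 0 := ne_zero_of_mem_unit_sphere q
  have hinv : (q : Quaternion ℝ)⁻¹ = star (q : Quaternion ℝ) := coe_SU2_inv q
  rw [coe_expSU2, imQ_adjSU2, ← mul_assoc, ← hinv, NormedSpace.exp_conj _ _ hq, hinv,
    ← coe_SU2_inv]
  rfl

/-- The adjoint action of `T² × SU(2)` on its Lie algebra. -/
def adjK (k : T2SU2) : LieK →ₗ[ℝ] LieK :=
  LinearMap.id.prodMap (LinearMap.id.prodMap (adjSU2 k.2.2))

theorem adjK_apply (k : T2SU2) (ξ : LieK) : adjK k ξ = (ξ.1, ξ.2.1, adjSU2 k.2.2 ξ.2.2) := rfl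

theorem conj_expK (k : T2SU2) (ξ : LieK) : k * expK ξ * k⁻¹ = expK (adjK k ξ) := by
  obtain ⟨a, b, q⟩ := k
  simp only [expK, adjK_apply, Prod.mk_mul_mk, Prod.inv_mk, conj_expSU2]
  simp [mul_inv_cancel_comm]

theorem norm_adjSU2 (q : SU2) (X : E3) : ‖adjSU2 q X‖ = ‖X‖ := by
  rw [← norm_imQ, imQ_adjSU2, norm_mul, norm_mul, norm_star, norm_imQ, norm_eq_of_mem_sphere]
  ring

/-- The axis of the rotation is the imaginary part of `q`, which commutes with `q`. If it vanishes,
`q` is real and any vector serves. -/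
theorem exists_adjSU2_eq_self (q : SU2) : ∃ X : E3, X ≠ 0 ∧ adjSU2 q X = X := by
  have hqq : (q : Quaternion ℝ) * star (q : Quaternion ℝ) = 1 := by
    rw [Quaternion.self_mul_star, normSq_SU2]; rfl
  have key (X : E3) (h : (q : Quaternion ℝ) * imQ X = imQ X * q) : adjSU2 q X = X := by
    apply imQ_injective
    rw [imQ_adjSU2, ← mul_assoc, h, mul_assoc, hqq, mul_one]
  by_cases h : imPart (q : Quaternion ℝ) = 0
  · have h0 : (q : Quaternion ℝ).imI = 0 := congrArg (fun X : E3 => X 0) h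
    have h1 : (q : Quaternion ℝ).imJ = 0 := congrArg (fun X : E3 => X 1) h
    have h2 : (q : Quaternion ℝ).imK = 0 := congrArg (fun X : E3 => X 2) h
    refine ⟨EuclideanSpace.single 0 1, by simp, key _ ?_⟩
    ext <;> simp [h0, h1, h2, imQ_re, mul_comm]
  · refine ⟨_, h, key _ ?_⟩
    ext <;> simp [imQ_re, imQ_imI, imQ_imJ, imQ_imK, imPart_0, imPart_1, imPart_2] <;> ring

/-- The Lie bracket of `ℝ³ ≅ 𝔰𝔲(2)`, up to a factor. -/
def bracket3 (X Y : E3) : E3 :=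
  WithLp.toLp 2 ![X 1 * Y 2 - X 2 * Y 1, X 2 * Y 0 - X 0 * Y 2, X 0 * Y 1 - X 1 * Y 0]

theorem bracket3_0 (X Y : E3) : bracket3 X Y 0 = X 1 * Y 2 - X 2 * Y 1 := rfl
theorem bracket3_1 (X Y : E3) : bracket3 X Y 1 = X 2 * Y 0 - X 0 * Y 2 := rfl
theorem bracket3_2 (X Y : E3) : bracket3 X Y 2 = X 0 * Y 1 - X 1 * Y 0 := rfl

theorem coe_expSU2_smul (s : ℝ) {X : E3} (hX : ‖X‖ = 1) :
    (expSU2 (s • X) : Quaternion ℝ) = (Real.cos s : Quaternion ℝ) + Real.sin s • imQ X := by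
  rw [coe_expSU2, Quaternion.exp_of_re_eq_zero _ (imQ_re _), norm_imQ, norm_smul, hX, mul_one,
    map_smul, smul_smul, Real.norm_eq_abs, Real.cos_abs]
  congr 2
  rcases abs_cases s with ⟨h, -⟩ | ⟨h, -⟩ <;> rw [h]
  · by_cases hs : s = 0
    · simp [hs]
    · field_simp
  · by_cases hs : s = 0
    · simp [hs]
    · rw [Real.sin_neg]; field_simp

/-- Conjugation by `exp (s X)` is the rotation about `X` by the doubled angle, as the double cover
of the rotation group requires. -/
theorem adjSU2_expSU2 (s : ℝ) {X Y : E3} (hX : ‖X‖ = 1) (hXY : (inner ℝ X Y : ℝ) = 0) :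
    adjSU2 (expSU2 (s • X)) Y = Real.cos (2 * s) • Y + Real.sin (2 * s) • bracket3 X Y := by
  have hX1 : X 0 * X 0 + X 1 * X 1 + X 2 * X 2 = 1 := by
    rw [← inner_E3, real_inner_self_eq_norm_sq, hX, one_pow]
  rw [inner_E3] at hXY
  have e : adjSU2 (expSU2 (s • X)) Y = imPart ((expSU2 (s • X) : Quaternion ℝ) * (imQ Y *
    star (expSU2 (s • X) : Quaternion ℝ))) := rfl
  rw [e, coe_expSU2_smul s hX, Real.cos_two_mul', Real.sin_two_mul]
  ext i
  fin_cases i <;>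
  simp [imPart_0, imPart_1, imPart_2, bracket3_0, bracket3_1, bracket3_2, imQ_re, imQ_imI,
    imQ_imJ, imQ_imK]
  · linear_combination (-(Real.sin s) ^ 2 * Y 0) * hX1 + (2 * (Real.sin s) ^ 2 * X 0) * hXY
  · linear_combination (-(Real.sin s) ^ 2 * Y 1) * hX1 + (2 * (Real.sin s) ^ 2 * X 1) * hXY
  · linear_combination (-(Real.sin s) ^ 2 * Y 2) * hX1 + (2 * (Real.sin s) ^ 2 * X 2) * hXY

theorem adjSU2_expSU2_pi_div_two {X Y : E3} (hX : ‖X‖ = 1) (hXY : (inner ℝ X Y : ℝ) = 0) :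
    adjSU2 (expSU2 ((Real.pi / 2) • X)) Y = -Y := by
  rw [adjSU2_expSU2 _ hX hXY, mul_div_cancel₀ _ (two_ne_zero), Real.cos_pi, Real.sin_pi]
  simp

theorem adjSU2_expSU2_pi_div_four {X Y : E3} (hX : ‖X‖ = 1) (hXY : (inner ℝ X Y : ℝ) = 0) :
    adjSU2 (expSU2 ((Real.pi / 4) • X)) Y = bracket3 X Y := by
  rw [adjSU2_expSU2 _ hX hXY, show 2 * (Real.pi / 4) = Real.pi / 2 by ring, Real.cos_pi_div_two,
    Real.sin_pi_div_two]
  simp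

/-- An invariant linear functional on `𝔰𝔲(2)` vanishes. -/
theorem eq_zero_of_adjSU2_invariant {F : Type*} [AddCommGroup F] [Module ℝ F] (μ : E3 →ₗ[ℝ] F)
    (h : ∀ X Y, μ (adjSU2 (expSU2 X) Y) = μ Y) : μ = 0 := by
  have key (i j : Fin 3) (hij : i ≠ j) : μ (EuclideanSpace.single j 1) = 0 := by
    -- A half turn about one coordinate axis reverses the other axes, so `μ` equals its own negative
    -- on them.
    have h1 := h ((Real.pi / 2) • EuclideanSpace.single i 1) (EuclideanSpace.single j 1)
    have h0 : (inner ℝ (EuclideanSpace.single i (1 : ℝ)) (EuclideanSpace.single j (1 : ℝ)) : ℝ) = 0 := by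
      rw [EuclideanSpace.inner_single_left, PiLp.single_apply, if_neg hij, mul_zero]
    rw [adjSU2_expSU2_pi_div_two (by simp) h0, map_neg] at h1
    have h2 : (2 : ℝ) • μ (EuclideanSpace.single j 1) = 0 := by
      rw [two_smul]; nth_rewrite 1 [← h1]; simp
    exact (smul_eq_zero.mp h2).resolve_left two_ne_zero
  refine (EuclideanSpace.basisFun (Fin 3) ℝ).toBasis.ext fun j => ?_
  obtain ⟨i, hij⟩ : ∃ i : Fin 3, i ≠ j := exists_ne j
  simpa using key i j hij

/-- A subspace of `𝔨` that contains two elements with independent `𝔰𝔲(2)`-components and is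
invariant under its one-parameter subgroups contains `𝔰𝔲(2)`. -/
theorem su2_le_of_two_le {h : Submodule ℝ LieK}
    (hinv : ∀ ξ ∈ h, ∀ η ∈ h, ∀ s : ℝ, adjK (expK (s • ξ)) η ∈ h)
    (h2 : 2 ≤ finrank ℝ (h.map (LinearMap.snd ℝ ℝ E3 ∘ₗ LinearMap.snd ℝ ℝ (ℝ × E3)))) (X : E3) :
    ((0, 0, X) : LieK) ∈ h := by
  set Q := h.map (LinearMap.snd ℝ ℝ E3 ∘ₗ LinearMap.snd ℝ ℝ (ℝ × E3))
  let P : Submodule ℝ E3 := h.comap (LinearMap.inr ℝ ℝ (ℝ × E3) ∘ₗ LinearMap.inr ℝ ℝ E3)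
  have hP {Y : E3} : Y ∈ P ↔ ((0, 0, Y) : LieK) ∈ h := Iff.rfl
  let b := stdOrthonormalBasis ℝ Q
  let X₁ : E3 := b ⟨0, by omega⟩
  let X₂ : E3 := b ⟨1, by omega⟩
  have ho := b.orthonormal
  have n1 : ‖X₁‖ = 1 := ho.1 _
  have n2 : ‖X₂‖ = 1 := ho.1 _
  have h12 : (inner ℝ X₁ X₂ : ℝ) = 0 := ho.2 (by simp)
  have h21 : (inner ℝ X₂ X₁ : ℝ) = 0 := (real_inner_comm _ _).trans h12
  obtain ⟨⟨a₁, c₁, Y₁⟩, hξ₁, e1⟩ := (b ⟨0, by omega⟩).2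
  obtain ⟨⟨a₂, c₂, Y₂⟩, hξ₂, e2⟩ := (b ⟨1, by omega⟩).2
  have e1' : Y₁ = X₁ := e1
  have e2' : Y₂ = X₂ := e2
  subst e1' e2'
  -- The adjoint action does not change torus components, so they cancel in the difference and only
  -- an element of 𝔰𝔲(2) remains.
  have diff {a c a' c' : ℝ} {Y Z : E3} (hY : ((a, c, Y) : LieK) ∈ h)
      (hZ : ((a', c', Z) : LieK) ∈ h) (s : ℝ) : adjSU2 (expSU2 (s • Y)) Z - Z ∈ P := by
    have h1 := h.sub_mem (hinv _ hY _ hZ s) hZ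
    rw [hP]
    convert h1 using 1
    simp [adjK_apply, expK]
  -- A half turn about `Y` sends `Z` to `-Z`; the difference is `-2 Z`.
  have flip {a c a' c' : ℝ} {Y Z : E3} (hY : ((a, c, Y) : LieK) ∈ h)
      (hZ : ((a', c', Z) : LieK) ∈ h) (hn : ‖Y‖ = 1) (hYZ : (inner ℝ Y Z : ℝ) = 0) : Z ∈ P := by
    have h1 := diff hY hZ (Real.pi / 2)
    rw [adjSU2_expSU2_pi_div_two hn hYZ] at h1
    have h2 : Z = (-(1 / 2) : ℝ) • (-Z - Z) := by module
    rw [h2]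
    exact P.smul_mem _ h1
  have m2 := flip hξ₁ hξ₂ n1 h12
  have m1 := flip hξ₂ hξ₁ n2 h21
  -- A quarter turn about `X₁` sends `X₂` to their bracket, the third vector of an orthonormal
  -- basis.
  have m3 : bracket3 X₁ X₂ ∈ P := by
    have h1 := diff hξ₁ hξ₂ (Real.pi / 4)
    rw [adjSU2_expSU2_pi_div_four n1 h12] at h1
    simpa using P.add_mem h1 m2
  have n1' := real_inner_self_eq_norm_sq X₁
  have n2' := real_inner_self_eq_norm_sq X₂
  rw [n1, one_pow] at n1'
  rw [n2, one_pow] at n2'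
  have hon : Orthonormal ℝ ![X₁, X₂, bracket3 X₁ X₂] := by
    have i1 : (inner ℝ X₁ (bracket3 X₁ X₂) : ℝ) = 0 := by
      simp only [inner_E3, bracket3_0, bracket3_1, bracket3_2]; ring
    have i2 : (inner ℝ X₂ (bracket3 X₁ X₂) : ℝ) = 0 := by
      simp only [inner_E3, bracket3_0, bracket3_1, bracket3_2]; ring
    have i1' := (real_inner_comm _ _).trans i1
    have i2' := (real_inner_comm _ _).trans i2
    have i3 : (inner ℝ (bracket3 X₁ X₂) (bracket3 X₁ X₂) : ℝ) = 1 := by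
      have : (inner ℝ (bracket3 X₁ X₂) (bracket3 X₁ X₂) : ℝ) =
          inner ℝ X₁ X₁ * inner ℝ X₂ X₂ - inner ℝ X₁ X₂ * inner ℝ X₁ X₂ := by
        simp only [inner_E3, bracket3_0, bracket3_1, bracket3_2]; ring
      rw [this, n1', n2', h12]; norm_num
    rw [orthonormal_iff_ite]
    intro i j
    fin_cases i <;> fin_cases j <;> simp_all
  have hspan := hon.linearIndependent.span_eq_top_of_card_eq_finrank' (by simp)
  have hle : Submodule.span ℝ (Set.range ![X₁, X₂, bracket3 X₁ X₂]) ≤ P := by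
    rw [Submodule.span_le]
    rintro _ ⟨i, rfl⟩
    fin_cases i
    · exact m1
    · exact m2
    · exact m3
  rw [hspan] at hle
  exact hP.mp (hle Submodule.mem_top)

/-! ### The derivative of the exponential map at the origin -/

/-- After composition with the inclusion of the circle in ℂ the derivative becomes `t ↦ t i`, which
is injective. -/
theorem injective_mfderiv_circleExp :
    Function.Injective (mfderiv 𝓘(ℝ, ℝ) (𝓡 1) Circle.exp 0 : ℝ → EuclideanSpace ℝ (Fin 1)) := by
  have h1 : MDifferentiableAt 𝓘(ℝ, ℝ) (𝓡 1) Circle.exp 0 :=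
    (contMDiff_circleExp (m := 1)).mdifferentiableAt one_ne_zero
  have := Complex.finrank_real_complex_fact
  let c : Circle → ℂ := (↑)
  have h2 : MDifferentiableAt (𝓡 1) 𝓘(ℝ, ℂ) c (Circle.exp 0) :=
    (contMDiff_coe_sphere (E := ℂ) (m := 1)).mdifferentiableAt one_ne_zero
  have h3 := mfderiv_comp (0 : ℝ) h2 h1
  have h4 : HasDerivAt (fun t : ℝ => Complex.exp (t * Complex.I)) Complex.I 0 := by
    have := ((Complex.ofRealCLM.hasDerivAt (x := (0 : ℝ))).mul_const Complex.I).cexp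
    simpa using this
  have h5 : mfderiv 𝓘(ℝ, ℝ) 𝓘(ℝ, ℂ) (c ∘ Circle.exp) 0 =
      fderiv ℝ (fun t : ℝ => Complex.exp (t * Complex.I)) 0 := by
    rw [mfderiv_eq_fderiv]
    congr 1
  rw [h5] at h3
  rw [injective_iff_map_eq_zero]
  intro (t : ℝ) ht
  have h6 : fderiv ℝ (fun t : ℝ => Complex.exp (t * Complex.I)) 0 t =
      mfderiv (𝓡 1) 𝓘(ℝ, ℂ) c (Circle.exp 0) (mfderiv 𝓘(ℝ, ℝ) (𝓡 1) Circle.exp 0 t) :=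
    DFunLike.congr_fun h3 t
  have h7 : (fderiv ℝ (fun t : ℝ => Complex.exp (t * Complex.I)) 0) t = t • Complex.I := by
    rw [h4.hasFDerivAt.fderiv]; rfl
  have h8 : t • Complex.I = 0 := by
    rw [← h7]
    refine h6.trans ?_
    erw [ht]
    exact map_zero _
  exact (smul_eq_zero.mp h8).resolve_right Complex.I_ne_zero

/-- After composition with the inclusion in the quaternions the derivative becomes the embedding of
imaginary quaternions. -/
theorem injective_mfderiv_expSU2 :
    Function.Injective (mfderiv 𝓘(ℝ, E3) (𝓡 3) expSU2 0 : E3 → EuclideanSpace ℝ (Fin 3)) := by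
  have h1 : MDifferentiableAt 𝓘(ℝ, E3) (𝓡 3) expSU2 0 :=
    contMDiff_expSU2.mdifferentiableAt (by simp)
  have h2 : MDifferentiableAt (𝓡 3) 𝓘(ℝ, Quaternion ℝ) ((↑) : SU2 → Quaternion ℝ) (expSU2 0) :=
    (contMDiff_coe_sphere (m := 1)).mdifferentiableAt one_ne_zero
  have h3 := mfderiv_comp (0 : E3) h2 h1
  have h4 : HasFDerivAt (fun X : E3 => NormedSpace.exp (imQ X))
      (LinearMap.toContinuousLinearMap imQ) 0 := by
    have h := (hasFDerivAt_exp_zero (𝕂 := ℝ) (𝔸 := Quaternion ℝ))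
    rw [← map_zero imQ] at h
    exact h.comp (0 : E3) (LinearMap.toContinuousLinearMap imQ).hasFDerivAt
  have h5 : mfderiv 𝓘(ℝ, E3) 𝓘(ℝ, Quaternion ℝ) ((↑) ∘ expSU2 : E3 → Quaternion ℝ) 0 =
      LinearMap.toContinuousLinearMap imQ := by
    rw [mfderiv_eq_fderiv]
    exact h4.fderiv
  rw [h5] at h3
  rw [injective_iff_map_eq_zero]
  intro t ht
  have h6 := DFunLike.congr_fun h3 t
  rw [ContinuousLinearMap.comp_apply] at h6
  have h8 : imQ t = 0 := by
    refine h6.trans ?_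
    erw [ht]
    exact map_zero _
  exact imQ_injective (h8.trans (map_zero imQ).symm)

/-- The derivative of the exponential map at the origin. -/
def dexpK : LieK →L[ℝ] LieT2SU2 :=
  ((mfderiv 𝓘(ℝ, ℝ) (𝓡 1) Circle.exp 0 : ℝ →L[ℝ] EuclideanSpace ℝ (Fin 1)).prodMap
    ((mfderiv 𝓘(ℝ, ℝ) (𝓡 1) Circle.exp 0 : ℝ →L[ℝ] EuclideanSpace ℝ (Fin 1)).prodMap
      (mfderiv 𝓘(ℝ, E3) (𝓡 3) expSU2 0 : E3 →L[ℝ] EuclideanSpace ℝ (Fin 3))) :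
    ℝ × ℝ × E3 →L[ℝ] EuclideanSpace ℝ (Fin 1) × EuclideanSpace ℝ (Fin 1) ×
      EuclideanSpace ℝ (Fin 3))

theorem hasMFDerivAt_expK : HasMFDerivAt 𝓘(ℝ, LieK) modelT2SU2 expK 0 dexpK := by
  have h1 : HasMFDerivAt 𝓘(ℝ, LieK) 𝓘(ℝ, ℝ) (fun ξ : LieK => ξ.1) 0
      (ContinuousLinearMap.fst ℝ ℝ (ℝ × E3)) := hasFDerivAt_fst.hasMFDerivAt
  have h2 : HasMFDerivAt 𝓘(ℝ, LieK) 𝓘(ℝ, ℝ) (fun ξ : LieK => ξ.2.1) 0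
      (ContinuousLinearMap.fst ℝ ℝ E3 ∘L ContinuousLinearMap.snd ℝ ℝ (ℝ × E3)) :=
    (hasFDerivAt_snd.fst).hasMFDerivAt
  have h3 : HasMFDerivAt 𝓘(ℝ, LieK) 𝓘(ℝ, E3) (fun ξ : LieK => ξ.2.2) 0
      (ContinuousLinearMap.snd ℝ ℝ E3 ∘L ContinuousLinearMap.snd ℝ ℝ (ℝ × E3)) :=
    (hasFDerivAt_snd.snd).hasMFDerivAt
  have c1 : MDifferentiableAt 𝓘(ℝ, ℝ) (𝓡 1) Circle.exp 0 :=
    (contMDiff_circleExp (m := 1)).mdifferentiableAt one_ne_zero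
  have c2 : MDifferentiableAt 𝓘(ℝ, E3) (𝓡 3) expSU2 0 :=
    contMDiff_expSU2.mdifferentiableAt (by simp)
  exact (HasMFDerivAt.comp (0 : LieK) c1.hasMFDerivAt h1).prodMk
    ((HasMFDerivAt.comp (0 : LieK) c1.hasMFDerivAt h2).prodMk
      (HasMFDerivAt.comp (0 : LieK) c2.hasMFDerivAt h3))

theorem bijective_of_injective_euclidean {V : Type*} [AddCommGroup V] [Module ℝ V]
    [FiniteDimensional ℝ V] {n : ℕ} (hn : finrank ℝ V = n)
    (f : V →ₗ[ℝ] EuclideanSpace ℝ (Fin n)) (hf : Function.Injective f) : Function.Bijective f :=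
  ⟨hf, (LinearMap.injective_iff_surjective_of_finrank_eq_finrank (by simp [hn])).mp hf⟩

theorem bijective_mfderiv_circleExp : Function.Bijective
    (mfderiv 𝓘(ℝ, ℝ) (𝓡 1) Circle.exp 0 : ℝ → EuclideanSpace ℝ (Fin 1)) :=
  bijective_of_injective_euclidean (finrank_self ℝ)
    (mfderiv 𝓘(ℝ, ℝ) (𝓡 1) Circle.exp 0 : ℝ →L[ℝ] EuclideanSpace ℝ (Fin 1)).toLinearMap
    injective_mfderiv_circleExp

theorem bijective_mfderiv_expSU2 : Function.Bijective
    (mfderiv 𝓘(ℝ, E3) (𝓡 3) expSU2 0 : E3 → EuclideanSpace ℝ (Fin 3)) :=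
  bijective_of_injective_euclidean finrank_euclideanSpace_fin
    (mfderiv 𝓘(ℝ, E3) (𝓡 3) expSU2 0 : E3 →L[ℝ] EuclideanSpace ℝ (Fin 3)).toLinearMap
    injective_mfderiv_expSU2

theorem bijective_dexpK : Function.Bijective dexpK :=
  bijective_mfderiv_circleExp.prodMap
    (bijective_mfderiv_circleExp.prodMap bijective_mfderiv_expSU2)

/-- The vectors of the Lie algebra of `T²` are the velocities of one-parameter subgroups
of `T²`. -/
theorem dexpK_torus_iff {p : LieT2SU2 → Prop} :
    (∃ a b : EuclideanSpace ℝ (Fin 1), (a, b) ≠ 0 ∧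
      p ((a, b, (0 : EuclideanSpace ℝ (Fin 3))) : LieT2SU2)) ↔
    ∃ s t : ℝ, (s, t) ≠ 0 ∧ p (dexpK ((s, t, 0) : LieK)) := by
  let D : ℝ →L[ℝ] EuclideanSpace ℝ (Fin 1) := mfderiv 𝓘(ℝ, ℝ) (𝓡 1) Circle.exp 0
  have hD : Function.Bijective D := bijective_mfderiv_circleExp
  have key (s t : ℝ) : dexpK ((s, t, 0) : LieK) =
      ((D s, D t, (0 : EuclideanSpace ℝ (Fin 3))) : LieT2SU2) := by
    have h0 := map_zero
      (mfderiv 𝓘(ℝ, E3) (𝓡 3) expSU2 0 : E3 →L[ℝ] EuclideanSpace ℝ (Fin 3))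
    exact Prod.ext rfl (Prod.ext rfl h0)
  have hne (s t : ℝ) : ((D s, D t) : EuclideanSpace ℝ (Fin 1) × EuclideanSpace ℝ (Fin 1)) ≠ 0 ↔
      (s, t) ≠ 0 := by
    rw [not_iff_not, Prod.mk_eq_zero, Prod.mk_eq_zero, map_eq_zero_iff _ hD.1,
      map_eq_zero_iff _ hD.1]
  constructor
  · rintro ⟨a, b, hab, hp⟩
    obtain ⟨s, rfl⟩ := hD.2 a
    obtain ⟨t, rfl⟩ := hD.2 b
    exact ⟨s, t, (hne s t).mp hab, by rw [key]; exact hp⟩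
  · rintro ⟨s, t, hst, hp⟩
    exact ⟨D s, D t, (hne s t).mpr hst, by rw [← key]; exact hp⟩

section Calculus

set_option linter.unusedSectionVars false

variable {M : Type*} [TopologicalSpace M] [ChartedSpace E7 M] [IsManifold (𝓡 7) ∞ M]
  [MulAction T2SU2 M]

/-! ### Differentials of the action -/

/-- The differential at `x` of the action of `k`. -/
def tr (k : T2SU2) (x : M) : E7 →L[ℝ] E7 := mfderiv (𝓡 7) (𝓡 7) (fun y : M => k • y) x

theorem contMDiff_smul_left (hs : IsSmoothAction M) (k : T2SU2) :
    ContMDiff (𝓡 7) (𝓡 7) ∞ (fun y : M => k • y) :=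
  hs.comp (contMDiff_const.prodMk contMDiff_id)

theorem contMDiff_smul_right (hs : IsSmoothAction M) (x : M) :
    ContMDiff modelT2SU2 (𝓡 7) ∞ (fun k : T2SU2 => k • x) :=
  hs.comp (contMDiff_id.prodMk contMDiff_const)

theorem continuous_action (hs : IsSmoothAction M) :
    Continuous (fun p : T2SU2 × M => p.1 • p.2) := hs.continuous

theorem mdifferentiableAt_smul (hs : IsSmoothAction M) (k : T2SU2) (x : M) :
    MDifferentiableAt (𝓡 7) (𝓡 7) (fun y : M => k • y) x :=
  (contMDiff_smul_left hs k).mdifferentiableAt (by simp)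

theorem hasMFDerivAt_smul (hs : IsSmoothAction M) (k : T2SU2) (x : M) :
    HasMFDerivAt (𝓡 7) (𝓡 7) (fun y : M => k • y) x (tr k x) :=
  (mdifferentiableAt_smul hs k x).hasMFDerivAt

theorem tr_mul (hs : IsSmoothAction M) (k l : T2SU2) (x : M) :
    tr (k * l) x = (tr k (l • x)).comp (tr l x) := by
  have h1 := (hasMFDerivAt_smul hs k (l • x)).comp x (hasMFDerivAt_smul hs l x)
  have h2 : ((fun y : M => k • y) ∘ fun y : M => l • y) = fun y : M => (k * l) • y := by
    funext y; exact (mul_smul k l y).symm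
  rw [h2] at h1
  exact h1.mfderiv

theorem tr_one (x : M) : tr (1 : T2SU2) x = ContinuousLinearMap.id ℝ E7 := by
  have h : (fun y : M => (1 : T2SU2) • y) = id := by funext y; exact one_smul _ y
  rw [tr, h]
  exact mfderiv_id

/-- The infinitesimal action in terms of the one-parameter subgroups. -/
def infK (x : M) : LieK →L[ℝ] E7 :=
  ContinuousLinearMap.comp (infinitesimalAction x : LieT2SU2 →L[ℝ] TangentSpace (𝓡 7) x) dexpK

theorem hasMFDerivAt_expK_smul (hs : IsSmoothAction M) (x : M) :
    HasMFDerivAt 𝓘(ℝ, LieK) (𝓡 7) (fun ξ : LieK => expK ξ • x) 0 (infK x) := by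
  have key : ∀ k : T2SU2, k = 1 →
      HasMFDerivAt modelT2SU2 (𝓡 7) (fun k : T2SU2 => k • x) k
        (infinitesimalAction x : LieT2SU2 →L[ℝ] E7) := by
    rintro k rfl
    exact ((contMDiff_smul_right hs x).mdifferentiableAt (by simp)).hasMFDerivAt
  exact HasMFDerivAt.comp (0 : LieK) (key _ expK_zero) hasMFDerivAt_expK

/-- The derivative at `ξ = 0` of the identity `k exp(ξ) x = exp(Ad_k ξ) k x`. -/
theorem tr_infK (hs : IsSmoothAction M) (k : T2SU2) (x : M) (ξ : LieK) :
    tr k x (infK x ξ) = infK (k • x) (adjK k ξ) := by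
  have key : ∀ y : M, y = x → HasMFDerivAt (𝓡 7) (𝓡 7) (fun y : M => k • y) y (tr k x) := by
    rintro y rfl; exact hasMFDerivAt_smul hs k y
  have h1 := HasMFDerivAt.comp (0 : LieK)
    (key (expK 0 • x) (by rw [expK_zero, one_smul])) (hasMFDerivAt_expK_smul hs x)
  let A : LieK →L[ℝ] LieK := LinearMap.toContinuousLinearMap (adjK k)
  have hA' : HasFDerivAt A A 0 := A.hasFDerivAt
  have hA : HasMFDerivAt 𝓘(ℝ, LieK) 𝓘(ℝ, LieK) A 0 A := hA'.hasMFDerivAt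
  have key2 : ∀ ζ : LieK, ζ = 0 →
      HasMFDerivAt 𝓘(ℝ, LieK) (𝓡 7) (fun ξ : LieK => expK ξ • (k • x)) ζ (infK (k • x)) := by
    rintro ζ rfl; exact hasMFDerivAt_expK_smul hs (k • x)
  have h2 := HasMFDerivAt.comp (0 : LieK) (key2 _ (map_zero A)) hA
  have e : ((fun y : M => k • y) ∘ fun ξ : LieK => expK ξ • x) =
      (fun ξ : LieK => expK ξ • (k • x)) ∘ A := by
    funext ξ
    change k • expK ξ • x = expK (adjK k ξ) • (k • x)
    rw [← conj_expK, smul_smul, smul_smul, inv_mul_cancel_right]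
  rw [e] at h1
  exact DFunLike.congr_fun (hasMFDerivAt_unique h1 h2) ξ

/-- Near time `t` the curve is `exp(t ξ)` applied to the curve through `x` restarted at time zero.
-/
theorem hasMFDerivAt_orbitCurve (hs : IsSmoothAction M) (x : M) (ξ : LieK) (t : ℝ) :
    HasMFDerivAt 𝓘(ℝ, ℝ) (𝓡 7) (fun s : ℝ => expK (s • ξ) • x) t
      (((tr (expK (t • ξ)) x).comp (infK x)).comp
        (ContinuousLinearMap.toSpanSingleton ℝ ξ)) := by
  have h0 : HasFDerivAt (fun s : ℝ => (s - t) • ξ) (ContinuousLinearMap.toSpanSingleton ℝ ξ) t := by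
    have h := ((hasDerivAt_id t).sub_const t).smul_const ξ
    simpa [hasDerivAt_iff_hasFDerivAt] using h
  have key1 : ∀ ζ : LieK, ζ = 0 →
      HasMFDerivAt 𝓘(ℝ, LieK) (𝓡 7) (fun ξ : LieK => expK ξ • x) ζ (infK x) := by
    rintro ζ rfl; exact hasMFDerivAt_expK_smul hs x
  have key2 : ∀ y : M, y = x → HasMFDerivAt (𝓡 7) (𝓡 7) (fun y : M => expK (t • ξ) • y) y
      (tr (expK (t • ξ)) x) := by
    rintro y rfl; exact hasMFDerivAt_smul hs _ y
  have h1 := HasMFDerivAt.comp t (key1 ((t - t) • ξ) (by simp)) h0.hasMFDerivAt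
  have h2 := HasMFDerivAt.comp t (key2 (expK ((t - t) • ξ) • x) (by simp [expK_zero])) h1
  have e : ((fun y : M => expK (t • ξ) • y) ∘ (fun ξ : LieK => expK ξ • x) ∘
      fun s : ℝ => (s - t) • ξ) = fun s : ℝ => expK (s • ξ) • x := by
    funext s
    simp only [Function.comp_apply]
    rw [smul_smul, ← expK_add_smul, add_sub_cancel]
  rw [e] at h2
  exact h2

/-- A curve with vanishing velocity is constant. -/
theorem eq_of_mfderiv_eq_zero [T2Space M] {c : ℝ → M}
    (hc : ∀ t, HasMFDerivAt 𝓘(ℝ, ℝ) (𝓡 7) c t (0 : ℝ →L[ℝ] E7)) (s t : ℝ) : c s = c t := by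
  have hcont : Continuous c := continuous_iff_continuousAt.mpr fun t => (hc t).continuousAt
  have hloc : IsLocallyConstant c := by
    rw [IsLocallyConstant.iff_eventually_eq]
    intro t
    have hsrc : c ⁻¹' (chartAt E7 (c t)).source ∈ 𝓝 t :=
      hcont.continuousAt.preimage_mem_nhds
        ((chartAt E7 (c t)).open_source.mem_nhds (mem_chart_source E7 (c t)))
    obtain ⟨ε, hε, hball⟩ := Metric.mem_nhds_iff.mp hsrc
    have hder : ∀ s ∈ Metric.ball t ε,
        HasFDerivWithinAt ((chartAt E7 (c t)) ∘ c) (0 : ℝ →L[ℝ] E7) (Metric.ball t ε) s := by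
      intro s hs
      have h1 : MDifferentiableAt (𝓡 7) 𝓘(ℝ, E7) (chartAt E7 (c t)) (c s) :=
        mdifferentiableAt_atlas (chart_mem_atlas E7 (c t)) (hball hs)
      have h2 := HasMFDerivAt.comp s h1.hasMFDerivAt (hc s)
      have h3 : HasMFDerivAt 𝓘(ℝ, ℝ) 𝓘(ℝ, E7) (chartAt E7 (c t) ∘ c) s (0 : ℝ →L[ℝ] E7) :=
        h2.congr_mfderiv (ContinuousLinearMap.comp_zero _)
      exact (hasMFDerivAt_iff_hasFDerivAt.mp h3).hasFDerivWithinAt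
    filter_upwards [Metric.ball_mem_nhds t hε] with s hs
    have h3 := (convex_ball t ε).is_const_of_fderivWithin_eq_zero (𝕜 := ℝ)
      (fun s hs => (hder s hs).differentiableWithinAt)
      (fun s hs => (hder s hs).fderivWithin (Metric.isOpen_ball.uniqueDiffWithinAt hs))
      hs (Metric.mem_ball_self hε)
    exact (chartAt E7 (c t)).injOn (hball hs) (hball (Metric.mem_ball_self hε)) h3
  exact hloc.apply_eq_of_isPreconnected isPreconnected_univ trivial trivial

/-- The velocity of `exp(s ξ) x` at any time is the translate of its velocity at time zero, so it
vanishes identically and the curve is constant. -/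
theorem expK_smul_eq_of_infK_eq_zero [T2Space M] (hs : IsSmoothAction M) {x : M} {ξ : LieK}
    (h : infK x ξ = 0) : expK ξ • x = x := by
  have hc : ∀ t, HasMFDerivAt 𝓘(ℝ, ℝ) (𝓡 7) (fun s : ℝ => expK (s • ξ) • x) t
      (0 : ℝ →L[ℝ] E7) := by
    refine fun t => (hasMFDerivAt_orbitCurve hs x ξ t).congr_mfderiv ?_
    ext1
    change tr (expK (t • ξ)) x (infK x ((1 : ℝ) • ξ)) = 0
    rw [one_smul, h, map_zero]
  have := eq_of_mfderiv_eq_zero hc 1 0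
  simpa [expK_zero] using this

theorem infK_eq_zero_of_expK_smul_eq (hs : IsSmoothAction M) {x : M} {ξ : LieK}
    (h : ∀ t : ℝ, expK (t • ξ) • x = x) : infK x ξ = 0 := by
  have h1 := hasMFDerivAt_orbitCurve hs x ξ 0
  have e : (fun s : ℝ => expK (s • ξ) • x) = fun _ => x := funext h
  rw [e] at h1
  have h2 := hasMFDerivAt_unique h1 (hasMFDerivAt_const x (0 : ℝ))
  have h3 := DFunLike.congr_fun h2 (1 : ℝ)
  have h4 : tr (expK ((0 : ℝ) • ξ)) x (infK x ((1 : ℝ) • ξ)) = 0 := h3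
  rw [zero_smul, expK_zero, one_smul, tr_one] at h4
  exact h4

end Calculus

/-- A differentiable one-parameter group in a Banach algebra is an exponential. -/
theorem eq_exp_of_hasDerivAt {𝔸 : Type*} [NormedRing 𝔸] [NormedAlgebra ℝ 𝔸] [CompleteSpace 𝔸]
    {P : ℝ → 𝔸} {a : 𝔸} (h0 : P 0 = 1) (hadd : ∀ s t, P (s + t) = P s * P t)
    (hder : HasDerivAt P a 0) (t : ℝ) : P t = NormedSpace.exp (t • a) := by
  let _ : NormedAlgebra ℚ 𝔸 := NormedAlgebra.restrictScalars ℚ ℝ 𝔸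
  have hP (t : ℝ) : HasDerivAt P (P t * a) t := by
    have h1 : HasDerivAt (fun s => P (s - t)) a t := by
      have h := HasDerivAt.scomp t (h := fun s : ℝ => s - t) (g₁ := P) (h' := 1)
        (by simpa using hder) ((hasDerivAt_id t).sub_const t)
      rw [one_smul] at h
      exact h
    have h2 := h1.const_mul (P t)
    have e : (fun s => P t * P (s - t)) = P := by
      funext s; rw [← hadd, add_sub_cancel]
    rwa [e] at h2
  have hE (t : ℝ) := hasDerivAt_exp_smul_const' (𝕂 := ℝ) (-a) t
  have hQ (t : ℝ) := (hP t).mul (hE t)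
  -- This is the derivative of `P t * exp (-t a)`; that product is therefore constantly `1`.
  have hz (t : ℝ) : P t * a * NormedSpace.exp (t • -a) + P t * (-a * NormedSpace.exp (t • -a)) = 0 := by
    noncomm_ring
  have hc := is_const_of_deriv_eq_zero (f := P * fun u => NormedSpace.exp (u • -a))
    (fun t => (hQ t).differentiableAt) (fun t => (hQ t).deriv.trans (hz t)) t 0
  have hc' : P t * NormedSpace.exp (t • -a) = 1 := by
    have h := hc
    simp only [Pi.mul_apply, h0, zero_smul, NormedSpace.exp_zero, mul_one] at h
    exact h
  have hinv : NormedSpace.exp (t • -a) * NormedSpace.exp (t • a) = 1 := by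
    rw [smul_neg, ← NormedSpace.exp_add_of_commute (Commute.neg_left (Commute.refl _)),
      neg_add_cancel, NormedSpace.exp_zero]
  calc P t = P t * (NormedSpace.exp (t • -a) * NormedSpace.exp (t • a)) := by rw [hinv, mul_one]
    _ = _ := by rw [← mul_assoc, hc', one_mul]

section Calculus

set_option linter.unusedSectionVars false

variable {M : Type*} [TopologicalSpace M] [ChartedSpace E7 M] [IsManifold (𝓡 7) ∞ M]
  [MulAction T2SU2 M]

/-! ### The isotropy representation -/

/-- The action of `k` in the preferred chart at `x`. -/
def locAct (x : M) (k : T2SU2) (v : E7) : E7 :=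
  chartAt E7 x (k • (chartAt E7 x).symm v)

/-- The differential of the action of `k` in the preferred chart at `x`. -/
def locD (x : M) (k : T2SU2) (v : E7) : E7 →L[ℝ] E7 := fderiv ℝ (locAct x k) v

theorem contMDiffAt_locAct (hs : IsSmoothAction M) {x : M} {k : T2SU2} {v : E7}
    (hv : v ∈ (chartAt E7 x).target) (hk : k • (chartAt E7 x).symm v ∈ (chartAt E7 x).source) :
    ContMDiffAt (modelT2SU2.prod 𝓘(ℝ, E7)) 𝓘(ℝ, E7) ∞
      (fun p : T2SU2 × E7 => locAct x p.1 p.2) (k, v) := by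
  have h1 : ContMDiffAt (𝓡 7) 𝓘(ℝ, E7) ∞ (chartAt E7 x) (k • (chartAt E7 x).symm v) :=
    (contMDiffOn_chart (I := 𝓡 7) (n := ∞)).contMDiffAt ((chartAt E7 x).open_source.mem_nhds hk)
  have h2 : ContMDiffAt 𝓘(ℝ, E7) (𝓡 7) ∞ (chartAt E7 x).symm v :=
    (contMDiffOn_chart_symm (I := 𝓡 7) (n := ∞)).contMDiffAt
      ((chartAt E7 x).open_target.mem_nhds hv)
  have h3 : ContMDiffAt (modelT2SU2.prod 𝓘(ℝ, E7)) (modelT2SU2.prod (𝓡 7)) ∞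
      (fun p : T2SU2 × E7 => (p.1, (chartAt E7 x).symm p.2)) (k, v) :=
    contMDiffAt_fst.prodMk (ContMDiffAt.comp (k, v) h2 contMDiffAt_snd)
  have h4 : ContMDiffAt (modelT2SU2.prod 𝓘(ℝ, E7)) (𝓡 7) ∞
      (fun p : T2SU2 × E7 => p.1 • (chartAt E7 x).symm p.2) (k, v) :=
    ContMDiffAt.comp (k, v) (hs (k, (chartAt E7 x).symm v)) h3
  exact ContMDiffAt.comp (k, v) h1 h4

/-- The differential along the second variable of a jointly smooth map is again jointly smooth.
Joint continuity in the group element and the base point gives uniform estimates over compact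
stabilizers. -/
theorem contMDiffAt_locD (hs : IsSmoothAction M) {x : M} {k : T2SU2} {v : E7}
    (hv : v ∈ (chartAt E7 x).target) (hk : k • (chartAt E7 x).symm v ∈ (chartAt E7 x).source) :
    ContMDiffAt (modelT2SU2.prod 𝓘(ℝ, E7)) 𝓘(ℝ, E7 →L[ℝ] E7) ∞
      (fun p : T2SU2 × E7 => locD x p.1 p.2) (k, v) := by
  have h1 : ContMDiffAt ((modelT2SU2.prod 𝓘(ℝ, E7)).prod 𝓘(ℝ, E7)) 𝓘(ℝ, E7) ∞
      (Function.uncurry fun (p : T2SU2 × E7) (w : E7) => locAct x p.1 w) ((k, v), v) :=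
    ContMDiffAt.comp ((k, v), v) (g := fun p : T2SU2 × E7 => locAct x p.1 p.2)
      (f := fun q : (T2SU2 × E7) × E7 => (q.1.1, q.2)) (contMDiffAt_locAct hs hv hk)
      ((contMDiffAt_fst.comp _ contMDiffAt_fst).prodMk contMDiffAt_snd)
  have h2 := ContMDiffAt.mfderiv (m := ∞) (fun (p : T2SU2 × E7) (w : E7) => locAct x p.1 w)
    (fun p : T2SU2 × E7 => p.2) h1 contMDiffAt_snd (by simp)
  have h3 := inTangentCoordinates_model_space (𝕜 := ℝ) (N := T2SU2 × E7) (I := 𝓘(ℝ, E7)) (I' := 𝓘(ℝ, E7))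
    (E := E7) (E' := E7) (fun p : T2SU2 × E7 => p.2) (fun p : T2SU2 × E7 => locAct x p.1 p.2)
    (fun p : T2SU2 × E7 => (mfderiv 𝓘(ℝ, E7) 𝓘(ℝ, E7) (locAct x p.1) p.2 : E7 →L[ℝ] E7)) (k, v)
  refine (ContMDiffAt.congr_of_eventuallyEq (f := _) h2 ?_)
  refine Filter.Eventually.of_forall fun p => ?_
  refine Eq.trans ?_ (congrFun h3 p).symm
  exact (mfderiv_eq_fderiv).symm

theorem tr_eq_locD (hs : IsSmoothAction M) {x : M} {k : T2SU2} (hk : k • x = x) :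
    tr k x = locD x k (chartAt E7 x x) := by
  rw [tr, (mdifferentiableAt_smul hs k x).mfderiv, locD]
  simp only [writtenInExtChartAt, hk, mfld_simps, fderivWithin_univ]
  rfl

theorem chart_mem_aux {x : M} {k : T2SU2} (hk : k • x = x) :
    k • (chartAt E7 x).symm (chartAt E7 x x) ∈ (chartAt E7 x).source := by
  rw [(chartAt E7 x).left_inv (mem_chart_source E7 x), hk]
  exact mem_chart_source E7 x

theorem contMDiffAt_locD_base (hs : IsSmoothAction M) {x : M} {k : T2SU2} (hk : k • x = x) :
    ContMDiffAt modelT2SU2 𝓘(ℝ, E7 →L[ℝ] E7) ∞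
      (fun l : T2SU2 => locD x l (chartAt E7 x x)) k :=
  ContMDiffAt.comp k (g := fun p : T2SU2 × E7 => locD x p.1 p.2)
    (f := fun l : T2SU2 => (l, chartAt E7 x x))
    (contMDiffAt_locD hs (mem_chart_target E7 x) (chart_mem_aux hk))
    (contMDiffAt_id.prodMk contMDiffAt_const)

theorem continuous_tr_stabilizer (hs : IsSmoothAction M) (x : M) :
    Continuous fun k : MulAction.stabilizer T2SU2 x => tr (k : T2SU2) x := by
  have e : (fun k : MulAction.stabilizer T2SU2 x => tr (k : T2SU2) x) =
      fun k : MulAction.stabilizer T2SU2 x => locD x (k : T2SU2) (chartAt E7 x x) := by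
    funext k; exact tr_eq_locD hs k.2
  rw [e, continuous_iff_continuousAt]
  intro k
  exact ContinuousAt.comp (f := fun k : MulAction.stabilizer T2SU2 x => (k : T2SU2))
    (contMDiffAt_locD_base hs k.2).continuousAt continuous_subtype_val.continuousAt

/-- The infinitesimal isotropy representation (meaningful on the Lie algebra of the
stabilizer). -/
def isoLie (x : M) : LieK →L[ℝ] (E7 →L[ℝ] E7) :=
  fderiv ℝ (fun ξ : LieK => locD x (expK ξ) (chartAt E7 x x)) 0

theorem hasFDerivAt_isoLie (hs : IsSmoothAction M) (x : M) :
    HasFDerivAt (fun ξ : LieK => locD x (expK ξ) (chartAt E7 x x)) (isoLie x) 0 := by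
  have h1 : ContMDiffAt 𝓘(ℝ, LieK) 𝓘(ℝ, E7 →L[ℝ] E7) ∞
      (fun ξ : LieK => locD x (expK ξ) (chartAt E7 x x)) 0 :=
    ContMDiffAt.comp (0 : LieK)
      (contMDiffAt_locD_base hs (k := expK 0) (by rw [expK_zero, one_smul]))
      contMDiff_expK.contMDiffAt
  exact (h1.contDiffAt.differentiableAt (by simp)).hasFDerivAt

/-- Since `exp(t η)` fixes `x` for all `t`, its differentials at `x` form a differentiable
one-parameter group of endomorphisms. -/
theorem tr_expK [T2Space M] (hs : IsSmoothAction M) {x : M} {η : LieK} (hη : infK x η = 0) :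
    tr (expK η) x = NormedSpace.exp (isoLie x η) := by
  have hfix (t : ℝ) : expK (t • η) • x = x :=
    expK_smul_eq_of_infK_eq_zero hs (by rw [map_smul, hη, smul_zero])
  have h := eq_exp_of_hasDerivAt (P := fun t : ℝ => tr (expK (t • η)) x) (a := isoLie x η)
    (by simp only [zero_smul, expK_zero]; exact tr_one x)
    (fun s t => by simp only [expK_add_smul]; rw [tr_mul hs, hfix]; rfl) ?_ 1
  · simpa using h
  · have e : (fun t : ℝ => tr (expK (t • η)) x) =
        fun t : ℝ => locD x (expK (t • η)) (chartAt E7 x x) := by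
      funext t; exact tr_eq_locD hs (hfix t)
    rw [e]
    have h1 : HasDerivAt (fun t : ℝ => t • η) η 0 := by
      simpa using (hasDerivAt_id (0 : ℝ)).smul_const η
    have h2 : HasFDerivAt (fun ξ : LieK => locD x (expK ξ) (chartAt E7 x x)) (isoLie x)
        ((0 : ℝ) • η) := by rw [zero_smul]; exact hasFDerivAt_isoLie hs x
    exact h2.comp_hasDerivAt (0 : ℝ) h1

/-! ### Rigidity -/

/-- All powers of `k` fix `x` with identity differential. The stabilizer is compact, so on one small
ball in the chart their differentials are uniformly within 1/2 of the identity. A displacement `w -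
v` caused by `k` then accumulates: after `n` steps the point has moved by at least `n/2` times its
length. The point also stays in a bounded set for all `n`, so the displacement is zero. -/
theorem smul_eq_near_of_tr_eq_id [T2Space M] (hs : IsSmoothAction M) {x : M} {k : T2SU2}
    (hk : k • x = x) (htr : tr k x = ContinuousLinearMap.id ℝ E7) :
    ∀ᶠ y in 𝓝 x, k • y = y := by
  set e := chartAt E7 x with he
  set v₀ := e x with hv₀
  have hx := mem_chart_source E7 x
  let S : Set T2SU2 := {h | h • x = x ∧ tr h x = ContinuousLinearMap.id ℝ E7}
  have hSpow (n : ℕ) : k ^ n ∈ S := by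
    induction n with
    | zero => exact ⟨by simp, by rw [pow_zero]; exact tr_one x⟩
    | succ n ih =>
      refine ⟨by rw [pow_succ, mul_smul, hk, ih.1], ?_⟩
      rw [pow_succ, tr_mul hs, hk, ih.2, htr]
      rfl
  have hclosed : IsClosed {h : T2SU2 | h • x = x} :=
    isClosed_eq (contMDiff_smul_right hs x).continuous continuous_const
  -- uniform control of the differentials near `x`
  have hunif : ∀ᶠ v in 𝓝 v₀, ∀ h ∈ {h : T2SU2 | h • x = x}, h ∈ S →
      (h • e.symm v ∈ e.source ∧ ‖locD x h v - ContinuousLinearMap.id ℝ E7‖ ≤ 1 / 2) := by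
    refine hclosed.isCompact.eventually_forall_of_forall_eventually fun h₀ hh₀ => ?_
    have c1 : ContinuousAt (fun p : E7 × T2SU2 => locD x p.2 p.1) (v₀, h₀) :=
      ContinuousAt.comp (x := (v₀, h₀)) (g := fun p : T2SU2 × E7 => locD x p.1 p.2)
        (f := Prod.swap)
        (contMDiffAt_locD hs (mem_chart_target E7 x) (chart_mem_aux hh₀)).continuousAt
        continuous_swap.continuousAt
    have c2 : ContinuousAt (fun p : E7 × T2SU2 => p.2 • e.symm p.1) (v₀, h₀) := by
      have h1 : ContinuousAt e.symm v₀ := e.continuousAt_symm (mem_chart_target E7 x)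
      exact (continuous_action hs).continuousAt.comp
        (f := fun p : E7 × T2SU2 => (p.2, e.symm p.1))
        (continuousAt_snd.prodMk (ContinuousAt.comp (x := (v₀, h₀)) h1 continuousAt_fst))
    have c3 : ContinuousAt (fun p : E7 × T2SU2 => locD x p.2 v₀) (v₀, h₀) :=
      ContinuousAt.comp (x := (v₀, h₀)) (g := fun l => locD x l v₀) (f := Prod.snd)
        (contMDiffAt_locD_base hs hh₀).continuousAt continuousAt_snd
    have n1 := c1.eventually (Metric.ball_mem_nhds (locD x h₀ v₀) (ε := 1 / 4) (by norm_num))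
    have n2 := c2.eventually (e.open_source.mem_nhds (chart_mem_aux hh₀))
    have n3 := c3.eventually (Metric.ball_mem_nhds (locD x h₀ v₀) (ε := 1 / 4) (by norm_num))
    filter_upwards [n1, n2, n3] with p h1 h2 h3 hp
    refine ⟨h2, ?_⟩
    have e1 : locD x p.2 v₀ = ContinuousLinearMap.id ℝ E7 := by
      rw [← hp.2, tr_eq_locD hs hp.1]
    rw [e1] at h3
    rw [← dist_eq_norm]
    have := dist_triangle_right (locD x p.2 p.1) (ContinuousLinearMap.id ℝ E7) (locD x h₀ v₀)
    have h1' := Metric.mem_ball.mp h1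
    have h3' := Metric.mem_ball.mp h3
    linarith
  have htarget : ∀ᶠ v in 𝓝 v₀, v ∈ e.target := e.open_target.mem_nhds (mem_chart_target E7 x)
  obtain ⟨r, hr, hball⟩ := Metric.eventually_nhds_iff_ball.mp (hunif.and htarget)
  have hdiff (n : ℕ) (v : E7) (hv : v ∈ Metric.ball v₀ r) :
      DifferentiableAt ℝ (locAct x (k ^ n)) v := by
    have h1 := contMDiffAt_locAct hs (hball v hv).2 ((hball v hv).1 _ (hSpow n).1 (hSpow n)).1
    have h2 : ContMDiffAt 𝓘(ℝ, E7) 𝓘(ℝ, E7) ∞ (locAct x (k ^ n)) v :=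
      ContMDiffAt.comp v (f := fun v : E7 => (k ^ n, v)) h1
        (contMDiffAt_const.prodMk contMDiffAt_id)
    exact h2.contDiffAt.differentiableAt (by simp)
  have hmv (n : ℕ) (v w : E7) (hv : v ∈ Metric.ball v₀ r) (hw : w ∈ Metric.ball v₀ r) :
      ‖locAct x (k ^ n) w - locAct x (k ^ n) v - (w - v)‖ ≤ 1 / 2 * ‖w - v‖ :=
    (convex_ball v₀ r).norm_image_sub_le_of_norm_fderiv_le' (𝕜 := ℝ)
      (φ := ContinuousLinearMap.id ℝ E7)
      (fun v hv => hdiff n v hv)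
      (fun v hv => ((hball v hv).1 _ (hSpow n).1 (hSpow n)).2) hv hw
  have hbase (n : ℕ) : locAct x (k ^ n) v₀ = v₀ := by
    rw [locAct, hv₀, e.left_inv hx, (hSpow n).1]
  have hball0 : v₀ ∈ Metric.ball v₀ r := Metric.mem_ball_self hr
  have hnear (n : ℕ) (v : E7) (hv : v ∈ Metric.ball v₀ r) :
      ‖locAct x (k ^ n) v - v₀‖ ≤ 3 / 2 * ‖v - v₀‖ := by
    have h1 := hmv n v₀ v hball0 hv
    rw [hbase] at h1
    have h2 := norm_add_le (locAct x (k ^ n) v - v₀ - (v - v₀)) (v - v₀)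
    rw [sub_add_cancel] at h2
    linarith
  have hzero (v : E7) (hv : v ∈ Metric.ball v₀ r) : locAct x (k ^ 0) v = v := by
    rw [locAct, pow_zero, one_smul]
    exact e.right_inv (hball v hv).2
  -- Powers of `k` stretch distances to `v₀` by at most 3/2, so a point at distance less than `r /
  -- 2` is moved inside the ball of radius `r`.
  have hfix : ∀ v ∈ Metric.ball v₀ (r / 2), k • e.symm v = e.symm v := by
    intro v hv
    have hv' : v ∈ Metric.ball v₀ r := Metric.ball_subset_ball (by linarith) hv
    have hvn : ‖v - v₀‖ < r / 2 := by rw [← dist_eq_norm]; exact hv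
    set w := locAct x (k ^ 1) v with hw
    have hwb : w ∈ Metric.ball v₀ r := by
      rw [Metric.mem_ball, dist_eq_norm]
      linarith [hnear 1 v hv']
    have hsrc := ((hball v hv').1 _ (hSpow 1).1 (hSpow 1)).1
    have hstep (n : ℕ) : locAct x (k ^ n) w = locAct x (k ^ (n + 1)) v := by
      rw [hw, locAct, locAct, e.left_inv hsrc, locAct, pow_one, pow_succ k n, mul_smul]
    -- Applying `k ^ n` to the pair `v`, `w` changes the difference `w - v` by at most half its
    -- length; the errors are summed over the steps.
    have hsum (n : ℕ) : ‖locAct x (k ^ n) v - v - (n : ℝ) • (w - v)‖ ≤ n * (1 / 2 * ‖w - v‖) := by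
      induction n with
      | zero => rw [hzero v hv']; simp
      | succ n ih =>
        have h1 := hmv n v w hv' hwb
        rw [hstep] at h1
        have h2 : locAct x (k ^ (n + 1)) v - v - ((n + 1 : ℕ) : ℝ) • (w - v) =
            (locAct x (k ^ (n + 1)) v - locAct x (k ^ n) v - (w - v)) +
            (locAct x (k ^ n) v - v - (n : ℝ) • (w - v)) := by
          push_cast; module
        rw [h2]
        refine (norm_add_le _ _).trans ?_
        push_cast
        linarith
    have hbound (n : ℕ) : (n : ℝ) * ‖w - v‖ ≤ 4 * r := by
      have h1 := hsum n
      have h2 := norm_sub_norm_le ((n : ℝ) • (w - v)) (locAct x (k ^ n) v - v)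
      rw [norm_sub_rev ((n : ℝ) • (w - v)), norm_smul, Real.norm_natCast] at h2
      have h3 : ‖locAct x (k ^ n) v - v‖ ≤ 3 / 2 * ‖v - v₀‖ + ‖v - v₀‖ := by
        have h4 := norm_sub_le (locAct x (k ^ n) v - v₀) (v - v₀)
        rw [sub_sub_sub_cancel_right] at h4
        linarith [hnear n v hv']
      nlinarith
    have hwv : w = v := by
      by_contra hne
      have hpos : 0 < ‖w - v‖ := norm_pos_iff.mpr (sub_ne_zero.mpr hne)
      obtain ⟨n, hn⟩ := exists_nat_gt (4 * r / ‖w - v‖)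
      rw [div_lt_iff₀ hpos] at hn
      linarith [hbound n]
    have h5 := congrArg e.symm hwv
    rw [hw, locAct, e.left_inv hsrc, pow_one] at h5
    exact h5
  have hcont : ContinuousAt e x := e.continuousAt hx
  have h6 : ∀ᶠ y in 𝓝 x, e y ∈ Metric.ball v₀ (r / 2) :=
    hcont.eventually (Metric.ball_mem_nhds _ (by linarith))
  filter_upwards [h6, e.open_source.mem_nhds hx] with y hy hys
  have := hfix _ hy
  rwa [e.left_inv hys] at this

/-- An element that fixes a point to first order acts trivially. -/
theorem smul_eq_of_tr_eq_id [T2Space M] [ConnectedSpace M] (hs : IsSmoothAction M) {x : M}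
    {k : T2SU2} (hk : k • x = x) (htr : tr k x = ContinuousLinearMap.id ℝ E7) (y : M) :
    k • y = y := by
  -- The interior of the fixed point set. It is closed too: at a limit point the differential is the
  -- identity by continuity, so local rigidity applies there.
  let Z : Set M := {y | ∀ᶠ z in 𝓝 y, k • z = z}
  have hopen : IsOpen Z := isOpen_iff_mem_nhds.mpr fun y hy => hy.eventually_nhds
  have hclosed : IsClosed Z := by
    refine isClosed_of_closure_subset fun y hy => ?_
    have hfix : IsClosed {z : M | k • z = z} :=
      isClosed_eq (contMDiff_smul_left hs k).continuous continuous_id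
    have hky : k • y = y := by
      have hsub : Z ⊆ {z : M | k • z = z} := fun z hz => hz.self_of_nhds
      exact hfix.closure_subset_iff.mpr hsub hy
    refine smul_eq_near_of_tr_eq_id hs hky ?_
    rw [tr_eq_locD hs hky]
    by_contra hne
    set e := chartAt E7 y
    have c1 : ContinuousAt (fun z : M => locD y k (e z)) y := by
      have h1 := (contMDiffAt_locD hs (mem_chart_target E7 y) (chart_mem_aux hky)).continuousAt
      exact ContinuousAt.comp (f := fun z : M => (k, e z)) (x := y) h1
        (continuousAt_const.prodMk (e.continuousAt (mem_chart_source E7 y)))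
    have h2 := c1.eventually_ne hne
    have h3 := h2.and (e.open_source.mem_nhds (mem_chart_source E7 y))
    obtain ⟨z, hz, hzne, hzs⟩ := ((mem_closure_iff_frequently.mp hy).and_eventually h3).exists
    apply hzne
    have h4 : ∀ᶠ v in 𝓝 (e z), k • e.symm v = e.symm v := by
      have c2 : ContinuousAt e.symm (e z) := e.continuousAt_symm (e.map_source hzs)
      have h5 : ∀ᶠ z' in 𝓝 (e.symm (e z)), k • z' = z' := by
        rw [e.left_inv hzs]; exact hz
      exact c2.eventually h5
    have h5 : locAct y k =ᶠ[𝓝 (e z)] id := by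
      filter_upwards [h4, e.open_target.mem_nhds (e.map_source hzs)] with v hv hvt
      rw [locAct, hv]
      exact e.right_inv hvt
    rw [locD, h5.fderiv_eq, fderiv_id]
  have huniv : Z = Set.univ :=
    IsClopen.eq_univ ⟨hclosed, hopen⟩ ⟨x, smul_eq_near_of_tr_eq_id hs hk htr⟩
  have hy : y ∈ Z := huniv ▸ Set.mem_univ y
  have hyZ : ∀ᶠ z in 𝓝 y, k • z = z := hy
  exact hyZ.self_of_nhds

/-! ### Dimensions of stabilizers and orbits -/

theorem mem_comap_stabilizer {x : M} {k : T2SU2} :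
    k ∈ (MulAction.stabilizer (EffGroup M) x).comap (QuotientGroup.mk' _) ↔ k • x = x := Iff.rfl

/-- A one-parameter subgroup in the stabilizer has constant orbit curve, and conversely an
infinitesimally trivial direction generates a subgroup that fixes `x`. -/
theorem lieAlgebraOf_stabilizer [T2Space M] (hs : IsSmoothAction M) (x : M) :
    lieAlgebraOf ((MulAction.stabilizer (EffGroup M) x).comap (QuotientGroup.mk' _)) =
      LinearMap.ker (infinitesimalAction x).toLinearMap := by
  apply le_antisymm
  · refine Submodule.span_le.mpr ?_
    rintro ξ ⟨γ, hγ, hsm, hmem, rfl⟩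
    have h0 : γ 0 = 1 := by
      have h := hγ 0 0
      rw [add_zero] at h
      exact left_eq_mul.mp h
    have key : ∀ k : T2SU2, k = 1 →
        HasMFDerivAt modelT2SU2 (𝓡 7) (fun k : T2SU2 => k • x) k
          (infinitesimalAction x : LieT2SU2 →L[ℝ] E7) := by
      rintro k rfl
      exact ((contMDiff_smul_right hs x).mdifferentiableAt (by simp)).hasMFDerivAt
    have h1 := HasMFDerivAt.comp (0 : ℝ) (key _ h0)
      (hsm.mdifferentiableAt (x := (0 : ℝ)) (by simp)).hasMFDerivAt
    have e : ((fun k : T2SU2 => k • x) ∘ γ) = fun _ => x := funext fun t => hmem t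
    rw [e] at h1
    have h2 := hasMFDerivAt_unique h1 (hasMFDerivAt_const x (0 : ℝ))
    exact DFunLike.congr_fun h2 (1 : ℝ)
  · intro ξ hξ
    obtain ⟨η, rfl⟩ := bijective_dexpK.2 ξ
    refine Submodule.subset_span ⟨fun t => expK (t • η), fun s t => expK_add_smul s t η, ?_, ?_, ?_⟩
    · have h1 : ContMDiff 𝓘(ℝ, ℝ) 𝓘(ℝ, LieK) ∞ fun t : ℝ => t • η :=
        (contDiff_id.smul contDiff_const).contMDiff
      exact contMDiff_expK.comp h1
    · intro t
      have h : infK x η = 0 := hξ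
      exact mem_comap_stabilizer.mpr
        (expK_smul_eq_of_infK_eq_zero hs (by rw [map_smul, h, smul_zero]))
    · have h1 : HasFDerivAt (fun t : ℝ => t • η) (ContinuousLinearMap.toSpanSingleton ℝ η) 0 := by
        simpa [hasDerivAt_iff_hasFDerivAt] using (hasDerivAt_id (0 : ℝ)).smul_const η
      have key : ∀ ζ : LieK, ζ = 0 → HasMFDerivAt 𝓘(ℝ, LieK) modelT2SU2 expK ζ dexpK := by
        rintro ζ rfl; exact hasMFDerivAt_expK
      have h2 := HasMFDerivAt.comp (0 : ℝ) (key ((0 : ℝ) • η) (zero_smul ℝ η)) h1.hasMFDerivAt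
      have h3 := h2.mfderiv
      have h4 := DFunLike.congr_fun h3 (1 : ℝ)
      refine h4.trans ?_
      change dexpK ((1 : ℝ) • η) = dexpK η
      rw [one_smul]

theorem orbitTangent_eq_range (x : M) :
    orbitTangent x = LinearMap.range (infK x).toLinearMap := by
  apply le_antisymm
  · rintro _ ⟨ξ, rfl⟩
    obtain ⟨η, rfl⟩ := bijective_dexpK.2 ξ
    exact ⟨η, rfl⟩
  · rintro _ ⟨η, rfl⟩
    exact ⟨dexpK η, rfl⟩

theorem stabDim_eq [T2Space M] (hs : IsSmoothAction M) (x : M) :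
    stabDim x = finrank ℝ (LinearMap.ker (infK x).toLinearMap) := by
  let D : LieK ≃ₗ[ℝ] LieT2SU2 := LinearEquiv.ofBijective dexpK.toLinearMap bijective_dexpK
  have : LinearMap.ker (infinitesimalAction x).toLinearMap =
      Submodule.map (D : LieK →ₗ[ℝ] LieT2SU2) (LinearMap.ker (infK x).toLinearMap) := by
    ext ξ
    constructor
    · intro hξ
      obtain ⟨η, rfl⟩ := bijective_dexpK.2 ξ
      exact ⟨η, hξ, rfl⟩
    · rintro ⟨η, hη, rfl⟩
      exact hη
  rw [stabDim, lieAlgebraOf_stabilizer hs, this]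
  exact LinearEquiv.finrank_map_eq D _

theorem finrank_ker_add_finrank_range (x : M) :
    finrank ℝ (LinearMap.ker (infK x).toLinearMap) +
      finrank ℝ (LinearMap.range (infK x).toLinearMap) = 5 := by
  rw [add_comm, LinearMap.finrank_range_add_finrank_ker]
  simp

theorem mem_torusSingularSet_iff (x : M) :
    x ∈ torusSingularSet M ↔ ∃ s t : ℝ, (s, t) ≠ 0 ∧ infK x (s, t, 0) = 0 :=
  dexpK_torus_iff (p := fun ξ => infinitesimalAction x ξ = 0)

theorem infK_eq_zero_of_ker_mem (hs : IsSmoothAction M) [T2Space M] {ξ : LieK}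
    (h : ∀ t : ℝ, ∀ y : M, expK (t • ξ) • y = y) (x : M) : infK x ξ = 0 :=
  infK_eq_zero_of_expK_smul_eq hs fun t => h t x

/-- If some stabilizer is discrete, the infinitesimal isotropy representation is faithful. -/
theorem eq_zero_of_isoLie_eq_zero [T2Space M] [ConnectedSpace M] (hs : IsSmoothAction M)
    {x₀ : M} (hx₀ : Function.Injective (infK x₀)) {x : M} {η : LieK} (hη : infK x η = 0)
    (h : isoLie x η = 0) : η = 0 := by
  refine (injective_iff_map_eq_zero _).mp hx₀ _ (infK_eq_zero_of_ker_mem hs (fun t y => ?_) x₀)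
  have h1 : infK x (t • η) = 0 := by rw [map_smul, hη, smul_zero]
  refine smul_eq_of_tr_eq_id hs (expK_smul_eq_of_infK_eq_zero hs h1) ?_ y
  have h2 : isoLie x (t • η) = 0 := by rw [map_smul, h]; exact smul_zero (A := E7 →L[ℝ] E7) t
  rw [tr_expK hs h1, h2, NormedSpace.exp_zero]
  rfl

end Calculus

/-! ### Differentiating one-parameter groups of linear maps -/

theorem exp_zero_smul (A : E7 →L[ℝ] E7) :
    NormedSpace.exp ((0 : ℝ) • A) = ContinuousLinearMap.id ℝ E7 := by
  have h : (0 : ℝ) • A = 0 := by ext1; simp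
  rw [h, NormedSpace.exp_zero]; rfl

theorem hasDerivAt_exp_smul_apply (A : E7 →L[ℝ] E7) (v : E7) :
    HasDerivAt (fun t : ℝ => NormedSpace.exp (t • A) v) (A v) 0 := by
  have h := hasDerivAt_exp_smul_const (𝕂 := ℝ) A (0 : ℝ)
  have h2 := h.clm_apply (hasDerivAt_const (0 : ℝ) v)
  rw [map_zero, add_zero] at h2
  refine h2.congr_deriv ?_
  change NormedSpace.exp ((0 : ℝ) • A) (A v) = A v
  rw [exp_zero_smul]; rfl

/-- The cross product as a continuous bilinear map. -/
def crossL : E7 →L[ℝ] E7 →L[ℝ] E7 := LinearMap.toContinuousBilinearMap cross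

theorem crossL_apply (u v : E7) : crossL u v = cross u v := rfl

/-- The Leibniz rule and skewness are the derivatives at `0` of the invariance of the cross product
and of the metric. -/
theorem isDer_of_isG2_exp {A : E7 →L[ℝ] E7} (h : ∀ t : ℝ, IsG2 (NormedSpace.exp (t • A))) :
    IsDer A where
  map_cross u v := by
    have h1 := hasDerivAt_exp_smul_apply A (cross u v)
    have h2 := (crossL.hasFDerivAt_of_bilinear (hasDerivAt_exp_smul_apply A u).hasFDerivAt
      (hasDerivAt_exp_smul_apply A v).hasFDerivAt).hasDerivAt
    have e : (fun t : ℝ => NormedSpace.exp (t • A) (cross u v)) = fun t : ℝ =>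
        crossL (NormedSpace.exp (t • A) u) (NormedSpace.exp (t • A) v) := by
      funext t; exact (h t).map_cross u v
    rw [e] at h1
    have h3 := h1.unique h2
    rw [h3]
    simp [crossL_apply, exp_zero_smul, add_comm]
  skew u v := by
    have h2 := (hasDerivAt_exp_smul_apply A u).inner ℝ (hasDerivAt_exp_smul_apply A v)
    have e : (fun t : ℝ => (inner ℝ (NormedSpace.exp (t • A) u) (NormedSpace.exp (t • A) v) : ℝ)) =
        fun _ => inner ℝ u v := by
      funext t; exact (h t).inner u v
    rw [e] at h2
    have h3 := (hasDerivAt_const (0 : ℝ) (inner ℝ u v : ℝ)).unique h2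
    simp only [exp_zero_smul, ContinuousLinearMap.id_apply] at h3
    linarith

theorem apply_eq_zero_of_exp_apply_eq {A : E7 →L[ℝ] E7} {v : E7}
    (h : ∀ t : ℝ, NormedSpace.exp (t • A) v = v) : A v = 0 := by
  have h1 := hasDerivAt_exp_smul_apply A v
  rw [funext h] at h1
  exact h1.unique (hasDerivAt_const _ _)

theorem apply_mem_of_exp_apply_mem {A : E7 →L[ℝ] E7} {v : E7} {V : Submodule ℝ E7}
    (h : ∀ t : ℝ, NormedSpace.exp (t • A) v ∈ V) : A v ∈ V := by
  have h1 := hasDerivAt_iff_tendsto_slope.mp (hasDerivAt_exp_smul_apply A v)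
  refine V.closed_of_finiteDimensional.mem_of_tendsto h1 (Filter.Eventually.of_forall fun t => ?_)
  rw [slope_def_module]
  refine V.smul_mem _ (V.sub_mem (h t) (h 0))

theorem comm_of_exp_comm {A B : E7 →L[ℝ] E7}
    (h : ∀ (t : ℝ) v, NormedSpace.exp (t • A) (B v) = B (NormedSpace.exp (t • A) v)) (v : E7) :
    A (B v) = B (A v) := by
  have h1 := hasDerivAt_exp_smul_apply A (B v)
  have h2 := B.hasFDerivAt.comp_hasDerivAt (0 : ℝ) (hasDerivAt_exp_smul_apply A v)
  have e : (B ∘ fun t : ℝ => NormedSpace.exp (t • A) v) =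
      fun t : ℝ => NormedSpace.exp (t • A) (B v) := by
    funext t; exact (h t v).symm
  rw [e] at h2
  exact h1.unique h2

/-- The algebraic properties of the isotropy representation `ρ` of a stabilizer `H`, of its
differential `A`, and of the infinitesimal action `U`, in terms of a `G₂` frame. -/
structure IsotropyData (H Γ : Subgroup T2SU2) (ρ : T2SU2 → E7 →L[ℝ] E7) (U : LieK →L[ℝ] E7)
    (A : LieK →L[ℝ] E7 →L[ℝ] E7) : Prop where
  isG2 : ∀ k ∈ H, IsG2 (ρ k)
  map_one : ρ 1 = ContinuousLinearMap.id ℝ E7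
  map_mul : ∀ k ∈ H, ∀ l ∈ H, ∀ v, ρ (k * l) v = ρ k (ρ l v)
  mem_ker : ∀ k ∈ H, ρ k = ContinuousLinearMap.id ℝ E7 → k ∈ Γ
  map_U : ∀ k ∈ H, ∀ ξ, ρ k (U ξ) = U (adjK k ξ)
  expK_mem : ∀ η, U η = 0 → expK η ∈ H
  exp : ∀ η, U η = 0 → ρ (expK η) = NormedSpace.exp (A η)
  injective : ∀ η, U η = 0 → A η = 0 → η = 0
  orthogonal : ∀ X : E3, inner ℝ (cross (U (1, 0, 0)) (U (0, 1, 0))) (U (0, 0, X)) = (0 : ℝ)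

/-! ### What closedness of the form says along orbits -/

section Closed

set_option linter.unusedSectionVars false

variable {M : Type*} [TopologicalSpace M] [ChartedSpace E7 M] [IsManifold (𝓡 7) ∞ M]
  [MulAction T2SU2 M]

/-- The derivative is determined on the two factors, and on each of them the map is the ordinary
orbit map. -/
theorem hasMFDerivAt_expK_smul_expK_smul (hs : IsSmoothAction M) (y : M) :
    HasMFDerivAt 𝓘(ℝ, LieK × LieK) (𝓡 7) (fun p : LieK × LieK => expK p.1 • expK p.2 • y) 0
      ((infK y).comp (ContinuousLinearMap.fst ℝ LieK LieK + ContinuousLinearMap.snd ℝ LieK LieK)) := by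
  have hsm : ContMDiff 𝓘(ℝ, LieK × LieK) (𝓡 7) ∞
      (fun p : LieK × LieK => expK p.1 • expK p.2 • y) :=
    hs.comp ((contMDiff_expK.comp contDiff_fst.contMDiff).prodMk
      ((contMDiff_smul_right hs y).comp (contMDiff_expK.comp contDiff_snd.contMDiff)))
  have h0 := (hsm.mdifferentiableAt (x := 0) (by simp)).hasMFDerivAt
  refine h0.congr_mfderiv ?_
  have hl : ∀ p : LieK × LieK, p = 0 → HasMFDerivAt 𝓘(ℝ, LieK × LieK) (𝓡 7)
      (fun p : LieK × LieK => expK p.1 • expK p.2 • y) p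
      (mfderiv 𝓘(ℝ, LieK × LieK) (𝓡 7)
        (fun p : LieK × LieK => expK p.1 • expK p.2 • y) 0 : LieK × LieK →L[ℝ] E7) := by
    rintro p rfl; exact h0
  have h1 := HasMFDerivAt.comp (0 : LieK) (hl (ContinuousLinearMap.inl ℝ LieK LieK 0) (map_zero _))
    (ContinuousLinearMap.inl ℝ LieK LieK).hasFDerivAt.hasMFDerivAt
  have h2 := HasMFDerivAt.comp (0 : LieK) (hl (ContinuousLinearMap.inr ℝ LieK LieK 0) (map_zero _))
    (ContinuousLinearMap.inr ℝ LieK LieK).hasFDerivAt.hasMFDerivAt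
  have e1 : ((fun p : LieK × LieK => expK p.1 • expK p.2 • y) ∘
      (ContinuousLinearMap.inl ℝ LieK LieK)) = fun ξ : LieK => expK ξ • y := by
    funext ξ; simp [expK_zero]
  have e2 : ((fun p : LieK × LieK => expK p.1 • expK p.2 • y) ∘
      (ContinuousLinearMap.inr ℝ LieK LieK)) = fun ξ : LieK => expK ξ • y := by
    funext ξ; simp [expK_zero]
  rw [e1] at h1
  rw [e2] at h2
  have h3 := hasMFDerivAt_unique h1 (hasMFDerivAt_expK_smul hs y)
  have h4 := hasMFDerivAt_unique h2 (hasMFDerivAt_expK_smul hs y)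
  refine ContinuousLinearMap.ext fun p => ?_
  have h5 := DFunLike.congr_fun h3 p.1
  have h6 := DFunLike.congr_fun h4 p.2
  have e : p = ContinuousLinearMap.inl ℝ LieK LieK p.1 + ContinuousLinearMap.inr ℝ LieK LieK p.2 :=
    Prod.ext (add_zero (p.1 : LieK)).symm (zero_add (p.2 : LieK)).symm
  refine (congrArg _ e).trans ?_
  refine (map_add _ _ _).trans ?_
  refine (congrArg₂ (· + ·) h5 h6).trans ?_
  exact (map_add (infK y) _ _).symm

/-- Pulling back a closed form by a smooth map from a vector space gives a closed form. -/
theorem extDeriv_pullback_eq_zero {k : ℕ} {φ : FormField k M} (hsm : IsSmoothForm φ)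
    (hcl : IsClosedForm φ) {W : Type*} [NormedAddCommGroup W] [NormedSpace ℝ W] {f : W → M}
    (hf : ContMDiff 𝓘(ℝ, W) (𝓡 7) ∞ f) (w₀ : W) :
    extDeriv (fun w => ((φ (f w)).compContinuousLinearMap
      (mfderiv 𝓘(ℝ, W) (𝓡 7) f w : W →L[ℝ] E7) : W [⋀^Fin k]→L[ℝ] ℝ)) w₀ = 0 := by
  set e := chartAt E7 (f w₀)
  have hsrc : ∀ᶠ w in 𝓝 w₀, f w ∈ e.source :=
    hf.continuous.continuousAt.eventually (e.open_source.mem_nhds (mem_chart_source E7 _))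
  have hF (w : W) (hw : f w ∈ e.source) : ContMDiffAt 𝓘(ℝ, W) 𝓘(ℝ, E7) ∞ (e ∘ f) w := by
    have h1 : ContMDiffAt (𝓡 7) 𝓘(ℝ, E7) ∞ e (f w) :=
      (contMDiffOn_chart (I := 𝓡 7) (n := ∞)).contMDiffAt (e.open_source.mem_nhds hw)
    exact ContMDiffAt.comp w h1 hf.contMDiffAt
  have h0 := mem_of_mem_nhds hsrc
  have htgt : e (f w₀) ∈ e.target := e.map_source h0
  -- In the chart at `f w₀` the form is a form on an open set of ℝ⁷, and exterior differentiation
  -- commutes with pullback by `e ∘ f`.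
  have hpb := extDeriv_pullback (r := ∞) (f := e ∘ f) (x := w₀)
    (show DifferentiableAt ℝ (inChart φ (f w₀)) ((e ∘ f) w₀) from ((hsm (f w₀)).contDiffAt (e.open_target.mem_nhds htgt)).differentiableAt (by simp))
    (hF w₀ h0).contDiffAt (by
      rw [minSmoothness_of_isRCLikeNormedField]; exact WithTop.coe_le_coe.mpr (le_top : (2 : ℕ∞) ≤ ⊤))
  have h1 : extDeriv (inChart φ (f w₀)) ((e ∘ f) w₀) = 0 := hcl (f w₀) _ htgt
  rw [h1] at hpb
  have h2 : (fun w => ((φ (f w)).compContinuousLinearMap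
      (mfderiv 𝓘(ℝ, W) (𝓡 7) f w : W →L[ℝ] E7) : W [⋀^Fin k]→L[ℝ] ℝ)) =ᶠ[𝓝 w₀]
      fun w => (inChart φ (f w₀) ((e ∘ f) w)).compContinuousLinearMap (fderiv ℝ (e ∘ f) w) := by
    filter_upwards [hsrc.eventually_nhds] with w hw
    have hw0 := hw.self_of_nhds
    have g1 : HasMFDerivAt 𝓘(ℝ, W) 𝓘(ℝ, E7) (e ∘ f) w (fderiv ℝ (e ∘ f) w) :=
      ((hF w hw0).contDiffAt.differentiableAt (by simp)).hasFDerivAt.hasMFDerivAt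
    have g2 : MDifferentiableAt 𝓘(ℝ, E7) (𝓡 7) e.symm (e (f w)) :=
      ((contMDiffOn_chart_symm (I := 𝓡 7) (n := ∞)).contMDiffAt
        (e.open_target.mem_nhds (e.map_source hw0))).mdifferentiableAt (by simp)
    have g3 := HasMFDerivAt.comp w g2.hasMFDerivAt g1
    have g4 : f =ᶠ[𝓝 w] e.symm ∘ (e ∘ f) := by
      filter_upwards [hw] with w' hw'
      exact (e.left_inv hw').symm
    have g5 := (g3.congr_of_eventuallyEq g4).mfderiv
    have key : ∀ y : M, y = f w → (φ y : E7 [⋀^Fin k]→L[ℝ] ℝ) = φ (f w) := by rintro y rfl; rfl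
    ext v
    have g6 := key _ (e.left_inv hw0)
    change (φ (f w) : E7 [⋀^Fin k]→L[ℝ] ℝ) (fun i => mfderiv 𝓘(ℝ, W) (𝓡 7) f w (v i)) =
      (φ (e.symm (e (f w))) : E7 [⋀^Fin k]→L[ℝ] ℝ) fun i =>
        (mfderiv (𝓡 7) (𝓡 7) e.symm (e (f w)) : E7 →L[ℝ] E7) (fderiv ℝ (e ∘ f) w (v i))
    rw [g6]
    congr 1
    funext i
    exact DFunLike.congr_fun g5 (v i)
  rw [h2.extDeriv_eq, hpb]
  ext v; rfl


theorem IsSmoothAction.tr_comp_infK (hs : IsSmoothAction M) (l : T2SU2) (x : M) (ξ : LieK) :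
    infK (l • x) ξ = tr l x (infK x (adjK l⁻¹ ξ)) := by
  rw [tr_infK hs, ← LinearMap.comp_apply]
  congr 1
  have h : adjK l ∘ₗ adjK l⁻¹ = LinearMap.id := by
    refine LinearMap.ext fun ξ => ?_
    rw [LinearMap.comp_apply, adjK_apply, adjK_apply]
    refine Prod.ext rfl (Prod.ext rfl (imQ_injective ?_))
    have h1 := imQ_adjSU2 l.2.2 (adjSU2 (l⁻¹).2.2 ξ.2.2)
    have h2 := imQ_adjSU2 (l⁻¹).2.2 ξ.2.2
    have h3 : (((l⁻¹).2.2 : SU2) : Quaternion ℝ) = star (l.2.2 : Quaternion ℝ) := coe_SU2_inv _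
    have h4 : (l.2.2 : Quaternion ℝ) * star (l.2.2 : Quaternion ℝ) = 1 := by
      rw [Quaternion.self_mul_star, normSq_SU2]; rfl
    refine h1.trans ?_
    rw [h2, h3, star_star]
    calc _ = ((l.2.2 : Quaternion ℝ) * star (l.2.2 : Quaternion ℝ)) * imQ ξ.2.2 *
        ((l.2.2 : Quaternion ℝ) * star (l.2.2 : Quaternion ℝ)) := by noncomm_ring
      _ = _ := by rw [h4, one_mul, mul_one]; rfl
  rw [h]; rfl

/-- The map `(a, b, c, d) ↦ (a, b, c X + d Y)`. -/
def torusPlane (X Y : E3) : (ℝ × ℝ × ℝ × ℝ) →L[ℝ] LieK × LieK :=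
  LinearMap.toContinuousLinearMap
    { toFun := fun w => ((w.1, w.2.1, w.2.2.1 • X), (0, 0, w.2.2.2 • Y))
      map_add' := fun v w => by simp [add_smul]
      map_smul' := fun c v => by simp [mul_smul] }

theorem torusPlane_apply (X Y : E3) (w : ℝ × ℝ × ℝ × ℝ) :
    torusPlane X Y w = ((w.1, w.2.1, w.2.2.1 • X), (0, 0, w.2.2.2 • Y)) := rfl

/-- The orbit map restricted to the torus and two further directions. -/
def orbitPlane (x : M) (X Y : E3) (w : ℝ × ℝ × ℝ × ℝ) : M :=
  expK (torusPlane X Y w).1 • expK (torusPlane X Y w).2 • x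

theorem contMDiff_orbitPlane (hs : IsSmoothAction M) (x : M) (X Y : E3) :
    ContMDiff 𝓘(ℝ, ℝ × ℝ × ℝ × ℝ) (𝓡 7) ∞ (orbitPlane x X Y) := by
  have h1 : ContMDiff 𝓘(ℝ, ℝ × ℝ × ℝ × ℝ) 𝓘(ℝ, LieK × LieK) ∞ (torusPlane X Y) :=
    (torusPlane X Y).contDiff.contMDiff
  have hsm : ContMDiff 𝓘(ℝ, LieK × LieK) (𝓡 7) ∞
      (fun p : LieK × LieK => expK p.1 • expK p.2 • x) :=
    hs.comp ((contMDiff_expK.comp contDiff_fst.contMDiff).prodMk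
      ((contMDiff_smul_right hs x).comp (contMDiff_expK.comp contDiff_snd.contMDiff)))
  exact hsm.comp h1

/-- In each of the two factors only commuting directions occur, so an increment can be split off at
the inner side of both. This reduces the derivative of the orbit map at any point to the one at the
origin. -/
theorem torusPlane_add_exp (x : M) (X Y : E3) (v w : ℝ × ℝ × ℝ × ℝ) :
    orbitPlane x X Y (v + w) = expK (torusPlane X Y v).1 • expK (torusPlane X Y w).1 •
      expK (torusPlane X Y w).2 • expK (torusPlane X Y v).2 • x := by
  have h1 : expK (torusPlane X Y (v + w)).1 =
      expK (torusPlane X Y v).1 * expK (torusPlane X Y w).1 := by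
    simp [torusPlane_apply, expK, Circle.exp_add, expSU2_add_smul]
  have h2 : expK (torusPlane X Y (v + w)).2 =
      expK (torusPlane X Y w).2 * expK (torusPlane X Y v).2 := by
    rw [add_comm]
    simp [torusPlane_apply, expK, expSU2_add_smul]
  rw [orbitPlane, h1, h2, mul_smul, mul_smul]

theorem hasMFDerivAt_orbitPlane (hs : IsSmoothAction M) (x : M) (X Y : E3)
    (w : ℝ × ℝ × ℝ × ℝ) :
    HasMFDerivAt 𝓘(ℝ, ℝ × ℝ × ℝ × ℝ) (𝓡 7) (orbitPlane x X Y) w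
      ((tr (expK (torusPlane X Y w).1) (expK (torusPlane X Y w).2 • x)).comp
        (((infK (expK (torusPlane X Y w).2 • x)).comp
          (ContinuousLinearMap.fst ℝ LieK LieK + ContinuousLinearMap.snd ℝ LieK LieK)).comp
            (torusPlane X Y))) := by
  set k := expK (torusPlane X Y w).1
  set y := expK (torusPlane X Y w).2 • x with hy
  have h0 : HasFDerivAt (fun v => torusPlane X Y (v - w)) (torusPlane X Y) w := by
    have h := (torusPlane X Y).hasFDerivAt.comp w ((hasFDerivAt_id w).sub_const w)
    exact h
  have key1 : ∀ p : LieK × LieK, p = 0 → HasMFDerivAt 𝓘(ℝ, LieK × LieK) (𝓡 7)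
      (fun p : LieK × LieK => expK p.1 • expK p.2 • y) p ((infK y).comp
        (ContinuousLinearMap.fst ℝ LieK LieK + ContinuousLinearMap.snd ℝ LieK LieK)) := by
    rintro p rfl; exact hasMFDerivAt_expK_smul_expK_smul hs y
  have key2 : ∀ z : M, z = y → HasMFDerivAt (𝓡 7) (𝓡 7) (fun z : M => k • z) z (tr k y) := by
    rintro z rfl; exact hasMFDerivAt_smul hs k _
  have h1 := HasMFDerivAt.comp w (key1 (torusPlane X Y (w - w)) (by rw [sub_self, map_zero]))
    h0.hasMFDerivAt
  have h2 := HasMFDerivAt.comp w (key2 _ (by simp [expK_zero])) h1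
  have e : ((fun z : M => k • z) ∘ (fun p : LieK × LieK => expK p.1 • expK p.2 • y) ∘
      fun v => torusPlane X Y (v - w)) = orbitPlane x X Y := by
    funext v
    have := torusPlane_add_exp x X Y w (v - w)
    rw [add_sub_cancel] at this
    exact this.symm
  rw [e] at h2
  exact h2

/-- The pulled back tangent map of `orbitPlane`. -/
def orbitPlaneD (x : M) (X Y : E3) (r : ℝ) : (ℝ × ℝ × ℝ × ℝ) →L[ℝ] E7 :=
  ((infK x).comp (LinearMap.toContinuousLinearMap (adjK (expK (0, 0, r • Y))⁻¹))).comp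
    ((ContinuousLinearMap.fst ℝ LieK LieK + ContinuousLinearMap.snd ℝ LieK LieK).comp
      (torusPlane X Y))

theorem orbitPlaneD_apply (x : M) (X Y : E3) (r : ℝ) (v : ℝ × ℝ × ℝ × ℝ) :
    orbitPlaneD x X Y r v = infK x (v.1, v.2.1,
      adjSU2 (expSU2 (r • Y))⁻¹ (v.2.2.1 • X + v.2.2.2 • Y)) := by
  refine congrArg (infK x) ?_
  refine Prod.ext (add_zero v.1) (Prod.ext (add_zero v.2.1) rfl)

/-- Invariance of `φ` moves the pulled back form to `x`. The left factor and the torus disappear in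
the process, so the coefficients depend on the last coordinate alone. -/
theorem pullback_orbitPlane (hs : IsSmoothAction M) {φ : FormField 3 M} (hp : PreservesForm φ)
    (x : M) (X Y : E3) (w : ℝ × ℝ × ℝ × ℝ) :
    (φ (orbitPlane x X Y w)).compContinuousLinearMap
      (mfderiv 𝓘(ℝ, ℝ × ℝ × ℝ × ℝ) (𝓡 7) (orbitPlane x X Y) w : (ℝ × ℝ × ℝ × ℝ) →L[ℝ] E7) =
    (φ x : E7 [⋀^Fin 3]→L[ℝ] ℝ).compContinuousLinearMap (orbitPlaneD x X Y w.2.2.2) := by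
  rw [(hasMFDerivAt_orbitPlane hs x X Y w).mfderiv]
  set k := expK (torusPlane X Y w).1
  set l := expK (torusPlane X Y w).2
  ext v
  have h1 := DFunLike.congr_fun (hp k (l • x)) fun i => infK (l • x)
    ((torusPlane X Y (v i)).1 + (torusPlane X Y (v i)).2)
  have h2 := DFunLike.congr_fun (hp l x) fun i => infK x (adjK l⁻¹
    ((torusPlane X Y (v i)).1 + (torusPlane X Y (v i)).2))
  refine Eq.trans h1 (Eq.trans ?_ h2)
  change φ (l • x) _ = φ (l • x) _
  congr 1
  funext i
  exact hs.tr_comp_infK l x _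

theorem expSU2_inv (X : E3) : (expSU2 X)⁻¹ = expSU2 (-X) := by
  have h := expSU2_add_smul (-1) 1 X
  rw [neg_add_cancel, zero_smul, expSU2_zero, neg_one_smul, one_smul] at h
  exact (eq_inv_of_mul_eq_one_left h.symm).symm

theorem contDiff_adjSU2_expSU2 (Y Z : E3) :
    ContDiff ℝ ∞ fun r : ℝ => adjSU2 (expSU2 (r • Y))⁻¹ Z := by
  have e : (fun r : ℝ => adjSU2 (expSU2 (r • Y))⁻¹ Z) = fun r : ℝ =>
      (LinearMap.toContinuousLinearMap imPart) (NormedSpace.exp (imQ (-(r • Y))) *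
        (imQ Z * NormedSpace.exp (imQ (r • Y)))) := by
    funext r
    change imPart (((expSU2 (r • Y))⁻¹ : SU2) *
      (imQ Z * star (((expSU2 (r • Y))⁻¹ : SU2) : Quaternion ℝ))) = _
    have h1 : star (((expSU2 (r • Y))⁻¹ : SU2) : Quaternion ℝ) = NormedSpace.exp (imQ (r • Y)) := by
      rw [coe_SU2_inv, star_star, coe_expSU2]
    rw [h1, expSU2_inv, coe_expSU2]
    rfl
  rw [e]
  have h1 : ContDiff ℝ ∞ fun r : ℝ => NormedSpace.exp (imQ (-(r • Y))) :=
    contDiff_exp_imQ.comp (contDiff_id.smul contDiff_const).neg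
  have h2 : ContDiff ℝ ∞ fun r : ℝ => NormedSpace.exp (imQ (r • Y)) :=
    contDiff_exp_imQ.comp (contDiff_id.smul contDiff_const)
  exact (LinearMap.toContinuousLinearMap imPart).contDiff.comp (h1.mul (contDiff_const.mul h2))

theorem differentiable_orbitPlaneD (x : M) (X Y : E3) :
    Differentiable ℝ (orbitPlaneD x X Y) := by
  have h : ContDiff ℝ ∞ (orbitPlaneD x X Y) := by
    refine contDiff_clm_apply_iff.mpr fun v => ?_
    simp only [orbitPlaneD_apply]
    exact (infK x).contDiff.comp
      (contDiff_const.prodMk (contDiff_const.prodMk (contDiff_adjSU2_expSU2 Y _)))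
  exact h.differentiable (by simp)

/-- Pull `φ` back to ℝ⁴ by torus coordinates `a`, `b`, the direction `X` and the direction `-Y`. The
result is closed and its coefficients depend only on the last coordinate, so the coefficient of the
first three differentials is constant. That coefficient is `φ(U₁, U₂, ·)` on the rotated vector `X`.
-/
theorem phi_infK_const (hs : IsSmoothAction M) {φ : FormField 3 M} (hsm : IsSmoothForm φ)
    (hcl : IsClosedForm φ) (hp : PreservesForm φ) (x : M) (X Y : E3) :
    φ x ![infK x (1, 0, 0), infK x (0, 1, 0), infK x (0, 0, adjSU2 (expSU2 Y) X)] =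
      φ x ![infK x (1, 0, 0), infK x (0, 1, 0), infK x (0, 0, X)] := by
  let W := ℝ × ℝ × ℝ × ℝ
  -- With `-Y` in place of `Y` the inverse in the pulled back tangent map becomes `exp Y` at `r =
  -- 1`.
  let Ω : ℝ → W [⋀^Fin 3]→L[ℝ] ℝ := fun r =>
    (φ x : E7 [⋀^Fin 3]→L[ℝ] ℝ).compContinuousLinearMap (orbitPlaneD x X (-Y) r)
  let pr : W →L[ℝ] ℝ := (ContinuousLinearMap.snd ℝ ℝ ℝ).comp
    ((ContinuousLinearMap.snd ℝ ℝ (ℝ × ℝ)).comp (ContinuousLinearMap.snd ℝ ℝ (ℝ × ℝ × ℝ)))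
  have hΩ : Differentiable ℝ Ω := fun r =>
    (differentiableAt_const _).continuousAlternatingMapCompContinuousLinearMap
      (differentiable_orbitPlaneD x X (-Y) r)
  have hext (w : W) : extDeriv (fun w => Ω (pr w)) w = 0 := by
    have h := extDeriv_pullback_eq_zero hsm hcl (contMDiff_orbitPlane hs x X (-Y)) w
    exact (congrArg (fun f => extDeriv f w)
      (funext (pullback_orbitPlane hs hp x X (-Y)))).symm.trans h
  let v : Fin 4 → W := ![(1, 0, 0, 0), (0, 1, 0, 0), (0, 0, 1, 0), (0, 0, 0, 1)]
  let u : Fin 3 → W := ![(1, 0, 0, 0), (0, 1, 0, 0), (0, 0, 1, 0)]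
  have hderiv (r : ℝ) : deriv (fun r => Ω r u) r = 0 := by
    have hd : DifferentiableAt ℝ (fun w => Ω (pr w)) ((0, 0, 0, r) : W) :=
      (hΩ _).comp _ pr.differentiableAt
    have h := DFunLike.congr_fun (hext (0, 0, 0, r)) v
    rw [extDeriv_apply hd] at h
    have hf (c : Fin 3 → W) (z : W) : fderiv ℝ (fun w => Ω (pr w) c) ((0, 0, 0, r) : W) z =
        pr z * deriv (fun r => Ω r c) r := by
      have h1 : HasFDerivAt (fun r => Ω r c) (fderiv ℝ (fun r => Ω r c) r) (pr (0, 0, 0, r)) :=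
        ((hΩ r).continuousAlternatingMap_apply_const c).hasFDerivAt
      have h2 := h1.comp ((0, 0, 0, r) : W) pr.hasFDerivAt
      have h3 := DFunLike.congr_fun h2.fderiv z
      refine h3.trans ?_
      exact fderiv_eq_smul_deriv (pr z)
    simp only [hf] at h
    replace h := (Fin.sum_univ_four _).symm.trans h
    have e : (3 : Fin 4).removeNth v = u := by
      funext i; fin_cases i <;> rfl
    have p0 : pr (v 0) = 0 := rfl
    have p1 : pr (v 1) = 0 := rfl
    have p2 : pr (v 2) = 0 := rfl
    have p3 : pr (v 3) = 1 := rfl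
    -- Only the last coordinate direction moves the form, so one of the four terms of the exterior
    -- derivative survives.
    rw [p0, p1, p2, p3, e] at h
    simpa using h
  have hdiff : Differentiable ℝ fun r => Ω r u := fun r =>
    (hΩ r).continuousAlternatingMap_apply_const u
  have hconst := is_const_of_deriv_eq_zero hdiff hderiv 1 0
  have hval (r : ℝ) : Ω r u = φ x ![infK x (1, 0, 0), infK x (0, 1, 0),
      infK x (0, 0, adjSU2 (expSU2 (r • -Y))⁻¹ X)] := by
    change (φ x : E7 [⋀^Fin 3]→L[ℝ] ℝ) (fun i => orbitPlaneD x X (-Y) r (u i)) = _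
    congr 1
    funext i
    rw [orbitPlaneD_apply]
    fin_cases i <;> simp [u]
  rw [hval, hval, one_smul, zero_smul, expSU2_zero, inv_one, expSU2_inv, neg_neg] at hconst
  rw [hconst]
  have h1 : adjSU2 1 X = X := by
    apply imQ_injective
    rw [imQ_adjSU2]
    have : ((1 : SU2) : Quaternion ℝ) = 1 := rfl
    rw [this, one_mul, star_one, mul_one]
  rw [h1]

/-- The closedness of `φ` makes `φ(U₁, U₂, ·)` vanish on the orbits of `SU(2)`. -/
theorem phi_infK_eq_zero (hs : IsSmoothAction M) {φ : FormField 3 M} (hsm : IsSmoothForm φ)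
    (hcl : IsClosedForm φ) (hp : PreservesForm φ) (x : M) (X : E3) :
    φ x ![infK x (1, 0, 0), infK x (0, 1, 0), infK x (0, 0, X)] = 0 := by
  let μ : E3 →ₗ[ℝ] ℝ := ((φ x : E7 [⋀^Fin 3]→L[ℝ] ℝ).toMultilinearMap.toLinearMap
    ![infK x (1, 0, 0), infK x (0, 1, 0), 0] 2).comp ((infK x).toLinearMap.comp
      ((LinearMap.inr ℝ ℝ (ℝ × E3)).comp (LinearMap.inr ℝ ℝ E3)))
  have hμ (X : E3) : μ X = φ x ![infK x (1, 0, 0), infK x (0, 1, 0), infK x (0, 0, X)] := by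
    change (φ x : E7 [⋀^Fin 3]→L[ℝ] ℝ) _ = _
    congr 1
    funext i
    fin_cases i <;> rfl
  have h := eq_zero_of_adjSU2_invariant μ fun Y X => by
    rw [hμ, hμ]; exact phi_infK_const hs hsm hcl hp x X Y
  rw [← hμ, h]; rfl

/-! ### The isotropy representation in a `G₂` frame -/

/-- The frame `g2Frame φ x` of `T_x M` as a linear map between copies of `ℝ⁷`. -/
def frame (φ : FormField 3 M) (x : M) : E7 ≃L[ℝ] E7 := g2Frame φ x

/-- Conjugation of endomorphisms by the frame. -/
def frameConj (φ : FormField 3 M) (x : M) : (E7 →L[ℝ] E7) ≃A[ℝ] (E7 →L[ℝ] E7) :=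
  (frame φ x).symm.conjContinuousAlgEquiv

theorem frameConj_apply (φ : FormField 3 M) (x : M) (A : E7 →L[ℝ] E7) (v : E7) :
    frameConj φ x A v = (frame φ x).symm (A (frame φ x v)) := rfl

/-- The differential of `k` at the fixed point `x` in the frame `g2Frame φ x`. -/
def rho (φ : FormField 3 M) (x : M) (k : T2SU2) : E7 →L[ℝ] E7 := frameConj φ x (tr k x)

/-- The infinitesimal action in the frame `g2Frame φ x`. -/
def infFrame (φ : FormField 3 M) (x : M) : LieK →L[ℝ] E7 :=
  ((frame φ x).symm : E7 →L[ℝ] E7).comp (infK x)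

/-- The infinitesimal isotropy representation in the frame `g2Frame φ x`. -/
def isoFrame (φ : FormField 3 M) (x : M) : LieK →L[ℝ] E7 →L[ℝ] E7 :=
  LinearMap.toContinuousLinearMap
    ((frameConj φ x).toAlgEquiv.toLinearMap ∘ₗ (isoLie x).toLinearMap)

theorem isoFrame_apply (φ : FormField 3 M) (x : M) (η : LieK) :
    isoFrame φ x η = frameConj φ x (isoLie x η) := rfl

theorem isG2Frame_g2Frame {φ : FormField 3 M} (hφ : IsG2Manifold φ) (x : M) :
    IsG2Frame φ x (g2Frame φ x) := by
  let _ : Nonempty (E7 ≃L[ℝ] TangentSpace (𝓡 7) x) := ⟨ContinuousLinearEquiv.refl ℝ E7⟩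
  exact Classical.epsilon_spec (hφ.exists_frame x)

theorem phi_frame {φ : FormField 3 M} (hφ : IsG2Manifold φ) (x : M) (v : Fin 3 → E7) :
    (φ x : E7 [⋀^Fin 3]→L[ℝ] ℝ) (fun i => frame φ x (v i)) = phi0 v :=
  DFunLike.congr_fun (isG2Frame_g2Frame hφ x) v

theorem phi_eq_phi0 {φ : FormField 3 M} (hφ : IsG2Manifold φ) (x : M) (v : Fin 3 → E7) :
    (φ x : E7 [⋀^Fin 3]→L[ℝ] ℝ) v = phi0 fun i => (frame φ x).symm (v i) := by
  rw [← phi_frame hφ x]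
  congr 1
  funext i
  exact ((frame φ x).apply_symm_apply (v i)).symm

theorem rho_smul {x : M} (hs : IsSmoothAction M) (φ : FormField 3 M) (k l : T2SU2)
    (hl : l • x = x) (v : E7) : rho φ x (k * l) v = rho φ x k (rho φ x l v) := by
  rw [rho, tr_mul hs, hl]
  simp [rho, frameConj_apply]

theorem infFrame_eq_zero_iff {φ : FormField 3 M} {x : M} {η : LieK} :
    infFrame φ x η = 0 ↔ infK x η = 0 :=
  (frame φ x).symm.map_eq_zero_iff

/-- Here the geometry ends: injectivity comes from rigidity together with a point of discrete
stabilizer, and orthogonality comes from closedness of `φ`. The case analysis below uses only these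
properties. -/
theorem isotropyData [T2Space M] [ConnectedSpace M] (hs : IsSmoothAction M) {φ : FormField 3 M}
    (hφ : IsG2Manifold φ) (hp : PreservesForm φ) {x₀ : M} (hx₀ : Function.Injective (infK x₀))
    (x : M) :
    IsotropyData (MulAction.stabilizer T2SU2 x) (MulAction.toPermHom T2SU2 M).ker
      (rho φ x) (infFrame φ x) (isoFrame φ x) where
  isG2 k hk := by
    have hk' : k • x = x := hk
    ext v
    have h1 := DFunLike.congr_fun (hp k x) fun i => frame φ x (v i)
    have key : ∀ y : M, y = x → (φ y : E7 [⋀^Fin 3]→L[ℝ] ℝ) = φ x := by rintro y rfl; rfl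
    have h2 : (φ x : E7 [⋀^Fin 3]→L[ℝ] ℝ) (fun i => tr k x (frame φ x (v i))) =
        (φ x : E7 [⋀^Fin 3]→L[ℝ] ℝ) (fun i => frame φ x (v i)) :=
      (DFunLike.congr_fun (key _ hk').symm _).trans h1
    rw [phi_frame hφ, phi_eq_phi0 hφ] at h2
    exact h2
  map_one := by rw [rho, tr_one]; exact map_one (frameConj φ x)
  map_mul k _ l hl v := rho_smul hs φ k l hl v
  mem_ker k hk h := by
    have h1 : tr k x = ContinuousLinearMap.id ℝ E7 :=
      (frameConj φ x).injective (h.trans (map_one (frameConj φ x)).symm)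
    rw [MonoidHom.mem_ker]
    ext y
    exact smul_eq_of_tr_eq_id hs hk h1 y
  map_U k hk ξ := by
    have hk' : k • x = x := hk
    have h := tr_infK hs k x ξ
    rw [hk'] at h
    simp [rho, frameConj_apply, infFrame, h]
  expK_mem η hη := expK_smul_eq_of_infK_eq_zero hs (infFrame_eq_zero_iff.mp hη)
  exp η hη := by
    let _ : NormedAlgebra ℚ (E7 →L[ℝ] E7) := NormedAlgebra.restrictScalars ℚ ℝ _
    rw [rho, tr_expK hs (infFrame_eq_zero_iff.mp hη), isoFrame_apply]
    exact NormedSpace.map_exp (frameConj φ x) (frameConj φ x).continuous _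
  injective η hη h := by
    refine eq_zero_of_isoLie_eq_zero hs hx₀ (infFrame_eq_zero_iff.mp hη) ?_
    exact (frameConj φ x).injective (h.trans (map_zero (frameConj φ x)).symm)
  orthogonal X := by
    have h := phi_infK_eq_zero hs hφ.smooth hφ.closed hp x X
    have h1 := (phi_eq_phi0 hφ x ![infK x (1, 0, 0), infK x (0, 1, 0), infK x (0, 0, X)]).symm.trans h
    rw [phi0_apply] at h1
    exact h1

end Closed

/-! ### Central torus elements, rotations and transitivity on spheres -/

theorem adjSU2_one (X : E3) : adjSU2 1 X = X := by
  apply imQ_injective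
  rw [imQ_adjSU2]
  have : ((1 : SU2) : Quaternion ℝ) = 1 := rfl
  rw [this, one_mul, star_one, mul_one]

theorem adjK_torus (k : T2SU2) (s t : ℝ) : adjK k (s, t, 0) = (s, t, 0) := by
  rw [adjK_apply]; simp

theorem adjK_eq_self {k : T2SU2} (hk : k.2.2 = 1) (ξ : LieK) : adjK k ξ = ξ := by
  rw [adjK_apply, hk, adjSU2_one]

theorem expK_torus_snd (s t : ℝ) : (expK (s, t, 0)).2.2 = 1 := expSU2_zero

theorem exists_unit_pair {W : Submodule ℝ E7} (h2 : 2 ≤ finrank ℝ W) {w₀ w₁ : E7} (h0 : w₀ ∈ W)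
    (h1 : w₁ ∈ W) (n0 : ‖w₀‖ = 1) (n1 : ‖w₁‖ = 1) :
    ∃ α : ℝ, ∃ z ∈ W, ‖z‖ = 1 ∧ (inner ℝ w₀ z : ℝ) = 0 ∧
      w₁ = Real.cos α • w₀ + Real.sin α • z := by
  set c : ℝ := inner ℝ w₀ w₁ with hc
  set y := w₁ - c • w₀ with hy
  have i0 := inner_self_of_norm_one n0
  have i1 := inner_self_of_norm_one n1
  have hyW : y ∈ W := W.sub_mem h1 (W.smul_mem _ h0)
  have hy0 : (inner ℝ w₀ y : ℝ) = 0 := by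
    rw [hy, inner_sub_right, inner_smul_right, i0, ← hc]; ring
  have hyy : (inner ℝ y y : ℝ) = 1 - c ^ 2 := by
    have h : (inner ℝ w₁ w₀ : ℝ) = c := real_inner_comm _ _
    rw [hy, inner_sub_left, inner_sub_right, inner_sub_right, inner_smul_left, inner_smul_left,
      inner_smul_right, inner_smul_right, i0, i1, h, ← hc]
    simp only [conj_trivial]; ring
  rw [real_inner_self_eq_norm_sq] at hyy
  -- If `w₁ = ± w₀` the sine vanishes and any unit normal of `w₀` in `W` will do; it exists because
  -- `W` has dimension at least two.
  by_cases hne : y = 0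
  · obtain ⟨z, hz, hz1, hz0⟩ := exists_unit_mem_orthogonal (F := W) (G := ℝ ∙ w₀)
      (lt_of_le_of_lt (finrank_span_singleton (K := ℝ) (by rintro rfl; simp at n0)).le (by omega))
    have hz0' := inner_eq_zero_of_mem (Submodule.mem_span_singleton_self w₀) hz0
    rw [hne, norm_zero] at hyy
    refine ⟨Real.arccos c, z, hz, hz1, hz0', ?_⟩
    rw [Real.sin_arccos, Real.cos_arccos (by nlinarith) (by nlinarith), ← hyy]
    simp only [ne_eq, OfNat.ofNat_ne_zero, not_false_eq_true, zero_pow, Real.sqrt_zero, zero_smul,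
      add_zero]
    exact sub_eq_zero.mp (hy ▸ hne)
  · have hp : 0 < ‖y‖ := norm_pos_iff.mpr hne
    refine ⟨Real.arccos c, ‖y‖⁻¹ • y, W.smul_mem _ hyW, norm_smul_inv_norm hne, ?_, ?_⟩
    · rw [inner_smul_right, hy0, mul_zero]
    · rw [Real.sin_arccos, Real.cos_arccos (by nlinarith) (by nlinarith), ← hyy,
        Real.sqrt_sq hp.le, smul_smul, mul_inv_cancel₀ hp.ne', one_smul, hy]
      abel

/-- The exponential of an infinitesimal rotation. -/
theorem exp_apply_of_rotation {B : E7 →L[ℝ] E7} {v z : E7} {θ : ℝ} (h1 : B v = θ • z)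
    (h2 : B z = -(θ • v)) :
    NormedSpace.exp B v = Real.cos θ • v + Real.sin θ • z := by
  let _ : NormedAlgebra ℚ (E7 →L[ℝ] E7) := NormedAlgebra.restrictScalars ℚ ℝ _
  let c : ℝ → E7 := fun t => Real.cos (t * θ) • v + Real.sin (t * θ) • z
  have hlin (t : ℝ) : HasDerivAt (fun t : ℝ => t * θ) θ t := by
    simpa using (hasDerivAt_id t).mul_const θ
  have hc (t : ℝ) : HasDerivAt c (B (c t)) t := by
    have h3 := ((hlin t).cos.smul_const v).add ((hlin t).sin.smul_const z)
    refine h3.congr_deriv ?_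
    simp only [c, map_add, map_smul, h1, h2]
    module
  have hE (t : ℝ) := hasDerivAt_exp_smul_const (𝕂 := ℝ) (-B) t
  -- The curve `c` solves `c' = B c`, so `exp(-t B) (c t)` is constant.
  have hP (t : ℝ) : HasDerivAt (fun t : ℝ => NormedSpace.exp (t • -B) (c t)) 0 t := by
    refine ((hE t).clm_apply (hc t)).congr_deriv ?_
    simp
  have h3 := is_const_of_deriv_eq_zero (fun t => (hP t).differentiableAt)
    (fun t => (hP t).deriv) 1 0
  have h4 : NormedSpace.exp (-B) (c 1) = v := by
    have e0 := exp_zero_smul (-B)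
    simp only [e0] at h3
    have e1 : (1 : ℝ) • -B = -B := one_smul ℝ _
    rw [e1] at h3
    rw [h3]
    simp [c]
  have h5 : NormedSpace.exp B (NormedSpace.exp (-B) (c 1)) = c 1 := by
    have h : NormedSpace.exp B * NormedSpace.exp (-B) = 1 := by
      rw [← NormedSpace.exp_add_of_commute (Commute.neg_right (Commute.refl B)), add_neg_cancel,
        NormedSpace.exp_zero]
    exact DFunLike.congr_fun h (c 1)
  rw [h4] at h5
  rw [h5]
  simp [c]

/-- A three-dimensional family of derivations that kill the associative plane `F` exponentiates to
a group acting transitively on the unit sphere of `Fᗮ`. -/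
theorem exists_exp_apply_eq {F : Submodule ℝ E7} (hF : CrossClosed F) (h3 : finrank ℝ F = 3)
    {B : E3 →ₗ[ℝ] E7 →L[ℝ] E7} (hB : ∀ X, IsDer (B X)) (hBF : ∀ X, ∀ v ∈ F, B X v = 0)
    (hinj : ∀ X, B X = 0 → X = 0) {w₀ w₁ : E7} (h0 : w₀ ∈ Fᗮ) (h1 : w₁ ∈ Fᗮ) (n0 : ‖w₀‖ = 1)
    (n1 : ‖w₁‖ = 1) : ∃ X, NormedSpace.exp (B X) w₀ = w₁ := by
  have h7 := finrank_orthogonal_E7 F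
  have hw0 : w₀ ≠ 0 := by rintro rfl; simp at n0
  obtain ⟨α, z, hz, nz, hwz, rfl⟩ := exists_unit_pair (W := Fᗮ) (by omega) h0 h1 n0 n1
  let T : E3 →ₗ[ℝ] E7 :=
    { toFun := fun X => B X w₀
      map_add' := fun X Y => by rw [map_add]; rfl
      map_smul' := fun c X => by rw [map_smul]; rfl }
  have hTinj : Function.Injective T := (injective_iff_map_eq_zero T).mpr fun X hX =>
    hinj X ((hB X).eq_zero_of_assoc h3 (hBF X) (not_mem_of_mem_orthogonal h0 hw0) hX)
  have hle : LinearMap.range T ≤ (ℝ ∙ w₀)ᗮ ⊓ Fᗮ := by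
    rintro _ ⟨X, rfl⟩
    refine ⟨?_, (hB X).mem_orthogonal (fun v hv => by rw [hBF X v hv]; exact F.zero_mem) h0⟩
    rw [SetLike.mem_coe, Submodule.mem_orthogonal_singleton_iff_inner_left]
    exact (hB X).inner_self w₀
  have hr : finrank ℝ (LinearMap.range T) = 3 := by
    rw [LinearMap.finrank_range_of_inj hTinj]; simp
  have hs : finrank ℝ ↥((ℝ ∙ w₀)ᗮ ⊓ Fᗮ) = 3 := by
    have h := Submodule.finrank_add_inf_finrank_orthogonal (K₁ := ℝ ∙ w₀) (K₂ := Fᗮ)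
      ((Submodule.span_singleton_le_iff_mem _ _).mpr h0)
    rw [finrank_span_singleton (K := ℝ) hw0] at h
    omega
  -- The vectors `B X w₀` fill the three-dimensional tangent space of the sphere at `w₀`, because a
  -- derivation of the family that kills `w₀` is zero. One of them points towards `w₁` with speed
  -- equal to the angle.
  have heq := Submodule.eq_of_le_of_finrank_eq hle (hr.trans hs.symm)
  have hmem : α • z ∈ LinearMap.range T := by
    rw [heq]
    refine ⟨?_, Fᗮ.smul_mem _ hz⟩
    rw [SetLike.mem_coe, Submodule.mem_orthogonal_singleton_iff_inner_right, inner_smul_right, hwz,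
      mul_zero]
  obtain ⟨X, hX⟩ := hmem
  have hX' : B X w₀ = α • z := hX
  refine ⟨X, exp_apply_of_rotation hX' ?_⟩
  -- Writing `z = f × w₀` with `f` in the plane killed by `B X` gives `B X z = f × (α z) = -α w₀`,
  -- so `B X` rotates the plane of `w₀` and `z`.
  obtain ⟨f, hf, rfl⟩ := hF.exists_cross_eq h3 h0 hw0 hz hwz
  have hfw := inner_eq_zero_of_mem hf h0
  have hff : (inner ℝ f f : ℝ) = 1 := by
    have h := inner_cross_cross f w₀ w₀
    rw [hfw, inner_self_of_norm_one nz, inner_self_of_norm_one n0] at h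
    linarith
  rw [(hB X).map_cross, hBF X f hf, hX', map_smul, cross_cross, hfw, hff]
  simp

/-! ### First consequences of the isotropy data -/

namespace IsotropyData

variable {H Γ : Subgroup T2SU2} {ρ : T2SU2 → E7 →L[ℝ] E7} {U : LieK →L[ℝ] E7}
  {A : LieK →L[ℝ] E7 →L[ℝ] E7}

theorem exp_smul (D : IsotropyData H Γ ρ U A) {η : LieK} (hη : U η = 0) (t : ℝ) :
    ρ (expK (t • η)) = NormedSpace.exp (t • A η) := by
  rw [D.exp _ (by rw [map_smul, hη, smul_zero]), map_smul]

theorem expK_smul_mem (D : IsotropyData H Γ ρ U A) {η : LieK} (hη : U η = 0) (t : ℝ) :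
    expK (t • η) ∈ H :=
  D.expK_mem _ (by rw [map_smul, hη, smul_zero])

theorem isDer (D : IsotropyData H Γ ρ U A) {η : LieK} (hη : U η = 0) : IsDer (A η) :=
  isDer_of_isG2_exp fun t => by rw [← D.exp_smul hη]; exact D.isG2 _ (D.expK_smul_mem hη t)

theorem map_adj_eq_zero (D : IsotropyData H Γ ρ U A) {k : T2SU2} (hk : k ∈ H) {η : LieK}
    (hη : U η = 0) : U (adjK k η) = 0 := by
  rw [← D.map_U k hk, hη, map_zero]

/-- The differentiated form of `k exp(t η) k⁻¹ = exp(t Ad_k η)`. -/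
theorem rho_A (D : IsotropyData H Γ ρ U A) {k : T2SU2} (hk : k ∈ H) {η : LieK}
    (hη : U η = 0) (v : E7) : ρ k (A η v) = A (adjK k η) (ρ k v) := by
  have h1 := (ρ k).hasFDerivAt.comp_hasDerivAt (0 : ℝ) (hasDerivAt_exp_smul_apply (A η) v)
  have h2 := hasDerivAt_exp_smul_apply (A (adjK k η)) (ρ k v)
  have e : (ρ k ∘ fun t : ℝ => NormedSpace.exp (t • A η) v) =
      fun t : ℝ => NormedSpace.exp (t • A (adjK k η)) (ρ k v) := by
    funext t
    have hη' := D.map_adj_eq_zero hk hη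
    rw [Function.comp_apply, ← D.exp_smul hη, ← D.exp_smul hη',
      ← D.map_mul _ hk _ (D.expK_smul_mem hη t), ← D.map_mul _ (D.expK_smul_mem hη' t) _ hk,
      ← map_smul, ← conj_expK, inv_mul_cancel_right]
  rw [e] at h1
  exact h1.unique h2

/-- The torus is central, so the adjoint action fixes its Lie algebra. -/
theorem rho_torus (D : IsotropyData H Γ ρ U A) {k : T2SU2} (hk : k ∈ H) (s t : ℝ) :
    ρ k (U (s, t, 0)) = U (s, t, 0) := by
  rw [D.map_U k hk, adjK_torus]

theorem A_apply_torus (D : IsotropyData H Γ ρ U A) {η : LieK} (hη : U η = 0) (s t : ℝ) :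
    A η (U (s, t, 0)) = 0 :=
  apply_eq_zero_of_exp_apply_eq fun r => by
    rw [← D.exp_smul hη, D.rho_torus (D.expK_smul_mem hη r)]

theorem expK_smul_torus_snd (r s t : ℝ) : (expK (r • ((s, t, 0) : LieK))).2.2 = 1 := by
  have : r • ((s, t, 0) : LieK) = (r * s, r * t, 0) := by simp
  rw [this, expK_torus_snd]

/-- Torus elements act trivially by the adjoint action, so those in the stabilizer fix the tangent
space of the orbit pointwise. -/
theorem torus_A_U (D : IsotropyData H Γ ρ U A) {s t : ℝ} (h : U (s, t, 0) = 0) (ξ : LieK) :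
    A (s, t, 0) (U ξ) = 0 :=
  apply_eq_zero_of_exp_apply_eq fun r => by
    rw [← D.exp_smul h, D.map_U _ (D.expK_smul_mem h r), adjK_eq_self (expK_smul_torus_snd r s t)]

theorem torus_comm (D : IsotropyData H Γ ρ U A) {s t : ℝ} (h : U (s, t, 0) = 0) {η : LieK}
    (hη : U η = 0) (v : E7) : A (s, t, 0) (A η v) = A η (A (s, t, 0) v) :=
  comm_of_exp_comm (fun r v => by
    rw [← D.exp_smul h, D.rho_A (D.expK_smul_mem h r) hη, adjK_eq_self (expK_smul_torus_snd r s t)]) v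

theorem rho_torus_comm (D : IsotropyData H Γ ρ U A) {k : T2SU2} (hk : k ∈ H) {s t : ℝ}
    (h : U (s, t, 0) = 0) (v : E7) : ρ k (A (s, t, 0) v) = A (s, t, 0) (ρ k v) := by
  rw [D.rho_A hk h, adjK_torus]

theorem A_mem_range (D : IsotropyData H Γ ρ U A) {η : LieK} (hη : U η = 0) {v : E7}
    (hv : v ∈ LinearMap.range U.toLinearMap) : A η v ∈ LinearMap.range U.toLinearMap := by
  obtain ⟨ξ, rfl⟩ := hv
  refine apply_mem_of_exp_apply_mem fun r => ?_
  rw [← D.exp_smul hη]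
  exact ⟨_, (D.map_U _ (D.expK_smul_mem hη r) ξ).symm⟩

theorem rho_mem_range (D : IsotropyData H Γ ρ U A) {k : T2SU2} (hk : k ∈ H) {v : E7}
    (hv : v ∈ LinearMap.range U.toLinearMap) : ρ k v ∈ LinearMap.range U.toLinearMap := by
  obtain ⟨ξ, rfl⟩ := hv
  exact ⟨_, (D.map_U _ hk ξ).symm⟩

theorem rho_mem_orthogonal (D : IsotropyData H Γ ρ U A) {k : T2SU2} (hk : k ∈ H)
    {F : Submodule ℝ E7} (hF : ∀ k ∈ H, ∀ v ∈ F, ρ k v ∈ F) {v : E7} (hv : v ∈ Fᗮ) :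
    ρ k v ∈ Fᗮ := by
  rw [Submodule.mem_orthogonal']
  intro f hf
  have h1 : ρ k (ρ k⁻¹ f) = f := by
    rw [← D.map_mul k hk _ (H.inv_mem hk), mul_inv_cancel, D.map_one]; rfl
  rw [← h1, (D.isG2 k hk).inner]
  exact inner_eq_zero_of_mem' (hF _ (H.inv_mem hk) f hf) hv

end IsotropyData

/-- The projection of the Lie algebra of `T² × SU(2)` to `𝔰𝔲(2)`. -/
def su2Proj : LieK →ₗ[ℝ] E3 := LinearMap.snd ℝ ℝ E3 ∘ₗ LinearMap.snd ℝ ℝ (ℝ × E3)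

theorem finrank_map_su2Proj_add (h : Submodule ℝ LieK) :
    finrank ℝ (h.map su2Proj) + finrank ℝ (LinearMap.ker (su2Proj.domRestrict h)) =
      finrank ℝ h := by
  rw [← LinearMap.range_domRestrict, LinearMap.finrank_range_add_finrank_ker]

theorem eq_torus_of_su2Proj_eq_zero {ξ : LieK} (h : su2Proj ξ = 0) : ξ = (ξ.1, ξ.2.1, 0) :=
  Prod.ext rfl (Prod.ext rfl h)

/-! ### Possible dimensions of the stabilizer -/

namespace IsotropyData

variable {H Γ : Subgroup T2SU2} {ρ : T2SU2 → E7 →L[ℝ] E7} {U : LieK →L[ℝ] E7}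
  {A : LieK →L[ℝ] E7 →L[ℝ] E7}

theorem su2_le (D : IsotropyData H Γ ρ U A)
    (h2 : 2 ≤ finrank ℝ ((LinearMap.ker U.toLinearMap).map su2Proj)) (X : E3) :
    U (0, 0, X) = 0 :=
  su2_le_of_two_le (h := LinearMap.ker U.toLinearMap)
    (fun _ hξ _ hη s => D.map_adj_eq_zero (D.expK_smul_mem hξ s) hη) h2 X

theorem map_su2Proj_eq_top (h : ∀ X, U (0, 0, X) = 0) :
    (LinearMap.ker U.toLinearMap).map su2Proj = ⊤ :=
  top_unique fun X _ => ⟨(0, 0, X), h X, rfl⟩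

theorem finrank_ker_add (U : LieK →L[ℝ] E7) : finrank ℝ (LinearMap.ker U.toLinearMap) +
    finrank ℝ (LinearMap.range U.toLinearMap) = 5 := by
  rw [add_comm, LinearMap.finrank_range_add_finrank_ker]
  simp

/-- The stabilizer algebra meets the torus algebra trivially and so embeds in 𝔰𝔲(2). A projection of
dimension at least two forces it to contain all of 𝔰𝔲(2), which excludes dimension two. -/
theorem finrank_ker_of_torus_injective (D : IsotropyData H Γ ρ U A)
    (h : ∀ s t : ℝ, U (s, t, 0) = 0 → s = 0 ∧ t = 0) :
    finrank ℝ (LinearMap.ker U.toLinearMap) = 0 ∨ finrank ℝ (LinearMap.ker U.toLinearMap) = 1 ∨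
      (finrank ℝ (LinearMap.ker U.toLinearMap) = 3 ∧ ∀ X, U (0, 0, X) = 0) := by
  have h1 := finrank_map_su2Proj_add (LinearMap.ker U.toLinearMap)
  have h2 : LinearMap.ker (su2Proj.domRestrict (LinearMap.ker U.toLinearMap)) = ⊥ := by
    rw [LinearMap.ker_eq_bot']
    rintro ⟨ξ, hξ⟩ h0
    have h3 := eq_torus_of_su2Proj_eq_zero (ξ := ξ) h0
    have h4 : U ξ = 0 := hξ
    rw [h3] at h4
    obtain ⟨h5, h6⟩ := h _ _ h4
    apply Subtype.ext
    change ξ = 0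
    rw [h3, h5, h6]; rfl
  rw [h2, finrank_bot, add_zero] at h1
  by_cases hq : 2 ≤ finrank ℝ ((LinearMap.ker U.toLinearMap).map su2Proj)
  · have h3 := D.su2_le hq
    rw [map_su2Proj_eq_top h3, finrank_top, finrank_euclideanSpace, Fintype.card_fin] at h1
    exact Or.inr (Or.inr ⟨h1.symm, h3⟩)
  · omega

/-- The torus does not fix a point. -/
theorem torus_ne_zero (D : IsotropyData H Γ ρ U A) (h : ∀ s t : ℝ, U (s, t, 0) = 0) : False := by
  have hd1 := D.isDer (h 1 0)
  have hd2 := D.isDer (h 0 1)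
  have h5 := finrank_ker_add U
  -- On an orbit of dimension at least two, the two torus derivations commute and share two
  -- independent zeros, hence are dependent, against faithfulness.
  by_cases h2 : 2 ≤ finrank ℝ (LinearMap.range U.toLinearMap)
  · obtain ⟨s, t, hst, h0⟩ := hd1.dependent_of_commute hd2 (D.torus_comm (h 1 0) (h 0 1)) h2
      (by rintro _ ⟨ξ, rfl⟩; exact D.torus_A_U (h 1 0) ξ)
      (by rintro _ ⟨ξ, rfl⟩; exact D.torus_A_U (h 0 1) ξ)
    rw [← map_smul, ← map_smul, ← map_add] at h0
    have e : s • ((1, 0, 0) : LieK) + t • ((0, 1, 0) : LieK) = (s, t, 0) := by simp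
    rw [e] at h0
    have h6 := D.injective _ (h s t) h0
    simp only [Prod.mk_eq_zero] at h6
    tauto
  -- Otherwise the stabilizer algebra has dimension at least four, at most two of which come from
  -- the torus. It contains 𝔰𝔲(2), and one element of that gives a third commuting derivation.
  · have h1 := finrank_map_su2Proj_add (LinearMap.ker U.toLinearMap)
    have h3 : finrank ℝ (LinearMap.ker (su2Proj.domRestrict (LinearMap.ker U.toLinearMap))) ≤ 2 := by
      let f : LinearMap.ker (su2Proj.domRestrict (LinearMap.ker U.toLinearMap)) →ₗ[ℝ] ℝ × ℝ :=
        (LinearMap.prod (LinearMap.fst ℝ ℝ (ℝ × E3))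
          (LinearMap.fst ℝ ℝ E3 ∘ₗ LinearMap.snd ℝ ℝ (ℝ × E3))) ∘ₗ
          (LinearMap.ker U.toLinearMap).subtype ∘ₗ Submodule.subtype _
      have hf : Function.Injective f := by
        rw [injective_iff_map_eq_zero]
        rintro ⟨⟨ξ, hξ⟩, h0⟩ h4
        have h5 := eq_torus_of_su2Proj_eq_zero (ξ := ξ) h0
        have h6 : (ξ.1, ξ.2.1) = ((0, 0) : ℝ × ℝ) := h4
        rw [Prod.mk.injEq] at h6
        apply Subtype.ext
        apply Subtype.ext
        change ξ = 0
        rw [h5, h6.1, h6.2]; rfl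
      have := LinearMap.finrank_le_finrank_of_injective hf
      simpa using this
    have hs := D.su2_le (by omega)
    let e0 : E3 := EuclideanSpace.single 0 1
    obtain ⟨r, s, t, hrst, h0⟩ := hd1.dependent_of_three_commute hd2 (D.isDer (hs e0))
      (D.torus_comm (h 1 0) (h 0 1)) (D.torus_comm (h 1 0) (hs e0)) (D.torus_comm (h 0 1) (hs e0))
    rw [← map_smul, ← map_smul, ← map_smul, ← map_add, ← map_add] at h0
    have e : r • ((1, 0, 0) : LieK) + s • ((0, 1, 0) : LieK) + t • ((0, 0, e0) : LieK) =
        (r, s, t • e0) := by simp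
    rw [e] at h0
    have e2 : U (r, s, t • e0) = 0 := by
      rw [← e, map_add, map_add, map_smul, map_smul, map_smul, h, h, hs]; simp
    have h6 := D.injective _ e2 h0
    simp [e0] at h6
    tauto

theorem torus_perp_ne_zero (D : IsotropyData H Γ ρ U A) {s₀ t₀ : ℝ} (hne : s₀ ≠ 0 ∨ t₀ ≠ 0)
    (hc : U (s₀, t₀, 0) = 0) : U (-t₀, s₀, 0) ≠ 0 := by
  intro h
  have hn : s₀ ^ 2 + t₀ ^ 2 ≠ 0 := by
    rcases hne with h | h <;> positivity
  refine D.torus_ne_zero fun s t => ?_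
  have e : ((s, t, 0) : LieK) = ((s * s₀ + t * t₀) / (s₀ ^ 2 + t₀ ^ 2)) • (s₀, t₀, 0) +
      ((t * s₀ - s * t₀) / (s₀ ^ 2 + t₀ ^ 2)) • (-t₀, s₀, 0) := by
    refine Prod.ext ?_ (Prod.ext ?_ ?_)
    · simp; field_simp; ring
    · simp; field_simp; ring
    · simp
  rw [e, map_add, map_smul, map_smul, hc, h, smul_zero, smul_zero, add_zero]

theorem torus_eq_smul (D : IsotropyData H Γ ρ U A) {s₀ t₀ : ℝ} (hne : s₀ ≠ 0 ∨ t₀ ≠ 0)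
    (hc : U (s₀, t₀, 0) = 0) {s t : ℝ} (h : U (s, t, 0) = 0) :
    ∃ r : ℝ, ((s, t, 0) : LieK) = r • (s₀, t₀, 0) := by
  have hn : s₀ ^ 2 + t₀ ^ 2 ≠ 0 := by
    rcases hne with h | h <;> positivity
  have e : ((s, t, 0) : LieK) = ((s * s₀ + t * t₀) / (s₀ ^ 2 + t₀ ^ 2)) • (s₀, t₀, 0) +
      ((t * s₀ - s * t₀) / (s₀ ^ 2 + t₀ ^ 2)) • (-t₀, s₀, 0) := by
    refine Prod.ext ?_ (Prod.ext ?_ ?_)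
    · simp; field_simp; ring
    · simp; field_simp; ring
    · simp
  have h2 := h
  rw [e, map_add, map_smul, map_smul, hc, smul_zero, zero_add] at h2
  rcases smul_eq_zero.mp h2 with h3 | h3
  · rw [h3, zero_smul, add_zero] at e
    exact ⟨_, e⟩
  · exact absurd h3 (D.torus_perp_ne_zero hne hc)

/-- The stabilizer algebra meets the torus algebra in exactly a line, and its projection to 𝔰𝔲(2)
has dimension 0, 1 or 3. Dimension 0 would mean a four-dimensional orbit on whose tangent space the
singular torus derivation vanishes, so that derivation would be zero. -/
theorem finrank_ker_of_torus_singular (D : IsotropyData H Γ ρ U A) {s₀ t₀ : ℝ}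
    (hne : s₀ ≠ 0 ∨ t₀ ≠ 0) (hc : U (s₀, t₀, 0) = 0) :
    (finrank ℝ (LinearMap.ker U.toLinearMap) = 2 ∧
      ∃ η : LieK, U η = 0 ∧ η.2.2 ≠ 0 ∧ ∀ ζ, U ζ = 0 → ∃ r : ℝ, ζ.2.2 = r • η.2.2) ∨
      (finrank ℝ (LinearMap.ker U.toLinearMap) = 4 ∧ ∀ X, U (0, 0, X) = 0) := by
  have h1 := finrank_map_su2Proj_add (LinearMap.ker U.toLinearMap)
  have hc0 : ((s₀, t₀, 0) : LieK) ≠ 0 := by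
    intro h
    simp only [Prod.mk_eq_zero] at h
    tauto
  have h2 : finrank ℝ (LinearMap.ker (su2Proj.domRestrict (LinearMap.ker U.toLinearMap))) = 1 := by
    refine finrank_eq_one
      (⟨⟨(s₀, t₀, 0), hc⟩, rfl⟩ : LinearMap.ker (su2Proj.domRestrict (LinearMap.ker U.toLinearMap)))
      ?_ ?_
    · intro h
      exact hc0 (congrArg (fun v => ((v : LinearMap.ker U.toLinearMap) : LieK)) (congrArg Subtype.val h))
    · rintro ⟨⟨ξ, hξ⟩, h0⟩
      have h3 := eq_torus_of_su2Proj_eq_zero (ξ := ξ) h0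
      have h4 : U ξ = 0 := hξ
      rw [h3] at h4
      obtain ⟨r, hr⟩ := D.torus_eq_smul hne hc h4
      refine ⟨r, Subtype.ext (Subtype.ext ?_)⟩
      exact (h3.trans hr).symm
  by_cases hq : 2 ≤ finrank ℝ ((LinearMap.ker U.toLinearMap).map su2Proj)
  · have h3 := D.su2_le hq
    rw [map_su2Proj_eq_top h3, finrank_top, finrank_euclideanSpace, Fintype.card_fin] at h1
    exact Or.inr ⟨by omega, h3⟩
  · left
    have hq0 : finrank ℝ ((LinearMap.ker U.toLinearMap).map su2Proj) ≠ 0 := by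
      intro h0
      have h5 := finrank_ker_add U
      exact hc0 (D.injective _ hc ((D.isDer hc).eq_zero_of_finrank
        (F := LinearMap.range U.toLinearMap) (by rintro _ ⟨ξ, rfl⟩; exact D.torus_A_U hc ξ)
        (by omega)))
    refine ⟨by omega, ?_⟩
    have h6 : finrank ℝ ((LinearMap.ker U.toLinearMap).map su2Proj) = 1 := by omega
    obtain ⟨⟨X, η, hη, hX⟩, hX0, hall⟩ := finrank_eq_one_iff'.mp h6
    have hX' : η.2.2 = X := hX
    refine ⟨η, hη, ?_, fun ζ hζ => ?_⟩
    · rw [hX']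
      intro h
      exact hX0 (Subtype.ext h)
    · obtain ⟨r, hr⟩ := hall ⟨ζ.2.2, ζ, hζ, rfl⟩
      refine ⟨r, ?_⟩
      rw [hX']
      exact (congrArg Subtype.val hr).symm

/-- A cross product is orthogonal to its factors, here the torus directions. Orthogonality to the
𝔰𝔲(2) directions is the relation obtained from closedness of the form. -/
theorem cross_mem_orthogonal_range (D : IsotropyData H Γ ρ U A) (a b c d : ℝ) :
    cross (U (a, b, 0)) (U (c, d, 0)) ∈ (LinearMap.range U.toLinearMap)ᗮ := by
  have e (s t : ℝ) : U (s, t, 0) = s • U (1, 0, 0) + t • U (0, 1, 0) := by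
    rw [← map_smul, ← map_smul, ← map_add]; simp
  have e1 : cross (U (a, b, 0)) (U (c, d, 0)) =
      (a * d - b * c) • cross (U (1, 0, 0)) (U (0, 1, 0)) := by
    rw [e a b, e c d]
    simp only [map_add, map_smul, LinearMap.add_apply, LinearMap.smul_apply, cross_self]
    rw [cross_anticomm (U (0, 1, 0)) (U (1, 0, 0))]
    module
  rw [e1, Submodule.mem_orthogonal']
  rintro _ ⟨ξ, rfl⟩
  change inner ℝ _ (U ξ) = 0
  have e2 : U ξ = ξ.1 • U (1, 0, 0) + ξ.2.1 • U (0, 1, 0) + U (0, 0, ξ.2.2) := by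
    rw [← map_smul, ← map_smul, ← map_add, ← map_add]; simp
  rw [e2, inner_smul_left, inner_add_right, inner_add_right, inner_smul_right, inner_smul_right,
    D.orthogonal, inner_cross_left_self, inner_cross_right_self]
  simp

/-- An orthonormal basis of the tangent space of a nonsingular torus orbit. -/
theorem exists_torus_frame (D : IsotropyData H Γ ρ U A)
    (h : ∀ s t : ℝ, U (s, t, 0) = 0 → s = 0 ∧ t = 0) :
    ∃ u₁ u₂ : E7, ‖u₁‖ = 1 ∧ ‖u₂‖ = 1 ∧ (inner ℝ u₁ u₂ : ℝ) = 0 ∧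
      (∃ a b : ℝ, U (a, b, 0) = u₁) ∧ (∃ c d : ℝ, U (c, d, 0) = u₂) ∧
      cross u₁ u₂ ∈ (LinearMap.range U.toLinearMap)ᗮ ∧
      (∀ s t, U (s, t, 0) ∈ assocSpan u₁ u₂) ∧
      (∀ k ∈ H, ∀ v ∈ assocSpan u₁ u₂, ρ k v = v) ∧
      (∀ η, U η = 0 → ∀ v ∈ assocSpan u₁ u₂, A η v = 0) := by
  let T : ℝ × ℝ →ₗ[ℝ] E7 := U.toLinearMap ∘ₗ LinearMap.prod (LinearMap.fst ℝ ℝ ℝ)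
    (LinearMap.inl ℝ ℝ E3 ∘ₗ LinearMap.snd ℝ ℝ ℝ)
  have hT (s t : ℝ) : T (s, t) = U (s, t, 0) := rfl
  have hTinj : Function.Injective T := (injective_iff_map_eq_zero T).mpr fun p hp => by
    obtain ⟨h1, h2⟩ := h p.1 p.2 hp
    exact Prod.ext h1 h2
  have hr : finrank ℝ (LinearMap.range T) = 2 := by
    rw [LinearMap.finrank_range_of_inj hTinj]; simp
  obtain ⟨_, ⟨⟨a, b⟩, rfl⟩, _, ⟨⟨c, d⟩, rfl⟩, n1, n2, h12⟩ := exists_orthonormal_pair hr.ge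
  rw [hT] at n1 n2 h12
  rw [hT] at h12
  refine ⟨_, _, n1, n2, h12, ⟨_, _, rfl⟩, ⟨_, _, rfl⟩, D.cross_mem_orthogonal_range a b c d, ?_, ?_, ?_⟩
  · intro s t
    -- Orthonormality of the images makes the coefficient vectors independent; Cramer's rule then
    -- expresses every torus direction through the chosen pair.
    have hne : a * d - b * c ≠ 0 := by
      intro h0
      have e1 : d • U (a, b, 0) - b • U (c, d, 0) = 0 := by
        rw [← map_smul, ← map_smul, ← map_sub]
        have : d • ((a, b, 0) : LieK) - b • ((c, d, 0) : LieK) = (a * d - b * c, 0, 0) := by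
          refine Prod.ext ?_ (Prod.ext ?_ ?_) <;> simp <;> ring
        rw [this, h0]
        exact map_zero U
      have i1 := congrArg (inner ℝ (U (a, b, 0))) e1
      have i2 := congrArg (inner ℝ (U (c, d, 0))) e1
      have h21 : (inner ℝ (U (c, d, 0)) (U (a, b, 0)) : ℝ) = 0 := by rw [real_inner_comm, h12]
      rw [inner_sub_right, inner_smul_right, inner_smul_right, h12, inner_self_of_norm_one n1,
        inner_zero_right] at i1
      rw [inner_sub_right, inner_smul_right, inner_smul_right, h21, inner_self_of_norm_one n2,
        inner_zero_right] at i2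
      have hd : d = 0 := by linarith
      have hb : b = 0 := by linarith
      subst hd hb
      have e3 : U (a, 0, 0) = a • U (1, 0, 0) := by rw [← map_smul]; simp
      have e4 : U (c, 0, 0) = c • U (1, 0, 0) := by rw [← map_smul]; simp
      rw [e3, e4, inner_smul_left, inner_smul_right] at h12
      rcases mul_eq_zero.mp h12 with h5 | h5
      · rw [e3, show a = 0 from h5, zero_smul, norm_zero] at n1
        exact zero_ne_one n1
      · rcases mul_eq_zero.mp h5 with h6 | h6
        · rw [e4, h6, zero_smul, norm_zero] at n2
          exact zero_ne_one n2
        · rw [e3, inner_self_eq_zero.mp h6, smul_zero, norm_zero] at n1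
          exact zero_ne_one n1
    have e : U (s, t, 0) = ((s * d - t * c) / (a * d - b * c)) • U (a, b, 0) +
        ((a * t - b * s) / (a * d - b * c)) • U (c, d, 0) := by
      rw [← map_smul, ← map_smul, ← map_add]
      congr 1
      refine Prod.ext ?_ (Prod.ext ?_ ?_)
      · simp only [Prod.fst_add, Prod.smul_fst, smul_eq_mul]
        rw [div_mul_eq_mul_div, div_mul_eq_mul_div, ← add_div, eq_div_iff hne]; ring
      · simp only [Prod.fst_add, Prod.smul_fst, Prod.snd_add, Prod.smul_snd, smul_eq_mul]
        rw [div_mul_eq_mul_div, div_mul_eq_mul_div, ← add_div, eq_div_iff hne]; ring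
      · simp
    rw [e]
    exact Submodule.add_mem _ (Submodule.smul_mem _ _ (left_mem_assocSpan _ _))
      (Submodule.smul_mem _ _ (right_mem_assocSpan _ _))
  · intro k hk v hv
    obtain ⟨x, y, z, rfl⟩ := mem_assocSpan.mp hv
    simp only [map_add, map_smul, (D.isG2 k hk).map_cross, D.rho_torus hk]
  · intro η hη v hv
    obtain ⟨x, y, z, rfl⟩ := mem_assocSpan.mp hv
    simp only [map_add, map_smul, (D.isDer hη).map_cross, D.A_apply_torus hη]
    simp

/-- The associative plane of the torus directions is fixed pointwise. The axis of the rotation `Ad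
k` supplies one more fixed vector, tangent to the orbit and outside that plane. -/
theorem rho_eq_id_of_injective (D : IsotropyData H Γ ρ U A) (h : ∀ ξ, U ξ = 0 → ξ = 0)
    {k : T2SU2} (hk : k ∈ H) : ρ k = ContinuousLinearMap.id ℝ E7 := by
  obtain ⟨u₁, u₂, n1, n2, h12, ⟨a, b, hab⟩, ⟨c, d, hcd⟩, ho, -, hfix, -⟩ := D.exists_torus_frame fun s t hst => by
    simpa only [Prod.mk_eq_zero, and_true] using h _ hst
  obtain ⟨X, hX0, hX⟩ := exists_adjSU2_eq_self k.2.2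
  have hUX : ρ k (U (0, 0, X)) = U (0, 0, X) := by
    rw [D.map_U k hk, adjK_apply]
    exact congrArg (fun Y => U (0, 0, Y)) hX
  refine (D.isG2 k hk).ext_of_assoc isG2_id (finrank_assocSpan n1 n2 h12) (hfix k hk)
    (w := U (0, 0, X)) (fun hmem => ?_) hUX
  obtain ⟨x, y, z, e⟩ := mem_assocSpan.mp hmem
  -- The vector `cross u₁ u₂` is normal to the orbit, so it does not contribute to a tangent vector.
  have hz : z = 0 := by
    have h1 := inner_eq_zero_of_mem (⟨_, rfl⟩ : U (0, 0, X) ∈ LinearMap.range U.toLinearMap) ho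
    rw [e, inner_add_left, inner_add_left, inner_smul_left, inner_smul_left, inner_smul_left,
      inner_self_of_norm_one ((norm_cross n1 h12).trans n2)] at h1
    rw [real_inner_comm, inner_cross_left_self, real_inner_comm, inner_cross_right_self] at h1
    simpa using h1
  rw [hz, zero_smul, add_zero, ← hab, ← hcd, ← map_smul, ← map_smul, ← map_add, ← sub_eq_zero,
    ← map_sub] at e
  have e2 := congrArg (fun ξ : LieK => ξ.2.2) (h _ e)
  simp at e2
  exact hX0 e2

theorem mem_orthogonal_assocSpan {u v w : E7} (h1 : (inner ℝ u w : ℝ) = 0)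
    (h2 : (inner ℝ v w : ℝ) = 0) (h3 : (inner ℝ (cross u v) w : ℝ) = 0) :
    w ∈ (assocSpan u v)ᗮ := by
  rw [Submodule.mem_orthogonal]
  intro x hx
  obtain ⟨a, b, c, rfl⟩ := mem_assocSpan.mp hx
  simp [inner_add_left, inner_smul_left, h1, h2, h3]

end IsotropyData

/-! ### Real and complex frames -/

theorem norm_sq_linearCombination {ι : Type*} [Fintype ι] {v : ι → E7} (ho : Orthonormal ℝ v)
    (c : ι → ℝ) : ‖∑ i, c i • v i‖ ^ 2 = ∑ i, c i ^ 2 := by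
  rw [← real_inner_self_eq_norm_sq, ho.inner_sum]
  simp [sq]

theorem eq_sum_of_orthonormal {ι : Type*} [Fintype ι] {v : ι → E7} (ho : Orthonormal ℝ v)
    {W : Submodule ℝ E7} (hv : ∀ i, v i ∈ W) (hcard : finrank ℝ W = Fintype.card ι) {x : E7}
    (hx : x ∈ W) : ∃ c : ι → ℝ, ∑ i, c i • v i = x := by
  have hle : Submodule.span ℝ (Set.range v) ≤ W := by
    rw [Submodule.span_le]
    rintro _ ⟨i, rfl⟩
    exact hv i
  have heq := Submodule.eq_of_le_of_finrank_eq hle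
    ((finrank_span_eq_card ho.linearIndependent).trans hcard.symm)
  rw [← heq] at hx
  exact Submodule.mem_span_range_iff_exists_fun ℝ |>.mp hx

/-- The linear map `ℝ² → ℝ⁷` with the given values on the basis. -/
def rframe (w₁ w₂ : E7) : EuclideanSpace ℝ (Fin 2) →ₗ[ℝ] E7 where
  toFun a := a 0 • w₁ + a 1 • w₂
  map_add' a b := by simp only [PiLp.add_apply]; module
  map_smul' c a := by simp only [PiLp.smul_apply, smul_eq_mul, RingHom.id_apply]; module

theorem rframe_apply (w₁ w₂ : E7) (a : EuclideanSpace ℝ (Fin 2)) :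
    rframe w₁ w₂ a = a 0 • w₁ + a 1 • w₂ := rfl

theorem orthonormal_pair {w₁ w₂ : E7} (n1 : ‖w₁‖ = 1) (n2 : ‖w₂‖ = 1)
    (h12 : (inner ℝ w₁ w₂ : ℝ) = 0) : Orthonormal ℝ ![w₁, w₂] := by
  rw [orthonormal_iff_ite]
  have h21 : (inner ℝ w₂ w₁ : ℝ) = 0 := by rw [real_inner_comm, h12]
  intro i j
  fin_cases i <;> fin_cases j <;>
    simp [h12, h21, n1, n2]

theorem norm_rframe {w₁ w₂ : E7} (n1 : ‖w₁‖ = 1) (n2 : ‖w₂‖ = 1)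
    (h12 : (inner ℝ w₁ w₂ : ℝ) = 0) (a : EuclideanSpace ℝ (Fin 2)) :
    ‖rframe w₁ w₂ a‖ = ‖a‖ := by
  have h := norm_sq_linearCombination (orthonormal_pair n1 n2 h12) a
  rw [Fin.sum_univ_two, ← EuclideanSpace.real_norm_sq_eq] at h
  exact (pow_left_inj₀ (norm_nonneg _) (norm_nonneg _) two_ne_zero).mp h

theorem range_rframe {w₁ w₂ : E7} (n1 : ‖w₁‖ = 1) (n2 : ‖w₂‖ = 1)
    (h12 : (inner ℝ w₁ w₂ : ℝ) = 0) {W : Submodule ℝ E7} (h1 : w₁ ∈ W) (h2 : w₂ ∈ W)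
    (hW : finrank ℝ W = 2) : LinearMap.range (rframe w₁ w₂) = W := by
  apply le_antisymm
  · rintro _ ⟨a, rfl⟩
    exact W.add_mem (W.smul_mem _ h1) (W.smul_mem _ h2)
  · intro x hx
    obtain ⟨c, rfl⟩ := eq_sum_of_orthonormal (orthonormal_pair n1 n2 h12) (W := W)
      (fun i => by fin_cases i; exacts [h1, h2]) (by simpa using hW) hx
    exact ⟨WithLp.toLp 2 c, by rw [Fin.sum_univ_two]; rfl⟩

theorem exists_cos_sin {c s : ℝ} (h : c ^ 2 + s ^ 2 = 1) :
    ∃ α : ℝ, c = Real.cos α ∧ s = Real.sin α := by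
  let z : ℂ := ⟨c, s⟩
  have hz : ‖z‖ = 1 := by
    rw [← sq_eq_sq₀ (norm_nonneg _) zero_le_one, Complex.sq_norm, Complex.normSq_mk]; nlinarith
  have hz0 : z ≠ 0 := by intro h0; rw [h0, norm_zero] at hz; exact zero_ne_one hz
  refine ⟨Complex.arg z, ?_, ?_⟩
  · rw [Complex.cos_arg hz0, hz, div_one]
  · rw [Complex.sin_arg, hz, div_one]

/-- The rotation of the plane by the angle `α`. -/
def rotation (α : ℝ) : Matrix.specialOrthogonalGroup (Fin 2) ℝ :=
  ⟨!![Real.cos α, -Real.sin α; Real.sin α, Real.cos α],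
    Matrix.of_mem_specialOrthogonalGroup_fin_two_iff.mpr
      ⟨rfl, by simp, by rw [neg_sq]; exact Real.cos_sq_add_sin_sq α⟩⟩

theorem exists_rotation (S : Matrix.specialOrthogonalGroup (Fin 2) ℝ) : ∃ α, S = rotation α := by
  obtain ⟨S, hS⟩ := S
  have e : S = !![S 0 0, S 0 1; S 1 0, S 1 1] := Matrix.eta_fin_two S
  rw [e] at hS
  have h := Matrix.of_mem_specialOrthogonalGroup_fin_two_iff.mp hS
  obtain ⟨α, h1, h2⟩ := exists_cos_sin (c := S 0 0) (s := S 1 0) (by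
    have h3 := h.2.2
    rwa [h.2.1, neg_sq] at h3)
  refine ⟨α, Subtype.ext (e.trans ?_)⟩
  rw [h.2.1, ← h.1, h1, h2]; rfl

/-! ### One-dimensional stabilizers -/

namespace IsotropyData

variable {H Γ : Subgroup T2SU2} {ρ : T2SU2 → E7 →L[ℝ] E7} {U : LieK →L[ℝ] E7}
  {A : LieK →L[ℝ] E7 →L[ℝ] E7}

theorem finrank_orthogonal_range (U : LieK →L[ℝ] E7) :
    finrank ℝ ↥(LinearMap.range U.toLinearMap)ᗮ = 2 + finrank ℝ (LinearMap.ker U.toLinearMap) := by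
  have h1 := finrank_ker_add U
  have h2 := finrank_orthogonal_E7 (LinearMap.range U.toLinearMap)
  omega

/-- A torus element fixes the tangent space of the orbit pointwise, and that space has dimension
four. -/
theorem rho_eq_id_of_forall_range (D : IsotropyData H Γ ρ U A)
    (h1 : finrank ℝ (LinearMap.ker U.toLinearMap) = 1) {k : T2SU2} (hk : k ∈ H)
    (hk1 : k.2.2 = 1) : ρ k = ContinuousLinearMap.id ℝ E7 := by
  have h5 := finrank_ker_add U
  refine (D.isG2 k hk).ext_of_finrank isG2_id (F := LinearMap.range U.toLinearMap) ?_ (by omega)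
  rintro _ ⟨ξ, rfl⟩
  exact (D.map_U k hk ξ).trans (congrArg U (adjK_eq_self hk1 ξ))

/-- The fixed normal vector is the cross product of the torus directions. On the remaining normal
plane the generator of the stabilizer is a nonzero infinitesimal rotation, so its exponentials give
all rotations. Conversely, every element of the stabilizer has the same differential as one of
these, because it agrees with it on the fixed associative plane and on one vector of the normal
plane. Hence the full stabilizer is captured, not only its identity component. -/
theorem exists_rotation_frame (D : IsotropyData H Γ ρ U A)
    (h : ∀ s t : ℝ, U (s, t, 0) = 0 → s = 0 ∧ t = 0)
    (h1 : finrank ℝ (LinearMap.ker U.toLinearMap) = 1) :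
    ∃ (u : E7) (e : EuclideanSpace ℝ (Fin 2) →ₗ[ℝ] E7), ‖u‖ = 1 ∧
      (ℝ ∙ u) ⊔ LinearMap.range e = (LinearMap.range U.toLinearMap)ᗮ ∧
      (∀ a, (inner ℝ u (e a) : ℝ) = 0) ∧ (∀ a, ‖e a‖ = ‖a‖) ∧ (∀ k ∈ H, ρ k u = u) ∧
      (∀ S : Matrix.specialOrthogonalGroup (Fin 2) ℝ, ∃ k ∈ H,
        ∀ a, ρ k (e a) = e (WithLp.toLp 2 (S.1 *ᵥ a.ofLp))) ∧
      (∀ k ∈ H, ∃ S : Matrix.specialOrthogonalGroup (Fin 2) ℝ,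
        ∀ a, ρ k (e a) = e (WithLp.toLp 2 (S.1 *ᵥ a.ofLp))) ∧
      (∀ k ∈ H, (∀ a, ρ k (e a) = e a) → ρ k = ContinuousLinearMap.id ℝ E7) := by
  obtain ⟨u₁, u₂, n1, n2, h12, ⟨a, b, hab⟩, ⟨c, d, hcd⟩, ho, -, hfix, hkill⟩ := D.exists_torus_frame h
  set u := cross u₁ u₂
  have nu : ‖u‖ = 1 := (norm_cross n1 h12).trans n2
  have hu0 : u ≠ 0 := by intro h0; rw [h0, norm_zero] at nu; exact zero_ne_one nu
  have h3 := finrank_assocSpan n1 n2 h12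
  have hspan : (ℝ ∙ u) ≤ (LinearMap.range U.toLinearMap)ᗮ :=
    (Submodule.span_singleton_le_iff_mem _ _).mpr ho
  set N₂ := (ℝ ∙ u)ᗮ ⊓ (LinearMap.range U.toLinearMap)ᗮ with hN₂
  have hN2 : finrank ℝ N₂ = 2 := by
    have h4 := Submodule.finrank_add_inf_finrank_orthogonal hspan
    rw [finrank_span_singleton (K := ℝ) hu0, finrank_orthogonal_range, h1] at h4
    change 1 + finrank ℝ N₂ = 3 at h4
    omega
  have hmemF {w : E7} (hw : w ∈ N₂) : w ∈ (assocSpan u₁ u₂)ᗮ := by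
    refine mem_orthogonal_assocSpan ?_ ?_ ?_
    · rw [← hab]; exact inner_eq_zero_of_mem (LinearMap.mem_range_self U.toLinearMap _) hw.2
    · rw [← hcd]; exact inner_eq_zero_of_mem (LinearMap.mem_range_self U.toLinearMap _) hw.2
    · exact inner_eq_zero_of_mem (Submodule.mem_span_singleton_self u) hw.1
  obtain ⟨η, hη0, hηall⟩ := finrank_eq_one_iff'.mp h1
  obtain ⟨η, hη⟩ := η
  have hη' : U η = 0 := hη
  have hB := D.isDer hη'
  have hukill : A η u = 0 := hkill η hη' u (cross_mem_assocSpan _ _)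
  have hufix (k : T2SU2) (hk : k ∈ H) : ρ k u = u := hfix k hk u (cross_mem_assocSpan _ _)
  have hBN {w : E7} (hw : w ∈ N₂) : A η w ∈ N₂ := by
    refine ⟨hB.mem_orthogonal ?_ hw.1, hB.mem_orthogonal (fun v hv => D.A_mem_range hη' hv) hw.2⟩
    intro v hv
    obtain ⟨r, rfl⟩ := Submodule.mem_span_singleton.mp hv
    rw [map_smul, hukill, smul_zero]
    exact Submodule.zero_mem _
  have hρN {k : T2SU2} (hk : k ∈ H) {w : E7} (hw : w ∈ N₂) : ρ k w ∈ N₂ := by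
    refine ⟨D.rho_mem_orthogonal hk ?_ hw.1,
      D.rho_mem_orthogonal hk (fun k hk v hv => D.rho_mem_range hk hv) hw.2⟩
    intro k hk v hv
    obtain ⟨r, rfl⟩ := Submodule.mem_span_singleton.mp hv
    rw [map_smul, hufix k hk]
    exact hv
  obtain ⟨w₁, hw1, w₂, hw2, m1, m2, hw12⟩ := exists_orthonormal_pair hN2.ge
  have hw21 : (inner ℝ w₂ w₁ : ℝ) = 0 := by rw [real_inner_comm, hw12]
  have i1 := inner_self_of_norm_one m1
  have i2 := inner_self_of_norm_one m2
  have hw10 : w₁ ≠ 0 := by rintro rfl; simp at m1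
  have hw1F : w₁ ∉ assocSpan u₁ u₂ := not_mem_of_mem_orthogonal (hmemF hw1) hw10
  have hex {w : E7} (hw : w ∈ N₂) : ∃ x y : ℝ, w = x • w₁ + y • w₂ := by
    have h5 : w ∈ LinearMap.range (rframe w₁ w₂) := by
      rw [range_rframe m1 m2 hw12 hw1 hw2 hN2]; exact hw
    obtain ⟨a, rfl⟩ := h5
    exact ⟨a 0, a 1, rfl⟩
  obtain ⟨x₁, θ, hBw1⟩ := hex (hBN hw1)
  obtain ⟨y₁, y₂, hBw2⟩ := hex (hBN hw2)
  have hx1 : x₁ = 0 := by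
    have := hB.inner_self w₁
    rw [hBw1, inner_add_left, inner_smul_left, inner_smul_left, i1, hw21] at this
    simpa using this
  have hy2 : y₂ = 0 := by
    have := hB.inner_self w₂
    rw [hBw2, inner_add_left, inner_smul_left, inner_smul_left, i2, hw12] at this
    simpa using this
  have hy1 : y₁ = -θ := by
    have := hB.skew w₁ w₂
    rw [hBw1, hBw2, inner_add_left, inner_add_right, inner_smul_left, inner_smul_left,
      inner_smul_right, inner_smul_right, i1, i2, hw12] at this
    simp at this
    linarith
  rw [hx1, zero_smul, zero_add] at hBw1
  rw [hy1, hy2, zero_smul, add_zero, neg_smul] at hBw2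
  -- For zero speed the generator would vanish on the associative plane and on `w₁`, hence
  -- everywhere.
  have hθ : θ ≠ 0 := by
    rintro rfl
    rw [zero_smul] at hBw1
    have h6 := hB.eq_zero_of_assoc h3 (hkill η hη') hw1F hBw1
    exact hη0 (Subtype.ext (D.injective η hη' h6))
  have hrot (α : ℝ) : ∃ k ∈ H, ρ k w₁ = Real.cos α • w₁ + Real.sin α • w₂ ∧
      ρ k w₂ = Real.cos α • w₂ - Real.sin α • w₁ := by
    refine ⟨expK ((α / θ) • η), D.expK_smul_mem hη' _, ?_, ?_⟩
    · rw [D.exp_smul hη', exp_apply_of_rotation (θ := α) (z := w₂)]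
      · rw [_root_.smul_apply, hBw1, smul_smul, div_mul_cancel₀ _ hθ]
      · rw [_root_.smul_apply, hBw2, smul_neg, smul_smul, div_mul_cancel₀ _ hθ]
    · rw [D.exp_smul hη', exp_apply_of_rotation (θ := α) (z := -w₁)]
      · module
      · rw [_root_.smul_apply, hBw2, smul_neg, smul_smul, div_mul_cancel₀ _ hθ, smul_neg]
      · rw [map_neg, _root_.smul_apply, hBw1, smul_smul, div_mul_cancel₀ _ hθ]
  have hact {k : T2SU2} {α : ℝ} (e1 : ρ k w₁ = Real.cos α • w₁ + Real.sin α • w₂)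
      (e2 : ρ k w₂ = Real.cos α • w₂ - Real.sin α • w₁) (a : EuclideanSpace ℝ (Fin 2)) :
      ρ k (rframe w₁ w₂ a) =
        rframe w₁ w₂ (WithLp.toLp 2 ((rotation α).1 *ᵥ a.ofLp)) := by
    rw [rframe_apply, rframe_apply, map_add, map_smul, map_smul, e1, e2]
    simp only [rotation, Matrix.mulVec, dotProduct, Fin.sum_univ_two, Matrix.of_apply,
      Matrix.cons_val', Matrix.cons_val_zero, Matrix.cons_val_one, Matrix.cons_val_fin_one]
    module
  refine ⟨u, rframe w₁ w₂, nu, ?_, ?_, norm_rframe m1 m2 hw12, hufix, ?_, ?_, ?_⟩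
  · rw [range_rframe m1 m2 hw12 hw1 hw2 hN2]
    exact Submodule.sup_orthogonal_inf_of_hasOrthogonalProjection hspan
  · intro a
    have h5 : rframe w₁ w₂ a ∈ N₂ := N₂.add_mem (N₂.smul_mem _ hw1) (N₂.smul_mem _ hw2)
    exact inner_eq_zero_of_mem (Submodule.mem_span_singleton_self u) h5.1
  · intro S
    obtain ⟨α, rfl⟩ := exists_rotation S
    obtain ⟨k, hk, e1, e2⟩ := hrot α
    exact ⟨k, hk, hact e1 e2⟩
  · intro k hk
    obtain ⟨x, y, hxy⟩ := hex (hρN hk hw1)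
    have hn : x ^ 2 + y ^ 2 = 1 := by
      have h5 := inner_self_of_norm_one (((D.isG2 k hk).norm w₁).trans m1)
      rw [hxy, inner_add_left, inner_add_right, inner_add_right] at h5
      simp only [inner_smul_left, inner_smul_right, i1, i2, hw12, hw21, conj_trivial] at h5
      linarith
    obtain ⟨α, rfl, rfl⟩ := exists_cos_sin hn
    obtain ⟨l, hl, e1, e2⟩ := hrot α
    have heq : ρ k = ρ l := (D.isG2 k hk).ext_of_assoc (D.isG2 l hl) h3
      (fun v hv => (hfix k hk v hv).trans (hfix l hl v hv).symm) hw1F (hxy.trans e1.symm)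
    exact ⟨rotation α, hact (by rw [heq, e1]) (by rw [heq, e2])⟩
  · intro k hk hall
    refine (D.isG2 k hk).ext_of_assoc isG2_id h3 (hfix k hk) hw1F ?_
    have := hall (EuclideanSpace.single 0 1)
    simpa [rframe_apply] using this

end IsotropyData

/-- Multiplication by a complex number for the complex structure `u ×` on `uᗮ`. -/
def cmul (u : E7) (z : ℂ) (v : E7) : E7 := z.re • v + z.im • cross u v

theorem cmul_def (u : E7) (z : ℂ) (v : E7) : cmul u z v = z.re • v + z.im • cross u v := rfl

theorem cmul_one (u v : E7) : cmul u 1 v = v := by simp [cmul_def]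

theorem cmul_zero (u v : E7) : cmul u 0 v = 0 := by simp [cmul_def]

theorem cmul_add (u : E7) (z w : ℂ) (v : E7) : cmul u (z + w) v = cmul u z v + cmul u w v := by
  simp only [cmul_def, Complex.add_re, Complex.add_im]; module

theorem cmul_vadd (u : E7) (z : ℂ) (v w : E7) : cmul u z (v + w) = cmul u z v + cmul u z w := by
  simp only [cmul_def, map_add]; module

theorem cmul_vzero (u : E7) (z : ℂ) : cmul u z 0 = 0 := by simp [cmul_def]

theorem cmul_sum {ι : Type*} (s : Finset ι) (u : E7) (z : ℂ) (v : ι → E7) :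
    cmul u z (∑ i ∈ s, v i) = ∑ i ∈ s, cmul u z (v i) := by
  classical
  induction s using Finset.induction_on with
  | empty => simp [cmul_vzero]
  | insert a s ha ih => rw [Finset.sum_insert ha, Finset.sum_insert ha, cmul_vadd, ih]

theorem sum_cmul {ι : Type*} (s : Finset ι) (u : E7) (z : ι → ℂ) (v : E7) :
    cmul u (∑ i ∈ s, z i) v = ∑ i ∈ s, cmul u (z i) v := by
  classical
  induction s using Finset.induction_on with
  | empty => simp [cmul_zero]
  | insert a s ha ih => rw [Finset.sum_insert ha, Finset.sum_insert ha, cmul_add, ih]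

theorem cross_cross_of_unit {u v : E7} (hu : ‖u‖ = 1) (huv : (inner ℝ u v : ℝ) = 0) :
    cross u (cross u v) = -v := by
  rw [cross_cross, huv, inner_self_of_norm_one hu]; simp

theorem cmul_mul {u v : E7} (hu : ‖u‖ = 1) (huv : (inner ℝ u v : ℝ) = 0) (z w : ℂ) :
    cmul u (z * w) v = cmul u z (cmul u w v) := by
  simp only [cmul_def, Complex.mul_re, Complex.mul_im, map_add, map_smul,
    cross_cross_of_unit hu huv]
  module

/-- Automorphisms that fix `u` commute with `u ×`, that is, they are complex linear. -/
theorem IsG2.map_cmul {g : E7 →L[ℝ] E7} (hg : IsG2 g) {u : E7} (hu : g u = u) (z : ℂ) (v : E7) :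
    g (cmul u z v) = cmul u z (g v) := by
  simp only [cmul_def, map_add, map_smul, hg.map_cross, hu]

theorem cmul_mem {W : Submodule ℝ E7} {u v : E7} (h1 : v ∈ W) (h2 : cross u v ∈ W) (z : ℂ) :
    cmul u z v ∈ W := W.add_mem (W.smul_mem _ h1) (W.smul_mem _ h2)

/-- A derivation that rotates the complex line of `f` exponentiates to a rotation. -/
theorem exp_apply_eq_cmul {B : E7 →L[ℝ] E7} (hB : IsDer B) {u f : E7} (hu : ‖u‖ = 1)
    (hBu : B u = 0) (huf : (inner ℝ u f : ℝ) = 0) {l : ℝ} (h : B f = l • cross u f) (t : ℝ) :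
    NormedSpace.exp (t • B) f = cmul u (Complex.exp ((t * l : ℝ) * Complex.I)) f := by
  rw [exp_apply_of_rotation (θ := t * l) (z := cross u f), cmul_def, Complex.exp_ofReal_mul_I_re,
    Complex.exp_ofReal_mul_I_im]
  · rw [_root_.smul_apply, h, smul_smul]
  · rw [_root_.smul_apply, hB.map_cross, hBu, h, map_smul, cross_cross_of_unit hu huf]
    simp only [map_zero, LinearMap.zero_apply]
    module

/-! ### Unitary frames for the complex structure of a unit vector -/

section CFrame

variable {n : ℕ}

/-- The linear map `ℂⁿ → ℝ⁷` with the given values on the basis, complex linear for the complex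
structure `u ×`. -/
def cframe (u : E7) (f : Fin n → E7) : EuclideanSpace ℂ (Fin n) →ₗ[ℝ] E7 where
  toFun a := ∑ j, cmul u (a j) (f j)
  map_add' a b := by
    simp only [PiLp.add_apply, cmul_add, Finset.sum_add_distrib]
  map_smul' c a := by
    simp only [PiLp.smul_apply, RingHom.id_apply, Finset.smul_sum, cmul_def, Complex.smul_re,
      Complex.smul_im, smul_add, smul_smul, smul_eq_mul]

theorem cframe_apply (u : E7) (f : Fin n → E7) (a : EuclideanSpace ℂ (Fin n)) :
    cframe u f a = ∑ j, cmul u (a j) (f j) := rfl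

theorem cframe_single (u : E7) (f : Fin n → E7) (j : Fin n) :
    cframe u f (EuclideanSpace.single j 1) = f j := by
  rw [cframe_apply, Finset.sum_eq_single j]
  · simp [cmul_one]
  · intro i _ hi
    simp [hi, cmul_zero]
  · simp

/-- `f` is a unitary frame for the complex structure `u ×`. -/
structure IsCFrame (u : E7) (f : Fin n → E7) : Prop where
  unit : ‖u‖ = 1
  orth : ∀ j, (inner ℝ u (f j) : ℝ) = 0
  inner_self : ∀ i j, (inner ℝ (f i) (f j) : ℝ) = if i = j then 1 else 0
  inner_cross : ∀ i j, (inner ℝ (cross u (f i)) (f j) : ℝ) = 0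

theorem IsCFrame.orthonormal {u : E7} {f : Fin n → E7} (h : IsCFrame u f) :
    Orthonormal ℝ (Sum.elim f fun j => cross u (f j)) := by
  rw [orthonormal_iff_ite]
  have h1 (i j) : (inner ℝ (cross u (f i)) (cross u (f j)) : ℝ) = if i = j then 1 else 0 := by
    rw [inner_cross_cross, inner_self_of_norm_one h.unit, h.orth, h.inner_self]; simp
  have h2 (i j) : (Inner.inner ℝ (f i) (cross u (f j)) : ℝ) = 0 := by
    rw [real_inner_comm, h.inner_cross]
  rintro (i | i) (j | j) <;> simp [h.inner_self, h.inner_cross, h1, h2]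

theorem cframe_eq_sum (u : E7) (f : Fin n → E7) (a : EuclideanSpace ℂ (Fin n)) :
    cframe u f a = ∑ p : Fin n ⊕ Fin n,
      (Sum.elim (fun j => (a j).re) (fun j => (a j).im) : Fin n ⊕ Fin n → ℝ) p •
        (Sum.elim f fun j => cross u (f j)) p := by
  rw [Fintype.sum_sum_type, cframe_apply]
  simp [cmul_def, Finset.sum_add_distrib]

theorem IsCFrame.norm_cframe {u : E7} {f : Fin n → E7} (h : IsCFrame u f)
    (a : EuclideanSpace ℂ (Fin n)) : ‖cframe u f a‖ = ‖a‖ := by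
  rw [← sq_eq_sq₀ (norm_nonneg _) (norm_nonneg _), cframe_eq_sum,
    norm_sq_linearCombination h.orthonormal, Fintype.sum_sum_type, EuclideanSpace.norm_sq_eq,
    ← Finset.sum_add_distrib]
  refine Finset.sum_congr rfl fun j _ => ?_
  rw [Complex.sq_norm, Complex.normSq_apply]
  simp [sq]

theorem IsCFrame.inner_cframe {u : E7} {f : Fin n → E7} (h : IsCFrame u f)
    (a : EuclideanSpace ℂ (Fin n)) : (Inner.inner ℝ u (cframe u f a) : ℝ) = 0 := by
  rw [cframe_apply, inner_sum]
  refine Finset.sum_eq_zero fun j _ => ?_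
  rw [cmul_def, inner_add_right, inner_smul_right, inner_smul_right, h.orth]
  have : (Inner.inner ℝ u (cross u (f j)) : ℝ) = 0 := by
    rw [real_inner_comm, inner_cross_left_self]
  rw [this]; simp

theorem IsCFrame.range_cframe {u : E7} {f : Fin n → E7} (h : IsCFrame u f) {W : Submodule ℝ E7}
    (h1 : ∀ j, f j ∈ W) (h2 : ∀ j, cross u (f j) ∈ W) (hW : finrank ℝ W = n + n) :
    LinearMap.range (cframe u f) = W := by
  apply le_antisymm
  · rintro _ ⟨a, rfl⟩
    rw [cframe_apply]
    exact W.sum_mem fun j _ => cmul_mem (h1 j) (h2 j) _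
  · intro x hx
    obtain ⟨c, rfl⟩ := eq_sum_of_orthonormal h.orthonormal (W := W)
      (by rintro (j | j); exacts [h1 j, h2 j]) (by simpa using hW) hx
    refine ⟨WithLp.toLp 2 fun j => ⟨c (Sum.inl j), c (Sum.inr j)⟩, ?_⟩
    rw [cframe_eq_sum]
    refine Finset.sum_congr rfl fun p _ => ?_
    rcases p with j | j <;> rfl

theorem IsCFrame.map_cframe {u : E7} {f : Fin n → E7} (h : IsCFrame u f) {g : E7 →L[ℝ] E7}
    (hg : IsG2 g) (hgu : g u = u) {S : Matrix (Fin n) (Fin n) ℂ}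
    (hS : ∀ j, g (f j) = ∑ i, cmul u (S i j) (f i)) (a : EuclideanSpace ℂ (Fin n)) :
    g (cframe u f a) = cframe u f (WithLp.toLp 2 (S *ᵥ a.ofLp)) := by
  rw [cframe_apply, cframe_apply, map_sum]
  have e (j : Fin n) : g (cmul u (a j) (f j)) = ∑ i, cmul u (S i j * a j) (f i) := by
    rw [hg.map_cmul hgu, hS, cmul_sum]
    refine Finset.sum_congr rfl fun i _ => ?_
    rw [mul_comm, cmul_mul h.unit (h.orth i)]
  simp only [e, Matrix.mulVec, dotProduct, sum_cmul]
  exact Finset.sum_comm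

end CFrame

/-! ### Matrices -/

open ComplexConjugate in
/-- The element of `SU(2)` with the given first column. -/
def su2Mat (b : EuclideanSpace ℂ (Fin 2)) : Matrix (Fin 2) (Fin 2) ℂ :=
  !![b 0, -conj (b 1); b 1, conj (b 0)]

open ComplexConjugate in
theorem conj_mul_add_of_norm_one {b : EuclideanSpace ℂ (Fin 2)} (hb : ‖b‖ = 1) :
    b 0 * conj (b 0) + b 1 * conj (b 1) = 1 := by
  have h1 := EuclideanSpace.norm_sq_eq b
  rw [hb, Fin.sum_univ_two, Complex.sq_norm, Complex.sq_norm, one_pow] at h1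
  rw [Complex.mul_conj, Complex.mul_conj, ← Complex.ofReal_add, ← h1, Complex.ofReal_one]

theorem su2Mat_mem {b : EuclideanSpace ℂ (Fin 2)} (hb : ‖b‖ = 1) :
    su2Mat b ∈ Matrix.specialUnitaryGroup (Fin 2) ℂ := by
  have h := conj_mul_add_of_norm_one hb
  rw [Matrix.mem_specialUnitaryGroup_iff, Matrix.mem_unitaryGroup_iff]
  constructor
  · ext i j
    fin_cases i <;> fin_cases j
    · simp [su2Mat, Matrix.mul_apply, Fin.sum_univ_two, Matrix.star_apply]
      linear_combination h
    · simp [su2Mat, Matrix.mul_apply, Fin.sum_univ_two, Matrix.star_apply]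
      ring
    · simp [su2Mat, Matrix.mul_apply, Fin.sum_univ_two, Matrix.star_apply]
      ring
    · simp [su2Mat, Matrix.mul_apply, Fin.sum_univ_two, Matrix.star_apply]
      linear_combination h
  · rw [su2Mat, Matrix.det_fin_two_of]
    linear_combination h

/-- For determinant one the inverse is the adjugate, so `star S` equals the adjugate; comparing
entries expresses the second column through the first. -/
theorem exists_su2Mat {S : Matrix (Fin 2) (Fin 2) ℂ} (hS : S ∈ Matrix.specialUnitaryGroup (Fin 2) ℂ) :
    ∃ b : EuclideanSpace ℂ (Fin 2), ‖b‖ = 1 ∧ S = su2Mat b := by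
  obtain ⟨h1, h2⟩ := Matrix.mem_specialUnitaryGroup_iff.mp hS
  have h3 := Matrix.mem_unitaryGroup_iff'.mp h1
  have h4 : star S = S.adjugate := by
    calc star S = star S * (S * S.adjugate) := by rw [Matrix.mul_adjugate, h2, one_smul, mul_one]
      _ = _ := by rw [← mul_assoc, h3, one_mul]
  rw [Matrix.adjugate_fin_two] at h4
  have e0 : (starRingEnd ℂ) (S 0 0) = S 1 1 :=
    congrArg (fun T : Matrix (Fin 2) (Fin 2) ℂ => T 0 0) h4
  have e1 : (starRingEnd ℂ) (S 1 0) = -S 0 1 :=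
    congrArg (fun T : Matrix (Fin 2) (Fin 2) ℂ => T 0 1) h4
  have e2 : (star S * S) 0 0 = (1 : Matrix (Fin 2) (Fin 2) ℂ) 0 0 := by rw [h3]
  rw [Matrix.mul_apply, Fin.sum_univ_two, Matrix.star_apply, Matrix.star_apply,
    Matrix.one_apply_eq] at e2
  let x : ℂ := S 0 0
  let y : ℂ := S 1 0
  have e2' : (starRingEnd ℂ) x * x + (starRingEnd ℂ) y * y = 1 := e2
  refine ⟨WithLp.toLp 2 ![x, y], ?_, ?_⟩
  · rw [← sq_eq_sq₀ (norm_nonneg _) zero_le_one, EuclideanSpace.norm_sq_eq, Fin.sum_univ_two]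
    change ‖x‖ ^ 2 + ‖y‖ ^ 2 = 1 ^ 2
    rw [Complex.sq_norm, Complex.sq_norm, ← Complex.ofReal_inj, Complex.ofReal_add,
      Complex.normSq_eq_conj_mul_self, Complex.normSq_eq_conj_mul_self, e2']
    simp
  · have e3 : S 1 1 = (starRingEnd ℂ) (S 0 0) := e0.symm
    have e4 : S 0 1 = -(starRingEnd ℂ) (S 1 0) := by rw [e1, neg_neg]
    refine (Matrix.eta_fin_two S).trans ?_
    rw [e3, e4]; rfl

/-- Elements of `G₂` that fix the associative plane `F` act on `Fᗮ` by `SU(2)`. -/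
theorem map_cframe_su2 {u₁ u₂ w₀ : E7} (hf : IsCFrame u₁ ![w₀, cross u₂ w₀])
    (n2 : ‖u₂‖ = 1) (h12 : (inner ℝ u₁ u₂ : ℝ) = 0) (h2 : (inner ℝ u₂ w₀ : ℝ) = 0)
    {g : E7 →L[ℝ] E7} (hg : IsG2 g) (hg1 : g u₁ = u₁) (hg2 : g u₂ = u₂)
    {b : EuclideanSpace ℂ (Fin 2)} (hb : g w₀ = cframe u₁ ![w₀, cross u₂ w₀] b)
    (a : EuclideanSpace ℂ (Fin 2)) :
    g (cframe u₁ ![w₀, cross u₂ w₀] a) =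
      cframe u₁ ![w₀, cross u₂ w₀] (WithLp.toLp 2 (su2Mat b *ᵥ a.ofLp)) := by
  have n1 := hf.unit
  have h1 : (inner ℝ u₁ w₀ : ℝ) = 0 := hf.orth 0
  have h3 : (inner ℝ (cross u₁ w₀) (cross u₂ w₀) : ℝ) = 0 := hf.inner_cross 0 1
  have hJ {v : E7} (huv : (inner ℝ u₂ v : ℝ) = 0) : cross u₂ (cross u₂ v) = -v :=
    cross_cross_of_unit n2 huv
  -- the two complex structures anticommute
  have hanti (v : E7) (hv1 : (inner ℝ u₁ v : ℝ) = 0) (hv2 : (inner ℝ u₂ v : ℝ) = 0) :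
      cross u₂ (cross u₁ v) = -cross u₁ (cross u₂ v) := by
    have h := cross_cross_add u₁ u₂ v
    rw [h12, hv1, hv2] at h
    simp only [zero_smul, mul_zero, sub_zero, add_zero] at h
    exact eq_neg_of_add_eq_zero_right (by simpa using h)
  refine hf.map_cframe hg hg1 (fun j => ?_) a
  have hb' : g w₀ = cmul u₁ (b 0) w₀ + cmul u₁ (b 1) (cross u₂ w₀) := by
    rw [hb, cframe_apply, Fin.sum_univ_two]; rfl
  fin_cases j
  · rw [Fin.sum_univ_two]
    exact hb'
  · rw [Fin.sum_univ_two]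
    -- As `g` fixes `u₂`, the second column is `u₂ ×` applied to the first, and `u₂ ×` is antilinear
    -- for the complex structure `u₁ ×`.
    change g (cross u₂ w₀) = cmul u₁ (-(starRingEnd ℂ) (b 1)) w₀ +
      cmul u₁ ((starRingEnd ℂ) (b 0)) (cross u₂ w₀)
    have h13 : (inner ℝ u₁ (cross u₂ w₀) : ℝ) = 0 := hf.orth 1
    have h23 : (inner ℝ u₂ (cross u₂ w₀) : ℝ) = 0 := by
      rw [real_inner_comm, inner_cross_left_self]
    rw [hg.map_cross, hg2, hb']
    simp only [cmul_def, map_add, map_smul, hJ h2, hanti w₀ h1 h2, hanti _ h13 h23, map_neg,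
      Complex.neg_re, Complex.neg_im, Complex.conj_re, Complex.conj_im]
    module

/-- With `u₁ ×` as multiplication by `i`, the operator `u₂ ×` plays the role of `j`: the complement
of the associative plane is a quaternionic line generated by `w₀`. -/
theorem isCFrame_cross {u₁ u₂ w₀ : E7} (n1 : ‖u₁‖ = 1) (n2 : ‖u₂‖ = 1) (n0 : ‖w₀‖ = 1)
    (h12 : (inner ℝ u₁ u₂ : ℝ) = 0) (h1 : (inner ℝ u₁ w₀ : ℝ) = 0)
    (h2 : (inner ℝ u₂ w₀ : ℝ) = 0) (h3 : (inner ℝ (cross u₁ u₂) w₀ : ℝ) = 0) :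
    IsCFrame u₁ ![w₀, cross u₂ w₀] := by
  have h4 : (inner ℝ (cross u₁ w₀) (cross u₂ w₀) : ℝ) = 0 := by
    rw [cross_anticomm u₁ w₀, cross_anticomm u₂ w₀, inner_neg_left, inner_neg_right, neg_neg,
      inner_cross_cross, h12, real_inner_comm u₁ w₀, h1]
    simp
  have h5 : ‖cross u₂ w₀‖ = 1 := (norm_cross n2 h2).trans n0
  refine ⟨n1, ?_, ?_, ?_⟩
  · intro j
    fin_cases j
    · exact h1
    · change (inner ℝ u₁ (cross u₂ w₀) : ℝ) = 0
      rw [real_inner_comm, ← inner_cross_cyclic]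
      exact h3
  · intro i j
    fin_cases i <;> fin_cases j
    · exact inner_self_of_norm_one n0
    · change (inner ℝ w₀ (cross u₂ w₀) : ℝ) = 0
      rw [real_inner_comm]; exact inner_cross_right_self _ _
    · exact inner_cross_right_self _ _
    · exact inner_self_of_norm_one h5
  · intro i j
    fin_cases i <;> fin_cases j
    · exact inner_cross_right_self _ _
    · exact h4
    · change (inner ℝ (cross u₁ (cross u₂ w₀)) w₀ : ℝ) = 0
      rw [inner_cross_right, real_inner_comm, h4, neg_zero]
    · exact inner_cross_right_self _ _

/-! ### Three-dimensional stabilizers -/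

namespace IsotropyData

variable {H Γ : Subgroup T2SU2} {ρ : T2SU2 → E7 →L[ℝ] E7} {U : LieK →L[ℝ] E7}
  {A : LieK →L[ℝ] E7 →L[ℝ] E7}

/-- The orbit directions are those of the torus, so the normal space is the line of `u₁ × u₂` plus
the complement of the fixed associative plane. The derivations of 𝔰𝔲(2) kill that plane and form a
three-dimensional family, hence the stabilizer is transitive on the unit sphere of the complement.
The image of one unit vector determines both an automorphism fixing the plane and a matrix of SU(2),
which matches the two. -/
theorem exists_su2_frame (D : IsotropyData H Γ ρ U A)
    (h : ∀ s t : ℝ, U (s, t, 0) = 0 → s = 0 ∧ t = 0)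
    (h1 : finrank ℝ (LinearMap.ker U.toLinearMap) = 3) (hsu : ∀ X, U (0, 0, X) = 0) :
    ∃ (u : E7) (e : EuclideanSpace ℂ (Fin 2) →ₗ[ℝ] E7), ‖u‖ = 1 ∧
      (ℝ ∙ u) ⊔ LinearMap.range e = (LinearMap.range U.toLinearMap)ᗮ ∧
      (∀ a, (inner ℝ u (e a) : ℝ) = 0) ∧ (∀ a, ‖e a‖ = ‖a‖) ∧ (∀ k ∈ H, ρ k u = u) ∧
      (∀ S : Matrix.specialUnitaryGroup (Fin 2) ℂ, ∃ k ∈ H,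
        ∀ a, ρ k (e a) = e (WithLp.toLp 2 (S.1 *ᵥ a.ofLp))) ∧
      (∀ k ∈ H, ∃ S : Matrix.specialUnitaryGroup (Fin 2) ℂ,
        ∀ a, ρ k (e a) = e (WithLp.toLp 2 (S.1 *ᵥ a.ofLp))) ∧
      (∀ k ∈ H, (∀ a, ρ k (e a) = e a) → ρ k = ContinuousLinearMap.id ℝ E7) := by
  obtain ⟨u₁, u₂, n1, n2, h12, -, -, ho, hmem, hfix, hkill⟩ := D.exists_torus_frame h
  set u := cross u₁ u₂
  have nu : ‖u‖ = 1 := (norm_cross n1 h12).trans n2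
  have hu0 : u ≠ 0 := by intro h0; rw [h0, norm_zero] at nu; exact zero_ne_one nu
  have h3 := finrank_assocSpan n1 n2 h12
  have h7 := finrank_orthogonal_E7 (assocSpan u₁ u₂)
  have hspan : (ℝ ∙ u) ≤ (LinearMap.range U.toLinearMap)ᗮ :=
    (Submodule.span_singleton_le_iff_mem _ _).mpr ho
  have hN : (ℝ ∙ u)ᗮ ⊓ (LinearMap.range U.toLinearMap)ᗮ = (assocSpan u₁ u₂)ᗮ := by
    symm
    apply Submodule.eq_of_le_of_finrank_eq
    · refine le_inf (Submodule.orthogonal_le ?_) (Submodule.orthogonal_le ?_)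
      · exact (Submodule.span_singleton_le_iff_mem _ _).mpr (cross_mem_assocSpan _ _)
      · rintro _ ⟨ξ, rfl⟩
        have e : U ξ = U (ξ.1, ξ.2.1, 0) + U (0, 0, ξ.2.2) := by rw [← map_add]; simp
        change U ξ ∈ _
        rw [e, hsu, add_zero]
        exact hmem _ _
    · have h4 := Submodule.finrank_add_inf_finrank_orthogonal hspan
      rw [finrank_span_singleton (K := ℝ) hu0, finrank_orthogonal_range, h1] at h4
      omega
  obtain ⟨w₀, hw, nw, -⟩ := exists_unit_mem_orthogonal (F := (assocSpan u₁ u₂)ᗮ) (G := ⊥)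
    (by simp; omega)
  have hw0 : w₀ ≠ 0 := by rintro rfl; simp at nw
  have hwF := not_mem_of_mem_orthogonal hw hw0
  have hort {w : E7} (hw : w ∈ (assocSpan u₁ u₂)ᗮ) {v : E7} (hv : v ∈ assocSpan u₁ u₂) :
      (inner ℝ v w : ℝ) = 0 := inner_eq_zero_of_mem hv hw
  have hf := isCFrame_cross n1 n2 nw h12 (hort hw (left_mem_assocSpan _ _))
    (hort hw (right_mem_assocSpan _ _)) (hort hw (cross_mem_assocSpan _ _))
  have hcr {f v : E7} (hf : f ∈ assocSpan u₁ u₂) (hv : v ∈ (assocSpan u₁ u₂)ᗮ) :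
      cross f v ∈ (assocSpan u₁ u₂)ᗮ := (crossClosed_assocSpan u₁ u₂).cross_mem_orthogonal hf hv
  have hr : LinearMap.range (cframe u₁ ![w₀, cross u₂ w₀]) = (assocSpan u₁ u₂)ᗮ := by
    have e1 := hcr (right_mem_assocSpan _ _) hw
    refine hf.range_cframe (fun j => ?_) (fun j => ?_) (by omega)
    · fin_cases j; exacts [hw, e1]
    · fin_cases j; exacts [hcr (left_mem_assocSpan _ _) hw, hcr (left_mem_assocSpan _ _) e1]
  have hmap {k : T2SU2} (hk : k ∈ H) {b : EuclideanSpace ℂ (Fin 2)}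
      (hb : ρ k w₀ = cframe u₁ ![w₀, cross u₂ w₀] b) (a : EuclideanSpace ℂ (Fin 2)) :=
    map_cframe_su2 hf n2 h12 (hort hw (right_mem_assocSpan _ _)) (D.isG2 k hk)
      (hfix k hk _ (left_mem_assocSpan _ _)) (hfix k hk _ (right_mem_assocSpan _ _)) hb a
  refine ⟨u, cframe u₁ ![w₀, cross u₂ w₀], nu, ?_, ?_, hf.norm_cframe,
    fun k hk => hfix k hk u (cross_mem_assocSpan _ _), ?_, ?_, ?_⟩
  · rw [hr, ← hN]
    exact Submodule.sup_orthogonal_inf_of_hasOrthogonalProjection hspan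
  · intro a
    exact hort (hr ▸ LinearMap.mem_range_self _ a) (cross_mem_assocSpan _ _)
  · intro S
    obtain ⟨b, nb, hb⟩ := exists_su2Mat S.2
    obtain ⟨X, hX⟩ := exists_exp_apply_eq (crossClosed_assocSpan u₁ u₂) h3
      (B := A.toLinearMap ∘ₗ LinearMap.inr ℝ ℝ (ℝ × E3) ∘ₗ LinearMap.inr ℝ ℝ E3)
      (fun X => D.isDer (hsu X)) (fun X => hkill _ (hsu X))
      (fun X hX => by
        have h5 := D.injective _ (hsu X) hX
        simpa using h5) hw (hr ▸ LinearMap.mem_range_self _ b) nw ((hf.norm_cframe b).trans nb)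
    refine ⟨expK (0, 0, X), D.expK_mem _ (hsu X), fun a => ?_⟩
    rw [hmap (D.expK_mem _ (hsu X)) (b := b) ((congrArg (fun g : E7 →L[ℝ] E7 => g w₀)
      (D.exp _ (hsu X))).trans hX) a, hb]
  · intro k hk
    have h5 : ρ k w₀ ∈ (assocSpan u₁ u₂)ᗮ := D.rho_mem_orthogonal hk
      (fun k hk v hv => by rw [hfix k hk v hv]; exact hv) hw
    rw [← hr] at h5
    obtain ⟨b, hb⟩ := h5
    have nb : ‖b‖ = 1 := by rw [← hf.norm_cframe, hb, (D.isG2 k hk).norm, nw]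
    exact ⟨⟨su2Mat b, su2Mat_mem nb⟩, hmap hk hb.symm⟩
  · intro k hk hall
    refine (D.isG2 k hk).ext_of_assoc isG2_id h3 (hfix k hk) hwF ?_
    have h5 := hall (EuclideanSpace.single 0 1)
    rwa [cframe_single] at h5

end IsotropyData

/-! ### Weights of derivations in a unitary frame -/

theorem IsDer.map_cmul {B : E7 →L[ℝ] E7} (hB : IsDer B) {u : E7} (hu : B u = 0) (z : ℂ) (v : E7) :
    B (cmul u z v) = cmul u z (B v) := by
  simp [cmul_def, hB.map_cross, hu]

theorem cross_cmul (u : E7) (z : ℂ) (v : E7) : cross u (cmul u z v) = cmul u z (cross u v) := by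
  simp [cmul_def]

theorem cmul_ofReal (u : E7) (r : ℝ) (v : E7) : cmul u r v = r • v := by
  simp [cmul_def]

theorem cross_injOn {u v w : E7} (hu : ‖u‖ = 1) (hv : (inner ℝ u v : ℝ) = 0)
    (hw : (inner ℝ u w : ℝ) = 0) (h : cross u v = cross u w) : v = w := by
  have h1 := congrArg (cross u) h
  rw [cross_cross_of_unit hu hv, cross_cross_of_unit hu hw] at h1
  exact neg_inj.mp h1

namespace IsCFrame

variable {n : ℕ} {u : E7} {f : Fin n → E7}

theorem cframe_injective (h : IsCFrame u f) : Function.Injective (cframe u f) :=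
  (injective_iff_map_eq_zero _).mpr fun a ha => by
    rw [← norm_eq_zero, ← h.norm_cframe, ha, norm_zero]

theorem map_cframe_diagonal (h : IsCFrame u f) {g : E7 →L[ℝ] E7} (hg : IsG2 g) (hgu : g u = u)
    {z : Fin n → ℂ} (hz : ∀ j, g (f j) = cmul u (z j) (f j)) (a : EuclideanSpace ℂ (Fin n)) :
    g (cframe u f a) = cframe u f (WithLp.toLp 2 fun j => z j * a j) := by
  rw [h.map_cframe hg hgu (S := Matrix.diagonal z)]
  · congr 2
    funext j
    exact Matrix.mulVec_diagonal _ _ _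
  · intro j
    rw [hz, Finset.sum_eq_single j]
    · rw [Matrix.diagonal_apply_eq]
    · intro i _ hi
      rw [Matrix.diagonal_apply_ne _ hi, cmul_zero]
    · simp

theorem der_cframe (h : IsCFrame u f) {C : E7 →L[ℝ] E7} (hC : IsDer C) (hCu : C u = 0)
    {l : Fin n → ℝ} (hl : ∀ j, C (f j) = l j • cross u (f j)) (b : EuclideanSpace ℂ (Fin n)) :
    C (cframe u f b) = cross u (cframe u f (WithLp.toLp 2 fun j => (l j : ℂ) * b j)) := by
  rw [cframe_apply, cframe_apply, map_sum, map_sum]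
  refine Finset.sum_congr rfl fun j _ => ?_
  change _ = cross u (cmul u ((l j : ℂ) * b j) (f j))
  rw [hC.map_cmul hCu, hl, ← cmul_ofReal u, ← cmul_mul h.unit, cross_cmul, mul_comm]
  rw [real_inner_comm]; exact inner_cross_left_self _ _

/-- An eigenvector of a diagonal derivation has nonzero coordinates only where the weight is its
eigenvalue. -/
theorem mul_eq_of_der (h : IsCFrame u f) {C : E7 →L[ℝ] E7} (hC : IsDer C) (hCu : C u = 0)
    {l : Fin n → ℝ} (hl : ∀ j, C (f j) = l j • cross u (f j)) {b : EuclideanSpace ℂ (Fin n)}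
    {m : ℝ} (hb : C (cframe u f b) = m • cross u (cframe u f b)) (j : Fin n) :
    l j = m ∨ b j = 0 := by
  rw [h.der_cframe hC hCu hl, ← map_smul, ← map_smul] at hb
  have h1 := h.cframe_injective (cross_injOn h.unit (h.inner_cframe _) (h.inner_cframe _) hb)
  have h2 : (l j : ℂ) * b j = (m : ℂ) * b j :=
    congrArg (fun x : EuclideanSpace ℂ (Fin n) => x j) h1
  rcases mul_eq_mul_right_iff.mp h2 with h3 | h3
  · exact Or.inl (Complex.ofReal_inj.mp h3)
  · exact Or.inr h3

theorem norm_cmul (h : IsCFrame u f) (z : ℂ) (j : Fin n) : ‖cmul u z (f j)‖ = ‖z‖ := by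
  have h1 := h.norm_cframe (EuclideanSpace.single j z)
  rw [PiLp.norm_single] at h1
  rw [← h1, cframe_apply, Finset.sum_eq_single j]
  · simp
  · intro i _ hi
    simp [hi, cmul_zero]
  · simp

/-- An element of `G₂` that commutes with a derivation preserves its simple eigenlines. -/
theorem exists_eq_cmul {g : E7 →L[ℝ] E7} {j : Fin n}
    (hmem : g (f j) ∈ LinearMap.range (cframe u f))
    (hsimple : ∀ b, cframe u f b = g (f j) → ∀ i, i ≠ j → b i = 0) :
    ∃ z : ℂ, g (f j) = cmul u z (f j) := by
  obtain ⟨b, hb⟩ := hmem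
  refine ⟨b j, ?_⟩
  rw [← hb, cframe_apply, Finset.sum_eq_single j]
  · intro i _ hi
    rw [hsimple b hb i hi, cmul_zero]
  · simp

end IsCFrame

theorem der_exp_apply {C : E7 →L[ℝ] E7} (hC : IsDer C) {u v : E7} (hu : ‖u‖ = 1)
    (hCu : C u = 0) (huv : (inner ℝ u v : ℝ) = 0) {l : ℝ} (h : C v = l • cross u v) :
    NormedSpace.exp C v = cmul u (Circle.exp l) v := by
  have h1 := exp_apply_eq_cmul hC hu hCu huv h 1
  rw [one_smul, one_mul] at h1
  rw [h1, Circle.coe_exp]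

/-! ### Two-dimensional stabilizers -/

namespace IsotropyData

variable {H Γ : Subgroup T2SU2} {ρ : T2SU2 → E7 →L[ℝ] E7} {U : LieK →L[ℝ] E7}
  {A : LieK →L[ℝ] E7 →L[ℝ] E7}

/-- The torus direction complementary to the singular one does not vanish at the point. Normalised,
it is fixed by the stabilizer and defines an invariant complex structure. -/
theorem exists_unit_torus (D : IsotropyData H Γ ρ U A) {s₀ t₀ : ℝ} (hne : s₀ ≠ 0 ∨ t₀ ≠ 0)
    (hc : U (s₀, t₀, 0) = 0) : ∃ u ∈ LinearMap.range U.toLinearMap, ‖u‖ = 1 ∧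
      (∀ k ∈ H, ρ k u = u) ∧ ∀ η, U η = 0 → A η u = 0 := by
  have hp := D.torus_perp_ne_zero hne hc
  refine ⟨(‖U (-t₀, s₀, 0)‖⁻¹ : ℝ) • U (-t₀, s₀, 0),
    Submodule.smul_mem _ _ (LinearMap.mem_range_self U.toLinearMap _), ?_, ?_, ?_⟩
  · rw [norm_smul, norm_inv, norm_norm, inv_mul_cancel₀ (norm_ne_zero_iff.mpr hp)]
  · intro k hk
    rw [map_smul, D.rho_torus hk]
  · intro η hη
    rw [map_smul, D.A_apply_torus hη, smul_zero]

/-- The three-dimensional tangent space lies in the kernel of the singular torus derivation. That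
kernel is closed under the cross product and proper, so it has dimension at most three and equals
the tangent space. -/
theorem crossClosed_range (D : IsotropyData H Γ ρ U A) {s₀ t₀ : ℝ} (hne : s₀ ≠ 0 ∨ t₀ ≠ 0)
    (hc : U (s₀, t₀, 0) = 0) (h2 : finrank ℝ (LinearMap.ker U.toLinearMap) = 2) :
    CrossClosed (LinearMap.range U.toLinearMap) := by
  have hder := D.isDer hc
  have hle : LinearMap.range U.toLinearMap ≤ LinearMap.ker (A (s₀, t₀, 0)).toLinearMap := by
    rintro _ ⟨ξ, rfl⟩; exact D.torus_A_U hc ξ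
  have h5 := finrank_ker_add U
  have heq : LinearMap.range U.toLinearMap = LinearMap.ker (A (s₀, t₀, 0)).toLinearMap := by
    apply Submodule.eq_of_le_of_finrank_le hle
    by_contra hlt
    have h0 := hder.eq_zero_of_finrank (F := LinearMap.ker (A (s₀, t₀, 0)).toLinearMap)
      (fun v hv => hv) (by omega)
    have := D.injective _ hc h0
    simp only [Prod.mk_eq_zero] at this
    tauto
  rw [heq]
  exact hder.crossClosed_ker

/-- The elements of the stabilizer whose adjoint action does not reverse the `𝔰𝔲(2)` part. -/
theorem exists_comm_or (D : IsotropyData H Γ ρ U A) {η : LieK} (hη : U η = 0) (hX : η.2.2 ≠ 0)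
    {s₀ t₀ : ℝ} (hne : s₀ ≠ 0 ∨ t₀ ≠ 0) (hc : U (s₀, t₀, 0) = 0)
    (hall : ∀ ζ, U ζ = 0 → ∃ r : ℝ, ζ.2.2 = r • η.2.2) :
    ∃ B' : E7 →L[ℝ] E7, A η ≠ B' ∧ ∀ k ∈ H,
      (∀ v, ρ k (A η v) = A η (ρ k v)) ∨ (∀ v, ρ k (A η v) = B' (ρ k v)) := by
  -- The adjoint action is isometric and preserves the one-dimensional projection to 𝔰𝔲(2), so it
  -- can only fix `η` or reverse its 𝔰𝔲(2) component.
  let η' : LieK := (η.1, η.2.1, -η.2.2)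
  have hadj (k : T2SU2) (hk : k ∈ H) : adjK k η = η ∨ adjK k η = η' := by
    obtain ⟨r, hr⟩ := hall _ (D.map_adj_eq_zero hk hη)
    have hr' : adjSU2 k.2.2 η.2.2 = r • η.2.2 := hr
    have hn := congrArg norm hr'
    rw [norm_adjSU2, norm_smul] at hn
    have h1 : ‖r‖ = 1 := by
      have := norm_ne_zero_iff.mpr hX
      exact mul_right_cancel₀ this (by rw [one_mul]; exact hn.symm)
    rw [adjK_apply, hr']
    rcases (abs_eq zero_le_one).mp h1 with h2 | h2
    · left; rw [h2, one_smul]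
    · right; rw [h2, neg_one_smul]
  by_cases hU : U η' = 0
  · refine ⟨A η', fun h => hX ?_, fun k hk => ?_⟩
    · have h1 : η - η' = 0 := D.injective _ (by rw [map_sub, hη, hU, sub_zero])
        (by rw [map_sub]; exact sub_eq_zero.mpr h)
      have h2 : η.2.2 - -η.2.2 = 0 := congrArg (fun ξ : LieK => ξ.2.2) h1
      rw [sub_neg_eq_add, ← two_smul ℝ] at h2
      exact (smul_eq_zero.mp h2).resolve_left two_ne_zero
    · rcases hadj k hk with h | h
      · left; intro v; rw [D.rho_A hk hη, h]
      · right; intro v; rw [D.rho_A hk hη, h]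
  -- If the reversed element is not in the stabilizer algebra, reversal never happens, and any
  -- operator different from `A η` may be named.
  · refine ⟨A η + A (s₀, t₀, 0), fun h => ?_, fun k hk => ?_⟩
    · have h0 : A (s₀, t₀, 0) = 0 := left_eq_add.mp h
      have := D.injective _ hc h0
      simp only [Prod.mk_eq_zero] at this
      tauto
    · rcases hadj k hk with h | h
      · left; intro v; rw [D.rho_A hk hη, h]
      · exact absurd (h ▸ D.map_adj_eq_zero hk hη) hU

/-- The stabilizer algebra is spanned by a torus derivation `C` and the derivation of `η`, which
commute and hence have common eigenvectors `f₁`, `f₂` in the normal space. Their weights are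
independent by faithfulness, so the exponentials realise all diagonal unitary matrices. An element
commuting with both derivations preserves the two eigenlines. Elements that reverse `η` need not be
diagonal, which is why commutation is assumed in the converse. -/
theorem exists_torus_normal_frame (D : IsotropyData H Γ ρ U A) {s₀ t₀ : ℝ}
    (hne : s₀ ≠ 0 ∨ t₀ ≠ 0) (hc : U (s₀, t₀, 0) = 0)
    (h2 : finrank ℝ (LinearMap.ker U.toLinearMap) = 2) {η : LieK} (hη : U η = 0)
    (hX : η.2.2 ≠ 0) (hall : ∀ ζ, U ζ = 0 → ∃ r : ℝ, ζ.2.2 = r • η.2.2) :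
    ∃ (e : EuclideanSpace ℂ (Fin 2) →ₗ[ℝ] E7) (B B' : E7 →L[ℝ] E7),
      LinearMap.range e = (LinearMap.range U.toLinearMap)ᗮ ∧ (∀ a, ‖e a‖ = ‖a‖) ∧ B ≠ B' ∧
      (∀ k ∈ H, (∀ v, ρ k (B v) = B (ρ k v)) ∨ (∀ v, ρ k (B v) = B' (ρ k v))) ∧
      (∀ z w : Circle, ∃ k ∈ Subgroup.closure (expK '' {ζ | U ζ = 0}),
        ∀ a, ρ k (e a) = e !₂[(z : ℂ) * a 0, (w : ℂ) * a 1]) ∧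
      (∀ k ∈ H, (∀ v, ρ k (B v) = B (ρ k v)) →
        ∃ z w : Circle, ∀ a, ρ k (e a) = e !₂[(z : ℂ) * a 0, (w : ℂ) * a 1]) ∧
      (∀ k ∈ H, (∀ a, ρ k (e a) = e a) → ρ k = ContinuousLinearMap.id ℝ E7) := by
  obtain ⟨u, huR, nu, hufix, hukill⟩ := D.exists_unit_torus hne hc
  have hR := D.crossClosed_range hne hc h2
  obtain ⟨B', hB', hor⟩ := D.exists_comm_or hη hX hne hc hall
  set R := LinearMap.range U.toLinearMap with hRdef
  have hN4 : finrank ℝ Rᗮ = 4 := by rw [finrank_orthogonal_range, h2]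
  set c : LieK := (s₀, t₀, 0) with hcdef
  set C := A c
  have hC := D.isDer hc
  have hB := D.isDer hη
  have hCB := D.torus_comm hc hη
  have hmemu {v : E7} (hv : v ∈ Rᗮ) : (inner ℝ u v : ℝ) = 0 := inner_eq_zero_of_mem huR hv
  have hAN {ζ : LieK} (hζ : U ζ = 0) {v : E7} (hv : v ∈ Rᗮ) : A ζ v ∈ Rᗮ :=
    (D.isDer hζ).mem_orthogonal (fun v hv => D.A_mem_range hζ hv) hv
  have hIN {v : E7} (hv : v ∈ Rᗮ) : cross u v ∈ Rᗮ := hR.cross_mem_orthogonal huR hv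
  obtain ⟨l₁, m₁, f₁, hf1, nf1, hCf1, hBf1⟩ := hC.exists_common_eigenvector hB hCB nu
    (hukill _ hc) (hukill _ hη) (V := Rᗮ)
    (by intro h; rw [h, finrank_bot] at hN4; omega) (fun v hv => hmemu hv)
    (fun v hv => hAN hc hv) (fun v hv => hAN hη hv) (fun v hv => hIN hv)
  have huf1 := hmemu hf1
  have h3 := finrank_assocSpan nu nf1 huf1
  have hAF {ζ : LieK} (hζ : U ζ = 0) {l : ℝ} (hl : A ζ f₁ = l • cross u f₁) {v : E7}
      (hv : v ∈ (assocSpan u f₁)ᗮ) : A ζ v ∈ (assocSpan u f₁)ᗮ := by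
    refine (D.isDer hζ).mem_orthogonal (fun v hv => ?_) hv
    obtain ⟨x, y, z, rfl⟩ := mem_assocSpan.mp hv
    rw [map_add, map_add, map_smul, map_smul, map_smul, (D.isDer hζ).map_cross, hukill _ hζ, hl,
      map_smul, cross_cross_of_unit nu huf1, map_zero, LinearMap.zero_apply, zero_add, smul_zero,
      zero_add]
    exact Submodule.add_mem _ (Submodule.smul_mem _ _ (Submodule.smul_mem _ _
      (cross_mem_assocSpan _ _))) (Submodule.smul_mem _ _ (Submodule.smul_mem _ _
      (Submodule.neg_mem _ (right_mem_assocSpan _ _))))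
  -- The normal space has dimension four and the plane of `u`, `f₁` dimension three, so a normal
  -- vector orthogonal to that plane is left.
  obtain ⟨w, hwN, nw, hwF⟩ := exists_unit_mem_orthogonal (F := Rᗮ) (G := assocSpan u f₁) (by omega)
  obtain ⟨l₂, m₂, f₂, hf2, nf2, hCf2, hBf2⟩ := hC.exists_common_eigenvector hB hCB nu
    (hukill _ hc) (hukill _ hη) (V := Rᗮ ⊓ (assocSpan u f₁)ᗮ)
    (by
      intro h
      have h0 : w ∈ Rᗮ ⊓ (assocSpan u f₁)ᗮ := ⟨hwN, hwF⟩
      rw [h, Submodule.mem_bot] at h0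
      rw [h0, norm_zero] at nw
      exact zero_ne_one nw) (fun v hv => hmemu hv.1)
    (fun v hv => ⟨hAN hc hv.1, hAF hc hCf1 hv.2⟩) (fun v hv => ⟨hAN hη hv.1, hAF hη hBf1 hv.2⟩)
    (fun v hv => ⟨hIN hv.1, (crossClosed_assocSpan u f₁).cross_mem_orthogonal
      (left_mem_assocSpan _ _) hv.2⟩)
  have i12 : (inner ℝ f₁ f₂ : ℝ) = 0 := inner_eq_zero_of_mem (right_mem_assocSpan _ _) hf2.2
  have iI12 : (inner ℝ (cross u f₁) f₂ : ℝ) = 0 :=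
    inner_eq_zero_of_mem (cross_mem_assocSpan _ _) hf2.2
  have iI21 : (inner ℝ (cross u f₂) f₁ : ℝ) = 0 := by
    rw [inner_cross_right, real_inner_comm, iI12, neg_zero]
  have hf : IsCFrame u ![f₁, f₂] := by
    refine ⟨nu, fun j => ?_, fun i j => ?_, fun i j => ?_⟩
    · fin_cases j; exacts [huf1, hmemu hf2.1]
    · fin_cases i <;> fin_cases j
      exacts [inner_self_of_norm_one nf1, i12, (real_inner_comm _ _).trans i12,
        inner_self_of_norm_one nf2]
    · fin_cases i <;> fin_cases j
      exacts [inner_cross_right_self _ _, iI12, iI21, inner_cross_right_self _ _]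
  have hr : LinearMap.range (cframe u ![f₁, f₂]) = Rᗮ := by
    refine hf.range_cframe (fun j => ?_) (fun j => ?_) hN4
    · fin_cases j; exacts [hf1, hf2.1]
    · fin_cases j; exacts [hIN hf1, hIN hf2.1]
  -- the weights are independent
  have hlin {s t : ℝ} (e1 : s * l₁ + t * m₁ = 0) (e2 : s * l₂ + t * m₂ = 0) : s = 0 ∧ t = 0 := by
    have hζ : U (s • c + t • η) = 0 := by
      rw [map_add, map_smul, map_smul, hη, hc, smul_zero, smul_zero, add_zero]
    have hz (f : E7) (l m : ℝ) (h1 : C f = l • cross u f) (h2 : A η f = m • cross u f)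
        (h3 : s * l + t * m = 0) : A (s • c + t • η) f = 0 := by
      rw [map_add, map_smul, map_smul]
      change s • C f + t • A η f = 0
      rw [h1, h2, smul_smul, smul_smul, ← add_smul, h3, zero_smul]
    have h0 := (D.isDer hζ).eq_zero_of_assoc h3
      (fun v hv => assocSpan_le (D.isDer hζ).crossClosed_ker (hukill _ hζ)
        (hz f₁ l₁ m₁ hCf1 hBf1 e1) hv)
      (not_mem_of_mem_orthogonal hf2.2 (by rintro rfl; simp at nf2))
      (hz f₂ l₂ m₂ hCf2 hBf2 e2)
    have h4 := D.injective _ hζ h0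
    have h5 : s • (0 : E3) + t • η.2.2 = 0 := congrArg (fun ξ : LieK => ξ.2.2) h4
    rw [smul_zero, zero_add] at h5
    have ht := (smul_eq_zero.mp h5).resolve_right hX
    rw [ht, zero_smul, add_zero] at h4
    refine ⟨(smul_eq_zero.mp h4).resolve_right ?_, ht⟩
    rw [hcdef]
    simp only [Prod.mk_eq_zero]
    tauto
  -- If the determinant vanished, both `(m₁, -l₁)` and `(m₂, -l₂)` would be relations; all weights
  -- would be zero and every pair a relation.
  have hd : l₁ * m₂ - l₂ * m₁ ≠ 0 := by
    intro hd
    obtain ⟨h4, h5⟩ := hlin (s := m₁) (t := -l₁) (by ring) (by linarith)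
    obtain ⟨h6, h7⟩ := hlin (s := m₂) (t := -l₂) (by rw [h4, neg_eq_zero.mp h5]; ring) (by ring)
    have h8 := hlin (s := 1) (t := 1) (by rw [h4, neg_eq_zero.mp h5]; ring)
      (by rw [h6, neg_eq_zero.mp h7]; ring)
    exact one_ne_zero h8.1
  have hdiag {k : T2SU2} (hk : k ∈ H) {z w : ℂ} (h4 : ρ k f₁ = cmul u z f₁)
      (h5 : ρ k f₂ = cmul u w f₂) (a : EuclideanSpace ℂ (Fin 2)) :
      ρ k (cframe u ![f₁, f₂] a) = cframe u ![f₁, f₂] !₂[z * a 0, w * a 1] := by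
    rw [hf.map_cframe_diagonal (D.isG2 k hk) (hufix k hk) (z := ![z, w])
      (fun j => by fin_cases j; exacts [h4, h5])]
    congr 2
    funext j
    fin_cases j <;> rfl
  refine ⟨cframe u ![f₁, f₂], A η, B', hr, hf.norm_cframe, hB', hor, ?_, ?_, ?_⟩
  · intro z w
    obtain ⟨α, hα⟩ : ∃ α : ℝ, Circle.exp α = z := ⟨_, Circle.exp_arg z⟩
    obtain ⟨β, hβ⟩ : ∃ β : ℝ, Circle.exp β = w := ⟨_, Circle.exp_arg w⟩
    -- Cramer's rule for the element whose weights on `f₁` and `f₂` are the prescribed angles.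
    let s := (α * m₂ - β * m₁) / (l₁ * m₂ - l₂ * m₁)
    let t := (β * l₁ - α * l₂) / (l₁ * m₂ - l₂ * m₁)
    have e1 : s * l₁ + t * m₁ = α := by
      simp only [s, t]
      rw [div_mul_eq_mul_div, div_mul_eq_mul_div, ← add_div, div_eq_iff hd]
      ring
    have e2 : s * l₂ + t * m₂ = β := by
      simp only [s, t]
      rw [div_mul_eq_mul_div, div_mul_eq_mul_div, ← add_div, div_eq_iff hd]
      ring
    have hζ : U (s • c + t • η) = 0 := by
      rw [map_add, map_smul, map_smul, hη, hc, smul_zero, smul_zero, add_zero]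
    have hz (f : E7) (l m : ℝ) (h1 : C f = l • cross u f) (h2 : A η f = m • cross u f)  :
        A (s • c + t • η) f = (s * l + t * m) • cross u f := by
      rw [map_add, map_smul, map_smul]
      change s • C f + t • A η f = _
      rw [h1, h2, smul_smul, smul_smul, ← add_smul]
    refine ⟨expK (s • c + t • η), Subgroup.subset_closure ⟨_, hζ, rfl⟩,
      hdiag (D.expK_mem _ hζ) ?_ ?_⟩
    · rw [D.exp _ hζ, der_exp_apply (D.isDer hζ) nu (hukill _ hζ) huf1 (hz f₁ l₁ m₁ hCf1 hBf1), e1, hα]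
    · rw [D.exp _ hζ, der_exp_apply (D.isDer hζ) nu (hukill _ hζ) (hmemu hf2.1)
        (hz f₂ l₂ m₂ hCf2 hBf2), e2, hβ]
  · intro k hk hcomm
    have hmem {v : E7} (hv : v ∈ Rᗮ) : ρ k v ∈ LinearMap.range (cframe u ![f₁, f₂]) := by
      rw [hr]
      exact D.rho_mem_orthogonal hk (fun k hk v hv => D.rho_mem_range hk hv) hv
    have hC' {f : E7} {l : ℝ} (h : C f = l • cross u f) : C (ρ k f) = l • cross u (ρ k f) := by
      rw [← D.rho_torus_comm hk hc]
      change ρ k (C f) = _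
      rw [h, map_smul, (D.isG2 k hk).map_cross, hufix k hk]
    have hBk {f : E7} {l : ℝ} (h : A η f = l • cross u f) :
        A η (ρ k f) = l • cross u (ρ k f) := by
      rw [← hcomm, h, map_smul, (D.isG2 k hk).map_cross, hufix k hk]
    have hCl (j : Fin 2) : C (![f₁, f₂] j) = ![l₁, l₂] j • cross u (![f₁, f₂] j) := by
      fin_cases j; exacts [hCf1, hCf2]
    have hBl (j : Fin 2) : A η (![f₁, f₂] j) = ![m₁, m₂] j • cross u (![f₁, f₂] j) := by
      fin_cases j; exacts [hBf1, hBf2]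
    have hz (j : Fin 2) : ∃ z : Circle, ρ k (![f₁, f₂] j) = cmul u z (![f₁, f₂] j) := by
      obtain ⟨z, hz⟩ := IsCFrame.exists_eq_cmul (j := j) (g := ρ k)
        (by fin_cases j; exacts [hmem hf1, hmem hf2.1])
        -- A nonzero coordinate along the other eigenvector would make the two weight pairs equal,
        -- and the determinant `hd` zero.
        (fun b hb i hij => by
          have e1 := hf.mul_eq_of_der hC (hukill _ hc) hCl (b := b) (by rw [hb]; exact hC' (hCl j)) i
          have e2 := hf.mul_eq_of_der hB (hukill _ hη) hBl (b := b) (by rw [hb]; exact hBk (hBl j)) i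
          rcases e1 with e1 | e1
          · rcases e2 with e2 | e2
            · exfalso
              fin_cases i <;> fin_cases j <;> simp at hij e1 e2 <;>
                exact hd (by rw [e1, e2]; ring)
            · exact e2
          · exact e1)
      refine ⟨⟨z, ?_⟩, hz⟩
      have h4 := (D.isG2 k hk).norm (![f₁, f₂] j)
      rw [hz, hf.norm_cmul] at h4
      refine mem_sphere_zero_iff_norm.mpr (h4.trans ?_)
      fin_cases j; exacts [nf1, nf2]
    obtain ⟨z, hz0⟩ := hz 0
    obtain ⟨w, hw0⟩ := hz 1
    exact ⟨z, w, hdiag hk hz0 hw0⟩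
  · intro k hk h
    refine (D.isG2 k hk).ext_of_finrank isG2_id (F := Rᗮ) (fun v hv => ?_) hN4.ge
    rw [← hr] at hv
    obtain ⟨a, rfl⟩ := hv
    exact h a

end IsotropyData

/-! ### Complex triples closed by the cross product -/

theorem cmul_injective {u v w : E7} (hu : ‖u‖ = 1) (hv : (inner ℝ u v : ℝ) = 0)
    (hw : (inner ℝ u w : ℝ) = 0) {z : ℂ} (hz : z ≠ 0) (h : cmul u z v = cmul u z w) : v = w := by
  have h1 := congrArg (cmul u z⁻¹) h
  rwa [← cmul_mul hu hv, ← cmul_mul hu hw, inv_mul_cancel₀ hz, cmul_one, cmul_one] at h1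

theorem inner_cross_left {u f : E7} : (inner ℝ u (cross u f) : ℝ) = 0 := by
  rw [real_inner_comm]; exact inner_cross_left_self _ _

/-- A unitary triple that is completed by the cross product. -/
theorem isCFrame_of_cross {u f₁ f₂ : E7} (nu : ‖u‖ = 1) (n1 : ‖f₁‖ = 1) (n2 : ‖f₂‖ = 1)
    (h1 : (inner ℝ u f₁ : ℝ) = 0) (h2 : (inner ℝ u f₂ : ℝ) = 0) (h12 : (inner ℝ f₁ f₂ : ℝ) = 0)
    (hI : (inner ℝ (cross u f₁) f₂ : ℝ) = 0) : IsCFrame u ![f₁, f₂, cross f₁ f₂] := by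
  have h21 : (inner ℝ f₂ f₁ : ℝ) = 0 := (real_inner_comm _ _).trans h12
  have n3 : ‖cross f₁ f₂‖ = 1 := (norm_cross n1 h12).trans n2
  have h3 : (inner ℝ u (cross f₁ f₂) : ℝ) = 0 := by
    rw [real_inner_comm, ← inner_cross_cyclic]; exact hI
  have h31 := inner_cross_left_self f₁ f₂
  have h32 := inner_cross_right_self f₁ f₂
  have I12 := hI
  have I21 : (inner ℝ (cross u f₂) f₁ : ℝ) = 0 := by
    rw [inner_cross_right, real_inner_comm, hI, neg_zero]
  have I13 : (inner ℝ (cross u f₁) (cross f₁ f₂) : ℝ) = 0 := by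
    rw [cross_anticomm u f₁, inner_neg_left, inner_cross_cross, h2, h12]; simp
  have I23 : (inner ℝ (cross u f₂) (cross f₁ f₂) : ℝ) = 0 := by
    rw [cross_anticomm u f₂, cross_anticomm f₁ f₂, inner_neg_left, inner_neg_right,
      inner_cross_cross, h1, h21]; simp
  have I31 : (inner ℝ (cross u (cross f₁ f₂)) f₁ : ℝ) = 0 := by
    rw [inner_cross_right, real_inner_comm, I13, neg_zero]
  have I32 : (inner ℝ (cross u (cross f₁ f₂)) f₂ : ℝ) = 0 := by
    rw [inner_cross_right, real_inner_comm, I23, neg_zero]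
  refine ⟨nu, fun j => ?_, fun i j => ?_, fun i j => ?_⟩
  · fin_cases j; exacts [h1, h2, h3]
  · fin_cases i <;> fin_cases j
    exacts [inner_self_of_norm_one n1, h12, (real_inner_comm _ _).trans h31, h21,
      inner_self_of_norm_one n2, (real_inner_comm _ _).trans h32, h31, h32,
      inner_self_of_norm_one n3]
  · fin_cases i <;> fin_cases j
    exacts [inner_cross_right_self _ _, I12, I13, I21, inner_cross_right_self _ _, I23, I31, I32,
      inner_cross_right_self _ _]

/-- The Clifford relation for the orthogonal pair `u`, `f₁`. On these vectors the product with `f₁`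
is antilinear for the complex structure `u ×`. -/
theorem cross_cross_right {u f₁ f₂ : E7} (h1 : (inner ℝ u f₁ : ℝ) = 0)
    (h2 : (inner ℝ u f₂ : ℝ) = 0) (h12 : (inner ℝ f₁ f₂ : ℝ) = 0) :
    cross f₁ (cross u f₂) = -cross u (cross f₁ f₂) := by
  have h := cross_cross_add f₁ u f₂
  rw [h12, h2, real_inner_comm, h1] at h
  exact eq_neg_of_add_eq_zero_left (by simpa using h)

theorem cross_cross_left {u f₁ f₂ : E7} (h1 : (inner ℝ u f₁ : ℝ) = 0)
    (h2 : (inner ℝ u f₂ : ℝ) = 0) (h12 : (inner ℝ f₁ f₂ : ℝ) = 0) :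
    cross (cross u f₁) f₂ = -cross u (cross f₁ f₂) := by
  rw [cross_anticomm, cross_cross_right h2 h1 ((real_inner_comm _ _).trans h12), neg_neg,
    cross_anticomm f₂ f₁, map_neg]

/-! ### Four-dimensional stabilizers: the weights -/

namespace IsotropyData

variable {H Γ : Subgroup T2SU2} {ρ : T2SU2 → E7 →L[ℝ] E7} {U : LieK →L[ℝ] E7}
  {A : LieK →L[ℝ] E7 →L[ℝ] E7}

/-- On the complement of `u`, a copy of ℂ³, the singular torus derivation has three weights with sum
zero. It commutes with 𝔰𝔲(2), which therefore preserves each simple weight line and, having no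
invariant functionals, kills it. If the weights were distinct, 𝔰𝔲(2) would act trivially. So two of
them coincide and the third is minus twice their value, which is nonzero by faithfulness. -/
theorem exists_simple_weight (D : IsotropyData H Γ ρ U A) {s₀ t₀ : ℝ} (hne : s₀ ≠ 0 ∨ t₀ ≠ 0)
    (hc : U (s₀, t₀, 0) = 0) (hsu : ∀ X, U (0, 0, X) = 0) {u : E7} (nu : ‖u‖ = 1)
    (hufix : ∀ k ∈ H, ρ k u = u) (hukill : ∀ η, U η = 0 → A η u = 0) :
    ∃ (f : E7) (l : ℝ), ‖f‖ = 1 ∧ (inner ℝ u f : ℝ) = 0 ∧ l ≠ 0 ∧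
      A (s₀, t₀, 0) f = (-2 * l) • cross u f ∧ (∀ X, A (0, 0, X) f = 0) ∧
      (∀ v ∈ (assocSpan u f)ᗮ, A (s₀, t₀, 0) v = l • cross u v) ∧
      (∀ k ∈ H, ∃ z : ℂ, ρ k f = cmul u z f) := by
  set c : LieK := (s₀, t₀, 0) with hcdef
  have hC := D.isDer hc
  have hCu := hukill _ hc
  have hu0 : u ≠ 0 := by rintro rfl; simp at nu
  have h6 := finrank_orthogonal_E7 (ℝ ∙ u)
  rw [finrank_span_singleton (K := ℝ) hu0] at h6
  have hmemu {v : E7} : v ∈ (ℝ ∙ u)ᗮ ↔ (inner ℝ u v : ℝ) = 0 :=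
    Submodule.mem_orthogonal_singleton_iff_inner_right
  have hAu {η : LieK} (hη : U η = 0) {v : E7} (hv : v ∈ (ℝ ∙ u)ᗮ) : A η v ∈ (ℝ ∙ u)ᗮ := by
    refine (D.isDer hη).mem_orthogonal (fun v hv => ?_) hv
    obtain ⟨r, rfl⟩ := Submodule.mem_span_singleton.mp hv
    rw [map_smul, hukill _ hη, smul_zero]; exact Submodule.zero_mem _
  have hρu {k : T2SU2} (hk : k ∈ H) {v : E7} (hv : v ∈ (ℝ ∙ u)ᗮ) : ρ k v ∈ (ℝ ∙ u)ᗮ := by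
    rw [hmemu] at hv ⊢
    rw [← hv, ← (D.isG2 k hk).inner u v, hufix k hk]
  obtain ⟨l₁, f₁, hf1, n1, hC1⟩ := hC.exists_eigenvector nu hCu (V := (ℝ ∙ u)ᗮ)
    (by intro h; rw [h, finrank_bot] at h6; omega) (fun v hv => hmemu.mp hv)
    (fun v hv => hAu hc hv) (fun v _ => hmemu.mpr inner_cross_left)
  rw [hmemu] at hf1
  have h3 := finrank_assocSpan nu n1 hf1
  have h7 := finrank_orthogonal_E7 (assocSpan u f₁)
  obtain ⟨l₂, f₂, hf2', n2, hC2⟩ := hC.exists_eigenvector nu hCu (V := (assocSpan u f₁)ᗮ)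
    (by intro h; rw [h, finrank_bot] at h7; omega)
    (fun v hv => inner_eq_zero_of_mem (left_mem_assocSpan _ _) hv)
    (fun v hv => hC.mem_orthogonal (fun v hv => by
      obtain ⟨x, y, z, rfl⟩ := mem_assocSpan.mp hv
      rw [map_add, map_add, map_smul, map_smul, map_smul, hC.map_cross, hCu, hC1,
        map_smul, cross_cross_of_unit nu hf1, map_zero, LinearMap.zero_apply, zero_add, smul_zero,
        zero_add]
      exact Submodule.add_mem _ (Submodule.smul_mem _ _ (Submodule.smul_mem _ _
        (cross_mem_assocSpan _ _))) (Submodule.smul_mem _ _ (Submodule.smul_mem _ _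
        (Submodule.neg_mem _ (right_mem_assocSpan _ _))))) hv)
    (fun v hv => (crossClosed_assocSpan u f₁).cross_mem_orthogonal (left_mem_assocSpan _ _) hv)
  have hf2 : (inner ℝ u f₂ : ℝ) = 0 := inner_eq_zero_of_mem (left_mem_assocSpan _ _) hf2'
  have h12 : (inner ℝ f₁ f₂ : ℝ) = 0 := inner_eq_zero_of_mem (right_mem_assocSpan _ _) hf2'
  have hI : (inner ℝ (cross u f₁) f₂ : ℝ) = 0 := inner_eq_zero_of_mem (cross_mem_assocSpan _ _) hf2'
  have hf2F : f₂ ∉ assocSpan u f₁ := not_mem_of_mem_orthogonal hf2' (by rintro rfl; simp at n2)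
  have hf := isCFrame_of_cross nu n1 n2 hf1 hf2 h12 hI
  -- The Leibniz rule adds the weights, and antilinearity of the cross product reverses the sign.
  have hC3 : A c (cross f₁ f₂) = (-l₁ - l₂) • cross u (cross f₁ f₂) := by
    rw [hC.map_cross, hC1, hC2, map_smul, map_smul, LinearMap.smul_apply,
      cross_cross_left hf1 hf2 h12, cross_cross_right hf1 hf2 h12]
    module
  set f : Fin 3 → E7 := ![f₁, f₂, cross f₁ f₂] with hfdef
  set l : Fin 3 → ℝ := ![l₁, l₂, -l₁ - l₂] with hldef
  have hl (j : Fin 3) : A c (f j) = l j • cross u (f j) := by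
    fin_cases j; exacts [hC1, hC2, hC3]
  have hfu (j : Fin 3) : f j ∈ (ℝ ∙ u)ᗮ := hmemu.mpr (hf.orth j)
  have hfn (j : Fin 3) : ‖f j‖ = 1 := by
    have h := hf.inner_self j j
    rw [if_pos rfl, real_inner_self_eq_norm_sq] at h
    exact (pow_eq_one_iff_of_nonneg (norm_nonneg _) two_ne_zero).mp h
  have hr : LinearMap.range (cframe u f) = (ℝ ∙ u)ᗮ :=
    hf.range_cframe hfu (fun j => hmemu.mpr inner_cross_left) (by omega)
  have hz0 (hall : ∀ j, A c (f j) = 0) : False := by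
    have h0 := hC.eq_zero_of_assoc h3 (fun v hv => assocSpan_le hC.crossClosed_ker hCu (hall 0) hv)
      hf2F (hall 1)
    have := D.injective _ hc h0
    rw [hcdef] at this
    simp only [Prod.mk_eq_zero] at this
    tauto
  -- a simple eigenline is preserved by everything that commutes with `A c`
  have hline (j : Fin 3) (hj : ∀ i, i ≠ j → l i ≠ l j) {g : E7 →L[ℝ] E7}
      (hgmem : g (f j) ∈ (ℝ ∙ u)ᗮ) (hg : A c (g (f j)) = l j • cross u (g (f j))) :
      ∃ z : ℂ, g (f j) = cmul u z (f j) := by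
    refine IsCFrame.exists_eq_cmul (by rw [hr]; exact hgmem) fun b hb i hij => ?_
    exact (hf.mul_eq_of_der hC hCu hl (by rw [hb]; exact hg) i).resolve_left (hj i hij)
  have hρline (j : Fin 3) (hj : ∀ i, i ≠ j → l i ≠ l j) {k : T2SU2} (hk : k ∈ H) :
      ∃ z : ℂ, ρ k (f j) = cmul u z (f j) := by
    refine hline j hj (hρu hk (hfu j)) ?_
    rw [← D.rho_torus_comm hk hc, ← hcdef, hl, map_smul, (D.isG2 k hk).map_cross, hufix k hk]
  have hAline (j : Fin 3) (hj : ∀ i, i ≠ j → l i ≠ l j) (X : E3) :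
      ∃ z : ℂ, A (0, 0, X) (f j) = cmul u z (f j) := by
    refine hline j hj (hAu (hsu X) (hfu j)) ?_
    rw [D.torus_comm hc (hsu X), ← hcdef, hl, map_smul, (D.isDer (hsu X)).map_cross, hukill _ (hsu X)]
    simp
  -- Both the group and its Lie algebra act by complex scalars on the line. Scalars commute, so
  -- equivariance makes `X ↦ A (0, 0, X) (f j)` invariant under the adjoint action.
  have hkill (j : Fin 3) (hj : ∀ i, i ≠ j → l i ≠ l j) (X : E3) : A (0, 0, X) (f j) = 0 := by
    let μ : E3 →ₗ[ℝ] E7 :=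
      (ContinuousLinearMap.apply ℝ E7 (f j)).toLinearMap ∘ₗ A.toLinearMap ∘ₗ
        LinearMap.inr ℝ ℝ (ℝ × E3) ∘ₗ LinearMap.inr ℝ ℝ E3
    have hμ (X : E3) : μ X = A (0, 0, X) (f j) := rfl
    have h0 : μ = 0 := eq_zero_of_adjSU2_invariant μ fun Y X => by
      have hk : expK (0, 0, Y) ∈ H := D.expK_mem _ (hsu Y)
      obtain ⟨z, hz⟩ := hρline j hj hk
      obtain ⟨w, hw⟩ := hAline j hj X
      have hz0 : z ≠ 0 := by
        rintro rfl
        have := (D.isG2 _ hk).norm (f j)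
        rw [hz, hf.norm_cmul, norm_zero, hfn] at this
        exact zero_ne_one this
      have e1 := D.rho_A hk (hsu X) (f j)
      have e2 : adjK (expK (0, 0, Y)) (0, 0, X) = (0, 0, adjSU2 (expSU2 Y) X) := rfl
      rw [e2, hz, (D.isDer (hsu _)).map_cmul (hukill _ (hsu _)), hw,
        (D.isG2 _ hk).map_cmul (hufix _ hk), hz, ← cmul_mul nu (hf.orth j), mul_comm,
        cmul_mul nu (hf.orth j), ← hw] at e1
      rw [hμ, hμ]
      exact (cmul_injective nu (hmemu.mp (hAu (hsu _) (hfu j))) (hmemu.mp (hAu (hsu _) (hfu j)))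
        hz0 e1).symm
    exact (hμ X).symm.trans (LinearMap.congr_fun h0 X)
  have key (j : Fin 3) (r : ℝ) (hr0 : r ≠ 0) (hj : l j = -2 * r) (hi : ∀ i, i ≠ j → l i = r) :
      ∃ (f : E7) (l : ℝ), ‖f‖ = 1 ∧ (inner ℝ u f : ℝ) = 0 ∧ l ≠ 0 ∧
      A c f = (-2 * l) • cross u f ∧ (∀ X, A (0, 0, X) f = 0) ∧
      (∀ v ∈ (assocSpan u f)ᗮ, A c v = l • cross u v) ∧
      (∀ k ∈ H, ∃ z : ℂ, ρ k f = cmul u z f) := by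
    have hj' : ∀ i, i ≠ j → l i ≠ l j := fun i hij h => hr0 (by
      rw [hi i hij, hj] at h; linarith)
    refine ⟨f j, r, hfn j, hf.orth j, hr0, by rw [hl, hj], hkill j hj', fun v hv => ?_,
      fun k hk => hρline j hj' hk⟩
    have hv' : v ∈ LinearMap.range (cframe u f) := by
      rw [hr, hmemu]; exact inner_eq_zero_of_mem (left_mem_assocSpan _ _) hv
    obtain ⟨b, rfl⟩ := hv'
    have e1 : (inner ℝ (f j) (cframe u f b) : ℝ) = 0 :=
      inner_eq_zero_of_mem (right_mem_assocSpan _ _) hv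
    have e2 : (inner ℝ (cross u (f j)) (cframe u f b) : ℝ) = 0 :=
      inner_eq_zero_of_mem (cross_mem_assocSpan _ _) hv
    have hb : b j = 0 := by
      rw [cframe_eq_sum] at e1 e2
      have e1' := hf.orthonormal.inner_right_fintype
        (Sum.elim (fun j => (b j).re) (fun j => (b j).im)) (Sum.inl j)
      have e2' := hf.orthonormal.inner_right_fintype
        (Sum.elim (fun j => (b j).re) (fun j => (b j).im)) (Sum.inr j)
      exact Complex.ext (e1'.symm.trans e1) (e2'.symm.trans e2)
    rw [hf.der_cframe hC hCu hl, ← map_smul, ← map_smul]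
    congr 2
    ext i
    change (l i : ℂ) * b i = r • b i
    by_cases hij : i = j
    · rw [hij, hb]; simp
    · rw [hi i hij]; simp
  by_cases e12 : l₁ = l₂
  · refine key 2 l₁ ?_ ?_ ?_
    · rintro rfl
      refine hz0 fun j => ?_
      rw [hl]
      fin_cases j <;> simp [hldef, ← e12]
    · simp [hldef, ← e12]; ring
    · intro i hi
      fin_cases i
      · rfl
      · exact e12.symm
      · exact absurd rfl hi
  by_cases e13 : -l₁ - l₂ = l₁
  · have e2 : l₂ = -2 * l₁ := by linarith
    refine key 1 l₁ ?_ e2 ?_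
    · rintro rfl
      exact e12 (by rw [e2]; ring)
    · intro i hi
      fin_cases i
      · rfl
      · exact absurd rfl hi
      · exact e13
  by_cases e23 : -l₁ - l₂ = l₂
  · have e1 : l₁ = -2 * l₂ := by linarith
    refine key 0 l₂ ?_ e1 ?_
    · rintro rfl
      exact e12 (by rw [e1]; ring)
    · intro i hi
      fin_cases i
      · exact absurd rfl hi
      · rfl
      · exact e23
  -- With three distinct weights an element of 𝔰𝔲(2) kills `u`, `f₁` and `f₂`, hence is zero.
  exfalso
  have k0 := hkill 0 (fun i hi => by
    fin_cases i
    · exact absurd rfl hi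
    · exact Ne.symm e12
    · exact e13) (EuclideanSpace.single 0 1)
  have k1 := hkill 1 (fun i hi => by
    fin_cases i
    · exact e12
    · exact absurd rfl hi
    · exact e23) (EuclideanSpace.single 0 1)
  have hd := D.isDer (hsu (EuclideanSpace.single 0 1))
  have h0 := hd.eq_zero_of_assoc h3
    (fun v hv => assocSpan_le hd.crossClosed_ker (hukill _ (hsu _)) k0 hv) hf2F k1
  have := D.injective _ (hsu _) h0
  simp at this

end IsotropyData

/-! ### Unitary matrices of size two and their action on ℂ³ -/

theorem map_cframe_u2 {u f₁ f₂ f : E7} (hf : IsCFrame u ![f₁, f₂, f]) {g : E7 →L[ℝ] E7}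
    (hg : IsG2 g) (hgu : g u = u) {S : Matrix.unitaryGroup (Fin 2) ℂ}
    (h1 : g f₁ = cmul u (S.1 0 0) f₁ + cmul u (S.1 1 0) f₂)
    (h2 : g f₂ = cmul u (S.1 0 1) f₁ + cmul u (S.1 1 1) f₂)
    (h3 : g f = cmul u (S.1.det)⁻¹ f) (a : EuclideanSpace ℂ (Fin 3)) :
    g (cframe u ![f₁, f₂, f] a) =
      cframe u ![f₁, f₂, f] (WithLp.toLp 2 (u2ToSU3 S *ᵥ a.ofLp)) := by
  refine hf.map_cframe hg hgu (fun j => ?_) a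
  rw [Fin.sum_univ_three]
  fin_cases j
  · change g f₁ = cmul u (S.1 0 0) f₁ + cmul u (S.1 1 0) f₂ + cmul u 0 f
    rw [cmul_zero, add_zero, h1]
  · change g f₂ = cmul u (S.1 0 1) f₁ + cmul u (S.1 1 1) f₂ + cmul u 0 f
    rw [cmul_zero, add_zero, h2]
  · change g f = cmul u 0 f₁ + cmul u 0 f₂ + cmul u (S.1.det)⁻¹ f
    rw [cmul_zero, cmul_zero, zero_add, zero_add, h3]

theorem exists_circle_sq {w : ℂ} (hw : ‖w‖ = 1) : ∃ z : ℂ, ‖z‖ = 1 ∧ z ^ 2 = w := by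
  obtain ⟨z, hz⟩ := IsAlgClosed.exists_pow_nat_eq w (n := 2) two_pos
  refine ⟨z, ?_, hz⟩
  have h := congrArg norm hz
  rw [norm_pow, hw] at h
  exact (pow_eq_one_iff_of_nonneg (norm_nonneg _) two_ne_zero).mp h

/-- Dividing by a square root of the determinant, which has modulus one, moves a unitary matrix into
SU(2). -/
theorem exists_smul_su2Mat (S : Matrix.unitaryGroup (Fin 2) ℂ) :
    ∃ (z : ℂ) (b : EuclideanSpace ℂ (Fin 2)), ‖z‖ = 1 ∧ ‖b‖ = 1 ∧ S.1 = z • su2Mat b ∧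
      S.1.det = z ^ 2 := by
  have hdet : ‖S.1.det‖ = 1 := CStarRing.norm_of_mem_unitary (Matrix.det_of_mem_unitary S.2)
  obtain ⟨z, nz, hz⟩ := exists_circle_sq hdet
  have hz0 : z ≠ 0 := by rintro rfl; simp at nz
  have hzz : star z * z = 1 := by
    rw [mul_comm]
    change z * (starRingEnd ℂ) z = 1
    rw [Complex.mul_conj, Complex.normSq_eq_norm_sq, nz]; simp
  have hsu : z⁻¹ • S.1 ∈ Matrix.specialUnitaryGroup (Fin 2) ℂ := by
    rw [Matrix.mem_specialUnitaryGroup_iff]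
    constructor
    · rw [Matrix.mem_unitaryGroup_iff, star_smul, Matrix.smul_mul, Matrix.mul_smul,
        Matrix.mem_unitaryGroup_iff.mp S.2, smul_smul, star_inv₀, ← mul_inv, mul_comm, hzz, inv_one,
        one_smul]
    · rw [Matrix.det_smul, Fintype.card_fin, ← hz, inv_pow, inv_mul_cancel₀ (pow_ne_zero 2 hz0)]
  obtain ⟨b, nb, hb⟩ := exists_su2Mat hsu
  refine ⟨z, b, nz, nb, ?_, hz.symm⟩
  rw [← hb, smul_smul, mul_inv_cancel₀ hz0, one_smul]

open ComplexConjugate in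
theorem su2Mat_mul_diagonal_mem {b : EuclideanSpace ℂ (Fin 2)} (hb : ‖b‖ = 1) {z : ℂ}
    (hz : ‖z‖ = 1) : su2Mat b * Matrix.diagonal ![1, z] ∈ Matrix.unitaryGroup (Fin 2) ℂ := by
  refine mul_mem (Matrix.mem_specialUnitaryGroup_iff.mp (su2Mat_mem hb)).1 ?_
  rw [Matrix.mem_unitaryGroup_iff, Matrix.star_eq_conjTranspose, Matrix.diagonal_conjTranspose,
    Matrix.diagonal_mul_diagonal, ← Matrix.diagonal_one]
  congr 1
  funext i
  fin_cases i
  · simp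
  · change z * conj z = 1
    rw [Complex.mul_conj, Complex.normSq_eq_norm_sq, hz]; simp

/-! ### Four-dimensional stabilizers: the unitary group -/

namespace IsotropyData

variable {H Γ : Subgroup T2SU2} {ρ : T2SU2 → E7 →L[ℝ] E7} {U : LieK →L[ℝ] E7}
  {A : LieK →L[ℝ] E7 →L[ℝ] E7}

/-- The normal space is the complement of `u`. In it 𝔰𝔲(2) kills the simple weight line `f` and
generates a group transitive on the unit sphere of the remaining ℂ², while the singular torus
direction acts by `z` there and by `z⁻²` on `f`. Since every unitary matrix is a scalar times an
element of SU(2), this produces all of U(2). Conversely, an element of the stabilizer acts by a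
scalar on `f`, and its image of `f₁` determines that of `f₂ = f × f₁`. -/
theorem exists_u2_frame (D : IsotropyData H Γ ρ U A) {s₀ t₀ : ℝ} (hne : s₀ ≠ 0 ∨ t₀ ≠ 0)
    (hc : U (s₀, t₀, 0) = 0) (h4 : finrank ℝ (LinearMap.ker U.toLinearMap) = 4)
    (hsu : ∀ X, U (0, 0, X) = 0) :
    ∃ e : EuclideanSpace ℂ (Fin 3) →ₗ[ℝ] E7,
      LinearMap.range e = (LinearMap.range U.toLinearMap)ᗮ ∧ (∀ a, ‖e a‖ = ‖a‖) ∧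
      (∀ S : Matrix.unitaryGroup (Fin 2) ℂ, ∃ k ∈ Subgroup.closure (expK '' {ζ | U ζ = 0}),
        ∀ a, ρ k (e a) = e (WithLp.toLp 2 (u2ToSU3 S *ᵥ a.ofLp))) ∧
      (∀ k ∈ H, ∃ S : Matrix.unitaryGroup (Fin 2) ℂ,
        ∀ a, ρ k (e a) = e (WithLp.toLp 2 (u2ToSU3 S *ᵥ a.ofLp))) ∧
      (∀ k ∈ H, (∀ a, ρ k (e a) = e a) → ρ k = ContinuousLinearMap.id ℝ E7) := by
  obtain ⟨u, huR, nu, hufix, hukill⟩ := D.exists_unit_torus hne hc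
  obtain ⟨f, l, nf, huf, hl0, hCf, hAf, hCv, hρf⟩ :=
    D.exists_simple_weight hne hc hsu nu hufix hukill
  have hu0 : u ≠ 0 := by rintro rfl; simp at nu
  have hN : finrank ℝ ↥(LinearMap.range U.toLinearMap)ᗮ = 3 + 3 := by
    rw [finrank_orthogonal_range, h4]
  have hR1 : finrank ℝ (LinearMap.range U.toLinearMap) = 1 := by
    have := finrank_ker_add U; omega
  have hR : (ℝ ∙ u) = LinearMap.range U.toLinearMap :=
    Submodule.eq_of_le_of_finrank_eq ((Submodule.span_singleton_le_iff_mem _ _).mpr huR)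
      ((finrank_span_singleton (K := ℝ) hu0).trans hR1.symm)
  rw [← hR] at hN ⊢
  have hmemu {v : E7} : v ∈ (ℝ ∙ u)ᗮ ↔ (inner ℝ u v : ℝ) = 0 :=
    Submodule.mem_orthogonal_singleton_iff_inner_right
  set c : LieK := (s₀, t₀, 0) with hcdef
  have hC := D.isDer hc
  have hCu := hukill _ hc
  have h3 := finrank_assocSpan nu nf huf
  have h7 := finrank_orthogonal_E7 (assocSpan u f)
  have hcl := crossClosed_assocSpan u f
  obtain ⟨f₁, hf1, n1, -⟩ := exists_unit_mem_orthogonal (F := (assocSpan u f)ᗮ) (G := ⊥)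
    (by simp; omega)
  have hort {w : E7} (hw : w ∈ (assocSpan u f)ᗮ) {v : E7} (hv : v ∈ assocSpan u f) :
      (inner ℝ v w : ℝ) = 0 := inner_eq_zero_of_mem hv hw
  have huf1 := hort hf1 (left_mem_assocSpan _ _)
  have hff1 := hort hf1 (right_mem_assocSpan _ _)
  have hf1f : (inner ℝ f₁ f : ℝ) = 0 := (real_inner_comm _ _).trans hff1
  have hIff1 := hort hf1 (cross_mem_assocSpan _ _)
  set f₂ := cross f f₁ with hf2def
  have hf2 : f₂ ∈ (assocSpan u f)ᗮ := hcl.cross_mem_orthogonal (right_mem_assocSpan _ _) hf1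
  have hfr2 : IsCFrame u ![f₁, f₂] := isCFrame_cross nu nf n1 huf huf1 hff1 hIff1
  -- Defining `f₂` as `f × f₁` makes `f` the cross product of the pair, so the simple weight vector
  -- itself completes the triple.
  have h12 : cross f₁ f₂ = f := by
    rw [hf2def, cross_anticomm f f₁, map_neg, cross_cross_of_unit n1 hf1f, neg_neg]
  have hfr : IsCFrame u ![f₁, f₂, f] := by
    have h := isCFrame_of_cross nu n1 ((norm_cross nf hff1).trans n1) huf1
      (hort hf2 (left_mem_assocSpan _ _)) (hfr2.inner_self 0 1) (hfr2.inner_cross 0 1)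
    rwa [← hf2def, h12] at h
  have hr : LinearMap.range (cframe u ![f₁, f₂, f]) = (ℝ ∙ u)ᗮ :=
    hfr.range_cframe (fun j => hmemu.mpr (hfr.orth j)) (fun j => hmemu.mpr inner_cross_left) hN
  have hr2 : LinearMap.range (cframe u ![f₁, f₂]) = (assocSpan u f)ᗮ := by
    refine hfr2.range_cframe (fun j => ?_) (fun j => ?_) (by omega)
    · fin_cases j; exacts [hf1, hf2]
    · fin_cases j
      exacts [hcl.cross_mem_orthogonal (left_mem_assocSpan _ _) hf1,
        hcl.cross_mem_orthogonal (left_mem_assocSpan _ _) hf2]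
  have he2 (b : EuclideanSpace ℂ (Fin 2)) :
      cframe u ![f₁, f₂] b = cmul u (b 0) f₁ + cmul u (b 1) f₂ := by
    rw [cframe_apply, Fin.sum_univ_two]; rfl
  -- the action of `SU(2)`
  have hexpf (X : E3) : ρ (expK (0, 0, X)) f = f := by
    rw [D.exp _ (hsu X), der_exp_apply (D.isDer (hsu X)) nu (hukill _ (hsu X)) huf (l := 0)
      (by rw [hAf, zero_smul]), Circle.exp_zero, Circle.coe_one, cmul_one]
  have htrans {w : E7} (hw : w ∈ (assocSpan u f)ᗮ) (nw : ‖w‖ = 1) :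
      ∃ X, ρ (expK (0, 0, X)) f₁ = w := by
    obtain ⟨X, hX⟩ := exists_exp_apply_eq hcl h3
      (B := A.toLinearMap ∘ₗ LinearMap.inr ℝ ℝ (ℝ × E3) ∘ₗ LinearMap.inr ℝ ℝ E3)
      (fun X => D.isDer (hsu X)) (fun X v hv => assocSpan_le (D.isDer (hsu X)).crossClosed_ker
        (hukill _ (hsu X)) (hAf X) hv)
      (fun X hX => by
        have h5 := D.injective _ (hsu X) hX
        simpa using h5) hf1 hw n1 nw
    exact ⟨X, (congrArg (fun g : E7 →L[ℝ] E7 => g f₁) (D.exp _ (hsu X))).trans hX⟩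
  have hsu2 {X : E3} {b : EuclideanSpace ℂ (Fin 2)}
      (hb : ρ (expK (0, 0, X)) f₁ = cframe u ![f₁, f₂] b) (a : EuclideanSpace ℂ (Fin 2)) :=
    map_cframe_su2 hfr2 nf huf hff1 (D.isG2 _ (D.expK_mem _ (hsu X)))
      (hufix _ (D.expK_mem _ (hsu X))) (hexpf X) hb a
  have hcol {X : E3} {b : EuclideanSpace ℂ (Fin 2)}
      (hb : ρ (expK (0, 0, X)) f₁ = cframe u ![f₁, f₂] b) :
      ρ (expK (0, 0, X)) f₂ = cmul u (su2Mat b 0 1) f₁ + cmul u (su2Mat b 1 1) f₂ := by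
    have h := hsu2 hb (EuclideanSpace.single 1 1)
    rw [← hf2def, cframe_single, he2] at h
    refine h.trans ?_
    congr 2 <;> simp [Matrix.mulVec, dotProduct]
  refine ⟨cframe u ![f₁, f₂, f], hr, hfr.norm_cframe, ?_, ?_, ?_⟩
  · intro S
    obtain ⟨z, b, nz, nb, hS, hdet⟩ := exists_smul_su2Mat S
    obtain ⟨X, hX⟩ := htrans (hr2 ▸ LinearMap.mem_range_self _ b) ((hfr2.norm_cframe b).trans nb)
    obtain ⟨α, hα⟩ : ∃ α : ℝ, (Circle.exp α : ℂ) = z :=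
      ⟨_, congrArg Subtype.val (Circle.exp_arg (⟨z, mem_sphere_zero_iff_norm.mpr nz⟩ : Circle))⟩
    have hζ : U ((α / l) • c) = 0 := by rw [map_smul, hc, smul_zero]
    have hk1 := D.expK_mem _ hζ
    have hk2 := D.expK_mem _ (hsu X)
    have hA (v : E7) : A ((α / l) • c) v = (α / l) • A c v := by rw [map_smul]; rfl
    have hzv {v : E7} (hv : v ∈ (assocSpan u f)ᗮ) : ρ (expK ((α / l) • c)) v = cmul u z v := by
      rw [D.exp _ hζ, der_exp_apply (D.isDer hζ) nu (hukill _ hζ)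
        (hort hv (left_mem_assocSpan _ _)) (l := α) _, hα]
      rw [hA, hCv v hv, smul_smul, div_mul_cancel₀ _ hl0]
    -- The weight `-2 l` on `f` turns the angle `α` into `-2 α`, giving the inverse of the
    -- determinant `z²`.
    have hzf : ρ (expK ((α / l) • c)) f = cmul u (z ^ 2)⁻¹ f := by
      rw [D.exp _ hζ, der_exp_apply (D.isDer hζ) nu (hukill _ hζ) huf (l := -(2 * α)) _]
      · rw [Circle.exp_neg, two_mul, Circle.exp_add, ← sq, Circle.coe_inv, Circle.coe_pow, hα]
      · rw [hA, hCf, smul_smul]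
        congr 1
        field_simp
    refine ⟨expK ((α / l) • c) * expK (0, 0, X),
      mul_mem (Subgroup.subset_closure ⟨_, hζ, rfl⟩) (Subgroup.subset_closure ⟨_, hsu X, rfl⟩), ?_⟩
    have hz (w : ℂ) {v : E7} (hv : v ∈ (assocSpan u f)ᗮ) :
        ρ (expK ((α / l) • c)) (cmul u w v) = cmul u (z * w) v := by
      rw [(D.isG2 _ hk1).map_cmul (hufix _ hk1), hzv hv,
        ← cmul_mul nu (hort hv (left_mem_assocSpan _ _)), mul_comm]
    have hS' (i j : Fin 2) : S.1 i j = z * su2Mat b i j := by rw [hS]; rfl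
    refine map_cframe_u2 hfr (D.isG2 _ (H.mul_mem hk1 hk2)) (hufix _ (H.mul_mem hk1 hk2)) ?_ ?_ ?_
    · rw [D.map_mul _ hk1 _ hk2, hX, he2, map_add, hz _ hf1, hz _ hf2, hS', hS']; rfl
    · rw [D.map_mul _ hk1 _ hk2, hcol hX, map_add, hz _ hf1, hz _ hf2, hS', hS']
    · rw [D.map_mul _ hk1 _ hk2, hexpf, hzf, hdet]
  · intro k hk
    obtain ⟨z, hz⟩ := hρf k hk
    have hg := D.isG2 k hk
    have nz : ‖z‖ = 1 := by
      have h := hfr.norm_cmul z 2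
      change ‖cmul u z f‖ = ‖z‖ at h
      rw [← h, ← hz, hg.norm, nf]
    have hzz : z * (starRingEnd ℂ) z = 1 := by
      rw [Complex.mul_conj, Complex.normSq_eq_norm_sq, nz]; simp
    have hw : ρ k f₁ ∈ (assocSpan u f)ᗮ := by
      refine D.rho_mem_orthogonal hk (fun k hk v hv => ?_) hf1
      obtain ⟨x, y, w, rfl⟩ := mem_assocSpan.mp hv
      obtain ⟨z, hz⟩ := hρf k hk
      have h5 : ρ k f ∈ assocSpan u f := by
        rw [hz]; exact cmul_mem (right_mem_assocSpan _ _) (cross_mem_assocSpan _ _) _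
      rw [map_add, map_add, map_smul, map_smul, map_smul, (D.isG2 k hk).map_cross, hufix k hk]
      exact Submodule.add_mem _ (Submodule.add_mem _ (Submodule.smul_mem _ _
        (left_mem_assocSpan _ _)) (Submodule.smul_mem _ _ h5)) (Submodule.smul_mem _ _
        (hcl _ (left_mem_assocSpan _ _) _ h5))
    obtain ⟨X, hX⟩ := htrans hw ((hg.norm _).trans n1)
    obtain ⟨b, hb⟩ : ρ k f₁ ∈ LinearMap.range (cframe u ![f₁, f₂]) := by rw [hr2]; exact hw
    have nb : ‖b‖ = 1 := by rw [← hfr2.norm_cframe, hb, hg.norm, n1]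
    rw [← hb] at hX
    have hm := D.expK_mem _ (hsu X)
    -- On `f₂ = f × f₁` the element `k` differs from the matching one-parameter element only by the
    -- scalar on `f`, which leaves the antilinear product conjugated.
    have hf2k : ρ k f₂ = cmul u ((starRingEnd ℂ) z) (ρ (expK (0, 0, X)) f₂) := by
      rw [hf2def, hg.map_cross, hz, (D.isG2 _ hm).map_cross, hexpf, hX, hb]
      simp only [cmul_def, map_add, map_smul, LinearMap.add_apply, LinearMap.smul_apply,
        Complex.conj_re, Complex.conj_im]
      rw [cross_cross_left huf (hort hw (left_mem_assocSpan _ _))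
        (hort hw (right_mem_assocSpan _ _))]
      module
    -- The first column is the image of `f₁`; the second is the SU(2) column multiplied by the
    -- conjugate of `z`, so that the inverse determinant is `z`.
    let S : Matrix.unitaryGroup (Fin 2) ℂ :=
      ⟨su2Mat b * Matrix.diagonal ![1, (starRingEnd ℂ) z],
        su2Mat_mul_diagonal_mem nb (by rw [RCLike.norm_conj, nz])⟩
    have hS0 (i : Fin 2) : S.1 i 0 = su2Mat b i 0 :=
      (Matrix.mul_diagonal _ _ _ _).trans (mul_one _)
    have hS1 (i : Fin 2) : S.1 i 1 = su2Mat b i 1 * (starRingEnd ℂ) z := Matrix.mul_diagonal _ _ _ _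
    have hdet : (S.1.det)⁻¹ = z := by
      have h : S.1.det = (starRingEnd ℂ) z := by
        change (su2Mat b * Matrix.diagonal ![1, (starRingEnd ℂ) z]).det = _
        rw [Matrix.det_mul, (Matrix.mem_specialUnitaryGroup_iff.mp (su2Mat_mem nb)).2,
          Matrix.det_diagonal, Fin.prod_univ_two]
        simp
      rw [h]
      exact inv_eq_of_mul_eq_one_left hzz
    refine ⟨S, map_cframe_u2 hfr hg (hufix k hk) ?_ ?_ ?_⟩
    · rw [← hb, he2, hS0, hS0]; rfl
    · rw [hf2k, hcol hX, cmul_vadd, hS1, hS1, ← cmul_mul nu huf1,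
        ← cmul_mul nu (hort hf2 (left_mem_assocSpan _ _)), mul_comm, mul_comm (su2Mat b 1 1)]
    · rw [hdet, hz]
  · intro k hk h
    refine (D.isG2 k hk).ext_of_finrank isG2_id (F := (ℝ ∙ u)ᗮ) (fun v hv => ?_) (by omega)
    rw [← hr] at hv
    obtain ⟨a, rfl⟩ := hv
    exact h a

end IsotropyData

/-! ### Isomorphisms of compact groups -/

/-- Two compact groups with the same orbits of faithful representations are isomorphic. -/
theorem exists_continuousMulEquiv {S L W : Type*} [Mul S] [Group L] [TopologicalSpace S]
    [TopologicalSpace L] [TopologicalSpace W] [CompactSpace S] [T2Space S]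
    [CompactSpace L] {m : S → W → W} (hm : ∀ s s' a, m (s * s') a = m s (m s' a))
    (hmc : ∀ a, Continuous fun s => m s a) (hmi : ∀ s s', (∀ a, m s a = m s' a) → s = s')
    {r : L → E7 → E7} (hr1 : ∀ v, r 1 v = v) (hr : ∀ l l' v, r (l * l') v = r l (r l' v))
    (hrc : ∀ v, Continuous fun l => r l v) {e : W → E7} (hec : Continuous e)
    (hei : Function.Injective e) (h1 : ∀ s, ∃ l, ∀ a, r l (e a) = e (m s a))
    (h2 : ∀ l, ∃ s, ∀ a, r l (e a) = e (m s a)) (hf : ∀ l, (∀ a, r l (e a) = e a) → l = 1) :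
    ∃ σ : S ≃ₜ* L, ∀ s a, r (σ s) (e a) = e (m s a) := by
  choose f hfs using h1
  choose g hgs using h2
  have huniq {l l' : L} (h : ∀ a, r l (e a) = r l' (e a)) : l = l' := by
    have h3 : l'⁻¹ * l = 1 := hf _ fun a => by
      rw [hr, h, ← hr, inv_mul_cancel, hr1]
    exact (inv_mul_eq_one.mp h3).symm
  have hgf (s : S) : g (f s) = s := hmi _ _ fun a => hei (by rw [← hgs, hfs])
  have hfg (l : L) : f (g l) = l := huniq fun a => by rw [hfs, ← hgs]
  let E : S ≃* L :=
    { toFun := f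
      invFun := g
      left_inv := hgf
      right_inv := hfg
      map_mul' := fun s s' => huniq fun a => by rw [hfs, hr, hfs, hfs, hm] }
  have hgc : Continuous g := by
    rw [continuous_iff_isClosed]
    intro C hC
    -- The graph of `g` is closed, and projecting along the compact group `S` is a closed map, so
    -- preimages of closed sets under `g` are closed.
    have hG : IsClosed {p : S × L | ∀ a, r p.2 (e a) = e (m p.1 a)} := by
      simp only [Set.ofPred_forall]
      exact isClosed_iInter fun a => isClosed_eq ((hrc _).comp continuous_snd)
        (hec.comp ((hmc a).comp continuous_fst))
    have h3 := isClosedMap_snd_of_compactSpace _ (hG.inter (hC.preimage continuous_fst))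
    convert h3 using 1
    ext l
    constructor
    · intro hl
      exact ⟨(g l, l), ⟨hgs l, hl⟩, rfl⟩
    · rintro ⟨⟨s, l⟩, ⟨hsl, hs⟩, rfl⟩
      have : g l = s := hmi _ _ fun a => hei (by rw [← hgs, hsl])
      exact Set.mem_preimage.mpr (this ▸ hs)
  let F : L ≃ₜ S := Continuous.homeoOfEquivCompactToT2 (f := E.symm.toEquiv) hgc
  exact ⟨{ E with
    continuous_toFun := F.symm.continuous
    continuous_invFun := hgc }, hfs⟩

theorem isCompact_matrix_ball {n : Type*} {𝕜 : Type*} [RCLike 𝕜] :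
    IsCompact {A : Matrix n n 𝕜 | ∀ i j, ‖A i j‖ ≤ 1} := by
  have h := isCompact_univ_pi (ι := n) (X := fun _ => n → 𝕜) (s := fun _ =>
    Set.univ.pi fun _ => Metric.closedBall (0 : 𝕜) 1) fun _ =>
      isCompact_univ_pi fun _ => isCompact_closedBall _ _
  have e : {A : Matrix n n 𝕜 | ∀ i j, ‖A i j‖ ≤ 1} = Set.univ.pi fun _ : n =>
      Set.univ.pi fun _ : n => Metric.closedBall (0 : 𝕜) 1 :=
    Set.ext fun A => ⟨fun h i _ j _ => mem_closedBall_zero_iff.mpr (h i j),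
      fun h i j => mem_closedBall_zero_iff.mp (h i trivial j trivial)⟩
  rw [e]
  exact h

/-! ### Compactness of the matrix groups -/

section Matrices

variable {n : Type*} [Fintype n] [DecidableEq n] {𝕜 : Type*} [RCLike 𝕜]

theorem isClosed_unitaryGroup : IsClosed (Matrix.unitaryGroup n 𝕜 : Set (Matrix n n 𝕜)) := by
  have e : (Matrix.unitaryGroup n 𝕜 : Set (Matrix n n 𝕜)) = {A | A * star A = 1} := by
    ext A; exact Matrix.mem_unitaryGroup_iff
  rw [e]
  exact isClosed_eq (continuous_id.matrix_mul continuous_id.star) continuous_const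

theorem isClosed_specialUnitaryGroup :
    IsClosed (Matrix.specialUnitaryGroup n 𝕜 : Set (Matrix n n 𝕜)) := by
  have e : (Matrix.specialUnitaryGroup n 𝕜 : Set (Matrix n n 𝕜)) =
      (Matrix.unitaryGroup n 𝕜 : Set (Matrix n n 𝕜)) ∩ {A | A.det = 1} := by
    ext A; exact Matrix.mem_specialUnitaryGroup_iff
  rw [e]
  exact isClosed_unitaryGroup.inter (isClosed_eq continuous_id.matrix_det continuous_const)

theorem isCompact_unitaryGroup : IsCompact (Matrix.unitaryGroup n 𝕜 : Set (Matrix n n 𝕜)) :=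
  isCompact_matrix_ball.of_isClosed_subset isClosed_unitaryGroup
    fun _ hA i j => entry_norm_bound_of_unitary hA i j

theorem isCompact_specialUnitaryGroup :
    IsCompact (Matrix.specialUnitaryGroup n 𝕜 : Set (Matrix n n 𝕜)) :=
  isCompact_unitaryGroup.of_isClosed_subset isClosed_specialUnitaryGroup
    fun _ hA => (Matrix.mem_specialUnitaryGroup_iff.mp hA).1

instance : CompactSpace (Matrix.unitaryGroup n 𝕜) :=
  isCompact_iff_compactSpace.mp isCompact_unitaryGroup

instance : CompactSpace (Matrix.specialUnitaryGroup n 𝕜) :=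
  isCompact_iff_compactSpace.mp isCompact_specialUnitaryGroup

instance : CompactSpace (Matrix.specialOrthogonalGroup n ℝ) :=
  isCompact_iff_compactSpace.mp isCompact_specialUnitaryGroup

end Matrices

section MatAct

variable {n : Type*} [Fintype n] {𝕜 : Type*} [RCLike 𝕜]

/-- The linear action of a matrix on a Euclidean space. -/
def matAct (A : Matrix n n 𝕜) (a : EuclideanSpace 𝕜 n) : EuclideanSpace 𝕜 n :=
  WithLp.toLp 2 (A *ᵥ a.ofLp)

theorem matAct_mul (A B : Matrix n n 𝕜) (a : EuclideanSpace 𝕜 n) :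
    matAct (A * B) a = matAct A (matAct B a) := by
  simp [matAct, Matrix.mulVec_mulVec]

theorem continuous_matAct (a : EuclideanSpace 𝕜 n) :
    Continuous fun A : Matrix n n 𝕜 => matAct A a :=
  (PiLp.continuous_toLp 2 _).comp (continuous_id.matrix_mulVec continuous_const)

theorem matAct_injective [DecidableEq n] {A B : Matrix n n 𝕜} (h : ∀ a, matAct A a = matAct B a) : A = B := by
  ext i j
  have h1 := congrArg (fun v : EuclideanSpace 𝕜 n => v i) (h (EuclideanSpace.single j 1))
  simpa [matAct] using h1

end MatAct

theorem u2ToSU3_mul (A B : Matrix.unitaryGroup (Fin 2) ℂ) :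
    u2ToSU3 (A * B) = u2ToSU3 A * u2ToSU3 B := by
  have hdet : (A * B).1.det = A.1.det * B.1.det := Matrix.det_mul _ _
  ext i j
  fin_cases i <;> fin_cases j <;>
    simp [u2ToSU3, Matrix.mul_apply, Fin.sum_univ_three, Fin.sum_univ_two, mul_comm]

theorem u2ToSU3_injective {A B : Matrix.unitaryGroup (Fin 2) ℂ} (h : u2ToSU3 A = u2ToSU3 B) :
    A = B := by
  have h' (i j : Fin 3) : u2ToSU3 A i j = u2ToSU3 B i j := by rw [h]
  apply Subtype.ext
  ext i j
  fin_cases i <;> fin_cases j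
  exacts [h' 0 0, h' 0 1, h' 1 0, h' 1 1]

theorem continuous_u2ToSU3 : Continuous u2ToSU3 := by
  have hc (i j : Fin 2) : Continuous fun A : Matrix.unitaryGroup (Fin 2) ℂ => A.1 i j :=
    continuous_subtype_val.matrix_elem i j
  refine continuous_matrix fun i j => ?_
  fin_cases i <;> fin_cases j
  · exact hc 0 0
  · exact hc 0 1
  · exact continuous_const
  · exact hc 1 0
  · exact hc 1 1
  · exact continuous_const
  · exact continuous_const
  · exact continuous_const
  · refine Continuous.inv₀ continuous_subtype_val.matrix_det fun A h => ?_
    have h1 : ‖A.1.det‖ = 1 := CStarRing.norm_of_mem_unitary (Matrix.det_of_mem_unitary A.2)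
    rw [h, norm_zero] at h1
    exact zero_ne_one h1

/-! ### The stabilizers in the effective group -/

section Stabilizer

set_option linter.unusedSectionVars false

variable {M : Type*} [TopologicalSpace M] [ChartedSpace E7 M] [IsManifold (𝓡 7) ∞ M]
  [MulAction T2SU2 M]

/-- The projection from the stabilizer in `T² × SU(2)` to the stabilizer in the effective group. -/
def toStab (x : M) : MulAction.stabilizer T2SU2 x →* MulAction.stabilizer (EffGroup M) x where
  toFun k := ⟨QuotientGroup.mk k.1, k.2⟩
  map_one' := rfl
  map_mul' _ _ := rfl

theorem toStab_surjective (x : M) : Function.Surjective (toStab x) := by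
  rintro ⟨g, hg⟩
  obtain ⟨k, rfl⟩ := QuotientGroup.mk_surjective g
  exact ⟨⟨k, hg⟩, rfl⟩

theorem continuous_toStab (x : M) : Continuous (toStab x) :=
  (QuotientGroup.continuous_mk.comp continuous_subtype_val).subtype_mk _

/-- The quotient map of the groups is open, and the stabilizer upstairs is the full preimage of the
one downstairs. Continuity on the effective stabilizer can therefore be tested upstairs. -/
theorem isOpenMap_toStab (x : M) : IsOpenMap (toStab x) := by
  rintro _ ⟨V, hV, rfl⟩
  refine ⟨_, QuotientGroup.isOpenMap_coe V hV, ?_⟩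
  ext ⟨g, hg⟩
  constructor
  · rintro ⟨k, hk, rfl⟩
    exact ⟨⟨k, hg⟩, hk, rfl⟩
  · rintro ⟨⟨k, hkx⟩, hk, h⟩
    exact ⟨k, hk, congrArg Subtype.val h⟩

theorem isQuotientMap_toStab (x : M) : Topology.IsQuotientMap (toStab x) :=
  (isOpenMap_toStab x).isQuotientMap (continuous_toStab x) (toStab_surjective x)

theorem isotropy_toStab (x : M) (k : MulAction.stabilizer T2SU2 x) (v : E7) :
    (isotropy x (toStab x k) : E7 →L[ℝ] E7) v = tr (k : T2SU2) x v := rfl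

theorem compactSpace_stabilizer [T2Space M] (hs : IsSmoothAction M) (x : M) :
    CompactSpace (MulAction.stabilizer (EffGroup M) x) := by
  have hc : IsClosed (MulAction.stabilizer T2SU2 x : Set T2SU2) :=
    isClosed_eq (contMDiff_smul_right hs x).continuous continuous_const
  have : CompactSpace (MulAction.stabilizer T2SU2 x) :=
    isCompact_iff_compactSpace.mp hc.isCompact
  exact (toStab_surjective x).compactSpace (continuous_toStab x)

theorem compactSpace_stabIdComponent [T2Space M] (hs : IsSmoothAction M) (x : M) :
    CompactSpace (stabIdComponent x) := by
  have := compactSpace_stabilizer hs x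
  exact isCompact_iff_compactSpace.mp
    (isClosed_connectedComponent (x := (1 : MulAction.stabilizer (EffGroup M) x))).isCompact

theorem continuous_isotropy (hs : IsSmoothAction M) (x : M) (v : E7) :
    Continuous fun g : MulAction.stabilizer (EffGroup M) x => (isotropy x g : E7 →L[ℝ] E7) v := by
  rw [(isQuotientMap_toStab x).continuous_iff]
  exact (continuous_tr_stabilizer hs x).clm_apply continuous_const

theorem isotropy_mul (hs : IsSmoothAction M) (x : M)
    (g h : MulAction.stabilizer (EffGroup M) x) (v : E7) :
    (isotropy x (g * h) : E7 →L[ℝ] E7) v =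
      (isotropy x g : E7 →L[ℝ] E7) ((isotropy x h : E7 →L[ℝ] E7) v) := by
  obtain ⟨k, rfl⟩ := toStab_surjective x g
  obtain ⟨l, rfl⟩ := toStab_surjective x h
  rw [← map_mul, isotropy_toStab, isotropy_toStab, isotropy_toStab]
  have h1 := tr_mul hs (k : T2SU2) (l : T2SU2) x
  have hl : (l : T2SU2) • x = x := l.2
  rw [hl] at h1
  exact DFunLike.congr_fun h1 v

theorem isotropy_one (x : M) (v : E7) :
    (isotropy x (1 : MulAction.stabilizer (EffGroup M) x) : E7 →L[ℝ] E7) v = v := by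
  rw [← map_one (toStab x), isotropy_toStab]
  exact DFunLike.congr_fun (tr_one x) v

/-- Each exponential is joined to the identity by its one-parameter subgroup inside the stabilizer,
and the identity component is a subgroup. -/
theorem mem_stabIdComponent_of_mem_closure [T2Space M] (hs : IsSmoothAction M) {x : M} {k : T2SU2}
    (hk : k ∈ Subgroup.closure (expK '' {ζ | infK x ζ = 0})) :
    ∃ h : k • x = x, toStab x ⟨k, h⟩ ∈ stabIdComponent x := by
  have hle : Subgroup.closure (expK '' {ζ | infK x ζ = 0}) ≤
      ((stabIdComponent x).comap (toStab x)).map (MulAction.stabilizer T2SU2 x).subtype := by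
    rw [Subgroup.closure_le]
    rintro _ ⟨ζ, hζ, rfl⟩
    have hζ' : infK x ζ = 0 := hζ
    have hst (t : ℝ) : expK (t • ζ) • x = x :=
      expK_smul_eq_of_infK_eq_zero hs (by rw [map_smul, hζ', smul_zero])
    let c : ℝ → MulAction.stabilizer (EffGroup M) x := fun t => toStab x ⟨expK (t • ζ), hst t⟩
    have hc : Continuous c := (continuous_toStab x).comp
      ((continuous_expK.comp (continuous_id.smul continuous_const)).subtype_mk _)
    have h0 : c 0 = 1 := by
      rw [← map_one (toStab x)]
      refine congrArg (toStab x) (Subtype.ext ?_)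
      change expK ((0 : ℝ) • ζ) = 1
      rw [zero_smul, expK_zero]
    have hsub := (isPreconnected_range hc).subset_connectedComponent (x := 1) ⟨0, h0⟩
    have e1 : (1 : ℝ) • ζ = ζ := one_smul ℝ ζ
    refine ⟨⟨expK ζ, e1 ▸ hst 1⟩, ?_, rfl⟩
    have h1 : c 1 ∈ connectedComponent (1 : MulAction.stabilizer (EffGroup M) x) := hsub ⟨1, rfl⟩
    have h2 : c 1 = toStab x ⟨expK ζ, e1 ▸ hst 1⟩ :=
      congrArg (toStab x) (Subtype.ext (congrArg expK e1))
    rw [h2] at h1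
    exact h1
  obtain ⟨⟨l, hl⟩, h1, rfl⟩ := hle hk
  exact ⟨hl, h1⟩

end Stabilizer

/-! ### From the linear model back to the tangent space -/

section Transfer

set_option linter.unusedSectionVars false

variable {M : Type*} [TopologicalSpace M] [ChartedSpace E7 M] [IsManifold (𝓡 7) ∞ M]
  [MulAction T2SU2 M]

theorem frame_rho (φ : FormField 3 M) (x : M) (k : T2SU2) (v : E7) :
    frame φ x (rho φ x k v) = tr k x (frame φ x v) := by
  rw [rho, frameConj_apply]
  exact (frame φ x).apply_symm_apply _

theorem isotropy_frame (φ : FormField 3 M) (x : M) (k : MulAction.stabilizer T2SU2 x) (v : E7) :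
    (isotropy x (toStab x k) : E7 →L[ℝ] E7) (frame φ x v) = frame φ x (rho φ x k v) := by
  rw [frame_rho, isotropy_toStab]

theorem g2Metric_frame (φ : FormField 3 M) (x : M) (v w : E7) :
    g2Metric φ x (frame φ x v) (frame φ x w) = inner ℝ v w := by
  have h (v : E7) : (frame φ x).symm (frame φ x v) = v := (frame φ x).symm_apply_apply v
  change (inner ℝ ((frame φ x).symm (frame φ x v)) ((frame φ x).symm (frame φ x w)) : ℝ) = _
  rw [h, h]

theorem mem_normalSpace_iff (φ : FormField 3 M) (x : M) (v : E7) :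
    (frame φ x v : TangentSpace (𝓡 7) x) ∈ normalSpace φ x ↔
      v ∈ (LinearMap.range (infFrame φ x).toLinearMap)ᗮ := by
  constructor
  · intro h
    rw [Submodule.mem_orthogonal]
    rintro _ ⟨ξ, rfl⟩
    have h1 : infK x ξ ∈ orbitTangent x := by
      rw [orbitTangent_eq_range]; exact LinearMap.mem_range_self (infK x).toLinearMap ξ
    have h2 := h _ h1
    have h3 : frame φ x (infFrame φ x ξ) = infK x ξ := (frame φ x).apply_symm_apply _
    rw [← h3] at h2
    exact (g2Metric_frame φ x _ _).symm.trans h2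
  · intro h w hw
    rw [orbitTangent_eq_range] at hw
    obtain ⟨ξ, rfl⟩ := hw
    have h3 : frame φ x (infFrame φ x ξ) = infK x ξ := (frame φ x).apply_symm_apply _
    change g2Metric φ x (infK x ξ) _ = 0
    rw [← h3]
    exact (g2Metric_frame φ x _ _).trans
      (inner_eq_zero_of_mem (LinearMap.mem_range_self (infFrame φ x).toLinearMap ξ) h)

/-- The frame as a linear equivalence onto the tangent space. -/
def frameEquiv (φ : FormField 3 M) (x : M) : E7 ≃ₗ[ℝ] TangentSpace (𝓡 7) x :=
  (g2Frame φ x).toLinearEquiv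

theorem normalSpace_eq_map (φ : FormField 3 M) (x : M) : normalSpace φ x =
    ((LinearMap.range (infFrame φ x).toLinearMap)ᗮ).map (frameEquiv φ x).toLinearMap := by
  ext v
  constructor
  · intro hv
    have h3 : frame φ x ((frame φ x).symm v) = v := (frame φ x).apply_symm_apply _
    refine ⟨(frame φ x).symm v, ?_, h3⟩
    refine (mem_normalSpace_iff φ x _).mp ?_
    rw [h3]; exact hv
  · rintro ⟨w, hw, rfl⟩
    exact (mem_normalSpace_iff φ x w).mpr hw

theorem isIsometryOnto_frame (φ : FormField 3 M) (x : M) {W : Type*} [NormedAddCommGroup W]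
    [Module ℝ W] {e : W →ₗ[ℝ] E7} (hn : ∀ a, ‖e a‖ = ‖a‖) :
    IsIsometryOnto φ x ((frameEquiv φ x).toLinearMap ∘ₗ e)
      ((LinearMap.range e).map (frameEquiv φ x).toLinearMap) := by
  refine ⟨LinearMap.range_comp _ _, fun a => ?_⟩
  rw [← hn, ← real_inner_self_eq_norm_sq]
  exact g2Metric_frame φ x (e a) (e a)

theorem finrank_ker_infFrame [T2Space M] (hs : IsSmoothAction M) (φ : FormField 3 M) (x : M) :
    finrank ℝ (LinearMap.ker (infFrame φ x).toLinearMap) = stabDim x := by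
  rw [stabDim_eq hs]
  have : LinearMap.ker (infFrame φ x).toLinearMap = LinearMap.ker (infK x).toLinearMap := by
    ext ξ; exact infFrame_eq_zero_iff
  rw [this]

theorem exists_splitting (φ : FormField 3 M) (x : M) {W : Type*} [NormedAddCommGroup W]
    [Module ℝ W] {u : E7} {e : W →ₗ[ℝ] E7} (hu : ‖u‖ = 1)
    (hsup : (ℝ ∙ u) ⊔ LinearMap.range e = (LinearMap.range (infFrame φ x).toLinearMap)ᗮ)
    (horth : ∀ a, (inner ℝ u (e a) : ℝ) = 0) (hn : ∀ a, ‖e a‖ = ‖a‖)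
    (hufix : ∀ k ∈ MulAction.stabilizer T2SU2 x, rho φ x k u = u) :
    ∃ N₁ N₂ : Submodule ℝ (TangentSpace (𝓡 7) x),
      N₁ ⊔ N₂ = normalSpace φ x ∧ (∀ u ∈ N₁, ∀ v ∈ N₂, g2Metric φ x u v = 0) ∧
      finrank ℝ N₁ = 1 ∧ finrank ℝ N₂ = finrank ℝ (LinearMap.range e) ∧
      (∀ g, ∀ v ∈ N₁, isotropy x g v = v) ∧
      IsIsometryOnto φ x ((frameEquiv φ x).toLinearMap ∘ₗ e) N₂ := by
  refine ⟨(ℝ ∙ u).map (frameEquiv φ x).toLinearMap,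
    (LinearMap.range e).map (frameEquiv φ x).toLinearMap, ?_, ?_, ?_, ?_, ?_,
    isIsometryOnto_frame φ x hn⟩
  · rw [← Submodule.map_sup, hsup, normalSpace_eq_map]
  · rintro _ ⟨v, hv, rfl⟩ _ ⟨_, ⟨a, rfl⟩, rfl⟩
    obtain ⟨r, rfl⟩ := Submodule.mem_span_singleton.mp hv
    refine (g2Metric_frame φ x (r • u) (e a)).trans ?_
    rw [inner_smul_left, horth, mul_zero]
  · rw [LinearEquiv.finrank_map_eq (frameEquiv φ x)]
    exact finrank_span_singleton (K := ℝ) (by rintro rfl; simp at hu)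
  · exact LinearEquiv.finrank_map_eq (frameEquiv φ x) _
  · rintro g _ ⟨v, hv, rfl⟩
    obtain ⟨r, rfl⟩ := Submodule.mem_span_singleton.mp hv
    obtain ⟨k, rfl⟩ := toStab_surjective x g
    refine (isotropy_frame φ x k (r • u)).trans ?_
    rw [map_smul, hufix k.1 k.2]
    rfl

section Groups

variable [T2Space M] [ConnectedSpace M] {φ : FormField 3 M}
  {x : M} {S W : Type*} [Mul S] [TopologicalSpace S] [CompactSpace S]
  [T2Space S] [NormedAddCommGroup W] [Module ℝ W] {m : S → W → W} {e : W →ₗ[ℝ] E7}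

theorem toStab_eq_one (hφ : IsG2Manifold φ) (hs : IsSmoothAction M) (hp : PreservesForm φ) {x₀ : M}
    (hx₀ : Function.Injective (infK x₀))
    (hf : ∀ k ∈ MulAction.stabilizer T2SU2 x, (∀ a, rho φ x k (e a) = e a) →
      rho φ x k = ContinuousLinearMap.id ℝ E7) (k : MulAction.stabilizer T2SU2 x)
    (hk : ∀ a, (isotropy x (toStab x k) : E7 →L[ℝ] E7) (frame φ x (e a)) = frame φ x (e a)) :
    toStab x k = 1 := by
  have h1 := hf k.1 k.2 fun a => (frame φ x).injective ((isotropy_frame φ x k _).symm.trans (hk a))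
  have h2 := (isotropyData hs hφ hp hx₀ x).mem_ker k.1 k.2 h1
  exact Subtype.ext ((QuotientGroup.eq_one_iff _).mpr h2)

theorem exists_iso_stabilizer (hs : IsSmoothAction M)
    (hm : ∀ s s' a, m (s * s') a = m s (m s' a)) (hmc : ∀ a, Continuous fun s => m s a)
    (hmi : ∀ s s', (∀ a, m s a = m s' a) → s = s') (hn : ∀ a, ‖e a‖ = ‖a‖)
    (hφ : IsG2Manifold φ) (hp : PreservesForm φ) {x₀ : M}
    (hx₀ : Function.Injective (infK x₀))
    (h1 : ∀ s, ∃ k ∈ MulAction.stabilizer T2SU2 x, ∀ a, rho φ x k (e a) = e (m s a))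
    (h2 : ∀ k ∈ MulAction.stabilizer T2SU2 x, ∃ s, ∀ a, rho φ x k (e a) = e (m s a))
    (hf : ∀ k ∈ MulAction.stabilizer T2SU2 x, (∀ a, rho φ x k (e a) = e a) →
      rho φ x k = ContinuousLinearMap.id ℝ E7) :
    ∃ σ : S ≃ₜ* MulAction.stabilizer (EffGroup M) x, ∀ s a,
      isotropy x (σ s) (((frameEquiv φ x).toLinearMap ∘ₗ e) a) =
        ((frameEquiv φ x).toLinearMap ∘ₗ e) (m s a) := by
  have := compactSpace_stabilizer hs x
  have hiso : Isometry e := AddMonoidHomClass.isometry_of_norm e hn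
  refine exists_continuousMulEquiv hm hmc hmi
    (r := fun g v => (isotropy x g : E7 →L[ℝ] E7) v) (isotropy_one x)
    (isotropy_mul hs x) (continuous_isotropy hs x) (e := fun a => frame φ x (e a))
    ((frame φ x).continuous.comp hiso.continuous)
    ((frame φ x).injective.comp hiso.injective) ?_ ?_ ?_
  · intro s
    obtain ⟨k, hk, h⟩ := h1 s
    exact ⟨toStab x ⟨k, hk⟩, fun a => (isotropy_frame φ x ⟨k, hk⟩ _).trans (by rw [h])⟩
  · intro g
    obtain ⟨k, rfl⟩ := toStab_surjective x g
    obtain ⟨s, h⟩ := h2 k.1 k.2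
    exact ⟨s, fun a => (isotropy_frame φ x k _).trans (by rw [h])⟩
  · intro g hg
    obtain ⟨k, rfl⟩ := toStab_surjective x g
    exact toStab_eq_one hφ hs hp hx₀ hf k hg

/-- The realising elements are products of exponentials, which places them in the identity
component. The matching of group elements with `S` is required only on that component. -/
theorem exists_iso_stabIdComponent (hs : IsSmoothAction M)
    (hm : ∀ s s' a, m (s * s') a = m s (m s' a)) (hmc : ∀ a, Continuous fun s => m s a)
    (hmi : ∀ s s', (∀ a, m s a = m s' a) → s = s') (hn : ∀ a, ‖e a‖ = ‖a‖)
    (hφ : IsG2Manifold φ) (hp : PreservesForm φ) {x₀ : M}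
    (hx₀ : Function.Injective (infK x₀))
    (h1 : ∀ s, ∃ k ∈ Subgroup.closure (expK '' {ζ | infFrame φ x ζ = 0}),
      ∀ a, rho φ x k (e a) = e (m s a))
    (h2 : ∀ k : MulAction.stabilizer T2SU2 x, toStab x k ∈ stabIdComponent x →
      ∃ s, ∀ a, rho φ x k (e a) = e (m s a))
    (hf : ∀ k ∈ MulAction.stabilizer T2SU2 x, (∀ a, rho φ x k (e a) = e a) →
      rho φ x k = ContinuousLinearMap.id ℝ E7) :
    ∃ σ : S ≃ₜ* stabIdComponent x, ∀ s a,
      isotropy x (σ s) (((frameEquiv φ x).toLinearMap ∘ₗ e) a) =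
        ((frameEquiv φ x).toLinearMap ∘ₗ e) (m s a) := by
  have := compactSpace_stabIdComponent hs x
  have hiso : Isometry e := AddMonoidHomClass.isometry_of_norm e hn
  refine exists_continuousMulEquiv hm hmc hmi
    (r := fun (g : stabIdComponent x) v =>
      (isotropy x (g : MulAction.stabilizer (EffGroup M) x) : E7 →L[ℝ] E7) v) (isotropy_one x)
    (fun g h => isotropy_mul hs x g h)
    (fun v => (continuous_isotropy hs x v).comp continuous_subtype_val)
    (e := fun a => frame φ x (e a))
    ((frame φ x).continuous.comp hiso.continuous)
    ((frame φ x).injective.comp hiso.injective) ?_ ?_ ?_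
  · intro s
    obtain ⟨k, hk, h⟩ := h1 s
    have hset : {ζ | infFrame φ x ζ = 0} = {ζ | infK x ζ = 0} :=
      Set.ext fun ζ => infFrame_eq_zero_iff
    rw [hset] at hk
    obtain ⟨hkx, hmem⟩ := mem_stabIdComponent_of_mem_closure hs hk
    exact ⟨⟨toStab x ⟨k, hkx⟩, hmem⟩, fun a => (isotropy_frame φ x ⟨k, hkx⟩ _).trans (by rw [h])⟩
  · rintro ⟨g, hg⟩
    obtain ⟨k, rfl⟩ := toStab_surjective x g
    obtain ⟨s, h⟩ := h2 k hg
    exact ⟨s, fun a => (isotropy_frame φ x k _).trans (by rw [h])⟩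
  · rintro ⟨g, hg⟩ hg1
    obtain ⟨k, rfl⟩ := toStab_surjective x g
    exact Subtype.ext (toStab_eq_one hφ hs hp hx₀ hf k hg1)

end Groups

/-- The identity component lies in each closed set of operators whose complement is closed. -/
theorem comm_of_mem_stabIdComponent (hs : IsSmoothAction M) {φ : FormField 3 M} {x : M}
    {B B' : E7 →L[ℝ] E7} (hne : B ≠ B')
    (hsurj : ∀ k ∈ MulAction.stabilizer T2SU2 x, Function.Surjective (rho φ x k))
    (hor : ∀ k ∈ MulAction.stabilizer T2SU2 x,
      (∀ v, rho φ x k (B v) = B (rho φ x k v)) ∨ (∀ v, rho φ x k (B v) = B' (rho φ x k v)))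
    {k : MulAction.stabilizer T2SU2 x} (hk : toStab x k ∈ stabIdComponent x) (v : E7) :
    rho φ x k (B v) = B (rho φ x k v) := by
  let ρ' (g : MulAction.stabilizer (EffGroup M) x) (v : E7) : E7 :=
    (frame φ x).symm ((isotropy x g : E7 →L[ℝ] E7) (frame φ x v))
  have hρ' (k : MulAction.stabilizer T2SU2 x) (v : E7) : ρ' (toStab x k) v = rho φ x k v := by
    change (frame φ x).symm ((isotropy x (toStab x k) : E7 →L[ℝ] E7) (frame φ x v)) = _
    rw [isotropy_frame, ContinuousLinearEquiv.symm_apply_apply]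
  have hc (v : E7) : Continuous fun g => ρ' g v :=
    (frame φ x).symm.continuous.comp (continuous_isotropy hs x _)
  let Z (C : E7 →L[ℝ] E7) : Set (MulAction.stabilizer (EffGroup M) x) :=
    {g | ∀ v, ρ' g (B v) = C (ρ' g v)}
  have hZ (C : E7 →L[ℝ] E7) : IsClosed (Z C) := by
    simp only [Z, Set.ofPred_forall]
    exact isClosed_iInter fun v => isClosed_eq (hc _) (C.continuous.comp (hc v))
  have hmem (C : E7 →L[ℝ] E7) (k : MulAction.stabilizer T2SU2 x) :
      toStab x k ∈ Z C ↔ ∀ v, rho φ x k (B v) = C (rho φ x k v) := by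
    simp only [Z, Set.mem_ofPred_eq, hρ']
  -- Surjectivity of the isotropy maps makes the two closed alternatives exclusive. The commutant of
  -- `B` is thus open and closed, and it contains the identity.
  have hcompl : (Z B)ᶜ = Z B' := by
    ext g
    obtain ⟨k, rfl⟩ := toStab_surjective x g
    rw [Set.mem_compl_iff, hmem, hmem]
    constructor
    · intro h; exact (hor k.1 k.2).resolve_left h
    · intro h h'
      apply hne
      ext1 w
      obtain ⟨v, rfl⟩ := hsurj k.1 k.2 w
      rw [← h', h]
  have hclopen : IsClopen (Z B) := ⟨hZ B, by rw [← isClosed_compl_iff, hcompl]; exact hZ B'⟩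
  have h1 : (1 : MulAction.stabilizer (EffGroup M) x) ∈ Z B := by
    intro v
    have e (w : E7) : ρ' 1 w = w := by
      change (frame φ x).symm ((isotropy x (1 : MulAction.stabilizer (EffGroup M) x) :
        E7 →L[ℝ] E7) (frame φ x w)) = w
      rw [isotropy_one, ContinuousLinearEquiv.symm_apply_apply]
    rw [e, e]
  exact (hmem B k).mp (hclopen.connectedComponent_subset h1 hk) v

end Transfer

/-! ### The stabilizer types on the manifold -/

section Cases

set_option linter.unusedSectionVars false

variable {M : Type*} [TopologicalSpace M] [ChartedSpace E7 M] [IsManifold (𝓡 7) ∞ M]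
  [MulAction T2SU2 M]

theorem infFrame_torus_injective {φ : FormField 3 M} {x : M} (hx : x ∉ torusSingularSet M)
    (s t : ℝ) (h : infFrame φ x (s, t, 0) = 0) : s = 0 ∧ t = 0 := by
  rw [mem_torusSingularSet_iff] at hx
  by_contra hne
  refine hx ⟨s, t, ?_, infFrame_eq_zero_iff.mp h⟩
  rw [Ne, Prod.mk_eq_zero]
  exact hne

theorem exists_infFrame_torus_eq_zero {φ : FormField 3 M} {x : M} (hx : x ∈ torusSingularSet M) :
    ∃ s t : ℝ, (s ≠ 0 ∨ t ≠ 0) ∧ infFrame φ x (s, t, 0) = 0 := by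
  obtain ⟨s, t, hne, h⟩ := (mem_torusSingularSet_iff x).mp hx
  refine ⟨s, t, ?_, infFrame_eq_zero_iff.mpr h⟩
  rw [Ne, Prod.mk_eq_zero] at hne
  tauto

variable [T2Space M] [ConnectedSpace M] {φ : FormField 3 M} {x₀ : M}

theorem stabDim_of_not_mem (hs : IsSmoothAction M) (hφ : IsG2Manifold φ) (hp : PreservesForm φ)
    (hx₀ : Function.Injective (infK x₀)) {x : M} (hx : x ∉ torusSingularSet M) :
    stabDim x = 0 ∨ stabDim x = 1 ∨ (stabDim x = 3 ∧ ∀ X, infFrame φ x (0, 0, X) = 0) := by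
  rw [← finrank_ker_infFrame hs φ x]
  exact (isotropyData hs hφ hp hx₀ x).finrank_ker_of_torus_injective (infFrame_torus_injective hx)

theorem stabDim_of_mem (hs : IsSmoothAction M) (hφ : IsG2Manifold φ) (hp : PreservesForm φ)
    (hx₀ : Function.Injective (infK x₀)) {x : M} (hx : x ∈ torusSingularSet M) :
    stabDim x = 2 ∨ (stabDim x = 4 ∧ ∀ X, infFrame φ x (0, 0, X) = 0) := by
  obtain ⟨s, t, hne, hc⟩ := exists_infFrame_torus_eq_zero (φ := φ) hx
  have h := (isotropyData hs hφ hp hx₀ x).finrank_ker_of_torus_singular hne hc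
  rw [finrank_ker_infFrame hs φ x] at h
  exact h.imp_left And.left

theorem stabDim_le_four (hs : IsSmoothAction M) (hφ : IsG2Manifold φ) (hp : PreservesForm φ)
    (hx₀ : Function.Injective (infK x₀)) (x : M) : stabDim x ≤ 4 := by
  by_cases hx : x ∈ torusSingularSet M
  · have := stabDim_of_mem hs hφ hp hx₀ hx; omega
  · have := stabDim_of_not_mem hs hφ hp hx₀ hx; omega

theorem smul_eq_of_rho_eq_id (hs : IsSmoothAction M) (hφ : IsG2Manifold φ) (hp : PreservesForm φ)
    (hx₀ : Function.Injective (infK x₀)) {x : M} {k : T2SU2} (hk : k • x = x)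
    (h : rho φ x k = ContinuousLinearMap.id ℝ E7) (y : M) : k • y = y :=
  DFunLike.congr_fun (MonoidHom.mem_ker.mp ((isotropyData hs hφ hp hx₀ x).mem_ker k hk h)) y

theorem stabilizer_eq_bot (hs : IsSmoothAction M) (hφ : IsG2Manifold φ) (hp : PreservesForm φ)
    (hx₀ : Function.Injective (infK x₀)) {x : M} (h0 : stabDim x = 0) :
    MulAction.stabilizer (EffGroup M) x = ⊥ := by
  have D := isotropyData hs hφ hp hx₀ x
  rw [← finrank_ker_infFrame hs φ x] at h0
  have hinj (ξ : LieK) (hξ : infFrame φ x ξ = 0) : ξ = 0 := by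
    have h1 : ξ ∈ LinearMap.ker (infFrame φ x).toLinearMap := hξ
    rwa [Submodule.finrank_eq_zero.mp h0, Submodule.mem_bot] at h1
  rw [eq_bot_iff]
  intro g hg
  obtain ⟨k, rfl⟩ := QuotientGroup.mk_surjective g
  have hk : k • x = x := hg
  exact (QuotientGroup.eq_one_iff _).mpr (D.mem_ker k hk (D.rho_eq_id_of_injective hinj hk))

theorem exists_specialOrthogonal (hs : IsSmoothAction M) (hφ : IsG2Manifold φ)
    (hp : PreservesForm φ) (hx₀ : Function.Injective (infK x₀)) {x : M} (h1 : stabDim x = 1) :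
    x ∉ torusSingularSet M ∧
      (∀ a b : Circle, ((a, b, 1) : T2SU2) • x = x → ∀ y : M, ((a, b, 1) : T2SU2) • y = y) ∧
      ∃ (σ : Matrix.specialOrthogonalGroup (Fin 2) ℝ ≃ₜ* MulAction.stabilizer (EffGroup M) x)
        (N₁ N₂ : Submodule ℝ (TangentSpace (𝓡 7) x))
        (e : EuclideanSpace ℝ (Fin 2) →ₗ[ℝ] TangentSpace (𝓡 7) x),
        N₁ ⊔ N₂ = normalSpace φ x ∧ (∀ u ∈ N₁, ∀ v ∈ N₂, g2Metric φ x u v = 0) ∧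
        Module.finrank ℝ N₁ = 1 ∧ Module.finrank ℝ N₂ = 2 ∧
        (∀ g, ∀ v ∈ N₁, isotropy x g v = v) ∧
        IsIsometryOnto φ x e N₂ ∧
        ∀ A a, isotropy x (σ A) (e a) = e (WithLp.toLp 2 (A.1 *ᵥ a.ofLp)) := by
  have D := isotropyData hs hφ hp hx₀ x
  have hx : x ∉ torusSingularSet M := fun hx => by
    have := stabDim_of_mem hs hφ hp hx₀ hx; omega
  have hker := (finrank_ker_infFrame hs φ x).trans h1
  refine ⟨hx, fun a b hab => smul_eq_of_rho_eq_id hs hφ hp hx₀ hab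
    (D.rho_eq_id_of_forall_range hker hab rfl), ?_⟩
  obtain ⟨u, e, hu, hsup, horth, hn, hufix, hS, hk, hf⟩ :=
    D.exists_rotation_frame (infFrame_torus_injective hx) hker
  obtain ⟨N₁, N₂, g1, g2, g3, g4, g5, g6⟩ := exists_splitting φ x hu hsup horth hn hufix
  obtain ⟨σ, hσ⟩ := exists_iso_stabilizer (S := Matrix.specialOrthogonalGroup (Fin 2) ℝ)
    (m := fun S a => matAct S.1 a) hs (fun _ _ a => matAct_mul _ _ a)
    (fun a => (continuous_matAct a).comp continuous_subtype_val)
    (fun _ _ h => Subtype.ext (matAct_injective h)) hn hφ hp hx₀ hS hk hf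
  refine ⟨σ, N₁, N₂, (frameEquiv φ x).toLinearMap ∘ₗ e, g1, g2, g3, ?_, g5, g6, hσ⟩
  rw [g4, LinearMap.finrank_range_of_inj (AddMonoidHomClass.isometry_of_norm e hn).injective,
    finrank_euclideanSpace, Fintype.card_fin]

theorem exists_specialUnitary (hs : IsSmoothAction M) (hφ : IsG2Manifold φ)
    (hp : PreservesForm φ) (hx₀ : Function.Injective (infK x₀)) {x : M} (h3 : stabDim x = 3) :
    x ∉ torusSingularSet M ∧
      ∃ (σ : Matrix.specialUnitaryGroup (Fin 2) ℂ ≃ₜ* MulAction.stabilizer (EffGroup M) x)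
        (N₁ N₂ : Submodule ℝ (TangentSpace (𝓡 7) x))
        (e : EuclideanSpace ℂ (Fin 2) →ₗ[ℝ] TangentSpace (𝓡 7) x),
        N₁ ⊔ N₂ = normalSpace φ x ∧ (∀ u ∈ N₁, ∀ v ∈ N₂, g2Metric φ x u v = 0) ∧
        Module.finrank ℝ N₁ = 1 ∧
        (∀ g, ∀ v ∈ N₁, isotropy x g v = v) ∧
        IsIsometryOnto φ x e N₂ ∧
        ∀ A a, isotropy x (σ A) (e a) = e (WithLp.toLp 2 (A.1 *ᵥ a.ofLp)) := by
  have D := isotropyData hs hφ hp hx₀ x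
  have hx : x ∉ torusSingularSet M := fun hx => by
    have := stabDim_of_mem hs hφ hp hx₀ hx; omega
  have hsu : ∀ X, infFrame φ x (0, 0, X) = 0 := by
    rcases stabDim_of_not_mem hs hφ hp hx₀ hx with h | h | h
    · omega
    · omega
    · exact h.2
  refine ⟨hx, ?_⟩
  obtain ⟨u, e, hu, hsup, horth, hn, hufix, hS, hk, hf⟩ := D.exists_su2_frame
    (infFrame_torus_injective hx) ((finrank_ker_infFrame hs φ x).trans h3) hsu
  obtain ⟨N₁, N₂, g1, g2, g3, -, g5, g6⟩ := exists_splitting φ x hu hsup horth hn hufix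
  obtain ⟨σ, hσ⟩ := exists_iso_stabilizer (S := Matrix.specialUnitaryGroup (Fin 2) ℂ)
    (m := fun S a => matAct S.1 a) hs (fun _ _ a => matAct_mul _ _ a)
    (fun a => (continuous_matAct a).comp continuous_subtype_val)
    (fun _ _ h => Subtype.ext (matAct_injective h)) hn hφ hp hx₀ hS hk hf
  exact ⟨σ, N₁, N₂, (frameEquiv φ x).toLinearMap ∘ₗ e, g1, g2, g3, g5, g6, hσ⟩

theorem exists_torus (hs : IsSmoothAction M) (hφ : IsG2Manifold φ)
    (hp : PreservesForm φ) (hx₀ : Function.Injective (infK x₀)) {x : M} (h2 : stabDim x = 2) :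
    x ∈ torusSingularSet M ∧
      ∃ (σ : Circle × Circle ≃ₜ* stabIdComponent x)
        (e : EuclideanSpace ℂ (Fin 2) →ₗ[ℝ] TangentSpace (𝓡 7) x),
        IsIsometryOnto φ x e (normalSpace φ x) ∧
        ∀ z w a, isotropy x (σ (z, w)) (e a) = e !₂[(z : ℂ) * a 0, (w : ℂ) * a 1] := by
  have D := isotropyData hs hφ hp hx₀ x
  have hx : x ∈ torusSingularSet M := by
    by_contra hx
    have := stabDim_of_not_mem hs hφ hp hx₀ hx; omega
  refine ⟨hx, ?_⟩
  obtain ⟨s, t, hne, hc⟩ := exists_infFrame_torus_eq_zero (φ := φ) hx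
  have hker := (finrank_ker_infFrame hs φ x).trans h2
  obtain ⟨η, hη, hX, hall⟩ : ∃ η : LieK, infFrame φ x η = 0 ∧ η.2.2 ≠ 0 ∧
      ∀ ζ, infFrame φ x ζ = 0 → ∃ r : ℝ, ζ.2.2 = r • η.2.2 := by
    rcases D.finrank_ker_of_torus_singular hne hc with h | h
    · exact h.2
    · omega
  obtain ⟨e, B, B', hr, hn, hBB, hor, hS, hk, hf⟩ :=
    D.exists_torus_normal_frame hne hc hker hη hX hall
  let m (p : Circle × Circle) (a : EuclideanSpace ℂ (Fin 2)) : EuclideanSpace ℂ (Fin 2) :=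
    !₂[(p.1 : ℂ) * a 0, (p.2 : ℂ) * a 1]
  obtain ⟨σ, hσ⟩ := exists_iso_stabIdComponent (S := Circle × Circle) (m := m) hs
    (fun p q a => by
      ext i
      fin_cases i
      · exact mul_assoc (p.1 : ℂ) q.1 (a 0)
      · exact mul_assoc (p.2 : ℂ) q.2 (a 1))
    (fun a => (PiLp.continuous_toLp 2 _).comp (continuous_pi fun i => by
      fin_cases i
      · exact (continuous_subtype_val.comp continuous_fst).mul continuous_const
      · exact (continuous_subtype_val.comp continuous_snd).mul continuous_const))
    (fun p q h => by
      have h1 := h !₂[1, 1]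
      have e0 : (p.1 : ℂ) * 1 = q.1 * 1 := congrArg (fun v : EuclideanSpace ℂ (Fin 2) => v 0) h1
      have e1 : (p.2 : ℂ) * 1 = q.2 * 1 := congrArg (fun v : EuclideanSpace ℂ (Fin 2) => v 1) h1
      rw [mul_one, mul_one] at e0 e1
      exact Prod.ext (Circle.ext e0) (Circle.ext e1))
    hn hφ hp hx₀ (fun p => hS p.1 p.2)
    (fun k hk' => by
      obtain ⟨z, w, h⟩ := hk k.1 k.2 fun v =>
        comm_of_mem_stabIdComponent hs hBB (fun k hk => (D.isG2 k hk).surjective) hor hk' v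
      exact ⟨(z, w), h⟩) hf
  refine ⟨σ, (frameEquiv φ x).toLinearMap ∘ₗ e, ?_, fun z w a => hσ (z, w) a⟩
  rw [normalSpace_eq_map, ← hr]
  exact isIsometryOnto_frame φ x hn

theorem exists_unitary (hs : IsSmoothAction M) (hφ : IsG2Manifold φ)
    (hp : PreservesForm φ) (hx₀ : Function.Injective (infK x₀)) {x : M} (h4 : stabDim x = 4) :
    x ∈ torusSingularSet M ∧
      ∃ (σ : Matrix.unitaryGroup (Fin 2) ℂ ≃ₜ* stabIdComponent x)
        (e : EuclideanSpace ℂ (Fin 3) →ₗ[ℝ] TangentSpace (𝓡 7) x),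
        IsIsometryOnto φ x e (normalSpace φ x) ∧
        ∀ A a, isotropy x (σ A) (e a) = e (WithLp.toLp 2 (u2ToSU3 A *ᵥ a.ofLp)) := by
  have D := isotropyData hs hφ hp hx₀ x
  have hx : x ∈ torusSingularSet M := by
    by_contra hx
    have := stabDim_of_not_mem hs hφ hp hx₀ hx; omega
  refine ⟨hx, ?_⟩
  obtain ⟨s, t, hne, hc⟩ := exists_infFrame_torus_eq_zero (φ := φ) hx
  have hsu : ∀ X, infFrame φ x (0, 0, X) = 0 := by
    rcases stabDim_of_mem hs hφ hp hx₀ hx with h | h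
    · omega
    · exact h.2
  obtain ⟨e, hr, hn, hS, hk, hf⟩ :=
    D.exists_u2_frame hne hc ((finrank_ker_infFrame hs φ x).trans h4) hsu
  obtain ⟨σ, hσ⟩ := exists_iso_stabIdComponent (S := Matrix.unitaryGroup (Fin 2) ℂ)
    (m := fun S a => matAct (u2ToSU3 S) a) hs (fun S S' a => by rw [u2ToSU3_mul, matAct_mul])
    (fun a => (continuous_matAct a).comp continuous_u2ToSU3)
    (fun _ _ h => u2ToSU3_injective (matAct_injective h)) hn hφ hp hx₀ hS
    (fun k _ => hk k.1 k.2) hf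
  refine ⟨σ, (frameEquiv φ x).toLinearMap ∘ₗ e, ?_, hσ⟩
  rw [normalSpace_eq_map, ← hr]
  exact isIsometryOnto_frame φ x hn

end Cases

/-! ### Local diffeomorphisms -/

/-- The inverse function theorem, with smoothness on the whole source and target. -/
theorem exists_openPartialHomeomorph {E : Type*} [NormedAddCommGroup E] [NormedSpace ℝ E]
    [CompleteSpace E] {f : E → E} {a : E} {f' : E ≃L[ℝ] E} {D : Set E} (hD : IsOpen D)
    (ha : a ∈ D) (hf : ∀ v ∈ D, ContDiffAt ℝ ∞ f v) (hf' : HasFDerivAt f (f' : E →L[ℝ] E) a) :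
    ∃ Φ : OpenPartialHomeomorph E E, a ∈ Φ.source ∧ Φ.source ⊆ D ∧ (∀ v, Φ v = f v) ∧
      ContDiffOn ℝ ∞ Φ Φ.source ∧ ContDiffOn ℝ ∞ Φ.symm Φ.target := by
  have hn : (∞ : ℕ∞ω) ≠ 0 := by simp
  let Φ₀ := (hf a ha).toOpenPartialHomeomorph f hf' hn
  have hcont : ContinuousOn (fderiv ℝ f) D := fun v hv =>
    (((hf v hv).fderiv_right (m := ∞) (by simp)).continuousAt).continuousWithinAt
  -- Shrinking to the open set where the derivative is invertible makes the inverse smooth on the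
  -- whole target and not only at one point.
  have hO : IsOpen (D ∩ fderiv ℝ f ⁻¹' interior (Set.range ((↑) : (E ≃L[ℝ] E) → E →L[ℝ] E))) :=
    hcont.isOpen_inter_preimage hD isOpen_interior
  have haO : a ∈ D ∩ fderiv ℝ f ⁻¹' interior (Set.range ((↑) : (E ≃L[ℝ] E) → E →L[ℝ] E)) := by
    refine ⟨ha, ?_⟩
    rw [Set.mem_preimage, hf'.fderiv, mem_interior_iff_mem_nhds]
    exact f'.nhds
  let Φ := Φ₀.restrOpen _ hO
  have hsub : Φ.source ⊆ D ∩ fderiv ℝ f ⁻¹' interior (Set.range ((↑) : (E ≃L[ℝ] E) → E →L[ℝ] E)) :=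
    fun v hv => hv.2
  refine ⟨Φ, ⟨(hf a ha).mem_toOpenPartialHomeomorph_source hf' hn, haO⟩,
    fun v hv => (hsub hv).1, fun v => rfl, fun v hv => (hf v (hsub hv).1).contDiffWithinAt,
    fun y hy => ?_⟩
  have h1 := Φ.map_target hy
  obtain ⟨g, hg⟩ := interior_subset (hsub h1).2
  refine (Φ.contDiffAt_symm (f₀' := g) hy ?_ (hf _ (hsub h1).1)).contDiffWithinAt
  rw [hg]
  exact ((hf _ (hsub h1).1).differentiableAt hn).hasFDerivAt

theorem hasMFDerivAt_expK_mul_expK :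
    HasMFDerivAt 𝓘(ℝ, LieK × LieK) modelT2SU2 (fun p : LieK × LieK => expK p.1 * expK p.2) 0
      (dexpK.comp (ContinuousLinearMap.fst ℝ LieK LieK + ContinuousLinearMap.snd ℝ LieK LieK)) := by
  have hsm : ContMDiff 𝓘(ℝ, LieK × LieK) modelT2SU2 ∞
      (fun p : LieK × LieK => expK p.1 * expK p.2) :=
    ContMDiff.mul (contMDiff_expK.comp contDiff_fst.contMDiff)
      (contMDiff_expK.comp contDiff_snd.contMDiff)
  have h0 := (hsm.mdifferentiableAt (x := 0) (by simp)).hasMFDerivAt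
  refine h0.congr_mfderiv ?_
  have hl : ∀ p : LieK × LieK, p = 0 → HasMFDerivAt 𝓘(ℝ, LieK × LieK) modelT2SU2
      (fun p : LieK × LieK => expK p.1 * expK p.2) p
      (mfderiv 𝓘(ℝ, LieK × LieK) modelT2SU2
        (fun p : LieK × LieK => expK p.1 * expK p.2) 0 : LieK × LieK →L[ℝ] LieT2SU2) := by
    rintro p rfl; exact h0
  have h1 := HasMFDerivAt.comp (0 : LieK) (hl (ContinuousLinearMap.inl ℝ LieK LieK 0) (map_zero _))
    (ContinuousLinearMap.inl ℝ LieK LieK).hasFDerivAt.hasMFDerivAt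
  have h2 := HasMFDerivAt.comp (0 : LieK) (hl (ContinuousLinearMap.inr ℝ LieK LieK 0) (map_zero _))
    (ContinuousLinearMap.inr ℝ LieK LieK).hasFDerivAt.hasMFDerivAt
  have e1 : ((fun p : LieK × LieK => expK p.1 * expK p.2) ∘
      (ContinuousLinearMap.inl ℝ LieK LieK)) = expK := by
    funext ξ; simp [expK_zero]
  have e2 : ((fun p : LieK × LieK => expK p.1 * expK p.2) ∘
      (ContinuousLinearMap.inr ℝ LieK LieK)) = expK := by
    funext ξ; simp [expK_zero]
  rw [e1] at h1
  rw [e2] at h2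
  have h3 := hasMFDerivAt_unique h1 hasMFDerivAt_expK
  have h4 := hasMFDerivAt_unique h2 hasMFDerivAt_expK
  refine ContinuousLinearMap.ext fun p => ?_
  have h5 := DFunLike.congr_fun h3 p.1
  have h6 := DFunLike.congr_fun h4 p.2
  have e : p = ContinuousLinearMap.inl ℝ LieK LieK p.1 + ContinuousLinearMap.inr ℝ LieK LieK p.2 :=
    Prod.ext (add_zero (p.1 : LieK)).symm (zero_add (p.2 : LieK)).symm
  refine (congrArg _ e).trans ?_
  refine (map_add _ _ _).trans ?_
  refine (congrArg₂ (· + ·) h5 h6).trans ?_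
  exact (map_add dexpK _ _).symm

/-- If `A + B = id`, then `ξ ↦ exp (A ξ) exp (B ξ)` is open at `0`. -/
theorem nhds_one_le_map_expK_mul_expK (A : LieK →L[ℝ] LieK) :
    𝓝 (1 : T2SU2) ≤ Filter.map (fun ξ : LieK => expK (A ξ) * expK (ξ - A ξ)) (𝓝 0) := by
  set f : LieK → T2SU2 := fun ξ => expK (A ξ) * expK (ξ - A ξ) with hf
  have hf0 : f 0 = 1 := by simp [hf, expK_zero]
  let L : LieK →L[ℝ] LieK × LieK := A.prod (ContinuousLinearMap.id ℝ LieK - A)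
  have hsm : ContMDiff 𝓘(ℝ, LieK) modelT2SU2 ∞ f :=
    ContMDiff.mul (contMDiff_expK.comp A.contDiff.contMDiff)
      (contMDiff_expK.comp (contDiff_id.sub A.contDiff).contMDiff)
  have key : ∀ p : LieK × LieK, p = 0 → HasMFDerivAt 𝓘(ℝ, LieK × LieK) modelT2SU2
      (fun p : LieK × LieK => expK p.1 * expK p.2) p
      (dexpK.comp (ContinuousLinearMap.fst ℝ LieK LieK +
        ContinuousLinearMap.snd ℝ LieK LieK)) := by
    rintro p rfl; exact hasMFDerivAt_expK_mul_expK
  have h1 : HasMFDerivAt 𝓘(ℝ, LieK) modelT2SU2 f 0 dexpK := by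
    refine (HasMFDerivAt.comp (0 : LieK) (key (L 0) (map_zero _))
      L.hasFDerivAt.hasMFDerivAt).congr_mfderiv ?_
    refine ContinuousLinearMap.ext fun ξ => ?_
    exact congrArg dexpK (add_sub_cancel (A ξ) ξ)
  let c := extChartAt modelT2SU2 (f 0)
  let d : LieK →L[ℝ] EuclideanSpace ℝ (Fin 1) × EuclideanSpace ℝ (Fin 1) ×
    EuclideanSpace ℝ (Fin 3) := dexpK
  have h2 : HasFDerivAt (fun ξ => c (f ξ)) d 0 := by
    have h : HasFDerivWithinAt (fun ξ => c (f ξ)) d (Set.range 𝓘(ℝ, LieK)) (0 : LieK) := h1.2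
    rwa [ModelWithCorners.range_eq_univ, hasFDerivWithinAt_univ] at h
  have h3 : ContDiffAt ℝ ∞ (fun ξ => c (f ξ)) 0 :=
    (ContMDiffAt.comp (0 : LieK) (contMDiffAt_extChartAt (I := modelT2SU2) (n := ∞) (x := f 0))
      hsm.contMDiffAt).contDiffAt
  -- The derivative at the origin is that of `expK`, because the two arguments add up to `ξ`; it is
  -- surjective, so the map is open there.
  have h4 := (h3.hasStrictFDerivAt' h2 (by simp)).map_nhds_eq_of_surj
    ((LinearMap.range_eq_top (f := d.toLinearMap)).mpr bijective_dexpK.2)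
  intro s hs
  rw [Filter.mem_map] at hs
  have h5 : f ⁻¹' c.source ∈ 𝓝 (0 : LieK) :=
    hsm.continuous.continuousAt.preimage_mem_nhds (extChartAt_source_mem_nhds (I := modelT2SU2) (f 0))
  have h6 : (fun ξ => c (f ξ)) '' (f ⁻¹' s ∩ f ⁻¹' c.source) ∈ 𝓝 (c (f 0)) := by
    rw [← h4]; exact Filter.image_mem_map (Filter.inter_mem hs h5)
  have h7 := (continuousAt_extChartAt (I := modelT2SU2) (f 0)).preimage_mem_nhds h6
  rw [← hf0]
  filter_upwards [h7, extChartAt_source_mem_nhds (I := modelT2SU2) (f 0)] with k hk hk'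
  obtain ⟨ξ, hξ, e⟩ := hk
  rw [← c.injOn hξ.2 hk' e]
  exact hξ.1

section Orbit

set_option linter.unusedSectionVars false

variable {M : Type*} [TopologicalSpace M] [ChartedSpace E7 M] [IsManifold (𝓡 7) ∞ M]
  [MulAction T2SU2 M]

/-- Points of an orbit that are close to `x` are moved from `x` by elements close to `1`. -/
theorem eventually_mem_orbit [T2Space M] (hs : IsSmoothAction M) (x : M) {U : Set T2SU2}
    (hU : U ∈ 𝓝 (1 : T2SU2)) :
    ∀ᶠ z in 𝓝 x, z ∈ MulAction.orbit T2SU2 x → ∃ u ∈ U, u • x = z := by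
  have hc : Continuous fun k : T2SU2 => k • x := (contMDiff_smul_right hs x).continuous
  -- The open set of products of elements near `1` with stabilizer elements. The orbit image of its
  -- complement is compact and misses `x`, so orbit points near `x` come from `V`.
  let V : Set T2SU2 := {k | ∃ u ∈ interior U, ∃ l : T2SU2, l • x = x ∧ k = u * l}
  have hV : IsOpen V := by
    have e : V = ⋃ l ∈ {l : T2SU2 | l • x = x}, (fun u => u * l) '' interior U := by
      ext k
      simp only [V, Set.mem_ofPred_eq, Set.mem_iUnion, Set.mem_image]
      constructor
      · rintro ⟨u, hu, l, hl, rfl⟩; exact ⟨l, hl, u, hu, rfl⟩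
      · rintro ⟨l, hl, u, hu, rfl⟩; exact ⟨u, hu, l, hl, rfl⟩
    rw [e]
    exact isOpen_biUnion fun l _ => isOpenMap_mul_right l _ isOpen_interior
  have hK : IsCompact ((fun k : T2SU2 => k • x) '' Vᶜ) := hV.isClosed_compl.isCompact.image hc
  have hx : x ∉ (fun k : T2SU2 => k • x) '' Vᶜ := by
    rintro ⟨k, hk, e⟩
    exact hk ⟨1, mem_interior_iff_mem_nhds.mpr hU, k, e, (one_mul k).symm⟩
  filter_upwards [hK.isClosed.isOpen_compl.mem_nhds hx] with z hz hzo
  obtain ⟨k, rfl⟩ := hzo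
  have hk : k ∈ V := by by_contra h; exact hz ⟨k, h, rfl⟩
  obtain ⟨u, hu, l, hl, rfl⟩ := hk
  exact ⟨u, interior_subset hu, by change u • x = (u * l) • x; rw [mul_smul, hl]⟩

end Orbit

/-! ### Slice charts -/

/-- Used with `L` the infinitesimal action: `L ∘ S` projects onto the orbit directions, `1 - L ∘ S`
onto a transversal, and `v - S (L v)` lies in the stabilizer algebra. -/
theorem exists_generalized_inverse {V W : Type*} [AddCommGroup V] [Module ℝ V] [AddCommGroup W]
    [Module ℝ W] (L : V →ₗ[ℝ] W) :
    ∃ S : W →ₗ[ℝ] V, (∀ v, L (S (L v)) = L v) ∧ ∀ w, S (L (S w)) = S w := by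
  obtain ⟨s, hs⟩ := L.rangeRestrict.exists_rightInverse_of_surjective L.range_rangeRestrict
  obtain ⟨p, hp⟩ := (LinearMap.range L).subtype.exists_leftInverse_of_injective
    (LinearMap.range L).ker_subtype
  have h1 (r : LinearMap.range L) : L (s r) = r := congrArg Subtype.val (DFunLike.congr_fun hs r)
  have h2 (r : LinearMap.range L) : p (r : W) = r := DFunLike.congr_fun hp r
  refine ⟨s.comp p, fun v => ?_, fun w => ?_⟩
  · simp only [LinearMap.comp_apply, h1]
    exact congrArg Subtype.val (h2 ⟨L v, LinearMap.mem_range_self L v⟩)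
  · simp only [LinearMap.comp_apply, h1, h2]

section Orbit

set_option linter.unusedSectionVars false

variable {M : Type*} [TopologicalSpace M] [ChartedSpace E7 M] [IsManifold (𝓡 7) ∞ M]
  [MulAction T2SU2 M]

/-- Move along a transversal to the orbit of `x` (in the chart at `x`) and then along the
orbits. -/
def sliceMap (x : M) (p : LieK × E7) : E7 := locAct x (expK p.1) (chartAt E7 x x + p.2)

theorem contDiffAt_sliceMap (hs : IsSmoothAction M) {x : M} {p : LieK × E7}
    (hp : chartAt E7 x x + p.2 ∈ (chartAt E7 x).target)
    (hp' : expK p.1 • (chartAt E7 x).symm (chartAt E7 x x + p.2) ∈ (chartAt E7 x).source) :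
    ContDiffAt ℝ ∞ (sliceMap x) p := by
  refine ContMDiffAt.contDiffAt ?_
  exact ContMDiffAt.comp p (g := fun q : T2SU2 × E7 => locAct x q.1 q.2)
    (f := fun p : LieK × E7 => (expK p.1, chartAt E7 x x + p.2)) (contMDiffAt_locAct hs hp hp')
    ((contMDiff_expK.comp contDiff_fst.contMDiff).prodMk
      (contDiff_const.add contDiff_snd).contMDiff).contMDiffAt

theorem sliceMap_zero_left (x : M) {w : E7} (hw : chartAt E7 x x + w ∈ (chartAt E7 x).target) :
    sliceMap x (0, w) = chartAt E7 x x + w := by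
  simp only [sliceMap, locAct, expK_zero, one_smul, (chartAt E7 x).right_inv hw]

theorem sliceMap_zero_right (x : M) (ξ : LieK) :
    sliceMap x (ξ, 0) = chartAt E7 x (expK ξ • x) := by
  simp only [sliceMap, locAct, add_zero, (chartAt E7 x).left_inv (mem_chart_source E7 x)]

theorem hasFDerivAt_sliceMap (hs : IsSmoothAction M) (x : M) :
    HasFDerivAt (sliceMap x) ((infK x).comp (ContinuousLinearMap.fst ℝ LieK E7) +
      ContinuousLinearMap.snd ℝ LieK E7) 0 := by
  have hc : chartAt E7 x x + (0 : LieK × E7).2 = chartAt E7 x x := add_zero _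
  have hsm : ContDiffAt ℝ ∞ (sliceMap x) 0 := by
    refine contDiffAt_sliceMap hs ?_ ?_
    · rw [hc]; exact mem_chart_target E7 x
    · rw [hc, Prod.fst_zero, expK_zero]; exact chart_mem_aux (one_smul _ x)
  have h0 := (hsm.differentiableAt (by simp)).hasFDerivAt
  refine h0.congr_fderiv ?_
  have hl : ∀ p : LieK × E7, p = 0 → HasFDerivAt (sliceMap x) (fderiv ℝ (sliceMap x) 0) p := by
    rintro p rfl; exact h0
  have h1 := HasFDerivAt.comp (0 : LieK) (hl (ContinuousLinearMap.inl ℝ LieK E7 0) (map_zero _))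
    (ContinuousLinearMap.inl ℝ LieK E7).hasFDerivAt
  have h2 := HasFDerivAt.comp (0 : E7) (hl (ContinuousLinearMap.inr ℝ LieK E7 0) (map_zero _))
    (ContinuousLinearMap.inr ℝ LieK E7).hasFDerivAt
  have e1 : sliceMap x ∘ ContinuousLinearMap.inl ℝ LieK E7 =
      fun ξ : LieK => chartAt E7 x (expK ξ • x) := funext fun ξ => sliceMap_zero_right x ξ
  have e2 : sliceMap x ∘ ContinuousLinearMap.inr ℝ LieK E7 =ᶠ[𝓝 0]
      fun w : E7 => chartAt E7 x x + w := by
    have h : ∀ᶠ w : E7 in 𝓝 0, chartAt E7 x x + w ∈ (chartAt E7 x).target := by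
      refine (continuous_const.add continuous_id).continuousAt.preimage_mem_nhds ?_
      refine (chartAt E7 x).open_target.mem_nhds ?_
      simp
    filter_upwards [h] with w hw
    exact sliceMap_zero_left x hw
  have h3 : HasFDerivAt (fun ξ : LieK => chartAt E7 x (expK ξ • x)) (infK x) 0 := by
    have h := (hasMFDerivAt_expK_smul hs x).2
    simp only [writtenInExtChartAt, expK_zero, one_smul] at h
    have h' : HasFDerivWithinAt (fun ξ : LieK => chartAt E7 x (expK ξ • x)) (infK x)
      (Set.range 𝓘(ℝ, LieK)) 0 := h
    rwa [ModelWithCorners.range_eq_univ, hasFDerivWithinAt_univ] at h'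
  have h4 : HasFDerivAt (fun w : E7 => chartAt E7 x x + w) (ContinuousLinearMap.id ℝ E7) 0 :=
    (hasFDerivAt_id 0).const_add _
  rw [e1] at h1
  have h5 := h1.unique h3
  have h6 := (h2.congr_of_eventuallyEq e2.symm).unique h4
  refine ContinuousLinearMap.ext fun p => ?_
  have e : p = ContinuousLinearMap.inl ℝ LieK E7 p.1 + ContinuousLinearMap.inr ℝ LieK E7 p.2 :=
    Prod.ext (add_zero (p.1 : LieK)).symm (zero_add (p.2 : E7)).symm
  refine (congrArg _ e).trans ?_
  refine (map_add _ _ _).trans ?_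
  exact congrArg₂ (· + ·) (DFunLike.congr_fun h5 p.1) (DFunLike.congr_fun h6 p.2)

/-- Around `x` there is a chart that maps the orbit of `x` to its tangent space. -/
theorem exists_slice_chart [T2Space M] (hs : IsSmoothAction M) (x : M) :
    ∃ e ∈ IsManifold.maximalAtlas (𝓡 7) ∞ M, x ∈ e.source ∧
      (∀ z ∈ e.source, z ∈ MulAction.orbit T2SU2 x ↔ e z ∈ LinearMap.range (infK x).toLinearMap) ∧
      HasMFDerivAt (𝓡 7) (𝓡 7) e x (ContinuousLinearMap.id ℝ E7) := by
  obtain ⟨S₀, hLSL, hSLS⟩ := exists_generalized_inverse (infK x).toLinearMap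
  let S : E7 →L[ℝ] LieK := S₀.toContinuousLinearMap
  let q : E7 →L[ℝ] E7 := ContinuousLinearMap.id ℝ E7 - (infK x).comp S
  have hq (v : E7) : q v = v - infK x (S v) := rfl
  replace hLSL (ξ : LieK) : infK x (S (infK x ξ)) = infK x ξ := hLSL ξ
  replace hSLS (v : E7) : S (infK x (S v)) = S v := hSLS v
  have hqR {v : E7} (hv : v ∈ LinearMap.range (infK x).toLinearMap) : q v = 0 := by
    obtain ⟨ξ, rfl⟩ := hv
    exact sub_eq_zero.mpr (hLSL ξ).symm
  have hSq (v : E7) : S (q v) = 0 := by rw [hq, map_sub, hSLS, sub_self]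
  have hqq (v : E7) : q (q v) = q v := by
    rw [hq (q v), hSq, map_zero, sub_zero]
  set c := chartAt E7 x with hc
  -- Go by the transversal part of `v` first, then along the orbit by its tangential part. The
  -- derivative at `0` is the identity.
  let G : E7 → E7 := fun v => sliceMap x (S v, q v)
  have hG0 : G 0 = c x := by
    change sliceMap x (S 0, q 0) = c x
    rw [map_zero, map_zero, sliceMap_zero_right, expK_zero, one_smul]
  have hGD : HasFDerivAt G (ContinuousLinearEquiv.refl ℝ E7 : E7 →L[ℝ] E7) 0 := by
    have key : ∀ p : LieK × E7, p = 0 → HasFDerivAt (sliceMap x)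
        ((infK x).comp (ContinuousLinearMap.fst ℝ LieK E7) + ContinuousLinearMap.snd ℝ LieK E7) p := by
      rintro p rfl; exact hasFDerivAt_sliceMap hs x
    refine (HasFDerivAt.comp (0 : E7) (key ((S.prod q) 0) (map_zero _))
      (S.prod q).hasFDerivAt).congr_fderiv ?_
    refine ContinuousLinearMap.ext fun v => ?_
    change infK x (S v) + q v = v
    rw [hq, add_sub_cancel]
  let b : E7 → E7 := fun v => c x + q v
  have hb : Continuous b := continuous_const.add q.continuous
  have hb0 : b 0 = c x := by change c x + q 0 = c x; rw [map_zero, add_zero]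
  let D : Set E7 := (b ⁻¹' c.target) ∩ (fun v => expK (S v) • c.symm (b v)) ⁻¹' c.source
  have hDo : IsOpen D := by
    have h : ContinuousOn (fun v => expK (S v) • c.symm (b v)) (b ⁻¹' c.target) :=
      (continuous_action hs).comp_continuousOn
        ((continuous_expK.comp S.continuous).continuousOn.prodMk
          (c.continuousOn_symm.comp hb.continuousOn fun v hv => hv))
    exact h.isOpen_inter_preimage (c.open_target.preimage hb) c.open_source
  have hD0 : (0 : E7) ∈ D := by
    refine ⟨?_, ?_⟩
    · rw [Set.mem_preimage, hb0]; exact mem_chart_target E7 x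
    · rw [Set.mem_preimage, hb0, map_zero, expK_zero]; exact chart_mem_aux (one_smul _ x)
  have hGsm : ∀ v ∈ D, ContDiffAt ℝ ∞ G v := fun v hv =>
    ContDiffAt.comp v (g := sliceMap x) (f := fun v => (S v, q v)) (contDiffAt_sliceMap hs (p := (S v, q v)) hv.1 hv.2)
      (S.prod q).contDiff.contDiffAt
  obtain ⟨Φ, hΦ0, hΦD, hΦG, hΦs, hΦt⟩ := exists_openPartialHomeomorph hDo hD0 hGsm hGD
  have hmk {v : E7} (hv : v ∈ D) : c.symm (G v) = expK (S v) • c.symm (b v) := c.left_inv hv.2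
  have hb1 {v : E7} (hv : v ∈ LinearMap.range (infK x).toLinearMap) : c.symm (b v) = x := by
    change c.symm (c x + q v) = x
    rw [hqR hv, add_zero]
    exact c.left_inv (mem_chart_source E7 x)
  -- near `x`, the orbit is the image of a small neighbourhood of `0` in its tangent space
  have hW : ∀ᶠ z in 𝓝 x, z ∈ MulAction.orbit T2SU2 x →
      ∃ u ∈ Φ.source, u ∈ LinearMap.range (infK x).toLinearMap ∧ expK (S u) • x = z := by
    have h1 : infK x ⁻¹' Φ.source ∈ 𝓝 (0 : LieK) :=
      (infK x).continuous.continuousAt.preimage_mem_nhds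
        (by rw [map_zero]; exact Φ.open_source.mem_nhds hΦ0)
    -- Elements near `1` factor as an exponential in the chosen complement times the exponential of
    -- an element of the stabilizer algebra, and the second factor fixes `x`.
    have h2 := nhds_one_le_map_expK_mul_expK (S.comp (infK x)) (Filter.image_mem_map h1)
    filter_upwards [eventually_mem_orbit hs x h2] with z hz hzo
    obtain ⟨_, ⟨ξ, hξ, rfl⟩, rfl⟩ := hz hzo
    refine ⟨infK x ξ, hξ, LinearMap.mem_range_self _ ξ, ?_⟩
    rw [mul_smul]
    have h3 : infK x (ξ - (S.comp (infK x)) ξ) = 0 := by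
      rw [map_sub]; exact sub_eq_zero.mpr (hLSL ξ).symm
    rw [expK_smul_eq_of_infK_eq_zero hs h3]
    rfl
  obtain ⟨W, hWs, hWo, hxW⟩ := mem_nhds_iff.mp hW
  -- On this smaller set the transversal part of a point stays where `G` is injective and where
  -- orbit points close to `x` are parametrised by tangential vectors.
  let O : Set E7 := q ⁻¹' Φ.source ∩ b ⁻¹' (c.target ∩ c.symm ⁻¹' W)
  have hO : IsOpen O := (Φ.open_source.preimage q.continuous).inter
    ((c.isOpen_inter_preimage_symm hWo).preimage hb)
  have hO0 : (0 : E7) ∈ O := by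
    refine ⟨?_, ?_⟩
    · rw [Set.mem_preimage, map_zero]; exact hΦ0
    · rw [Set.mem_preimage, hb0]
      exact ⟨mem_chart_target E7 x, by
        rw [Set.mem_preimage, hc, (chartAt E7 x).left_inv (mem_chart_source E7 x)]; exact hxW⟩
  let Ψ := Φ.restrOpen O hO
  have hΨ0 : (0 : E7) ∈ Ψ.source := ⟨hΦ0, hO0⟩
  have hΨG (v : E7) : Ψ v = G v := hΦG v
  have hΨs : ContDiffOn ℝ ∞ Ψ Ψ.source := hΦs.mono Set.inter_subset_left
  have hΨt : ContDiffOn ℝ ∞ Ψ.symm Ψ.target := hΦt.mono fun y hy => by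
    have h := Φ.map_source (Ψ.map_target hy).1
    rwa [show Φ (Ψ.symm y) = y from Ψ.right_inv hy] at h
  have hcx : c x ∈ Ψ.target := by rw [← hG0, ← hΨG]; exact Ψ.map_source hΨ0
  have hΨcx : Ψ.symm (c x) = 0 := by rw [← hG0, ← hΨG, Ψ.left_inv hΨ0]
  refine ⟨c.trans Ψ.symm, ?_, ⟨mem_chart_source E7 x, hcx⟩, ?_, ?_⟩
  · refine OpenPartialHomeomorph.mem_maximalAtlas_of_contMDiffOn _ ?_ ?_
    · exact hΨt.contMDiffOn.comp ((contMDiffOn_chart (I := 𝓡 7) (n := ∞) (x := x)).mono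
        fun z hz => hz.1) fun z hz => hz.2
    · exact (contMDiffOn_chart_symm (I := 𝓡 7) (n := ∞) (x := x)).comp
        (hΨs.contMDiffOn.mono fun z hz => hz.1) fun z hz => hz.2
  · intro z hz
    change z ∈ MulAction.orbit T2SU2 x ↔ Ψ.symm (c z) ∈ LinearMap.range (infK x).toLinearMap
    have hzc : z ∈ c.source := hz.1
    have hzt : c z ∈ Ψ.target := hz.2
    obtain ⟨v, hv⟩ : ∃ v, Ψ.symm (c z) = v := ⟨_, rfl⟩
    have hvs : v ∈ Ψ.source := hv ▸ Ψ.map_target hzt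
    have hGv : G v = c z := by rw [← hΨG, ← hv, Ψ.right_inv hzt]
    have hz' : z = expK (S v) • c.symm (b v) := by
      rw [← hmk (hΦD hvs.1), hGv]; exact (c.left_inv hzc).symm
    rw [hv]
    constructor
    · rintro ⟨k, hk⟩
      have h1 : c.symm (b v) ∈ MulAction.orbit T2SU2 x := by
        refine ⟨(expK (S v))⁻¹ * k, ?_⟩
        change ((expK (S v))⁻¹ * k) • x = _
        rw [mul_smul]
        change k • x = z at hk
        rw [hk, hz', inv_smul_smul]
      obtain ⟨u, hu, huR, he⟩ := hWs hvs.2.2.2 h1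
      have h2 : G u = b v := by
        change sliceMap x (S u, q u) = b v
        rw [hqR huR, sliceMap_zero_right, he]
        exact c.right_inv hvs.2.2.1
      have h3 : G (q v) = b v := by
        change sliceMap x (S (q v), q (q v)) = b v
        rw [hSq, hqq]
        exact sliceMap_zero_left x hvs.2.2.1
      -- A tangential vector and the transversal vector `q v` have the same image, so they are equal
      -- and `v` is tangential.
      have h4 : u = q v := Φ.injOn hu hvs.2.1 (by rw [hΦG, hΦG, h2, h3])
      have h5 : v = u + infK x (S v) := by rw [h4, hq, sub_add_cancel]
      rw [h5]
      exact Submodule.add_mem _ huR (LinearMap.mem_range_self _ _)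
    · intro hvR
      rw [hz', hb1 hvR]
      exact MulAction.mem_orbit x _
  · refine ⟨(c.trans Ψ.symm).continuousAt ⟨mem_chart_source E7 x, hcx⟩, ?_⟩
    have h1 : HasFDerivAt Ψ.symm (ContinuousLinearMap.id ℝ E7) (c x) := by
      have h := Ψ.hasFDerivAt_symm (f' := ContinuousLinearEquiv.refl ℝ E7) hcx
        (by rw [hΨcx]; exact hGD.congr_of_eventuallyEq (Filter.Eventually.of_forall hΨG))
      exact h
    have h2 : (fun y => (c.trans Ψ.symm) (c.symm y)) =ᶠ[𝓝 (c x)] Ψ.symm := by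
      filter_upwards [c.open_target.mem_nhds (mem_chart_target E7 x)] with y hy
      exact congrArg Ψ.symm (c.right_inv hy)
    exact (h1.congr_of_eventuallyEq h2).hasFDerivWithinAt

end Orbit

/-! ### Associative orbits and the principal stratum -/

section Orbit

set_option linter.unusedSectionVars false

variable {M : Type*} [TopologicalSpace M] [ChartedSpace E7 M] [IsManifold (𝓡 7) ∞ M]
  [MulAction T2SU2 M] [T2Space M]

/-- Translation by `k` maps the tangent space of the orbit at `x` injectively into the one at `k •
x`. -/
theorem stabDim_smul_le (hs : IsSmoothAction M) (k : T2SU2) (x : M) :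
    stabDim (k • x) ≤ stabDim x := by
  have hinj : Function.Injective (tr k x).toLinearMap := by
    have h := tr_mul hs k⁻¹ k x
    rw [inv_mul_cancel, tr_one] at h
    intro v w hvw
    have h1 : tr k⁻¹ (k • x) (tr k x v) = tr k⁻¹ (k • x) (tr k x w) := congrArg _ hvw
    rwa [← ContinuousLinearMap.comp_apply, ← ContinuousLinearMap.comp_apply, ← h] at h1
  have hmap : (LinearMap.range (infK x).toLinearMap).map (tr k x).toLinearMap ≤
      LinearMap.range (infK (k • x)).toLinearMap := by
    rintro _ ⟨_, ⟨ξ, rfl⟩, rfl⟩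
    exact ⟨adjK k ξ, (tr_infK hs k x ξ).symm⟩
  have h1 := (LinearEquiv.finrank_eq (Submodule.equivMapOfInjective (tr k x).toLinearMap hinj
    (LinearMap.range (infK x).toLinearMap))).trans_le (Submodule.finrank_mono hmap)
  have h2 := finrank_ker_add_finrank_range x
  have h3 := finrank_ker_add_finrank_range (k • x)
  rw [stabDim_eq hs, stabDim_eq hs]
  omega

theorem stabDim_smul (hs : IsSmoothAction M) (k : T2SU2) (x : M) :
    stabDim (k • x) = stabDim x := by
  refine le_antisymm (stabDim_smul_le hs k x) ?_
  have h := stabDim_smul_le hs k⁻¹ (k • x)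
  rwa [inv_smul_smul] at h

theorem stabDim_eq_zero_iff (hs : IsSmoothAction M) {x : M} :
    stabDim x = 0 ↔ Function.Injective (infK x) := by
  rw [stabDim_eq hs, Submodule.finrank_eq_zero, LinearMap.ker_eq_bot]
  rfl

theorem exists_injective_infK (h : HasCohomogeneityTwo M) :
    ∃ x₀ : M, Function.Injective (infK x₀) := by
  obtain ⟨x, hx⟩ := h.1
  refine ⟨x, ?_⟩
  have h1 := finrank_ker_add_finrank_range x
  have hx' : finrank ℝ (orbitTangent x) = 5 := hx
  rw [orbitTangent_eq_range] at hx'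
  have h2 : finrank ℝ (LinearMap.ker (infK x).toLinearMap) = 0 := by
    have h3 : finrank ℝ (LinearMap.range (infK x).toLinearMap) = 5 := hx'
    omega
  exact LinearMap.ker_eq_bot.mp (Submodule.finrank_eq_zero.mp h2)

variable [ConnectedSpace M] {φ : FormField 3 M} {x₀ : M}

/-- The tangent space is closed under the cross product, so two orthonormal vectors in it are
completed by their product, and `φ` takes the value `|u × v|² = 1` on this basis. -/
theorem isAssociativePlane_range (hs : IsSmoothAction M) (hφ : IsG2Manifold φ)
    (hp : PreservesForm φ) (hx₀ : Function.Injective (infK x₀)) {x : M} (h2 : stabDim x = 2) :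
    IsAssociativePlane φ x (LinearMap.range (infK x).toLinearMap) := by
  have hx : x ∈ torusSingularSet M := by
    by_contra hx
    have := stabDim_of_not_mem hs hφ hp hx₀ hx; omega
  obtain ⟨s, t, hne, hc⟩ := exists_infFrame_torus_eq_zero (φ := φ) hx
  have hcl := (isotropyData hs hφ hp hx₀ x).crossClosed_range hne hc
    ((finrank_ker_infFrame hs φ x).trans h2)
  have h5 := finrank_ker_add_finrank_range x
  rw [← stabDim_eq hs, h2] at h5
  have h3 : finrank ℝ (LinearMap.range (infFrame φ x).toLinearMap) = 3 := by
    have h6 := (infFrame φ x).toLinearMap.finrank_range_add_finrank_ker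
    have h7 : finrank ℝ LieK = 5 := by simp
    rw [finrank_ker_infFrame hs φ x, h2, h7] at h6
    omega
  obtain ⟨u, hu, v, hv, hu1, hv1, huv⟩ := exists_orthonormal_pair (F := LinearMap.range
    (infFrame φ x).toLinearMap) (by omega)
  have hmem {w : E7} (hw : w ∈ LinearMap.range (infFrame φ x).toLinearMap) :
      frame φ x w ∈ LinearMap.range (infK x).toLinearMap := by
    obtain ⟨ξ, rfl⟩ := hw
    have h : frame φ x (infFrame φ x ξ) = infK x ξ := (frame φ x).apply_symm_apply _
    refine Eq.mpr (congrArg (· ∈ LinearMap.range (infK x).toLinearMap) h) ?_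
    exact LinearMap.mem_range_self _ ξ
  have hon := orthonormal_cross hu1 hv1 huv
  refine ⟨by have h : finrank ℝ (LinearMap.range (infK x).toLinearMap) = 3 := by omega
             exact h, fun i => frame φ x (![u, v, cross u v] i), fun i => ?_, fun i j => ?_, ?_⟩
  · refine hmem ?_
    fin_cases i
    exacts [hu, hv, hcl u hu v hv]
  · exact (g2Metric_frame φ x _ _).trans (orthonormal_iff_ite.mp hon i j)
  · refine (phi_frame hφ x _).trans ?_
    rw [phi0_apply]
    have h := orthonormal_iff_ite.mp hon 2 2
    rwa [if_pos rfl] at h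

theorem isAssociativeSubmanifold_orbit (hs : IsSmoothAction M) (hφ : IsG2Manifold φ)
    (hp : PreservesForm φ) (hx₀ : Function.Injective (infK x₀)) {x : M} (h2 : stabDim x = 2) :
    IsAssociativeSubmanifold φ (MulAction.orbit (EffGroup M) x) := by
  have horb : MulAction.orbit (EffGroup M) x = MulAction.orbit T2SU2 x := by
    ext z
    constructor
    · rintro ⟨g, rfl⟩
      obtain ⟨k, rfl⟩ := QuotientGroup.mk_surjective g
      exact ⟨k, rfl⟩
    · rintro ⟨k, rfl⟩
      exact ⟨(QuotientGroup.mk k : EffGroup M), rfl⟩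
  rw [horb]
  intro y hy
  obtain ⟨e, he, hye, hiff, hd⟩ := exists_slice_chart hs y
  rw [MulAction.orbit_eq_iff.mpr hy] at hiff
  refine ⟨e, he, _, hye, hiff, ?_⟩
  have h2y : stabDim y = 2 := by
    obtain ⟨k, rfl⟩ := hy
    exact (stabDim_smul hs k x).trans h2
  have hcomap : (LinearMap.range (infK y).toLinearMap).comap
      (mfderiv (𝓡 7) (𝓡 7) e y : TangentSpace (𝓡 7) y →L[ℝ] E7).toLinearMap =
      LinearMap.range (infK y).toLinearMap := by
    rw [hd.mfderiv]
    exact Submodule.comap_id _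
  rw [hcomap]
  exact isAssociativePlane_range hs hφ hp hx₀ h2y

/-- Some point has a discrete stabilizer, which is then trivial. A principal stabilizer is conjugate
into it and therefore trivial too, so it contains no one-parameter subgroup. -/
theorem mem_principalSet_iff (hs : IsSmoothAction M) (hφ : IsG2Manifold φ)
    (hp : PreservesForm φ) (hx₀ : Function.Injective (infK x₀)) {x : M} :
    x ∈ principalSet (EffGroup M) M ↔ stabDim x = 0 := by
  constructor
  · intro hx
    obtain ⟨a, ha⟩ := hx x₀
    obtain ⟨k, rfl⟩ := QuotientGroup.mk_surjective a
    have h0 : stabDim (k • x₀) = 0 :=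
      (stabDim_smul hs k x₀).trans ((stabDim_eq_zero_iff hs).mpr hx₀)
    have hbot : MulAction.stabilizer (EffGroup M) x = ⊥ :=
      le_bot_iff.mp (ha.trans (stabilizer_eq_bot hs hφ hp hx₀ h0).le)
    rw [stabDim_eq_zero_iff hs]
    refine (injective_iff_map_eq_zero _).mpr fun η hη => ?_
    refine (injective_iff_map_eq_zero _).mp hx₀ η (infK_eq_zero_of_expK_smul_eq hs fun t => ?_)
    have h1 : (QuotientGroup.mk (expK (t • η)) : EffGroup M) ∈
        MulAction.stabilizer (EffGroup M) x :=
      expK_smul_eq_of_infK_eq_zero hs (by rw [map_smul, hη, smul_zero])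
    rw [hbot, Subgroup.mem_bot] at h1
    exact DFunLike.congr_fun (MonoidHom.mem_ker.mp ((QuotientGroup.eq_one_iff _).mp h1)) x₀
  · intro h0 y
    refine ⟨1, ?_⟩
    rw [stabilizer_eq_bot hs hφ hp hx₀ h0]
    exact bot_le

theorem compl_principalSet (hs : IsSmoothAction M) (hφ : IsG2Manifold φ)
    (hp : PreservesForm φ) (hx₀ : Function.Injective (infK x₀)) :
    (principalSet (EffGroup M) M)ᶜ = stratum M 1 ∪ stratum M 2 ∪ stratum M 3 ∪ stratum M 4 := by
  ext x
  have h4 := stabDim_le_four hs hφ hp hx₀ x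
  rw [Set.mem_compl_iff, mem_principalSet_iff hs hφ hp hx₀]
  change ¬ stabDim x = 0 ↔ ((stabDim x = 1 ∨ stabDim x = 2) ∨ stabDim x = 3) ∨ stabDim x = 4
  omega

end Orbit

end G2Sym
end

theorem mainTheorem2 {M : Type*} [TopologicalSpace M] [T2Space M] [SecondCountableTopology M]
    [ConnectedSpace M] [ChartedSpace E7 M] [IsManifold (𝓡 7) ∞ M]
    (φ : FormField 3 M) (hφ : IsG2Manifold φ)
    [MulAction T2SU2 M] (hsmooth : IsSmoothAction M) (hpres : PreservesForm φ)
    (hcohom : HasCohomogeneityTwo M) :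
    (∀ x : M,
      stabDim x ≤ 4 ∧
      (stabDim x = 0 → MulAction.stabilizer (EffGroup M) x = ⊥) ∧
      (stabDim x = 1 →
        x ∉ torusSingularSet M ∧
        (∀ a b : Circle, ((a, b, 1) : T2SU2) • x = x → ∀ y : M, ((a, b, 1) : T2SU2) • y = y) ∧
        ∃ (σ : Matrix.specialOrthogonalGroup (Fin 2) ℝ ≃ₜ* MulAction.stabilizer (EffGroup M) x)
          (N₁ N₂ : Submodule ℝ (TangentSpace (𝓡 7) x))
          (e : EuclideanSpace ℝ (Fin 2) →ₗ[ℝ] TangentSpace (𝓡 7) x),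
          N₁ ⊔ N₂ = normalSpace φ x ∧ (∀ u ∈ N₁, ∀ v ∈ N₂, g2Metric φ x u v = 0) ∧
          Module.finrank ℝ N₁ = 1 ∧ Module.finrank ℝ N₂ = 2 ∧
          (∀ g, ∀ v ∈ N₁, isotropy x g v = v) ∧
          IsIsometryOnto φ x e N₂ ∧
          ∀ A a, isotropy x (σ A) (e a) = e (WithLp.toLp 2 (A.1 *ᵥ a.ofLp))) ∧
      (stabDim x = 2 →
        x ∈ torusSingularSet M ∧
        (∃ (σ : Circle × Circle ≃ₜ* stabIdComponent x)
          (e : EuclideanSpace ℂ (Fin 2) →ₗ[ℝ] TangentSpace (𝓡 7) x),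
          IsIsometryOnto φ x e (normalSpace φ x) ∧
          ∀ z w a, isotropy x (σ (z, w)) (e a) = e !₂[(z : ℂ) * a 0, (w : ℂ) * a 1]) ∧
        IsAssociativeSubmanifold φ (MulAction.orbit (EffGroup M) x)) ∧
      (stabDim x = 3 →
        x ∉ torusSingularSet M ∧
        ∃ (σ : Matrix.specialUnitaryGroup (Fin 2) ℂ ≃ₜ* MulAction.stabilizer (EffGroup M) x)
          (N₁ N₂ : Submodule ℝ (TangentSpace (𝓡 7) x))
          (e : EuclideanSpace ℂ (Fin 2) →ₗ[ℝ] TangentSpace (𝓡 7) x),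
          N₁ ⊔ N₂ = normalSpace φ x ∧ (∀ u ∈ N₁, ∀ v ∈ N₂, g2Metric φ x u v = 0) ∧
          Module.finrank ℝ N₁ = 1 ∧
          (∀ g, ∀ v ∈ N₁, isotropy x g v = v) ∧
          IsIsometryOnto φ x e N₂ ∧
          ∀ A a, isotropy x (σ A) (e a) = e (WithLp.toLp 2 (A.1 *ᵥ a.ofLp))) ∧
      (stabDim x = 4 →
        x ∈ torusSingularSet M ∧
        ∃ (σ : Matrix.unitaryGroup (Fin 2) ℂ ≃ₜ* stabIdComponent x)
          (e : EuclideanSpace ℂ (Fin 3) →ₗ[ℝ] TangentSpace (𝓡 7) x),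
          IsIsometryOnto φ x e (normalSpace φ x) ∧
          ∀ A a, isotropy x (σ A) (e a) = e (WithLp.toLp 2 (u2ToSU3 A *ᵥ a.ofLp)))) ∧
    (principalSet (EffGroup M) M)ᶜ = stratum M 1 ∪ stratum M 2 ∪ stratum M 3 ∪ stratum M 4 := by
  obtain ⟨x₀, hx₀⟩ := exists_injective_infK hcohom
  refine ⟨fun x => ⟨stabDim_le_four hsmooth hφ hpres hx₀ x,
    fun h => stabilizer_eq_bot hsmooth hφ hpres hx₀ h,
    fun h => exists_specialOrthogonal hsmooth hφ hpres hx₀ h,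
    fun h => ?_,
    fun h => exists_specialUnitary hsmooth hφ hpres hx₀ h,
    fun h => exists_unitary hsmooth hφ hpres hx₀ h⟩,
    compl_principalSet hsmooth hφ hpres hx₀⟩
  obtain ⟨h1, h2⟩ := exists_torus hsmooth hφ hpres hx₀ h
  exact ⟨h1, h2, isAssociativeSubmanifold_orbit hsmooth hφ hpres hx₀ h⟩
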